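/- **Setting.** For $n\ge 2$, a tensor $\mathbf T\in(\mathbb R^n)^{\otimes 3}$ has slices $(T_i)_{j,k}=\mathbf T_{ijk}$ and cubic form $\mathbf T(x)=\sum_{ijk}\mathbf T_{ijk}x_ix_jx_k$. Put $N(\mathbf T)=\sum_i T_i\otimes T_i-\mathbb E\sum_i G_i\otimes G_i$, where $\mathbf G$ has independent $\mathcal N(0,1)$ entries; this is an $n^2\times n^2$ matrix. A *top singular vector* is a left or right unit singular vector for the largest singular value. *Recovery.* On input $\mathbf T$, take a top singular vector $v'$ of $N(\mathbf T)$, reshape it into an $n\times n$ matrix $V'$, and output a top singular vector $v$ of $V'$. *Certification* (with a threshold constant $\kappa$). On input $\mathbf T$ and $\tau$, run Recovery to obtain $v$, with its sign chosen such that $\mathbf T(v)\ge 0$. Let $\mathbf S=\mathbf T-\tau\, v^{\otimes 3}$. Output CERTIFY if the largest singular value of $N(\mathbf S)$ is at most $\kappa\, n^{3/2}(\log n)^{1/2}$, and FAIL otherwise. **Theorem.** There are absolute constants $C,\kappa>0$ such that the following holds for all $n\ge 2$. "Spiked input" means $\mathbf T=\tau\, v_0^{\otimes 3}+\mathbf A$,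 where $v_0\in\mathbb R^n$ is a unit vector, $\mathbf A$ has independent $\mathcal N(0,1)$ entries, and $\tau\ge n^{3/4}(\log n)^{1/4}/\epsilon$. "With high probability" means with probability at least $1-Cn^{-10}$. 1. For every $\epsilon>0$, on a spiked input, with high probability over $\mathbf A$ every possible output $v$ of Recovery satisfies $\langle v,v_0\rangle^2\ge 1-C\epsilon$. 2. For every tensor $\mathbf T$ and every $\tau\in\mathbb R$: if Certification, having found $v$, outputs CERTIFY, then $\mathbf T(x)\le\tau\langle v,x\rangle^3+C\,n^{3/4}(\log n)^{1/4}$ for all unit vectors $x$. For every $\epsilon>0$, on a spiked input, with high probability over $\mathbf A$ Certification outputs CERTIFY, whichever top singular vectors it uses. 3. Both algorithms can be implemented in time $C\,n^4\log(1/\epsilon)$ for $0<\epsilon\le 1/2$. Precisely, there are two fixed programs for a randomized random access machine with unit-cost operations. Its operations are $+,-,\times,\div,\sqrt{\cdot}$ and comparison on reals; addition, truncated subtraction, multiplication and comparison on indices; and drawing an independent $\mathcal N(0,1)$ number. On every input and for all random choices, each program halts within $C\,n^4\log(1/\epsilon)$ steps, and the following holds. - The recovery program receives $n,\epsilon,\mathbf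 T$. On a spiked input, with high probability over $\mathbf A$ and its random choices, it outputs a unit vector $u$ with $\langle u,v_0\rangle^2\ge 1-C\epsilon$, and $\langle u,v\rangle^2\ge 1-C\epsilon$ for every possible output $v$ of Recovery on $\mathbf T$. - The certification program receives $n,\epsilon,\tau,\mathbf T$. For every $\mathbf T$ and $\tau$, with high probability over its random choices, if it answers CERTIFY, then its output vector $u$ is a unit vector, the largest singular value of $N(\mathbf T-\tau u^{\otimes 3})$ is at most $C\,n^{3/2}(\log n)^{1/2}$, and $\mathbf T(x)\le\tau\langle u,x\rangle^3+C\,n^{3/4}(\log n)^{1/4}$ for all unit vectors $x$. On a spiked input, with high probability over $\mathbf A$ and its random choices, it answers CERTIFY with a vector $u$ as in the previous item. -/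

import Mathlib

open MeasureTheory ProbabilityTheory
open scoped Kronecker InnerProductSpace

namespace SpikedTensor

noncomputable section

/-! ### Tensors, matrix slices and the Gaussian noise tensor -/

/-- Real order-3 tensors of format `n × n × n`. -/
abbrev Tensor3 (n : ℕ) : Type := Fin n × Fin n × Fin n → ℝ

/-- The rank-one tensor `v ⊗ v ⊗ v`. -/
def cube {n : ℕ} (v : EuclideanSpace ℝ (Fin n)) : Tensor3 n :=
  fun p => v p.1 * v p.2.1 * v p.2.2

/-- The homogeneous cubic polynomial `T(x) = ∑ T_{ijk} x_i x_j x_k`. -/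
def cubicForm {n : ℕ} (T : Tensor3 n) (x : EuclideanSpace ℝ (Fin n)) : ℝ :=
  ∑ i, ∑ j, ∑ k, T (i, j, k) * x i * x j * x k

/-- The slice `T_i` along the first mode, `(T_i)_{j,k} = T_{i,j,k}`. -/
def slice {n : ℕ} (T : Tensor3 n) (i : Fin n) : Matrix (Fin n) (Fin n) ℝ :=
  Matrix.of fun j k => T (i, j, k)

/-- The law of a noise tensor with independent standard Gaussian entries. -/
def noise (n : ℕ) : Measure (Tensor3 n) :=
  Measure.pi fun _ => gaussianReal 0 1

/-- The spiked tensor `τ · v₀ ⊗ v₀ ⊗ v₀ + A`. -/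
def spiked {n : ℕ} (τ : ℝ) (v₀ : EuclideanSpace ℝ (Fin n)) (A : Tensor3 n) : Tensor3 n :=
  τ • cube v₀ + A

/-- The matrix `∑ i, T_i ⊗ T_i`. -/
def sliceSquare {n : ℕ} (T : Tensor3 n) : Matrix (Fin n × Fin n) (Fin n × Fin n) ℝ :=
  ∑ i, slice T i ⊗ₖ slice T i

/-- The entrywise expectation of `∑ i, A_i ⊗ A_i` over standard Gaussian noise `A`. -/
def noiseMean (n : ℕ) : Matrix (Fin n × Fin n) (Fin n × Fin n) ℝ :=
  Matrix.of fun p q => ∫ A, sliceSquare A p q ∂(noise n)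

/-- The matrix `∑ i, T_i ⊗ T_i - 𝔼 ∑ i, A_i ⊗ A_i`. -/
def centered {n : ℕ} (T : Tensor3 n) : Matrix (Fin n × Fin n) (Fin n × Fin n) ℝ :=
  sliceSquare T - noiseMean n

/-! ### Singular values and singular vectors -/

/-- The largest singular value. -/
def topSingularValue {ι : Type*} [Fintype ι] [DecidableEq ι] (M : Matrix ι ι ℝ) : ℝ :=
  (Matrix.toEuclideanLin M).singularValues 0

/-- `u` and `w` are unit left and right singular vectors of `M` for its largest singular value. -/
def IsTopSingularPair {ι : Type*} [Fintype ι] [DecidableEq ι] (M : Matrix ι ι ℝ)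
    (u w : EuclideanSpace ℝ ι) : Prop :=
  ‖u‖ = 1 ∧ ‖w‖ = 1 ∧
    Matrix.toEuclideanLin M w = topSingularValue M • u ∧
    Matrix.toEuclideanLin M.transpose u = topSingularValue M • w

/-- `w` is a (left or right) unit top singular vector of `M`. -/
def IsTopSingularVector {ι : Type*} [Fintype ι] [DecidableEq ι] (M : Matrix ι ι ℝ)
    (w : EuclideanSpace ℝ ι) : Prop :=
  ∃ u, IsTopSingularPair M w u ∨ IsTopSingularPair M u w

/-- Folding a vector indexed by pairs into a square matrix. -/
def fold {n : ℕ} (w : EuclideanSpace ℝ (Fin n × Fin n)) : Matrix (Fin n) (Fin n) ℝ :=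
  Matrix.of fun j k => w (j, k)

/-! ### The two algorithms, with exact singular vectors

Top singular vectors are not unique (the sign, at least, is free), so the possible outputs are
described by a predicate. -/

/-- `v` is a possible output of the recovery algorithm on input `T`: a unit top singular vector of
the folding of a top singular vector of `∑ i, T_i ⊗ T_i - 𝔼 ∑ i, A_i ⊗ A_i`. -/
def IsRecoveryOutput {n : ℕ} (T : Tensor3 n) (v : EuclideanSpace ℝ (Fin n)) : Prop :=
  ∃ w, IsTopSingularVector (centered T) w ∧ IsTopSingularVector (fold w) v

/-- The answer of the certification algorithm. -/
inductive Verdict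
  | certify
  | fail

/-- The order of the threshold that the certification algorithm compares a singular value with. -/
def threshold (n : ℕ) : ℝ := (n : ℝ) ^ (3 / 2 : ℝ) * Real.log n ^ (1 / 2 : ℝ)

/-- The bound `n^{3/4} (log n)^{1/4}`. -/
def noiseLevel (n : ℕ) : ℝ := (n : ℝ) ^ (3 / 4 : ℝ) * Real.log n ^ (1 / 4 : ℝ)

/-- The vector `v` and the verdict `b` are a possible output of the certification algorithm with
threshold constant `κ` on input `T` and `τ`: `v` is an output of the recovery algorithm, its sign
chosen so that `T(v) ≥ 0`, and `b` records whether, with `S = T - τ · v ⊗ v ⊗ v`, the largest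
singular value of `∑ i, S_i ⊗ S_i - 𝔼 ∑ i, A_i ⊗ A_i` is at most `κ n^{3/2} (log n)^{1/2}`. -/
def IsCertificationOutput {n : ℕ} (κ τ : ℝ) (T : Tensor3 n)
    (v : EuclideanSpace ℝ (Fin n)) (b : Verdict) : Prop :=
  IsRecoveryOutput T v ∧ 0 ≤ cubicForm T v ∧
    (b = Verdict.certify ↔ topSingularValue (centered (T - τ • cube v)) ≤ κ * threshold n)

/-! ### A randomized real random access machine with unit costs -/

/-- The state of the machine: registers and memory cells for indices (natural numbers) and for
reals, and the number of random numbers used so far. A program names registers directly; memory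
cells are reached only through an address in an index register. -/
structure State where
  idx : ℕ → ℕ
  val : ℕ → ℝ
  idxMem : ℕ → ℕ
  valMem : ℕ → ℝ
  used : ℕ

/-- Elementary instructions. The first argument names the register that is written (for the stores,
the index register that holds the address of the memory cell that is written). -/
inductive Instr
  | idxConst (d c : ℕ)
  | idxAdd (d a b : ℕ)
  | idxSub (d a b : ℕ)
  | idxMul (d a b : ℕ)
  | idxLoad (d a : ℕ)
  | idxStore (d a : ℕ)
  | valOfIdx (d a : ℕ)
  | valAdd (d a b : ℕ)
  | valSub (d a b : ℕ)
  | valMul (d a b : ℕ)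
  | valDiv (d a b : ℕ)
  | valSqrt (d a : ℕ)
  | valLoad (d a : ℕ)
  | valStore (d a : ℕ)
  | sample (d : ℕ)

/-- Write to an index register. -/
def State.setIdx (s : State) (d x : ℕ) : State :=
  { s with idx := Function.update s.idx d x }

/-- Write to a real register. -/
def State.setVal (s : State) (d : ℕ) (x : ℝ) : State :=
  { s with val := Function.update s.val d x }

/-- The effect of an instruction; `ω` is the tape of random numbers. -/
def Instr.run (ω : ℕ → ℝ) : Instr → State → State
  | idxConst d c, s => s.setIdx d c
  | idxAdd d a b, s => s.setIdx d (s.idx a + s.idx b)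
  | idxSub d a b, s => s.setIdx d (s.idx a - s.idx b)
  | idxMul d a b, s => s.setIdx d (s.idx a * s.idx b)
  | idxLoad d a, s => s.setIdx d (s.idxMem (s.idx a))
  | idxStore d a, s => { s with idxMem := Function.update s.idxMem (s.idx d) (s.idx a) }
  | valOfIdx d a, s => s.setVal d (s.idx a : ℝ)
  | valAdd d a b, s => s.setVal d (s.val a + s.val b)
  | valSub d a b, s => s.setVal d (s.val a - s.val b)
  | valMul d a b, s => s.setVal d (s.val a * s.val b)
  | valDiv d a b, s => s.setVal d (s.val a / s.val b)
  | valSqrt d a, s => s.setVal d (Real.sqrt (s.val a))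
  | valLoad d a, s => s.setVal d (s.valMem (s.idx a))
  | valStore d a, s => { s with valMem := Function.update s.valMem (s.idx d) (s.val a) }
  | sample d, s => { s.setVal d (ω s.used) with used := s.used + 1 }

/-- Programs: branching compares two registers, loops run while `idx a < idx b`. -/
inductive Program
  | skip
  | instr (c : Instr)
  | seq (p q : Program)
  | ifIdxLt (a b : ℕ) (p q : Program)
  | ifValLe (a b : ℕ) (p q : Program)
  | whileIdxLt (a b : ℕ) (p : Program)

/-- `Exec ω p s t s₁`: started in state `s` with random tape `ω`, the program `p` halts in state
`s₁` after `t` steps. Every instruction and every comparison is one step. -/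
inductive Exec (ω : ℕ → ℝ) : Program → State → ℕ → State → Prop
  | skip (s : State) : Exec ω .skip s 1 s
  | instr (c : Instr) (s : State) : Exec ω (.instr c) s 1 (c.run ω s)
  | seq {p q : Program} {s s₁ s₂ : State} {t u : ℕ} :
      Exec ω p s t s₁ → Exec ω q s₁ u s₂ → Exec ω (.seq p q) s (t + u) s₂
  | ifIdxTrue {a b : ℕ} {p q : Program} {s s₁ : State} {t : ℕ} :
      s.idx a < s.idx b → Exec ω p s t s₁ → Exec ω (.ifIdxLt a b p q) s (t + 1) s₁
  | ifIdxFalse {a b : ℕ} {p q : Program} {s s₁ : State} {t : ℕ} :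
      ¬ s.idx a < s.idx b → Exec ω q s t s₁ → Exec ω (.ifIdxLt a b p q) s (t + 1) s₁
  | ifValTrue {a b : ℕ} {p q : Program} {s s₁ : State} {t : ℕ} :
      s.val a ≤ s.val b → Exec ω p s t s₁ → Exec ω (.ifValLe a b p q) s (t + 1) s₁
  | ifValFalse {a b : ℕ} {p q : Program} {s s₁ : State} {t : ℕ} :
      ¬ s.val a ≤ s.val b → Exec ω q s t s₁ → Exec ω (.ifValLe a b p q) s (t + 1) s₁
  | whileStop {a b : ℕ} {p : Program} {s : State} :
      ¬ s.idx a < s.idx b → Exec ω (.whileIdxLt a b p) s 1 s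
  | whileStep {a b : ℕ} {p : Program} {s s₁ s₂ : State} {t u : ℕ} :
      s.idx a < s.idx b → Exec ω p s t s₁ → Exec ω (.whileIdxLt a b p) s₁ u s₂ →
        Exec ω (.whileIdxLt a b p) s (t + u + 1) s₂

/-- The law of the random tape: independent standard Gaussian numbers. -/
def tape : Measure (ℕ → ℝ) := Measure.infinitePi fun _ => gaussianReal 0 1

/-- The initial state: `n` is in index register `0`, the scalar parameters are in the first real
registers, the entries of `T` are in the first `n³` real memory cells in lexicographic order, and
everything else is `0`. -/
def input (n : ℕ) (params : List ℝ) (T : Tensor3 n) : State where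
  idx := fun a => if a = 0 then n else 0
  val := fun a => params.getD a 0
  idxMem := fun _ => 0
  valMem := fun a =>
    if h : a < n * (n * n) then
      let p := finProdFinEquiv.symm (⟨a, h⟩ : Fin (n * (n * n)))
      T (p.1, finProdFinEquiv.symm p.2)
    else 0
  used := 0

/-- The output vector is read from the first `n` real memory cells. -/
def outVector (n : ℕ) (s : State) : EuclideanSpace ℝ (Fin n) :=
  WithLp.toLp 2 fun i => s.valMem i

/-- A certifying program answers CERTIFY by leaving `1` in index register `0`. -/
def SaysCertify (s : State) : Prop := s.idx 0 = 1

/-! ### What it means to implement the algorithms -/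

/-- The probability bound `C n^{-10}`. -/
def smallProb (C : ℝ) (n : ℕ) : ENNReal := ENNReal.ofReal (C / (n : ℝ) ^ 10)

/-- The unit vector `u` agrees, up to `C ε`, with `v₀` and with every exact output of the recovery
algorithm on `T`. -/
def ApproxRecovery {n : ℕ} (C ε : ℝ) (v₀ : EuclideanSpace ℝ (Fin n)) (T : Tensor3 n)
    (u : EuclideanSpace ℝ (Fin n)) : Prop :=
  ‖u‖ = 1 ∧ 1 - C * ε ≤ ⟪u, v₀⟫_ℝ ^ 2 ∧
    ∀ v, IsRecoveryOutput T v → 1 - C * ε ≤ ⟪u, v⟫_ℝ ^ 2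

/-- On all inputs and all random tapes, `P` halts within `C n⁴ log (1/ε)` steps. Here `params ε τ`
lists the scalars that are given to the program. -/
def RunsInTime (C : ℝ) (P : Program) (params : ℝ → ℝ → List ℝ) : Prop :=
  ∀ n : ℕ, 2 ≤ n → ∀ ε τ : ℝ, 0 < ε → ε ≤ 1 / 2 → ∀ (T : Tensor3 n) (ω : ℕ → ℝ),
    ∃ (t : ℕ) (s : State), Exec ω P (input n (params ε τ) T) t s ∧
      (t : ℝ) ≤ C * (n : ℝ) ^ 4 * Real.log (1 / ε)

/-- `P` implements the recovery algorithm in time `C n⁴ log (1/ε)`. The input is `ε` and `T`. -/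
def ImplementsRecovery (C : ℝ) (P : Program) : Prop :=
  RunsInTime C P (fun ε _ => [ε]) ∧
  ∀ n : ℕ, 2 ≤ n → ∀ v₀ : EuclideanSpace ℝ (Fin n), ‖v₀‖ = 1 →
    ∀ ε τ : ℝ, 0 < ε → ε ≤ 1 / 2 → noiseLevel n / ε ≤ τ →
      ((noise n).prod tape) {q | ¬ ∃ (t : ℕ) (s : State),
          Exec q.2 P (input n [ε] (spiked τ v₀ q.1)) t s ∧
          ApproxRecovery C ε v₀ (spiked τ v₀ q.1) (outVector n s)} ≤ smallProb C n

/-- `Q` implements the certification algorithm in time `C n⁴ log (1/ε)`. The input is `ε`, `τ` and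
`T`. For every tensor, except with probability `C n^{-10}` over the tape, the answer CERTIFY comes
with a unit vector `v` such that the tested singular value is indeed `O(n^{3/2} (log n)^{1/2})`, and
such that `T(x) ≤ τ ⟨v, x⟩³ + O(n^{3/4} (log n)^{1/4})` on the unit sphere. On spiked tensors with
Gaussian noise the answer is CERTIFY, with an accurate vector, with high probability. -/
def ImplementsCertification (C : ℝ) (Q : Program) : Prop :=
  RunsInTime C Q (fun ε τ => [ε, τ]) ∧
  (∀ n : ℕ, 2 ≤ n → ∀ ε τ : ℝ, 0 < ε → ε ≤ 1 / 2 → ∀ T : Tensor3 n,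
    tape {ω | ¬ ∀ (t : ℕ) (s : State), Exec ω Q (input n [ε, τ] T) t s → SaysCertify s →
        ‖outVector n s‖ = 1 ∧
        topSingularValue (centered (T - τ • cube (outVector n s))) ≤ C * threshold n ∧
        ∀ x : EuclideanSpace ℝ (Fin n), ‖x‖ = 1 →
          cubicForm T x ≤ τ * ⟪outVector n s, x⟫_ℝ ^ 3 + C * noiseLevel n} ≤ smallProb C n) ∧
  ∀ n : ℕ, 2 ≤ n → ∀ v₀ : EuclideanSpace ℝ (Fin n), ‖v₀‖ = 1 →
    ∀ ε τ : ℝ, 0 < ε → ε ≤ 1 / 2 → noiseLevel n / ε ≤ τ →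
      ((noise n).prod tape) {q | ¬ ∃ (t : ℕ) (s : State),
          Exec q.2 Q (input n [ε, τ] (spiked τ v₀ q.1)) t s ∧ SaysCertify s ∧
          ApproxRecovery C ε v₀ (spiked τ v₀ q.1) (outVector n s)} ≤ smallProb C n

end

end SpikedTensor

/-! For a unit vector v₀, the matrix N(T) of a spiked tensor is τ²(v₀⊗v₀)(v₀⊗v₀)ᵀ, plus the cross
terms τ·(v₀v₀ᵀ ⊗ A(v₀) + A(v₀) ⊗ v₀v₀ᵀ) with A(v₀) = ∑ (v₀)ᵢ Aᵢ, plus N(A). All the exact-algorithm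
claims rest on a single event, `NoiseBound`: both ‖N(A)‖ and ‖∑ Aᵢ Aᵢᵀ − n² I‖ are O(n^{3/2} (log
n)^{1/2}), which is the square of the noise level. On that event everything is deterministic. Indeed
⟨x⊗x, (∑ Tᵢ⊗Tᵢ)(y⊗y)⟩ = ∑ ⟨x, Tᵢ y⟩², and the subtracted mean contributes only n‖x‖²‖y‖² to this
form, so ‖N(T)‖ + n bounds the squares of all contractions of T (`norm_contract_le`) and of its
cubic form on the sphere (`cubicForm_sq_le`).

The bound on contractions controls the cross terms, so N(T)/τ² is a rank-one projection up to
O(noiseLevel/τ). Perturbation of singular vectors, followed by folding, gives recovery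
(`inner_sq_ge_of_isRecoveryOutput`). The bound on the cubic form, applied to the residual S, is the
soundness of certification. For completeness, an accurate vector with the right sign satisfies τ‖v₀
− v‖ = O(noiseLevel), and expanding N(S) shows that the residual is as good as noise
(`norm_centered_residual_le`).

The noise event comes from `exists_sliceSum_concentration`. Exchanging slices between two
independent copies of the noise turns the deviation into a Rademacher sum of symmetric matrices. Its
even trace moments obey a recursion obtained by flipping one sign at a time
(`sum_trace_signedSum_pow_le`), a matrix Khintchine inequality. A net argument bounds all slices by
O(√n), and a second-moment argument passes from the symmetrized deviation back to the deviation from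
the mean, at the price of a factor n³ in probability.

The recovery program works with the n × n matrix B = ∑ Tᵢ Tᵢᵀ − n² I, which is again a spike τ²
v₀v₀ᵀ with relative error O(noiseLevel/τ). With d = ⌈log₂ n⌉, some column grows by nearly the factor
‖B‖ between B^d and B^(d+1) (`exists_growing_column`), and one multiplication of such a vector by B
already has the accuracy of the exact algorithm. No iteration count depends on ε.

The certification program tests the norm of C = N(S) by d steps of power iteration from a Gaussian
start, scaled by s of the order of the threshold. If ‖C‖ ≤ s, the iterate cannot grow. If it stays
polynomially bounded, then ‖C‖ = O(s), since the d-th root of a power of n is bounded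
(`norm_sq_le_of_powIter`). One application of C consists of n products of the form Sᵢ X Sᵢᵀ. With
schoolbook products the d iterations would cost n⁴ log n, so Strassen's algorithm is used: n · d ·
7^d = O(n⁴). -/

namespace SpikedTensor

set_option linter.unusedSectionVars false

open scoped Matrix.Norms.L2Operator

/-! ### Matrices as operators on Euclidean space -/

section Operators

variable {ι : Type*} [Fintype ι] [DecidableEq ι]

/-- The continuous linear map of a square matrix on Euclidean space. -/
noncomputable abbrev op (M : Matrix ι ι ℝ) : EuclideanSpace ℝ ι →L[ℝ] EuclideanSpace ℝ ι :=
  Matrix.toEuclideanCLM (n := ι) (𝕜 := ℝ) M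

lemma norm_op (M : Matrix ι ι ℝ) : ‖op M‖ = ‖M‖ := Matrix.l2_opNorm_toEuclideanCLM M

lemma op_apply (M : Matrix ι ι ℝ) (x : EuclideanSpace ℝ ι) (i : ι) :
    op M x i = ∑ j, M i j * x j := by
  rw [op, Matrix.ofLp_toEuclideanCLM]; rfl

lemma norm_op_apply_le (M : Matrix ι ι ℝ) (x : EuclideanSpace ℝ ι) :
    ‖op M x‖ ≤ ‖M‖ * ‖x‖ := by
  rw [← norm_op]; exact (op M).le_opNorm x

lemma op_mul_apply (M N : Matrix ι ι ℝ) (x : EuclideanSpace ℝ ι) :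
    op (M * N) x = op M (op N x) := by
  rw [op, map_mul]; rfl

lemma op_one_apply (x : EuclideanSpace ℝ ι) : op (1 : Matrix ι ι ℝ) x = x := by
  rw [op, map_one]; rfl

lemma inner_eq_sum (x y : EuclideanSpace ℝ ι) : ⟪x, y⟫_ℝ = ∑ i, x i * y i := by
  simp [PiLp.inner_apply, mul_comm]

lemma norm_sq_eq_sum (x : EuclideanSpace ℝ ι) : ‖x‖ ^ 2 = ∑ i, x i ^ 2 := by
  rw [EuclideanSpace.real_norm_sq_eq]

lemma inner_op_transpose (M : Matrix ι ι ℝ) (x y : EuclideanSpace ℝ ι) :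
    ⟪op M.transpose x, y⟫_ℝ = ⟪x, op M y⟫_ℝ := by
  simp only [inner_eq_sum, op_apply, Matrix.transpose_apply, Finset.sum_mul, Finset.mul_sum]
  rw [Finset.sum_comm]
  exact Finset.sum_congr rfl fun i _ => Finset.sum_congr rfl fun j _ => by ring

lemma inner_op_transpose' (M : Matrix ι ι ℝ) (x y : EuclideanSpace ℝ ι) :
    ⟪x, op M.transpose y⟫_ℝ = ⟪op M x, y⟫_ℝ := by
  rw [real_inner_comm, inner_op_transpose, real_inner_comm]

lemma norm_transpose_eq (M : Matrix ι ι ℝ) : ‖M.transpose‖ = ‖M‖ := by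
  rw [← Matrix.conjTranspose_eq_transpose_of_trivial, Matrix.l2_opNorm_conjTranspose]

lemma norm_transpose_mul_self (M : Matrix ι ι ℝ) : ‖M.transpose * M‖ = ‖M‖ ^ 2 := by
  rw [← Matrix.conjTranspose_eq_transpose_of_trivial, Matrix.l2_opNorm_conjTranspose_mul_self, sq]

lemma op_vecMulVec (a b x : EuclideanSpace ℝ ι) :
    op (Matrix.vecMulVec a b) x = ⟪b, x⟫_ℝ • a := by
  ext i
  rw [op_apply, PiLp.smul_apply, inner_eq_sum]
  simp only [Matrix.vecMulVec_apply, smul_eq_mul, Finset.sum_mul]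
  exact Finset.sum_congr rfl fun j _ => by ring

lemma norm_matrix_le_of_inner {M : Matrix ι ι ℝ} {K : ℝ} (hK : 0 ≤ K)
    (h : ∀ x y, ⟪x, op M y⟫_ℝ ≤ K * ‖x‖ * ‖y‖) : ‖M‖ ≤ K := by
  rw [← norm_op]
  refine ContinuousLinearMap.opNorm_le_bound _ hK fun y => ?_
  have h1 := h (op M y) y
  rw [real_inner_self_eq_norm_sq] at h1
  rcases eq_or_lt_of_le (norm_nonneg (op M y)) with h0 | h0
  · rw [← h0]; positivity
  · nlinarith

lemma norm_vecMulVec (a b : EuclideanSpace ℝ ι) : ‖Matrix.vecMulVec a b‖ ≤ ‖a‖ * ‖b‖ := by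
  refine norm_matrix_le_of_inner (by positivity) fun x y => ?_
  rw [op_vecMulVec, real_inner_smul_right]
  have h1 := abs_real_inner_le_norm b y
  have h2 := abs_real_inner_le_norm x a
  calc ⟪b, y⟫_ℝ * ⟪x, a⟫_ℝ ≤ |⟪b, y⟫_ℝ| * |⟪x, a⟫_ℝ| := by rw [← abs_mul]; exact le_abs_self _
    _ ≤ (‖b‖ * ‖y‖) * (‖x‖ * ‖a‖) := by gcongr
    _ = _ := by ring

lemma inner_op_le (M : Matrix ι ι ℝ) (x y : EuclideanSpace ℝ ι) :
    |⟪x, op M y⟫_ℝ| ≤ ‖M‖ * ‖x‖ * ‖y‖ := by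
  calc |⟪x, op M y⟫_ℝ| ≤ ‖x‖ * ‖op M y‖ := abs_real_inner_le_norm _ _
    _ ≤ ‖x‖ * (‖M‖ * ‖y‖) := by gcongr; exact norm_op_apply_le M y
    _ = _ := by ring

lemma toEuclideanLin_apply_eq_op (M : Matrix ι ι ℝ) (x : EuclideanSpace ℝ ι) :
    Matrix.toEuclideanLin M x = op M x := by
  rw [← Matrix.coe_toEuclideanCLM_eq_toEuclideanLin]; rfl

lemma topSingularValue_nonneg (M : Matrix ι ι ℝ) : 0 ≤ topSingularValue M :=
  LinearMap.singularValues_nonneg _ _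

/-- A right singular vector for the largest singular value exists. -/
lemma exists_topSingular_eigenvector [Nonempty ι] (M : Matrix ι ι ℝ) :
    ∃ w : EuclideanSpace ℝ ι, ‖w‖ = 1 ∧
      op (M.transpose * M) w = topSingularValue M ^ 2 • w := by
  set T := Matrix.toEuclideanLin M with hT
  have hpos : 0 < Module.finrank ℝ (EuclideanSpace ℝ ι) := by
    simp [Fintype.card_pos]
  have hev := T.hasEigenvalue_adjoint_comp_self_sq_singularValues hpos
  obtain ⟨v, hv⟩ := hev.exists_hasEigenvector
  have hv0 : ‖v‖ ≠ 0 := norm_ne_zero_iff.mpr hv.2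
  have key : op (M.transpose * M) v = topSingularValue M ^ 2 • v := by
    have h1 := hv.apply_eq_smul
    rw [LinearMap.comp_apply] at h1
    have h2 : ∀ y, LinearMap.adjoint T y = op M.transpose y := by
      intro y
      refine ext_inner_right ℝ fun z => ?_
      rw [LinearMap.adjoint_inner_left, inner_op_transpose, hT, toEuclideanLin_apply_eq_op]
    rw [h2, hT, toEuclideanLin_apply_eq_op] at h1
    rw [op, map_mul]
    exact h1
  refine ⟨‖v‖⁻¹ • v, ?_, ?_⟩
  · rw [norm_smul, norm_inv, norm_norm, inv_mul_cancel₀ hv0]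
  · rw [map_smul, key, smul_comm]

/-- The largest singular value is the operator norm. -/
lemma topSingularValue_eq_norm [Nonempty ι] (M : Matrix ι ι ℝ) : topSingularValue M = ‖M‖ := by
  have hpos : 0 < Module.finrank ℝ (EuclideanSpace ℝ ι) := by
    simp [Fintype.card_pos]
  apply le_antisymm
  · obtain ⟨w, hw, h⟩ := exists_topSingular_eigenvector M
    have h1 : ‖op (M.transpose * M) w‖ ≤ ‖M‖ ^ 2 := by
      have := norm_op_apply_le (M.transpose * M) w
      rwa [norm_transpose_mul_self, hw, mul_one] at this
    rw [h, norm_smul, hw, mul_one, Real.norm_eq_abs, abs_of_nonneg (sq_nonneg _)] at h1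
    exact (pow_le_pow_iff_left₀ (topSingularValue_nonneg M) (norm_nonneg _) two_ne_zero).mp h1
  · rw [← norm_op]
    refine ContinuousLinearMap.opNorm_le_bound _ (topSingularValue_nonneg M) fun x => ?_
    set T := Matrix.toEuclideanLin M with hT
    -- In an orthonormal eigenbasis of T*T, ‖Tx‖² is a combination of the eigenvalues with weights
    -- ⟨bᵢ, x⟩². All eigenvalues are at most the square of the zeroth singular value.
    set b := T.isSymmetric_adjoint_comp_self.eigenvectorBasis rfl with hb
    have hx : ‖op M x‖ ^ 2 = ∑ i, T.isSymmetric_adjoint_comp_self.eigenvalues rfl i *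
        ⟪b i, x⟫_ℝ ^ 2 := by
      rw [← toEuclideanLin_apply_eq_op, ← real_inner_self_eq_norm_sq, ← hT,
        ← LinearMap.adjoint_inner_left, ← b.sum_inner_mul_inner]
      refine Finset.sum_congr rfl fun i _ => ?_
      have h1 : ⟪LinearMap.adjoint T (T x), b i⟫_ℝ
          = T.isSymmetric_adjoint_comp_self.eigenvalues rfl i * ⟪b i, x⟫_ℝ := by
        have := T.isSymmetric_adjoint_comp_self x (b i)
        simp only [LinearMap.comp_apply] at this
        rw [this]
        have h2 := T.isSymmetric_adjoint_comp_self.apply_eigenvectorBasis rfl i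
        simp only [LinearMap.comp_apply] at h2
        rw [← hb] at h2
        rw [h2, real_inner_comm]
        simp [real_inner_smul_left]
      rw [h1]; ring
    have hle : ∀ i, T.isSymmetric_adjoint_comp_self.eigenvalues rfl i ≤ topSingularValue M ^ 2 := by
      intro i
      rw [← T.sq_singularValues_fin rfl i]
      have := T.singularValues_antitone (Nat.zero_le i)
      exact pow_le_pow_left₀ (T.singularValues_nonneg _) this 2
    have : ‖op M x‖ ^ 2 ≤ (topSingularValue M * ‖x‖) ^ 2 := by
      rw [hx, mul_pow, ← b.sum_sq_inner_right x, Finset.mul_sum]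
      exact Finset.sum_le_sum fun i _ => mul_le_mul_of_nonneg_right (hle i) (sq_nonneg _)
    exact (pow_le_pow_iff_left₀ (norm_nonneg _)
      (mul_nonneg (topSingularValue_nonneg M) (norm_nonneg _)) two_ne_zero).mp this

lemma exists_norm_sq_eigenvector [Nonempty ι] (M : Matrix ι ι ℝ) :
    ∃ w : EuclideanSpace ℝ ι, ‖w‖ = 1 ∧ op (M.transpose * M) w = ‖M‖ ^ 2 • w := by
  simpa only [topSingularValue_eq_norm] using exists_topSingular_eigenvector M

end Operators

/-! ### Perturbation of rank-one operators -/

section Perturbation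

variable {E : Type*} [NormedAddCommGroup E] [InnerProductSpace ℝ E]

lemma norm_sq_sub_inner_smul {p u : E} (hp : ‖p‖ = 1) :
    ‖u - ⟪u, p⟫_ℝ • p‖ ^ 2 = ‖u‖ ^ 2 - ⟪u, p⟫_ℝ ^ 2 := by
  rw [norm_sub_sq_real, norm_smul, real_inner_smul_right, hp, mul_one, Real.norm_eq_abs, sq_abs]
  ring

/-- A vector close to a multiple of `p` is almost parallel to `p`. -/
lemma norm_sq_sub_inner_sq_le {p u : E} (hp : ‖p‖ = 1) (a : ℝ) :
    ‖u‖ ^ 2 - ⟪u, p⟫_ℝ ^ 2 ≤ ‖u - a • p‖ ^ 2 := by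
  have h : ‖u - a • p‖ ^ 2 = ‖u‖ ^ 2 - 2 * a * ⟪u, p⟫_ℝ + a ^ 2 := by
    rw [norm_sub_sq_real, norm_smul, real_inner_smul_right, hp, mul_one, Real.norm_eq_abs, sq_abs]
    ring
  rw [h]; nlinarith [sq_nonneg (a - ⟪u, p⟫_ℝ)]

/-- If `σ u = a p + e` with `u`, `p` unit vectors, then `u` is almost parallel to `p`. -/
lemma one_sub_inner_sq_le_of_smul_eq {p u e : E} {σ a δ : ℝ} (hp : ‖p‖ = 1) (hu : ‖u‖ = 1)
    (hσ : 0 < σ) (h : σ • u = a • p + e) (he : ‖e‖ ≤ δ * σ) : 1 - ⟪u, p⟫_ℝ ^ 2 ≤ δ ^ 2 := by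
  -- The multiple a/σ of `p` lies at distance exactly ‖e‖/σ from `u`.
  have h1 := norm_sq_sub_inner_sq_le (u := u) hp (σ⁻¹ * a)
  have h2 : u - (σ⁻¹ * a) • p = σ⁻¹ • e := by
    rw [← sub_eq_iff_eq_add'] at h
    rw [← h, smul_sub, smul_smul, smul_smul, inv_mul_cancel₀ hσ.ne', one_smul]
  rw [h2, norm_smul, hu, norm_inv, Real.norm_eq_abs, abs_of_pos hσ] at h1
  have h3 : σ⁻¹ * ‖e‖ ≤ δ := by rw [inv_mul_le_iff₀ hσ]; linarith
  have h4 : (σ⁻¹ * ‖e‖) ^ 2 ≤ δ ^ 2 := pow_le_pow_left₀ (by positivity) h3 2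
  linarith

/-- Angles to a common unit vector are subadditive, up to a constant factor. -/
lemma inner_sq_ge_of_inner_sq_ge {u v p : E} (hu : ‖u‖ = 1) (hv : ‖v‖ = 1) (hp : ‖p‖ = 1)
    {a b : ℝ} (h1 : 1 - a ≤ ⟪u, p⟫_ℝ ^ 2) (h2 : 1 - b ≤ ⟪v, p⟫_ℝ ^ 2) :
    1 - 2 * (a + b) ≤ ⟪u, v⟫_ℝ ^ 2 := by
  set s := ⟪u, p⟫_ℝ
  set t := ⟪v, p⟫_ℝ
  have ht : t ^ 2 ≤ 1 := by
    have := abs_real_inner_le_norm v p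
    rw [hv, hp, mul_one] at this
    exact (sq_le_one_iff_abs_le_one _).mpr this
  have hs : s ^ 2 ≤ 1 := by
    have := abs_real_inner_le_norm u p
    rw [hu, hp, mul_one] at this
    exact (sq_le_one_iff_abs_le_one _).mpr this
  -- Splitting off the components along `p` leaves a remainder r with r² ≤ (1 − s²)(1 − t²). By the
  -- inequality of arithmetic and geometric means it lowers the square of s t + r by at most (1 −
  -- s²) + (1 − t²).
  have hinner : ⟪u, v⟫_ℝ = s * t + ⟪u - s • p, v - t • p⟫_ℝ := by
    simp only [inner_sub_left, inner_sub_right, real_inner_smul_left, real_inner_smul_right,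
      real_inner_self_eq_norm_sq, hp]
    rw [real_inner_comm v p]; simp only [s, t]; rw [real_inner_comm p v]; ring
  have habs := abs_real_inner_le_norm (u - s • p) (v - t • p)
  set r := ⟪u - s • p, v - t • p⟫_ℝ
  have hr : r ^ 2 ≤ (1 - s ^ 2) * (1 - t ^ 2) := by
    have h3 : r ^ 2 ≤ (‖u - s • p‖ * ‖v - t • p‖) ^ 2 := sq_le_sq' (by linarith [neg_abs_le r]) (by
      linarith [le_abs_self r])
    rw [mul_pow, norm_sq_sub_inner_smul hp, norm_sq_sub_inner_smul hp, hu, hv] at h3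
    simpa using h3
  have hmul : (s * t) ^ 2 = s ^ 2 * t ^ 2 := by ring
  have hst : 2 * (s * t * r) ≥ - (2 * (1 - s ^ 2) / 2 + 2 * (1 - t ^ 2) / 2) := by
    have h5 : (s * t * r) ^ 2 ≤ (((1 - s ^ 2) + (1 - t ^ 2)) / 2) ^ 2 := by
      have h6 : (s * t * r) ^ 2 ≤ (1 - s ^ 2) * (1 - t ^ 2) := by
        calc (s * t * r) ^ 2 = (s ^ 2 * t ^ 2) * r ^ 2 := by ring
          _ ≤ 1 * r ^ 2 := by
            gcongr
            nlinarith [sq_nonneg s, sq_nonneg t]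
          _ ≤ _ := by linarith
      nlinarith [sq_nonneg ((1 - s ^ 2) - (1 - t ^ 2))]
    have h7 := abs_le_of_sq_le_sq' h5 (by linarith)
    linarith [h7.1]
  rw [hinner]
  nlinarith [sq_nonneg r, mul_nonneg (sub_nonneg.mpr hs) (sub_nonneg.mpr ht)]

end Perturbation

/-! ### Top singular vectors of perturbed rank-one matrices -/

section TopSingular

variable {ι : Type*} [Fintype ι] [DecidableEq ι] [Nonempty ι]

/-- Top singular vectors of a perturbed rank-one matrix are almost parallel to the spike. -/
lemma one_sub_inner_sq_le_of_isTopSingularVector {M F : Matrix ι ι ℝ} {p w : EuclideanSpace ℝ ι}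
    {c η : ℝ} (hc : 0 < c) (hη : η ≤ 1 / 2) (hp : ‖p‖ = 1)
    (hM : M = c • Matrix.vecMulVec p p + F) (hF : ‖F‖ ≤ η * c)
    (hw : IsTopSingularVector M w) : 1 - ⟪w, p⟫_ℝ ^ 2 ≤ (2 * η) ^ 2 := by
  have hη0 : 0 ≤ η := by
    by_contra h
    nlinarith [norm_nonneg F]
  have hMx : ∀ x, op M x = (c * ⟪p, x⟫_ℝ) • p + op F x := by
    intro x
    rw [hM, op, map_add, map_smul]
    change c • op (Matrix.vecMulVec p p) x + op F x = _
    rw [op_vecMulVec, smul_smul]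
  have hMt : M.transpose = c • Matrix.vecMulVec p p + F.transpose := by
    rw [hM, Matrix.transpose_add, Matrix.transpose_smul, Matrix.transpose_vecMulVec]
  have hMtx : ∀ x, op M.transpose x = (c * ⟪p, x⟫_ℝ) • p + op F.transpose x := by
    intro x
    rw [hMt, op, map_add, map_smul]
    change c • op (Matrix.vecMulVec p p) x + op F.transpose x = _
    rw [op_vecMulVec, smul_smul]
  set σ := topSingularValue M with hσ
  -- Testing on `p` gives ‖M p‖ ≥ c − ‖F‖ ≥ (1 − η) c.
  have hσ2 : c / 2 ≤ σ := by
    rw [hσ, topSingularValue_eq_norm]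
    have h1 := norm_op_apply_le M p
    have h2 : ‖(c * ⟪p, p⟫_ℝ) • p‖ ≤ ‖op M p‖ + ‖op F p‖ := by
      rw [hMx]
      simpa using norm_sub_le ((c * ⟪p, p⟫_ℝ) • p + op F p) (op F p)
    have h3 := norm_op_apply_le F p
    rw [real_inner_self_eq_norm_sq, norm_smul, hp] at h2
    rw [hp] at h1 h3
    norm_num at h2
    rw [abs_of_pos hc] at h2
    nlinarith
  have hσ0 : 0 < σ := by linarith
  have hb : ∀ e : EuclideanSpace ℝ ι, ‖e‖ ≤ η * c → ‖e‖ ≤ (2 * η) * σ := by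
    intro e he; nlinarith
  -- A left singular vector is read off from M u = σ w, a right one from Mᵀ u = σ w. In both cases σ
  -- w is a multiple of `p` plus an error of norm at most η c ≤ 2 η σ.
  obtain ⟨u, h | h⟩ := hw
  · obtain ⟨h1, h2, h3, -⟩ := h
    rw [toEuclideanLin_apply_eq_op, hMx] at h3
    refine one_sub_inner_sq_le_of_smul_eq hp h1 hσ0 h3.symm (hb _ ?_)
    have := norm_op_apply_le F u
    rw [h2, mul_one] at this
    exact this.trans hF
  · obtain ⟨h1, h2, -, h3⟩ := h
    rw [toEuclideanLin_apply_eq_op, hMtx] at h3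
    refine one_sub_inner_sq_le_of_smul_eq hp h2 hσ0 h3.symm (hb _ ?_)
    have := norm_op_apply_le F.transpose u
    rw [h1, mul_one, norm_transpose_eq] at this
    exact this.trans hF

end TopSingular

/-! ### Product vectors -/

section Products

variable {n : ℕ}

/-- The product vector `a ⊗ b`. -/
noncomputable def tens (a b : EuclideanSpace ℝ (Fin n)) : EuclideanSpace ℝ (Fin n × Fin n) :=
  WithLp.toLp 2 fun p => a p.1 * b p.2

lemma tens_apply (a b : EuclideanSpace ℝ (Fin n)) (p : Fin n × Fin n) :
    tens a b p = a p.1 * b p.2 := rfl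

lemma inner_tens (a b c d : EuclideanSpace ℝ (Fin n)) :
    ⟪tens a b, tens c d⟫_ℝ = ⟪a, c⟫_ℝ * ⟪b, d⟫_ℝ := by
  simp only [inner_eq_sum, tens_apply, Fintype.sum_prod_type, Finset.sum_mul_sum]
  exact Finset.sum_congr rfl fun i _ => Finset.sum_congr rfl fun j _ => by ring

lemma norm_tens (a b : EuclideanSpace ℝ (Fin n)) : ‖tens a b‖ = ‖a‖ * ‖b‖ := by
  have h : ‖tens a b‖ ^ 2 = (‖a‖ * ‖b‖) ^ 2 := by
    rw [← real_inner_self_eq_norm_sq, inner_tens, real_inner_self_eq_norm_sq,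
      real_inner_self_eq_norm_sq, mul_pow]
  exact (pow_left_inj₀ (norm_nonneg _) (by positivity) two_ne_zero).mp h

lemma inner_tens_eq_fold (w : EuclideanSpace ℝ (Fin n × Fin n)) (a b : EuclideanSpace ℝ (Fin n)) :
    ⟪tens a b, w⟫_ℝ = ⟪a, op (fold w) b⟫_ℝ := by
  simp only [inner_eq_sum, tens_apply, Fintype.sum_prod_type, op_apply, Finset.mul_sum, fold,
    Matrix.of_apply]
  exact Finset.sum_congr rfl fun i _ => Finset.sum_congr rfl fun j _ => by ring

lemma inner_op_kronecker (P Q : Matrix (Fin n) (Fin n) ℝ) (a b c d : EuclideanSpace ℝ (Fin n)) :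
    ⟪tens a b, op (P ⊗ₖ Q) (tens c d)⟫_ℝ = ⟪a, op P c⟫_ℝ * ⟪b, op Q d⟫_ℝ := by
  have : op (P ⊗ₖ Q) (tens c d) = tens (op P c) (op Q d) := by
    ext p
    rw [op_apply, tens_apply, op_apply, op_apply, Fintype.sum_prod_type, Finset.sum_mul_sum]
    refine Finset.sum_congr rfl fun i _ => Finset.sum_congr rfl fun j _ => ?_
    rw [Matrix.kroneckerMap_apply, tens_apply]; ring
  rw [this, inner_tens]

/-- The top singular vectors of a folded unit vector that is close to `v₀ ⊗ v₀`. -/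
lemma one_sub_inner_sq_le_of_fold [Nonempty (Fin n)] {w : EuclideanSpace ℝ (Fin n × Fin n)}
    {v v₀ : EuclideanSpace ℝ (Fin n)} {δ : ℝ} (hw : ‖w‖ = 1) (hv₀ : ‖v₀‖ = 1)
    (h : 1 - δ ≤ ⟪w, tens v₀ v₀⟫_ℝ ^ 2) (hv : IsTopSingularVector (fold w) v) :
    1 - 8 * δ ≤ ⟪v, v₀⟫_ℝ ^ 2 := by
  -- For δ ≥ 1/8 the lower bound is not positive.
  by_cases hδ : 1 / 8 ≤ δ
  · nlinarith [sq_nonneg ⟪v, v₀⟫_ℝ]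
  push Not at hδ
  have hv0n : ‖tens v₀ v₀‖ = 1 := by rw [norm_tens, hv₀, mul_one]
  -- the pair of singular vectors
  have main : ∀ a b : EuclideanSpace ℝ (Fin n), ‖a‖ = 1 → ‖b‖ = 1 →
      ⟪a, op (fold w) b⟫_ℝ = topSingularValue (fold w) →
      1 - 8 * δ ≤ ⟪a, v₀⟫_ℝ ^ 2 ∧ 1 - 8 * δ ≤ ⟪b, v₀⟫_ℝ ^ 2 := by
    intro a b ha hb hab
    set t := ⟪w, tens v₀ v₀⟫_ℝ with ht
    have ht1 : |t| ≤ 1 := by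
      have := abs_real_inner_le_norm w (tens v₀ v₀)
      rwa [hw, hv0n, mul_one] at this
    have htabs : 1 - δ ≤ |t| := by nlinarith [sq_abs t, abs_nonneg t]
    -- Maximality of the top singular value: the pair (a, b) does at least as well as (v₀, v₀).
    -- Hence both ± v₀⊗v₀ and a⊗b are within √(2δ) of `w`, so they are close to each other.
    have hσ : |t| ≤ ⟪w, tens a b⟫_ℝ := by
      rw [real_inner_comm, inner_tens_eq_fold, hab, topSingularValue_eq_norm, ht,
        real_inner_comm, inner_tens_eq_fold]
      simpa [hv₀] using inner_op_le (fold w) v₀ v₀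
    have habn : ‖tens a b‖ = 1 := by rw [norm_tens, ha, hb, mul_one]
    -- sign
    obtain ⟨s, hs, hst⟩ : ∃ s : ℝ, s ^ 2 = 1 ∧ s * t = |t| := by
      rcases le_total 0 t with h0 | h0
      · exact ⟨1, by norm_num, by rw [abs_of_nonneg h0, one_mul]⟩
      · exact ⟨-1, by norm_num, by rw [abs_of_nonpos h0]; ring⟩
    have hs1 : ‖s‖ = 1 := by
      rw [Real.norm_eq_abs, ← pow_left_inj₀ (abs_nonneg s) zero_le_one two_ne_zero, sq_abs, hs]
      norm_num
    have hq : ‖s • tens v₀ v₀‖ = 1 := by rw [norm_smul, hs1, hv0n, mul_one]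
    have e1 : ‖w - s • tens v₀ v₀‖ ^ 2 ≤ 2 * δ := by
      rw [norm_sub_sq_real, hw, hq, real_inner_smul_right, ← ht, hst]; linarith
    have e2 : ‖w - tens a b‖ ^ 2 ≤ 2 * δ := by
      rw [norm_sub_sq_real, hw, habn]; linarith
    have e3 : ‖s • tens v₀ v₀ - tens a b‖ ^ 2 ≤ 8 * δ := by
      have h1 : ‖s • tens v₀ v₀ - tens a b‖ ≤ ‖w - s • tens v₀ v₀‖ + ‖w - tens a b‖ := by
        have : s • tens v₀ v₀ - tens a b = -(w - s • tens v₀ v₀) + (w - tens a b) := by abel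
        rw [this]
        exact (norm_add_le _ _).trans (by rw [norm_neg])
      have h2 : ‖s • tens v₀ v₀ - tens a b‖ ^ 2 ≤
          (‖w - s • tens v₀ v₀‖ + ‖w - tens a b‖) ^ 2 := pow_le_pow_left₀ (norm_nonneg _) h1 2
      nlinarith [sq_nonneg (‖w - s • tens v₀ v₀‖ - ‖w - tens a b‖)]
    rw [norm_sub_sq_real, hq, habn, real_inner_smul_left, inner_tens] at e3
    set x := ⟪v₀, a⟫_ℝ with hx
    set y := ⟪v₀, b⟫_ℝ with hy
    have hx1 : |x| ≤ 1 := by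
      have := abs_real_inner_le_norm v₀ a
      rwa [hv₀, ha, mul_one] at this
    have hy1 : |y| ≤ 1 := by
      have := abs_real_inner_le_norm v₀ b
      rwa [hv₀, hb, mul_one] at this
    have h4 : 1 - 4 * δ ≤ |x| * |y| := by
      have : s * (x * y) ≤ |x| * |y| := by
        calc s * (x * y) ≤ |s * (x * y)| := le_abs_self _
          _ = |x| * |y| := by rw [abs_mul, abs_mul, ← Real.norm_eq_abs s, hs1, one_mul]
      linarith
    rw [real_inner_comm, ← hx, real_inner_comm v₀ b, ← hy, ← sq_abs x, ← sq_abs y]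
    have hxl : 1 - 4 * δ ≤ |x| := by nlinarith [abs_nonneg x, abs_nonneg y]
    have hyl : 1 - 4 * δ ≤ |y| := by nlinarith [abs_nonneg x, abs_nonneg y]
    constructor <;> nlinarith
  obtain ⟨u, h' | h'⟩ := hv
  · obtain ⟨h1, h2, h3, -⟩ := h'
    refine (main v u h1 h2 ?_).1
    rw [← toEuclideanLin_apply_eq_op, h3, real_inner_smul_right, real_inner_self_eq_norm_sq, h1]
    norm_num
  · obtain ⟨h1, h2, h3, -⟩ := h'
    refine (main u v h1 h2 ?_).2
    rw [← toEuclideanLin_apply_eq_op, h3, real_inner_smul_right, real_inner_self_eq_norm_sq, h1]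
    norm_num

end Products

/-! ### Moments of the noise tensor -/

section Noise

instance (n : ℕ) : IsProbabilityMeasure (noise n) := by unfold noise; infer_instance

lemma integral_sq_gaussianReal : ∫ x, x ^ 2 ∂(gaussianReal 0 1) = 1 := by
  have h := variance_id_gaussianReal (μ := 0) (v := 1)
  rw [variance_eq_integral (by fun_prop)] at h
  simpa using h

lemma integral_noise_mul {n : ℕ} (a b : Fin n × Fin n × Fin n) :
    ∫ A, A a * A b ∂(noise n) = if a = b then 1 else 0 := by
  split_ifs with h
  · subst h
    have := integral_comp_eval (μ := fun _ : Fin n × Fin n × Fin n => gaussianReal 0 1) (i := a)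
      (f := fun x : ℝ => x * x) (by fun_prop)
    rw [noise, this]
    simpa [sq] using integral_sq_gaussianReal
  · have hind : IndepFun (fun A : Tensor3 n => A a) (fun A => A b) (noise n) :=
      (iIndepFun_pi (μ := fun _ : Fin n × Fin n × Fin n => gaussianReal 0 1)
        (X := fun _ x => x) (fun _ => aemeasurable_id)).indepFun h
    rw [hind.integral_fun_mul_eq_mul_integral (measurable_pi_apply a).aestronglyMeasurable
      (measurable_pi_apply b).aestronglyMeasurable]
    have : ∫ A, A a ∂(noise n) = 0 := by
      have := integral_comp_eval (μ := fun _ : Fin n × Fin n × Fin n => gaussianReal 0 1) (i := a)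
        (f := fun x : ℝ => x) (by fun_prop)
      rw [noise, this]
      simp
    rw [this, zero_mul]

lemma memLp_noise_eval {n : ℕ} (a : Fin n × Fin n × Fin n) {p : ENNReal}
    (hp : p ≠ ⊤) : MemLp (fun A : Tensor3 n => A a) p (noise n) :=
  (memLp_id_gaussianReal' p hp).comp_measurePreserving
    (measurePreserving_eval (fun _ : Fin n × Fin n × Fin n => gaussianReal 0 1) a)

lemma integrable_noise_mul {n : ℕ} (a b : Fin n × Fin n × Fin n) :
    Integrable (fun A : Tensor3 n => A a * A b) (noise n) :=
  (memLp_noise_eval a (p := 2) (by simp)).integrable_mul (memLp_noise_eval b (p := 2) (by simp))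

lemma sliceSquare_apply {n : ℕ} (T : Tensor3 n) (p q : Fin n × Fin n) :
    sliceSquare T p q = ∑ i, T (i, p.1, q.1) * T (i, p.2, q.2) := by
  rw [sliceSquare, Matrix.sum_apply]
  exact Finset.sum_congr rfl fun i _ => by simp [slice]

/-- The expectation of the slice square. -/
lemma noiseMean_apply {n : ℕ} (p q : Fin n × Fin n) :
    noiseMean n p q = if p.1 = p.2 ∧ q.1 = q.2 then (n : ℝ) else 0 := by
  simp only [noiseMean, Matrix.of_apply, sliceSquare_apply]
  rw [integral_finsetSum _ fun i _ => integrable_noise_mul _ _]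
  simp only [integral_noise_mul, Prod.mk.injEq, true_and]
  split_ifs <;> simp

lemma op_noiseMean_apply {n : ℕ} (x : EuclideanSpace ℝ (Fin n × Fin n)) (p : Fin n × Fin n) :
    op (noiseMean n) x p = if p.1 = p.2 then n * ∑ k, x (k, k) else 0 := by
  simp only [op_apply, noiseMean_apply, Fintype.sum_prod_type]
  split_ifs with h
  · simp [h, Finset.mul_sum]
  · simp [h]

lemma transpose_noiseMean (n : ℕ) : (noiseMean n).transpose = noiseMean n := by
  ext p q
  simp only [Matrix.transpose_apply, noiseMean_apply, and_comm]

/-- The mean is n e eᵀ with e = vec(I). Its operator norm is n², but ⟨e, x⊗x⟩ = ‖x‖², so symmetric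
product vectors see only n. This is why subtracting the mean costs almost nothing in the bounds on
contractions. -/
lemma inner_op_noiseMean {n : ℕ} (x y : EuclideanSpace ℝ (Fin n)) :
    ⟪tens x x, op (noiseMean n) (tens y y)⟫_ℝ = n * ‖x‖ ^ 2 * ‖y‖ ^ 2 := by
  simp only [inner_eq_sum, op_noiseMean_apply, tens_apply, Fintype.sum_prod_type, norm_sq_eq_sum]
  simp [Finset.sum_mul, Finset.mul_sum]
  rw [Finset.sum_comm]
  refine Finset.sum_congr rfl fun i _ => Finset.sum_congr rfl fun j _ => by ring

end Noise

/-! ### Contractions of a tensor with controlled slice square -/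

section Contractions

variable {n : ℕ}

/-- Kronecker products factor on product vectors. The resulting sum of squares is what lets a norm
bound on one matrix control every contraction of the tensor. -/
lemma inner_op_sliceSquare (T : Tensor3 n) (x y : EuclideanSpace ℝ (Fin n)) :
    ⟪tens x x, op (sliceSquare T) (tens y y)⟫_ℝ = ∑ i, ⟪x, op (slice T i) y⟫_ℝ ^ 2 := by
  rw [sliceSquare, op, map_sum, sum_apply, inner_sum]
  exact Finset.sum_congr rfl fun i _ => by
    rw [sq]; exact inner_op_kronecker _ _ _ _ _ _

/-- Bilinear forms of the slices are square summable with a bound from the centered matrix. -/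
lemma sum_inner_op_slice_sq_le (T : Tensor3 n) (x y : EuclideanSpace ℝ (Fin n)) :
    ∑ i, ⟪x, op (slice T i) y⟫_ℝ ^ 2 ≤ (‖centered T‖ + n) * (‖x‖ * ‖y‖) ^ 2 := by
  have h : sliceSquare T = centered T + noiseMean n := by rw [centered, sub_add_cancel]
  rw [← inner_op_sliceSquare, h, op, map_add, add_apply, inner_add_right]
  have h1 := (le_abs_self _).trans (inner_op_le (centered T) (tens x x) (tens y y))
  have h2 := inner_op_noiseMean x y
  rw [norm_tens, norm_tens] at h1
  change ⟪tens x x, op (centered T) (tens y y)⟫_ℝ +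
    ⟪tens x x, op (noiseMean n) (tens y y)⟫_ℝ ≤ _
  rw [h2]
  nlinarith

/-- The contraction `∑ a_i T_i`. -/
noncomputable def contract (T : Tensor3 n) (a : EuclideanSpace ℝ (Fin n)) :
    Matrix (Fin n) (Fin n) ℝ := ∑ i, a i • slice T i

lemma inner_op_contract (T : Tensor3 n) (a x y : EuclideanSpace ℝ (Fin n)) :
    ⟪x, op (contract T a) y⟫_ℝ = ∑ i, a i * ⟪x, op (slice T i) y⟫_ℝ := by
  rw [contract, op, map_sum, sum_apply, inner_sum]
  refine Finset.sum_congr rfl fun i _ => ?_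
  rw [map_smul, smul_apply, real_inner_smul_right]

lemma inner_op_contract_sq_le (T : Tensor3 n) (a x y : EuclideanSpace ℝ (Fin n)) :
    ⟪x, op (contract T a) y⟫_ℝ ^ 2 ≤ (‖centered T‖ + n) * (‖a‖ * ‖x‖ * ‖y‖) ^ 2 := by
  rw [inner_op_contract]
  refine (Finset.sum_mul_sq_le_sq_mul_sq _ _ _).trans ?_
  rw [← norm_sq_eq_sum]
  calc ‖a‖ ^ 2 * ∑ i, ⟪x, op (slice T i) y⟫_ℝ ^ 2
      ≤ ‖a‖ ^ 2 * ((‖centered T‖ + n) * (‖x‖ * ‖y‖) ^ 2) := by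
        gcongr; exact sum_inner_op_slice_sq_le T x y
    _ = _ := by ring

/-- Cauchy–Schwarz over the slice index. Since it holds for every tensor, the noise contracted with
the spike needs no probabilistic estimate of its own. -/
lemma norm_contract_le (T : Tensor3 n) (a : EuclideanSpace ℝ (Fin n)) :
    ‖contract T a‖ ≤ √(‖centered T‖ + n) * ‖a‖ := by
  refine norm_matrix_le_of_inner (by positivity) fun x y => ?_
  refine le_trans (Real.le_sqrt_of_sq_le (inner_op_contract_sq_le T a x y)) ?_
  rw [Real.sqrt_mul (by positivity), Real.sqrt_sq (by positivity)]
  exact le_of_eq (by ring)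

lemma cubicForm_eq_inner (T : Tensor3 n) (x : EuclideanSpace ℝ (Fin n)) :
    cubicForm T x = ⟪x, op (contract T x) x⟫_ℝ := by
  rw [inner_op_contract, cubicForm]
  refine Finset.sum_congr rfl fun i _ => ?_
  simp only [inner_eq_sum, op_apply, slice, Matrix.of_apply, Finset.mul_sum]
  exact Finset.sum_congr rfl fun j _ => Finset.sum_congr rfl fun k _ => by ring

/-- The certificate: the cubic form is the bilinear form of the contraction by `x`, taken at (x, x).
-/
lemma cubicForm_sq_le (T : Tensor3 n) {x : EuclideanSpace ℝ (Fin n)} (hx : ‖x‖ = 1) :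
    cubicForm T x ^ 2 ≤ ‖centered T‖ + n := by
  have := inner_op_contract_sq_le T x x x
  rw [← cubicForm_eq_inner, hx] at this
  simpa using this

lemma cubicForm_cube (v x : EuclideanSpace ℝ (Fin n)) : cubicForm (cube v) x = ⟪v, x⟫_ℝ ^ 3 := by
  simp only [cubicForm, cube, inner_eq_sum]
  rw [pow_succ, sq, Finset.sum_mul_sum, Finset.sum_mul]
  refine Finset.sum_congr rfl fun i _ => ?_
  rw [Finset.sum_mul_sum]
  exact Finset.sum_congr rfl fun j _ => Finset.sum_congr rfl fun k _ => by ring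

lemma cubicForm_add (S T : Tensor3 n) (x : EuclideanSpace ℝ (Fin n)) :
    cubicForm (S + T) x = cubicForm S x + cubicForm T x := by
  simp only [cubicForm, Pi.add_apply, add_mul, Finset.sum_add_distrib]

lemma cubicForm_smul (c : ℝ) (T : Tensor3 n) (x : EuclideanSpace ℝ (Fin n)) :
    cubicForm (c • T) x = c * cubicForm T x := by
  simp only [cubicForm, Pi.smul_apply, smul_eq_mul, Finset.mul_sum, mul_assoc]

end Contractions

/-! ### The orders of magnitude -/

section Orders

lemma noiseLevel_sq (n : ℕ) : noiseLevel n ^ 2 = threshold n := by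
  have hl : 0 ≤ Real.log n := Real.log_natCast_nonneg n
  rw [noiseLevel, threshold, mul_pow, ← Real.rpow_natCast, ← Real.rpow_natCast,
    ← Real.rpow_mul (Nat.cast_nonneg n), ← Real.rpow_mul hl]
  norm_num

lemma threshold_sq (n : ℕ) : threshold n ^ 2 = n ^ 3 * Real.log n := by
  have hl : 0 ≤ Real.log n := Real.log_natCast_nonneg n
  rw [threshold, mul_pow, ← Real.rpow_natCast, ← Real.rpow_natCast,
    ← Real.rpow_mul (Nat.cast_nonneg n), ← Real.rpow_mul hl]
  norm_num

lemma log_pos_of_two_le {n : ℕ} (hn : 2 ≤ n) : 0 < Real.log n :=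
  Real.log_pos (by exact_mod_cast hn)

lemma half_le_log {n : ℕ} (hn : 2 ≤ n) : 1 / 2 ≤ Real.log n := by
  have h1 := Real.log_two_gt_d9
  have h2 : Real.log 2 ≤ Real.log n := Real.log_le_log (by norm_num) (by exact_mod_cast hn)
  linarith

lemma noiseLevel_pos {n : ℕ} (hn : 2 ≤ n) : 0 < noiseLevel n := by
  have := log_pos_of_two_le hn
  unfold noiseLevel; positivity

lemma threshold_nonneg (n : ℕ) : 0 ≤ threshold n := by
  have := Real.log_natCast_nonneg n
  unfold threshold; positivity

/-- Squared, this says n² ≤ n³ log n, and n log n ≥ 1 for n ≥ 2. It absorbs the additive n left by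
the mean. -/
lemma natCast_le_threshold {n : ℕ} (hn : 2 ≤ n) : (n : ℝ) ≤ threshold n := by
  refine (pow_le_pow_iff_left₀ (Nat.cast_nonneg n) (threshold_nonneg n) two_ne_zero).mp ?_
  rw [threshold_sq]
  have h := half_le_log hn
  have h2 : (2 : ℝ) ≤ n := by exact_mod_cast hn
  nlinarith [mul_le_mul h2 h (by norm_num) (by positivity), sq_nonneg (n : ℝ)]

/-- With small centered matrix the contractions are of the order of the noise level. -/
lemma sqrt_norm_centered_le {n : ℕ} (hn : 2 ≤ n) {K : ℝ} (hK : 0 ≤ K) {T : Tensor3 n}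
    (h : ‖centered T‖ ≤ K * threshold n) : √(‖centered T‖ + n) ≤ (K + 1) * noiseLevel n := by
  have h1 := natCast_le_threshold hn
  have h2 := threshold_nonneg n
  refine Real.sqrt_le_iff.mpr ⟨mul_nonneg (by linarith) (noiseLevel_pos hn).le, ?_⟩
  rw [mul_pow, noiseLevel_sq]
  nlinarith [mul_nonneg (mul_nonneg hK hK) h2, mul_nonneg hK h2]

/-- A small centered residual certifies an upper bound on the cubic form. -/
lemma cubicForm_le_of_norm_centered_le {n : ℕ} (hn : 2 ≤ n) {K τ : ℝ} (hK : 0 ≤ K) {T : Tensor3 n}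
    {v : EuclideanSpace ℝ (Fin n)} (h : ‖centered (T - τ • cube v)‖ ≤ K * threshold n)
    {x : EuclideanSpace ℝ (Fin n)} (hx : ‖x‖ = 1) :
    cubicForm T x ≤ τ * ⟪v, x⟫_ℝ ^ 3 + (K + 1) * noiseLevel n := by
  have h1 := (Real.le_sqrt_of_sq_le (cubicForm_sq_le (T - τ • cube v) hx)).trans
    (sqrt_norm_centered_le hn hK h)
  have h2 : T = τ • cube v + (T - τ • cube v) := by abel
  conv_lhs => rw [h2]
  rw [cubicForm_add, cubicForm_smul, cubicForm_cube]
  linarith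

end Orders

/-! ### Kronecker products and the operator norm -/

section Kronecker

variable {n : ℕ}

/-- The matrix acts as `Q` on each block of coordinates with fixed first index, and squared norms
add over the blocks. -/
lemma norm_one_kronecker_le (Q : Matrix (Fin n) (Fin n) ℝ) :
    ‖(1 : Matrix (Fin n) (Fin n) ℝ) ⊗ₖ Q‖ ≤ ‖Q‖ := by
  rw [← norm_op]
  refine ContinuousLinearMap.opNorm_le_bound _ (norm_nonneg _) fun x => ?_
  refine (pow_le_pow_iff_left₀ (norm_nonneg _) (by positivity) two_ne_zero).mp ?_
  rw [mul_pow, norm_sq_eq_sum, norm_sq_eq_sum, Fintype.sum_prod_type, Fintype.sum_prod_type,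
    Finset.mul_sum]
  refine Finset.sum_le_sum fun j _ => ?_
  have h := norm_op_apply_le Q (WithLp.toLp 2 fun k => x (j, k))
  have h2 := pow_le_pow_left₀ (norm_nonneg _) h 2
  rw [mul_pow, norm_sq_eq_sum, norm_sq_eq_sum] at h2
  refine le_of_eq_of_le (Finset.sum_congr rfl fun k _ => ?_) h2
  rw [op_apply, op_apply, Fintype.sum_prod_type]
  simp [Matrix.kroneckerMap_apply, Matrix.one_apply]

lemma norm_kronecker_one_le (Q : Matrix (Fin n) (Fin n) ℝ) :
    ‖Q ⊗ₖ (1 : Matrix (Fin n) (Fin n) ℝ)‖ ≤ ‖Q‖ := by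
  rw [← norm_op]
  refine ContinuousLinearMap.opNorm_le_bound _ (norm_nonneg _) fun x => ?_
  refine (pow_le_pow_iff_left₀ (norm_nonneg _) (by positivity) two_ne_zero).mp ?_
  rw [mul_pow, norm_sq_eq_sum, norm_sq_eq_sum, Fintype.sum_prod_type_right,
    Fintype.sum_prod_type_right, Finset.mul_sum]
  refine Finset.sum_le_sum fun j _ => ?_
  have h := norm_op_apply_le Q (WithLp.toLp 2 fun k => x (k, j))
  have h2 := pow_le_pow_left₀ (norm_nonneg _) h 2
  rw [mul_pow, norm_sq_eq_sum, norm_sq_eq_sum] at h2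
  refine le_of_eq_of_le (Finset.sum_congr rfl fun k _ => ?_) h2
  rw [op_apply, op_apply, Fintype.sum_prod_type]
  simp [Matrix.kroneckerMap_apply, Matrix.one_apply]

lemma norm_kronecker_le (P Q : Matrix (Fin n) (Fin n) ℝ) : ‖P ⊗ₖ Q‖ ≤ ‖P‖ * ‖Q‖ := by
  have h : P ⊗ₖ Q = (P ⊗ₖ 1) * (1 ⊗ₖ Q) := by
    rw [← Matrix.mul_kronecker_mul, mul_one, one_mul]
  rw [h]
  exact (norm_mul_le _ _).trans
    (mul_le_mul (norm_kronecker_one_le P) (norm_one_kronecker_le Q) (norm_nonneg _) (norm_nonneg _))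

end Kronecker

/-! ### Spiked tensors -/

section Spiked

variable {n : ℕ}

/-- The centered matrix of a spiked tensor. -/
lemma centered_spiked (τ : ℝ) {v : EuclideanSpace ℝ (Fin n)} (hv : ‖v‖ = 1) (A : Tensor3 n) :
    centered (spiked τ v A) = τ ^ 2 • Matrix.vecMulVec (tens v v) (tens v v) +
      (τ • (Matrix.vecMulVec v v ⊗ₖ contract A v + contract A v ⊗ₖ Matrix.vecMulVec v v) +
        centered A) := by
  have hs : ∑ i, v i ^ 2 = 1 := by rw [← norm_sq_eq_sum, hv, one_pow]
  rw [centered, centered, ← add_sub_assoc, ← add_sub_assoc]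
  congr 1
  ext p q
  simp only [sliceSquare_apply, Matrix.add_apply, Matrix.smul_apply, Matrix.kroneckerMap_apply,
    Matrix.vecMulVec_apply, tens_apply, contract, Matrix.sum_apply, slice, Matrix.of_apply,
    spiked, cube, Pi.add_apply, Pi.smul_apply, smul_eq_mul]
  have : τ ^ 2 * (v p.1 * v p.2 * (v q.1 * v q.2)) =
      ∑ i, v i ^ 2 * (τ ^ 2 * (v p.1 * v p.2 * (v q.1 * v q.2))) := by
    rw [← Finset.sum_mul, hs, one_mul]
  rw [this, Finset.mul_sum, Finset.sum_mul, ← Finset.sum_add_distrib, Finset.mul_sum,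
    ← Finset.sum_add_distrib, ← Finset.sum_add_distrib]
  exact Finset.sum_congr rfl fun i _ => by ring

/-- The matrix `∑ T_i T_iᵀ - n² I`. -/
noncomputable def gram (T : Tensor3 n) : Matrix (Fin n) (Fin n) ℝ :=
  ∑ i, slice T i * (slice T i).transpose - (n : ℝ) ^ 2 • 1

lemma gram_apply (T : Tensor3 n) (a b : Fin n) :
    gram T a b = ∑ i, ∑ k, T (i, a, k) * T (i, b, k) - if a = b then (n : ℝ) ^ 2 else 0 := by
  simp [gram, Matrix.sum_apply, Matrix.mul_apply, slice, Matrix.one_apply]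

lemma transpose_gram (T : Tensor3 n) : (gram T).transpose = gram T := by
  ext a b
  rw [Matrix.transpose_apply, gram_apply, gram_apply]
  simp only [eq_comm (a := a), mul_comm]

/-- The analogue in dimension n of the expansion of the centered matrix. The spike has the same
strength τ², and the cross terms involve only the vector A(v)v. This smaller matrix is the one used
by the programs to find the spike. -/
lemma gram_spiked (τ : ℝ) {v : EuclideanSpace ℝ (Fin n)} (hv : ‖v‖ = 1) (A : Tensor3 n) :
    gram (spiked τ v A) = τ ^ 2 • Matrix.vecMulVec v v +
      (τ • (Matrix.vecMulVec v (op (contract A v) v) + Matrix.vecMulVec (op (contract A v) v) v) +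
        gram A) := by
  have hs : ∑ i, v i ^ 2 = 1 := by rw [← norm_sq_eq_sum, hv, one_pow]
  ext a b
  simp only [gram_apply, Matrix.add_apply, Matrix.smul_apply,
    Matrix.vecMulVec_apply, op_apply, contract, Matrix.sum_apply, slice, Matrix.of_apply,
    spiked, cube, Pi.add_apply, Pi.smul_apply, smul_eq_mul]
  have : τ ^ 2 * (v a * v b) = ∑ i, ∑ k, v i ^ 2 * v k ^ 2 * (τ ^ 2 * (v a * v b)) := by
    simp_rw [← Finset.sum_mul, ← Finset.mul_sum]
    rw [← Finset.sum_mul, hs]; ring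
  rw [← add_sub_assoc, ← add_sub_assoc, this]
  congr 1
  simp only [Finset.sum_mul, Finset.mul_sum, mul_add]
  rw [Finset.sum_comm (γ := Fin n) (f := fun i j => τ * (v a * (v j * A (j, b, i) * v i))),
    Finset.sum_comm (γ := Fin n) (f := fun i j => τ * (v j * A (j, a, i) * v i * v b))]
  simp only [← Finset.sum_add_distrib]
  exact Finset.sum_congr rfl fun i _ => Finset.sum_congr rfl fun k _ => by ring

/-- The good event for the noise. -/
def NoiseBound (K : ℝ) (A : Tensor3 n) : Prop :=
  ‖centered A‖ ≤ K * threshold n ∧ ‖gram A‖ ≤ K * threshold n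

/-- Each of the two cross terms is at most τ (K + 1) noiseLevel, and the pure noise is at most K
noiseLevel² ≤ K noiseLevel τ; hence the constant 3K + 2. The bound is written as a multiple of the
spike strength τ². -/
lemma norm_centered_spiked_error_le (hn : 2 ≤ n) {K τ : ℝ} (hK : 0 ≤ K) (hτ : 0 < τ)
    (hle : noiseLevel n ≤ τ)
    {v : EuclideanSpace ℝ (Fin n)} (hv : ‖v‖ = 1) {A : Tensor3 n}
    (hA : ‖centered A‖ ≤ K * threshold n) :
    ‖τ • (Matrix.vecMulVec v v ⊗ₖ contract A v + contract A v ⊗ₖ Matrix.vecMulVec v v) +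
        centered A‖ ≤ ((3 * K + 2) * (noiseLevel n / τ)) * τ ^ 2 := by
  have hJ := (norm_contract_le A v).trans_eq (by rw [hv, mul_one])
  have hJ2 := hJ.trans (sqrt_norm_centered_le hn hK hA)
  have hvv : ‖Matrix.vecMulVec v v‖ ≤ 1 := by simpa [hv] using norm_vecMulVec v v
  have h1 : ‖Matrix.vecMulVec v v ⊗ₖ contract A v‖ ≤ (K + 1) * noiseLevel n :=
    (norm_kronecker_le _ _).trans (by nlinarith [norm_nonneg (contract A v)])
  have h2 : ‖contract A v ⊗ₖ Matrix.vecMulVec v v‖ ≤ (K + 1) * noiseLevel n :=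
    (norm_kronecker_le _ _).trans (by nlinarith [norm_nonneg (contract A v)])
  refine (norm_add_le _ _).trans ?_
  rw [norm_smul, Real.norm_eq_abs, abs_of_pos hτ]
  have h3 := norm_add_le (Matrix.vecMulVec v v ⊗ₖ contract A v) (contract A v ⊗ₖ Matrix.vecMulVec v v)
  have hnl := noiseLevel_pos hn
  have h4 : K * threshold n ≤ K * (noiseLevel n * τ) := by
    rw [← noiseLevel_sq, sq]; gcongr
  have h5 : ((3 * K + 2) * (noiseLevel n / τ)) * τ ^ 2 = (3 * K + 2) * (noiseLevel n * τ) := by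
    field_simp
  rw [h5]
  nlinarith [mul_le_mul_of_nonneg_left (h3.trans (add_le_add h1 h2)) hτ.le]

lemma norm_gram_spiked_error_le (hn : 2 ≤ n) {K τ : ℝ} (hK : 0 ≤ K) (hτ : 0 < τ)
    (hle : noiseLevel n ≤ τ)
    {v : EuclideanSpace ℝ (Fin n)} (hv : ‖v‖ = 1) {A : Tensor3 n} (hA : NoiseBound K A) :
    ‖τ • (Matrix.vecMulVec v (op (contract A v) v) + Matrix.vecMulVec (op (contract A v) v) v) +
        gram A‖ ≤ ((3 * K + 2) * (noiseLevel n / τ)) * τ ^ 2 := by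
  have hJ := (norm_contract_le A v).trans_eq (by rw [hv, mul_one])
  have hJ2 := hJ.trans (sqrt_norm_centered_le hn hK hA.1)
  have hw : ‖op (contract A v) v‖ ≤ (K + 1) * noiseLevel n := by
    have := norm_op_apply_le (contract A v) v
    rw [hv, mul_one] at this
    exact this.trans hJ2
  have h1 : ‖Matrix.vecMulVec v (op (contract A v) v)‖ ≤ (K + 1) * noiseLevel n :=
    (norm_vecMulVec _ _).trans (by rw [hv, one_mul]; exact hw)
  have h2 : ‖Matrix.vecMulVec (op (contract A v) v) v‖ ≤ (K + 1) * noiseLevel n :=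
    (norm_vecMulVec _ _).trans (by rw [hv, mul_one]; exact hw)
  refine (norm_add_le _ _).trans ?_
  rw [norm_smul, Real.norm_eq_abs, abs_of_pos hτ]
  have h3 := norm_add_le (Matrix.vecMulVec v (op (contract A v) v))
    (Matrix.vecMulVec (op (contract A v) v) v)
  have hnl := noiseLevel_pos hn
  have h4 : K * threshold n ≤ K * (noiseLevel n * τ) := by
    rw [← noiseLevel_sq, sq]; gcongr
  have h5 : ((3 * K + 2) * (noiseLevel n / τ)) * τ ^ 2 = (3 * K + 2) * (noiseLevel n * τ) := by
    field_simp
  rw [h5]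
  nlinarith [mul_le_mul_of_nonneg_left (h3.trans (add_le_add h1 h2)) hτ.le, hA.2]

lemma abs_inner_le_one {u v : EuclideanSpace ℝ (Fin n)} (hu : ‖u‖ = 1) (hv : ‖v‖ = 1) :
    |⟪u, v⟫_ℝ| ≤ 1 := by
  simpa [hu, hv] using abs_real_inner_le_norm u v

lemma norm_eq_one_of_isTopSingularVector {ι : Type*} [Fintype ι] [DecidableEq ι]
    {M : Matrix ι ι ℝ} {w : EuclideanSpace ℝ ι} (h : IsTopSingularVector M w) : ‖w‖ = 1 := by
  obtain ⟨u, h | h⟩ := h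
  · exact h.1
  · exact h.2.1

lemma nonempty_fin {n : ℕ} (hn : 2 ≤ n) : Nonempty (Fin n) := ⟨⟨0, by omega⟩⟩

/-- Every output of the exact recovery algorithm is close to the spike, up to sign. -/
lemma inner_sq_ge_of_isRecoveryOutput (hn : 2 ≤ n) {K τ : ℝ} (hK : 0 ≤ K) (hτ : 0 < τ)
    {v₀ v : EuclideanSpace ℝ (Fin n)} (hv₀ : ‖v₀‖ = 1) {A : Tensor3 n}
    (hA : ‖centered A‖ ≤ K * threshold n) (hv : IsRecoveryOutput (spiked τ v₀ A) v) :
    1 - 32 * (3 * K + 2) ^ 2 * (noiseLevel n / τ) ^ 2 ≤ ⟪v, v₀⟫_ℝ ^ 2 := by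
  have := nonempty_fin hn
  have hρ : 0 < noiseLevel n / τ := div_pos (noiseLevel_pos hn) hτ
  set ρ := noiseLevel n / τ with hρd
  -- Otherwise 32 (3K + 2)² ρ² > 8 and the claim is vacuous. In the main case the perturbation bound
  -- is δ = (2 (3K + 2) ρ)² and folding multiplies it by 8, whence 32.
  by_cases hη : (3 * K + 2) * ρ ≤ 1 / 2
  · have hle : noiseLevel n ≤ τ := by
      have : ρ ≤ 1 := by nlinarith [mul_nonneg hK hρ.le]
      rwa [hρd, div_le_one hτ] at this
    obtain ⟨w, hw, hvw⟩ := hv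
    have h1 := one_sub_inner_sq_le_of_isTopSingularVector (c := τ ^ 2) (by positivity) hη
      (by rw [norm_tens, hv₀, mul_one]) (centered_spiked τ hv₀ A)
      (norm_centered_spiked_error_le hn hK hτ hle hv₀ hA) hw
    have h2 := one_sub_inner_sq_le_of_fold (norm_eq_one_of_isTopSingularVector hw) hv₀
      (δ := (2 * ((3 * K + 2) * ρ)) ^ 2) (by linarith) hvw
    nlinarith
  · push Not at hη
    nlinarith [sq_nonneg ⟪v, v₀⟫_ℝ]

/-- With the right sign, an accurate direction is accurate as a vector. -/
lemma mul_norm_sub_le_of_cubicForm_nonneg (hn : 2 ≤ n) {K K₁ τ : ℝ} (hK : 0 ≤ K) (hK₁ : 0 ≤ K₁)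
    (hτ : 0 < τ) {v₀ u : EuclideanSpace ℝ (Fin n)} (hv₀ : ‖v₀‖ = 1) (hu : ‖u‖ = 1) {A : Tensor3 n}
    (hA : ‖centered A‖ ≤ K * threshold n)
    (h : 1 - K₁ * (noiseLevel n / τ) ^ 2 ≤ ⟪u, v₀⟫_ℝ ^ 2)
    (hpos : 0 ≤ cubicForm (spiked τ v₀ A) u) :
    τ * ‖v₀ - u‖ ≤ (8 * K + 5 * K₁ + 9) * noiseLevel n := by
  have hnl := noiseLevel_pos hn
  have hd2 : ‖v₀ - u‖ ≤ 2 := (norm_sub_le _ _).trans (by rw [hv₀, hu]; norm_num)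
  -- For τ of the order of the noise level, the trivial bound ‖v₀ − u‖ ≤ 2 is enough.
  by_cases hbig : τ ≤ (4 * (K + 1) + 2 * K₁) * noiseLevel n
  · nlinarith [mul_nonneg hK hnl.le, mul_nonneg hK₁ hnl.le, norm_nonneg (v₀ - u)]
  push Not at hbig
  set ρ := noiseLevel n / τ with hρ
  have hρ0 : 0 < ρ := div_pos hnl hτ
  have hρτ : ρ * τ = noiseLevel n := by rw [hρ]; field_simp
  have hρs : (4 * (K + 1) + 2 * K₁) * ρ < 1 := by
    have : (4 * (K + 1) + 2 * K₁) * ρ * τ < 1 * τ := by rw [mul_assoc, hρτ]; linarith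
    exact lt_of_mul_lt_mul_right this hτ.le
  have hρ1 : ρ < 1 := by nlinarith [mul_nonneg hK hρ0.le, mul_nonneg hK₁ hρ0.le]
  have hKρ : K₁ * ρ ^ 2 ≤ 1 / 2 := by
    nlinarith [mul_nonneg hK hρ0.le, mul_nonneg hK₁ hρ0.le]
  set t := ⟪u, v₀⟫_ℝ with ht
  have ht1 : |t| ≤ 1 := abs_inner_le_one hu hv₀
  -- A negative t would satisfy t ≤ −1/2 and t² ≥ 1/2, hence τ t³ ≤ −τ/4. This outweighs the noise
  -- contribution (K + 1) noiseLevel and makes the cubic form at `u` negative.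
  have ht0 : 0 ≤ t := by
    by_contra hneg
    push Not at hneg
    rw [spiked, cubicForm_add, cubicForm_smul, cubicForm_cube, real_inner_comm, ← ht] at hpos
    have h2 := (Real.le_sqrt_of_sq_le (cubicForm_sq_le A hu)).trans
      (sqrt_norm_centered_le hn hK hA)
    have h3 : t ≤ -(1 / 2) := by nlinarith
    have h4 : t ^ 3 ≤ -(1 / 4) := by nlinarith
    nlinarith [mul_nonneg hK₁ hnl.le]
  -- For 0 ≤ t ≤ 1 one has 2 − 2t ≤ 2(1 − t²).
  have hns : ‖v₀ - u‖ ^ 2 ≤ 2 * K₁ * ρ ^ 2 := by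
    rw [norm_sub_sq_real, hv₀, hu, real_inner_comm, ← ht]
    nlinarith [(abs_le.mp ht1).2]
  have hns2 : ‖v₀ - u‖ ≤ (K₁ + 1) * ρ := by
    refine (pow_le_pow_iff_left₀ (norm_nonneg _) (by positivity) two_ne_zero).mp (hns.trans ?_)
    rw [mul_pow]
    nlinarith [sq_nonneg ρ, sq_nonneg (K₁ * ρ)]
  calc τ * ‖v₀ - u‖ ≤ τ * ((K₁ + 1) * ρ) := by gcongr
    _ = (K₁ + 1) * noiseLevel n := by rw [← hρτ]; ring
    _ ≤ _ := by gcongr <;> linarith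

lemma norm_vecMulVec_sub_le {u v : EuclideanSpace ℝ (Fin n)} (hu : ‖u‖ = 1) (hv : ‖v‖ = 1) :
    ‖Matrix.vecMulVec v v - Matrix.vecMulVec u u‖ ≤ 2 * ‖v - u‖ := by
  have h : Matrix.vecMulVec v v - Matrix.vecMulVec u u =
      Matrix.vecMulVec (v - u) v + Matrix.vecMulVec u (v - u) := by
    ext i j; simp [Matrix.vecMulVec_apply]; ring
  rw [h]
  refine (norm_add_le _ _).trans ?_
  have h1 := norm_vecMulVec (v - u) v
  have h2 := norm_vecMulVec u (v - u)
  rw [hv] at h1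
  rw [hu] at h2
  simp only [WithLp.ofLp_sub] at h1 h2 ⊢
  linarith

lemma slice_cube (v : EuclideanSpace ℝ (Fin n)) (i : Fin n) :
    slice (cube v) i = v i • Matrix.vecMulVec v v := by
  ext j k
  simp [slice, cube, Matrix.vecMulVec_apply, mul_assoc]

/-- The residual after subtracting an accurate spike is as good as noise. -/
lemma norm_centered_residual_le (hn : 2 ≤ n) {K K₂ τ : ℝ} (hK : 0 ≤ K)
    (hτ : 0 < τ) {v₀ u : EuclideanSpace ℝ (Fin n)} (hv₀ : ‖v₀‖ = 1) (hu : ‖u‖ = 1) {A : Tensor3 n}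
    (hA : ‖centered A‖ ≤ K * threshold n) (h : τ * ‖v₀ - u‖ ≤ K₂ * noiseLevel n) :
    ‖centered (spiked τ v₀ A - τ • cube u)‖ ≤
      (10 * K₂ ^ 2 + 6 * K₂ * (K + 1) + K) * threshold n := by
  -- The slices of v₀^{⊗3} − u^{⊗3}, written so that each term carries one factor that is small with
  -- ‖v₀ − u‖.
  set D : Fin n → Matrix (Fin n) (Fin n) ℝ := fun i =>
    v₀ i • (Matrix.vecMulVec v₀ v₀ - Matrix.vecMulVec u u) + (v₀ - u) i • Matrix.vecMulVec u u
    with hD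
  set d := ‖v₀ - u‖ with hd
  have hd0 : 0 ≤ d := norm_nonneg _
  have hnl := noiseLevel_pos hn
  have huu : ‖Matrix.vecMulVec u u‖ ≤ 1 := by simpa [hu] using norm_vecMulVec u u
  have hdiff := norm_vecMulVec_sub_le hu hv₀
  have hslice : ∀ i, slice (spiked τ v₀ A - τ • cube u) i = τ • D i + slice A i := by
    intro i
    have : slice (spiked τ v₀ A - τ • cube u) i =
        τ • (slice (cube v₀) i - slice (cube u) i) + slice A i := by
      ext j k; simp [slice, spiked]; ring
    rw [this, slice_cube, slice_cube, hD]
    simp only [PiLp.sub_apply]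
    congr 2
    module
  have hexp : centered (spiked τ v₀ A - τ • cube u) =
      τ ^ 2 • ∑ i, D i ⊗ₖ D i + τ • (∑ i, D i ⊗ₖ slice A i + ∑ i, slice A i ⊗ₖ D i)
        + centered A := by
    rw [centered, centered, sliceSquare, sliceSquare, ← add_sub_assoc]
    congr 1
    simp only [hslice]
    rw [← Finset.sum_add_distrib, Finset.smul_sum, Finset.smul_sum, ← Finset.sum_add_distrib,
      ← Finset.sum_add_distrib]
    refine Finset.sum_congr rfl fun i _ => ?_
    simp only [Matrix.kronecker_add, Matrix.add_kronecker, Matrix.smul_kronecker,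
      Matrix.kronecker_smul]
    module
  -- Summing over i contracts the noise with v₀ and with v₀ − u, so the deterministic contraction
  -- bound applies. Estimating the terms one by one would lose the cancellation.
  have hDA : ∑ i, D i ⊗ₖ slice A i =
      (Matrix.vecMulVec v₀ v₀ - Matrix.vecMulVec u u) ⊗ₖ contract A v₀ +
        Matrix.vecMulVec u u ⊗ₖ contract A (v₀ - u) := by
    ext p q
    simp only [Matrix.sum_apply, Matrix.add_apply, Matrix.kroneckerMap_apply, contract, hD,
      Matrix.smul_apply, smul_eq_mul, Finset.mul_sum, ← Finset.sum_add_distrib]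
    exact Finset.sum_congr rfl fun i _ => by ring
  have hAD : ∑ i, slice A i ⊗ₖ D i =
      contract A v₀ ⊗ₖ (Matrix.vecMulVec v₀ v₀ - Matrix.vecMulVec u u) +
        contract A (v₀ - u) ⊗ₖ Matrix.vecMulVec u u := by
    ext p q
    simp only [Matrix.sum_apply, Matrix.add_apply, Matrix.kroneckerMap_apply, contract, hD,
      Matrix.smul_apply, smul_eq_mul, Finset.sum_mul, ← Finset.sum_add_distrib]
    exact Finset.sum_congr rfl fun i _ => by ring
  set J := √(‖centered A‖ + n) with hJ
  have hJle : J ≤ (K + 1) * noiseLevel n := sqrt_norm_centered_le hn hK hA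
  have hJ0 : 0 ≤ J := Real.sqrt_nonneg _
  have c1 := norm_contract_le A v₀
  have c2 := norm_contract_le A (v₀ - u)
  rw [hv₀, mul_one, ← hJ] at c1
  rw [← hd, ← hJ] at c2
  have b1 : ‖∑ i, D i ⊗ₖ slice A i‖ ≤ 3 * d * J := by
    rw [hDA]
    refine (norm_add_le _ _).trans ?_
    have e1 := (norm_kronecker_le (Matrix.vecMulVec v₀ v₀ - Matrix.vecMulVec u u)
      (contract A v₀)).trans (mul_le_mul hdiff c1 (norm_nonneg _) (by positivity))
    have e2 := (norm_kronecker_le (Matrix.vecMulVec u u) (contract A (v₀ - u))).trans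
      (mul_le_mul huu c2 (norm_nonneg _) zero_le_one)
    linarith
  have b2 : ‖∑ i, slice A i ⊗ₖ D i‖ ≤ 3 * d * J := by
    rw [hAD]
    refine (norm_add_le _ _).trans ?_
    have e1 := (norm_kronecker_le (contract A v₀)
      (Matrix.vecMulVec v₀ v₀ - Matrix.vecMulVec u u)).trans
      (mul_le_mul c1 hdiff (norm_nonneg _) (by positivity))
    have e2 := (norm_kronecker_le (contract A (v₀ - u)) (Matrix.vecMulVec u u)).trans
      (mul_le_mul c2 huu (norm_nonneg _) (by positivity))
    linarith
  have b3 : ‖∑ i, D i ⊗ₖ D i‖ ≤ 10 * d ^ 2 := by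
    -- From (a + b)² ≤ 2a² + 2b². Summation over i, with ‖v₀‖ = 1 and ‖v₀ − u‖ = d, gives 8d² + 2d².
    have hDi : ∀ i, ‖D i ⊗ₖ D i‖ ≤ 8 * d ^ 2 * v₀ i ^ 2 + 2 * (v₀ - u) i ^ 2 := by
      intro i
      refine (norm_kronecker_le _ _).trans ?_
      have e : ‖D i‖ ≤ |v₀ i| * (2 * d) + |(v₀ - u) i| * 1 := by
        refine (norm_add_le _ _).trans ?_
        rw [norm_smul, norm_smul, Real.norm_eq_abs, Real.norm_eq_abs]
        gcongr
      rw [← sq]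
      refine (pow_le_pow_left₀ (norm_nonneg _) e 2).trans ?_
      rw [← sq_abs (v₀ i), ← sq_abs ((v₀ - u) i)]
      nlinarith [sq_nonneg (|v₀ i| * (2 * d) - |(v₀ - u) i|)]
    refine (norm_sum_le _ _).trans ((Finset.sum_le_sum fun i _ => hDi i).trans ?_)
    rw [Finset.sum_add_distrib, ← Finset.mul_sum, ← Finset.mul_sum, ← norm_sq_eq_sum,
      ← norm_sq_eq_sum, hv₀, ← hd]
    exact le_of_eq (by ring)
  rw [hexp]
  refine (norm_add_le _ _).trans ?_
  have n1 : ‖τ ^ 2 • ∑ i, D i ⊗ₖ D i‖ ≤ 10 * (τ * d) ^ 2 := by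
    rw [norm_smul, Real.norm_eq_abs, abs_of_nonneg (sq_nonneg τ)]
    nlinarith [mul_le_mul_of_nonneg_left b3 (sq_nonneg τ)]
  have n2 : ‖τ • (∑ i, D i ⊗ₖ slice A i + ∑ i, slice A i ⊗ₖ D i)‖ ≤ 6 * (τ * d) * J := by
    rw [norm_smul, Real.norm_eq_abs, abs_of_pos hτ]
    nlinarith [mul_le_mul_of_nonneg_left ((norm_add_le _ _).trans (add_le_add b1 b2)) hτ.le]
  have hτd : 0 ≤ τ * d := by positivity
  have n3 : (τ * d) ^ 2 ≤ K₂ ^ 2 * threshold n := by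
    rw [← noiseLevel_sq, ← mul_pow]; exact pow_le_pow_left₀ hτd h 2
  have n4 : (τ * d) * J ≤ K₂ * (K + 1) * threshold n := by
    calc (τ * d) * J ≤ (K₂ * noiseLevel n) * ((K + 1) * noiseLevel n) :=
          mul_le_mul h hJle hJ0 (hτd.trans h)
      _ = _ := by rw [← noiseLevel_sq]; ring
  have := norm_add_le (τ ^ 2 • ∑ i, D i ⊗ₖ D i)
    (τ • (∑ i, D i ⊗ₖ slice A i + ∑ i, slice A i ⊗ₖ D i))
  nlinarith

end Spiked

/-! ### Trace moments of Rademacher sums of symmetric matrices -/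

section Rademacher

variable {ι : Type*} [Fintype ι] [DecidableEq ι]

lemma exists_spectral {X : Matrix ι ι ℝ} (hX : X.transpose = X) :
    ∃ (U : Matrix ι ι ℝ) (l : ι → ℝ), U.transpose * U = 1 ∧ U * U.transpose = 1 ∧
      X = U * Matrix.diagonal l * U.transpose := by
  have hH : X.IsHermitian := by
    rw [Matrix.IsHermitian, Matrix.conjTranspose_eq_transpose_of_trivial, hX]
  refine ⟨(hH.eigenvectorUnitary : Matrix ι ι ℝ), hH.eigenvalues, ?_, ?_, ?_⟩
  · have := Unitary.coe_star_mul_self hH.eigenvectorUnitary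
    rwa [Matrix.star_eq_conjTranspose, Matrix.conjTranspose_eq_transpose_of_trivial] at this
  · have := Unitary.coe_mul_star_self hH.eigenvectorUnitary
    rwa [Unitary.coe_star, Matrix.star_eq_conjTranspose,
      Matrix.conjTranspose_eq_transpose_of_trivial] at this
  · have := hH.spectral_theorem
    rw [Unitary.conjStarAlgAut_apply, Matrix.star_eq_conjTranspose,
      Matrix.conjTranspose_eq_transpose_of_trivial] at this
    exact this

lemma pow_spectral {U : Matrix ι ι ℝ} {l : ι → ℝ} (hU : U.transpose * U = 1)
    (hU' : U * U.transpose = 1) (m : ℕ) :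
    (U * Matrix.diagonal l * U.transpose) ^ m =
      U * Matrix.diagonal (fun a => l a ^ m) * U.transpose := by
  induction m with
  | zero => simp [hU']
  | succ m ih =>
    rw [pow_succ, ih]
    calc U * Matrix.diagonal (fun a => l a ^ m) * U.transpose *
          (U * Matrix.diagonal l * U.transpose)
        = U * Matrix.diagonal (fun a => l a ^ m) * (U.transpose * U) *
          (Matrix.diagonal l * U.transpose) := by simp only [Matrix.mul_assoc]
      _ = _ := by
        rw [hU, Matrix.mul_one, ← Matrix.mul_assoc, Matrix.mul_assoc U, Matrix.diagonal_mul_diagonal]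
        simp only [pow_succ]

lemma trace_pow_spectral {U : Matrix ι ι ℝ} {l : ι → ℝ} (hU : U.transpose * U = 1)
    (hU' : U * U.transpose = 1) (m : ℕ) :
    ((U * Matrix.diagonal l * U.transpose) ^ m).trace = ∑ a, l a ^ m := by
  rw [pow_spectral hU hU', Matrix.trace_mul_comm, ← Matrix.mul_assoc, hU, Matrix.one_mul,
    Matrix.trace_diagonal]

lemma sum_sq_col_le (K : Matrix ι ι ℝ) (b : ι) : ∑ a, K a b ^ 2 ≤ ‖K‖ ^ 2 := by
  have h := norm_op_apply_le K (EuclideanSpace.single b 1)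
  have h2 := pow_le_pow_left₀ (norm_nonneg _) h 2
  rw [norm_sq_eq_sum] at h2
  simpa [op_apply] using h2

lemma sum_sq_row_le (K : Matrix ι ι ℝ) (a : ι) : ∑ b, K a b ^ 2 ≤ ‖K‖ ^ 2 := by
  simpa [norm_transpose_eq] using sum_sq_col_le K.transpose a

lemma norm_le_one_of_orthogonal {U : Matrix ι ι ℝ} (hU : U.transpose * U = 1) : ‖U‖ ≤ 1 := by
  have h := norm_transpose_mul_self U
  rw [hU] at h
  have h1 : ‖(1 : Matrix ι ι ℝ)‖ ≤ 1 := by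
    rw [← norm_op]
    exact ContinuousLinearMap.opNorm_le_bound _ zero_le_one fun x => by simp [op]
  nlinarith [norm_nonneg U]

/-- Powers of absolute values are monotone, so (|a|^q − |b|^q)(|a|^s − |b|^s) ≥ 0. Evenness of q + s
removes the absolute values on the right. -/
lemma pow_mul_pow_add_le {a b : ℝ} (q s : ℕ) (he : Even (q + s)) :
    a ^ q * b ^ s + a ^ s * b ^ q ≤ a ^ (q + s) + b ^ (q + s) := by
  have h1 : ∀ q s : ℕ, a ^ q * b ^ s ≤ |a| ^ q * |b| ^ s := fun q s => by
    rw [← abs_pow, ← abs_pow, ← abs_mul]; exact le_abs_self _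
  have h2 : 0 ≤ (|a| ^ q - |b| ^ q) * (|a| ^ s - |b| ^ s) := by
    rcases le_total |a| |b| with h | h
    · exact mul_nonneg_of_nonpos_of_nonpos
        (sub_nonpos.mpr (pow_le_pow_left₀ (abs_nonneg _) h _))
        (sub_nonpos.mpr (pow_le_pow_left₀ (abs_nonneg _) h _))
    · exact mul_nonneg (sub_nonneg.mpr (pow_le_pow_left₀ (abs_nonneg _) h _))
        (sub_nonneg.mpr (pow_le_pow_left₀ (abs_nonneg _) h _))
  rw [← he.pow_abs a, ← he.pow_abs b, pow_add, pow_add]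
  nlinarith [h1 q s, h1 s q]

/-- The key trace inequality. -/
lemma trace_mul_pow_add_le {X Y H : Matrix ι ι ℝ} (hX : X.transpose = X) (hY : Y.transpose = Y)
    (hH : H.transpose = H) (q s : ℕ) (he : Even (q + s)) :
    (H * X ^ q * H * Y ^ s).trace + (H * X ^ s * H * Y ^ q).trace ≤
      ‖H‖ ^ 2 * ((X ^ (q + s)).trace + (Y ^ (q + s)).trace) := by
  obtain ⟨U, l, hU, hU', rfl⟩ := exists_spectral hX
  obtain ⟨V, m, hV, hV', rfl⟩ := exists_spectral hY
  -- `K` is `H` expressed between the eigenbases of `X` and `Y`. The trace of H X^q H Y^s becomes ∑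
  -- K_ab² l_a^q m_b^s, to which the scalar inequality applies termwise. Row and column sums of
  -- K_ab² are at most ‖H‖².
  set K := U.transpose * H * V with hK
  have hKn : ‖K‖ ^ 2 ≤ ‖H‖ ^ 2 := by
    have hUt : ‖U.transpose‖ ≤ 1 := by rw [norm_transpose_eq]; exact norm_le_one_of_orthogonal hU
    have hVn := norm_le_one_of_orthogonal hV
    refine pow_le_pow_left₀ (norm_nonneg _) ?_ 2
    refine (norm_mul_le _ _).trans ?_
    have := norm_mul_le U.transpose H
    nlinarith [norm_nonneg H, norm_nonneg (U.transpose * H), norm_nonneg V, norm_nonneg U.transpose]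
  have key : ∀ q s : ℕ, (H * (U * Matrix.diagonal l * U.transpose) ^ q * H *
      (V * Matrix.diagonal m * V.transpose) ^ s).trace = ∑ b, ∑ a, K a b ^ 2 * (l a ^ q * m b ^ s) := by
    intro q s
    rw [pow_spectral hU hU', pow_spectral hV hV']
    have hKt : K.transpose = V.transpose * H * U := by
      rw [hK, Matrix.transpose_mul, Matrix.transpose_mul, hH, Matrix.transpose_transpose,
        Matrix.mul_assoc]
    have : H * (U * Matrix.diagonal (fun a => l a ^ q) * U.transpose) * H *
        (V * Matrix.diagonal (fun a => m a ^ s) * V.transpose) =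
        (H * U * Matrix.diagonal (fun a => l a ^ q) * K * Matrix.diagonal (fun a => m a ^ s)) *
          V.transpose := by
      rw [hK]; simp only [Matrix.mul_assoc]
    rw [this, Matrix.trace_mul_comm]
    have h2 : V.transpose * (H * U * Matrix.diagonal (fun a => l a ^ q) * K *
        Matrix.diagonal (fun a => m a ^ s)) = K.transpose * Matrix.diagonal (fun a => l a ^ q) * K *
        Matrix.diagonal (fun a => m a ^ s) := by
      rw [hKt]; simp only [Matrix.mul_assoc]
    rw [h2, Matrix.trace]
    refine Finset.sum_congr rfl fun b _ => ?_
    rw [Matrix.diag_apply, Matrix.mul_diagonal, Matrix.mul_apply, Finset.sum_mul]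
    refine Finset.sum_congr rfl fun a _ => ?_
    rw [Matrix.mul_diagonal, Matrix.transpose_apply]; ring
  rw [key, key, trace_pow_spectral hU hU', trace_pow_spectral hV hV', ← Finset.sum_add_distrib]
  calc ∑ b, (∑ a, K a b ^ 2 * (l a ^ q * m b ^ s) + ∑ a, K a b ^ 2 * (l a ^ s * m b ^ q))
      ≤ ∑ b, ∑ a, K a b ^ 2 * (l a ^ (q + s) + m b ^ (q + s)) := by
        refine Finset.sum_le_sum fun b _ => ?_
        rw [← Finset.sum_add_distrib]
        refine Finset.sum_le_sum fun a _ => ?_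
        rw [← mul_add]
        exact mul_le_mul_of_nonneg_left (pow_mul_pow_add_le q s he) (sq_nonneg _)
    _ = ∑ a, (∑ b, K a b ^ 2) * l a ^ (q + s) + ∑ b, (∑ a, K a b ^ 2) * m b ^ (q + s) := by
        simp only [mul_add, Finset.sum_add_distrib, Finset.sum_mul]
        rw [Finset.sum_comm]
    _ ≤ ∑ a, ‖H‖ ^ 2 * l a ^ (q + s) + ∑ b, ‖H‖ ^ 2 * m b ^ (q + s) := by
        gcongr with a _ b _
        · exact he.pow_nonneg _
        · exact (sum_sq_row_le K a).trans hKn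
        · exact he.pow_nonneg _
        · exact (sum_sq_col_le K b).trans hKn
    _ = _ := by rw [← Finset.mul_sum, ← Finset.mul_sum, mul_add]

lemma pow_sub_pow_eq_sum (X Y : Matrix ι ι ℝ) (m : ℕ) :
    X ^ (m + 1) - Y ^ (m + 1) = ∑ q ∈ Finset.range (m + 1), X ^ q * (X - Y) * Y ^ (m - q) := by
  induction m with
  | zero => simp
  | succ m ih =>
    rw [Finset.sum_range_succ, Nat.sub_self, pow_zero, mul_one]
    have h1 : ∑ q ∈ Finset.range (m + 1), X ^ q * (X - Y) * Y ^ (m + 1 - q) =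
        (X ^ (m + 1) - Y ^ (m + 1)) * Y := by
      rw [ih, Finset.sum_mul]
      refine Finset.sum_congr rfl fun q hq => ?_
      rw [Nat.succ_sub (Nat.lt_succ_iff.mp (Finset.mem_range.mp hq)), pow_succ Y, ← mul_assoc]
    rw [h1, pow_succ X (m + 1), pow_succ Y (m + 1)]
    noncomm_ring

/-- The difference of two even trace moments against the increment. -/
lemma trace_mul_pow_sub_le {X Y H : Matrix ι ι ℝ} (hX : X.transpose = X) (hY : Y.transpose = Y)
    (hH : H.transpose = H) {s : ℝ} (hs : s ^ 2 = 1) (hXY : X - Y = (2 * s) • H) (p : ℕ) :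
    s * ((H * X ^ (2 * p + 1)).trace - (H * Y ^ (2 * p + 1)).trace) ≤
      (2 * p + 1) * ‖H‖ ^ 2 * ((X ^ (2 * p)).trace + (Y ^ (2 * p)).trace) := by
  have h1 : s * ((H * X ^ (2 * p + 1)).trace - (H * Y ^ (2 * p + 1)).trace) =
      2 * ∑ q ∈ Finset.range (2 * p + 1), (H * X ^ q * H * Y ^ (2 * p - q)).trace := by
    rw [← Matrix.trace_sub, ← Matrix.mul_sub, pow_sub_pow_eq_sum, hXY, Matrix.mul_sum,
      Matrix.trace_sum, Finset.mul_sum, Finset.mul_sum]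
    refine Finset.sum_congr rfl fun q _ => ?_
    have : H * (X ^ q * (2 * s) • H * Y ^ (2 * p - q)) =
        (2 * s) • (H * X ^ q * H * Y ^ (2 * p - q)) := by
      simp only [Matrix.mul_smul, Matrix.smul_mul, Matrix.mul_assoc]
    rw [this, Matrix.trace_smul, smul_eq_mul]
    linear_combination 2 * (H * X ^ q * H * Y ^ (2 * p - q)).trace * hs
  -- Pairing the term q with its mirror image 2p − q produces the symmetric sum that the trace
  -- inequality bounds. A single term has no such bound, since odd powers have no sign.
  have h2 : 2 * ∑ q ∈ Finset.range (2 * p + 1), (H * X ^ q * H * Y ^ (2 * p - q)).trace =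
      ∑ q ∈ Finset.range (2 * p + 1), ((H * X ^ q * H * Y ^ (2 * p - q)).trace +
        (H * X ^ (2 * p - q) * H * Y ^ q).trace) := by
    rw [Finset.sum_add_distrib, two_mul]
    congr 1
    rw [← Finset.sum_range_reflect]
    refine Finset.sum_congr rfl fun q hq => ?_
    have hq' := Finset.mem_range.mp hq
    rw [show 2 * p + 1 - 1 - q = 2 * p - q by omega, show 2 * p - (2 * p - q) = q by omega]
  rw [h1, h2]
  calc _ ≤ ∑ q ∈ Finset.range (2 * p + 1),
        ‖H‖ ^ 2 * ((X ^ (2 * p)).trace + (Y ^ (2 * p)).trace) := by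
        refine Finset.sum_le_sum fun q hq => ?_
        have hq' := Finset.mem_range.mp hq
        have h := trace_mul_pow_add_le hX hY hH q (2 * p - q) (by
          rw [show q + (2 * p - q) = 2 * p by omega]; exact even_two_mul p)
        rwa [show q + (2 * p - q) = 2 * p by omega] at h
    _ = _ := by rw [Finset.sum_const, Finset.card_range, nsmul_eq_mul]; push_cast; ring

/-- The real sign of a Boolean. -/
def boolSign (b : Bool) : ℝ := if b then 1 else -1

lemma boolSign_sq (b : Bool) : boolSign b ^ 2 = 1 := by cases b <;> simp [boolSign]

lemma boolSign_not (b : Bool) : boolSign (!b) = -boolSign b := by cases b <;> simp [boolSign]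

variable {n : ℕ}

/-- The signed sum of a family of matrices. -/
noncomputable def signedSum (H : Fin n → Matrix ι ι ℝ) (ε : Fin n → Bool) : Matrix ι ι ℝ :=
  ∑ i, boolSign (ε i) • H i

/-- Flip one sign. -/
def flipAt (i : Fin n) (ε : Fin n → Bool) : Fin n → Bool := Function.update ε i (!ε i)

lemma flipAt_involutive (i : Fin n) : Function.Involutive (flipAt i) := by
  intro ε; simp [flipAt]

lemma transpose_signedSum {H : Fin n → Matrix ι ι ℝ} (hH : ∀ i, (H i).transpose = H i)
    (ε : Fin n → Bool) : (signedSum H ε).transpose = signedSum H ε := by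
  simp [signedSum, Matrix.transpose_sum, Matrix.transpose_smul, hH]

lemma signedSum_sub_flipAt (H : Fin n → Matrix ι ι ℝ) (ε : Fin n → Bool) (i : Fin n) :
    signedSum H ε - signedSum H (flipAt i ε) = (2 * boolSign (ε i)) • H i := by
  rw [signedSum, signedSum, ← Finset.sum_sub_distrib, Finset.sum_eq_single i]
  · simp only [flipAt, Function.update_self, boolSign_not]; module
  · intro j _ hj; simp [flipAt, Function.update_of_ne hj]
  · simp

lemma trace_signedSum_pow_succ (H : Fin n → Matrix ι ι ℝ) (ε : Fin n → Bool) (m : ℕ) :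
    (signedSum H ε ^ (m + 1)).trace =
      ∑ i, boolSign (ε i) * (H i * signedSum H ε ^ m).trace := by
  rw [pow_succ']
  conv_lhs => enter [1, 1]; rw [signedSum]
  rw [Matrix.sum_mul, Matrix.trace_sum]
  simp only [Matrix.smul_mul, Matrix.trace_smul, smul_eq_mul]

/-- The recursion behind the matrix Khintchine inequality. One factor of the power is expanded into
∑ εᵢ Hᵢ. Averaging the i-th term with its image under flipping εᵢ replaces X^(2p+1) by half the
difference of two such powers, whose bases differ by 2 εᵢ Hᵢ. Flipping permutes the sign vectors, so
the two trace moments on the right have equal sums. -/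
lemma sum_trace_signedSum_pow_le {H : Fin n → Matrix ι ι ℝ} (hH : ∀ i, (H i).transpose = H i)
    (p : ℕ) :
    ∑ ε, (signedSum H ε ^ (2 * (p + 1))).trace ≤
      (2 * p + 1) * (∑ i, ‖H i‖ ^ 2) * ∑ ε, (signedSum H ε ^ (2 * p)).trace := by
  have h1 : ∀ i, ∑ ε, boolSign (ε i) * (H i * signedSum H ε ^ (2 * p + 1)).trace ≤
      (2 * p + 1) * ‖H i‖ ^ 2 * ∑ ε, (signedSum H ε ^ (2 * p)).trace := by
    intro i
    have hflip : ∀ f : (Fin n → Bool) → ℝ, ∑ ε, f (flipAt i ε) = ∑ ε, f ε := fun f =>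
      Function.Bijective.sum_comp (flipAt_involutive i).bijective f
    have h2 : 2 * ∑ ε, boolSign (ε i) * (H i * signedSum H ε ^ (2 * p + 1)).trace =
        ∑ ε, boolSign (ε i) * ((H i * signedSum H ε ^ (2 * p + 1)).trace -
          (H i * signedSum H (flipAt i ε) ^ (2 * p + 1)).trace) := by
      rw [two_mul]
      conv_lhs => enter [2]; rw [← hflip]
      rw [← Finset.sum_add_distrib]
      refine Finset.sum_congr rfl fun ε _ => ?_
      rw [show boolSign (flipAt i ε i) = -boolSign (ε i) by
        simp only [flipAt, Function.update_self, boolSign_not]]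
      ring
    have h3 : ∑ ε, boolSign (ε i) * ((H i * signedSum H ε ^ (2 * p + 1)).trace -
          (H i * signedSum H (flipAt i ε) ^ (2 * p + 1)).trace) ≤
        ∑ ε, (2 * p + 1) * ‖H i‖ ^ 2 * ((signedSum H ε ^ (2 * p)).trace +
          (signedSum H (flipAt i ε) ^ (2 * p)).trace) :=
      Finset.sum_le_sum fun ε _ => trace_mul_pow_sub_le (transpose_signedSum hH _)
        (transpose_signedSum hH _) (hH i) (boolSign_sq _) (signedSum_sub_flipAt H ε i) p
    rw [← Finset.mul_sum, Finset.sum_add_distrib,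
      hflip fun ε => (signedSum H ε ^ (2 * p)).trace] at h3
    linarith
  calc ∑ ε, (signedSum H ε ^ (2 * (p + 1))).trace
      = ∑ i, ∑ ε, boolSign (ε i) * (H i * signedSum H ε ^ (2 * p + 1)).trace := by
        rw [Finset.sum_comm]
        exact Finset.sum_congr rfl fun ε _ => trace_signedSum_pow_succ H ε (2 * p + 1)
    _ ≤ ∑ i, (2 * p + 1) * ‖H i‖ ^ 2 * ∑ ε, (signedSum H ε ^ (2 * p)).trace :=
        Finset.sum_le_sum fun i _ => h1 i
    _ = _ := by rw [← Finset.sum_mul, ← Finset.mul_sum]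

lemma trace_pow_two_mul_nonneg {X : Matrix ι ι ℝ} (hX : X.transpose = X) (p : ℕ) :
    0 ≤ (X ^ (2 * p)).trace := by
  obtain ⟨U, l, hU, hU', rfl⟩ := exists_spectral hX
  rw [trace_pow_spectral hU hU']
  exact Finset.sum_nonneg fun a _ => (even_two_mul p).pow_nonneg _

/-- The bound P on all exponents is fixed before the induction, so that every factor 2p + 1 is at
most 2P and the product is a pure power. -/
lemma sum_trace_signedSum_le {H : Fin n → Matrix ι ι ℝ} (hH : ∀ i, (H i).transpose = H i)
    {s : ℝ} (hs : ∑ i, ‖H i‖ ^ 2 ≤ s) (P p : ℕ) (hp : p ≤ P) :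
    ∑ ε, (signedSum H ε ^ (2 * p)).trace ≤ 2 ^ n * Fintype.card ι * (2 * P * s) ^ p := by
  have hs0 : 0 ≤ s := (Finset.sum_nonneg fun i _ => sq_nonneg _).trans hs
  induction p with
  | zero => simp
  | succ p ih =>
    refine (sum_trace_signedSum_pow_le hH p).trans ?_
    have h0 : 0 ≤ ∑ ε, (signedSum H ε ^ (2 * p)).trace :=
      Finset.sum_nonneg fun ε _ => trace_pow_two_mul_nonneg (transpose_signedSum hH ε) p
    have hpP : (2 * p + 1 : ℝ) ≤ 2 * P := by
      have : (p + 1 : ℝ) ≤ P := by exact_mod_cast hp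
      linarith
    calc _ ≤ (2 * P) * s * (2 ^ n * Fintype.card ι * (2 * P * s) ^ p) := by
          have := ih (by omega)
          gcongr
      _ = _ := by ring

/-- The trace of X^(2p) is the squared Frobenius norm of X^p, and X^p applied to a top eigenvector
of X² has squared norm ‖X‖^(2p). Working with X² avoids asking whether the extreme eigenvalue of `X`
is positive or negative. -/
lemma norm_pow_le_trace [Nonempty ι] {X : Matrix ι ι ℝ} (hX : X.transpose = X) (p : ℕ) :
    ‖X‖ ^ (2 * p) ≤ (X ^ (2 * p)).trace := by
  obtain ⟨w, hw, h⟩ := exists_norm_sq_eigenvector X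
  rw [hX, ← sq] at h
  have h1 : ∀ m : ℕ, op ((X ^ 2) ^ m) w = (‖X‖ ^ 2) ^ m • w := by
    intro m
    induction m with
    | zero => rw [pow_zero, op_one_apply, pow_zero, one_smul]
    | succ m ih => rw [pow_succ, op_mul_apply, h, map_smul, ih, smul_smul, ← pow_succ']
  have h2 : ‖op (X ^ p) w‖ ^ 2 = ‖X‖ ^ (2 * p) := by
    have ht : (X ^ p).transpose = X ^ p := by rw [Matrix.transpose_pow, hX]
    rw [← real_inner_self_eq_norm_sq, ← inner_op_transpose, ht]
    have : op (X ^ p) (op (X ^ p) w) = op ((X ^ 2) ^ p) w := by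
      rw [← op_mul_apply, ← sq, ← pow_mul, ← pow_mul, mul_comm]
    rw [this, h1, real_inner_smul_left, real_inner_self_eq_norm_sq, hw, pow_mul]; ring
  rw [← h2, norm_sq_eq_sum]
  obtain ⟨U, l, hU, hU', hXU⟩ := exists_spectral hX
  have h3 : (X ^ (2 * p)).trace = ∑ i, ∑ j, (X ^ p) i j ^ 2 := by
    rw [two_mul, pow_add, Matrix.trace]
    refine Finset.sum_congr rfl fun i _ => ?_
    rw [Matrix.diag_apply, Matrix.mul_apply]
    refine Finset.sum_congr rfl fun j _ => ?_
    have ht : (X ^ p) j i = (X ^ p) i j := by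
      conv_lhs => rw [← hX, ← Matrix.transpose_pow, Matrix.transpose_apply]
    rw [ht, sq]
  rw [h3]
  refine Finset.sum_le_sum fun i _ => ?_
  rw [op_apply]
  have := Finset.sum_mul_sq_le_sq_mul_sq Finset.univ (fun j => (X ^ p) i j) (fun j => w j)
  rwa [← norm_sq_eq_sum, hw, one_pow, mul_one] at this

/-- Tail bound for the operator norm of a Rademacher sum of symmetric matrices. -/
lemma card_le_norm_signedSum_symm [Nonempty ι] {H : Fin n → Matrix ι ι ℝ}
    (hH : ∀ i, (H i).transpose = H i) {s t : ℝ} (ht : 0 ≤ t) (hs : ∑ i, ‖H i‖ ^ 2 ≤ s) (p : ℕ) :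
    (Finset.univ.filter fun ε => t ≤ ‖signedSum H ε‖).card * t ^ (2 * p) ≤
      2 ^ n * Fintype.card ι * (2 * p * s) ^ p := by
  -- Markov's inequality for the 2p-th power, in counting form.
  refine le_trans ?_ (sum_trace_signedSum_le hH hs p p le_rfl)
  calc _ = ∑ ε ∈ Finset.univ.filter (fun ε => t ≤ ‖signedSum H ε‖), t ^ (2 * p) := by
        rw [Finset.sum_const, nsmul_eq_mul]
    _ ≤ ∑ ε ∈ Finset.univ.filter (fun ε => t ≤ ‖signedSum H ε‖),
          (signedSum H ε ^ (2 * p)).trace := by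
        refine Finset.sum_le_sum fun ε hε => ?_
        exact (pow_le_pow_left₀ ht (Finset.mem_filter.mp hε).2 _).trans
          (norm_pow_le_trace (transpose_signedSum hH ε) p)
    _ ≤ _ := Finset.sum_le_sum_of_subset_of_nonneg (Finset.filter_subset _ _) fun ε _ _ =>
        trace_pow_two_mul_nonneg (transpose_signedSum hH ε) p

end Rademacher

/-! ### Gaussian linear forms -/

section LinearForms

variable {κ : Type*} [Fintype κ]

/-- The law of a linear form of independent standard Gaussian variables. -/
lemma map_sum_mul_pi_gaussianReal (c : κ → ℝ) :
    (Measure.pi fun _ : κ => gaussianReal 0 1).map (fun x => ∑ k, c k * x k) =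
      gaussianReal 0 (∑ k, c k ^ 2).toNNReal := by
  refine Measure.ext_of_charFun (funext fun t => ?_)
  have hs : (0 : ℝ) ≤ ∑ k, c k ^ 2 := Finset.sum_nonneg fun k _ => sq_nonneg _
  have hm : Measurable fun x : κ → ℝ => ∑ k, c k * x k := by fun_prop
  rw [charFun_gaussianReal, charFun_apply_real, integral_map hm.aemeasurable (by fun_prop)]
  have h1 : ∀ x : κ → ℝ, Complex.exp (t * ((∑ k, c k * x k : ℝ) : ℂ) * Complex.I) =
      ∏ k, Complex.exp (((t * c k : ℝ) : ℂ) * (x k : ℂ) * Complex.I) := by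
    intro x
    rw [← Complex.exp_sum]
    congr 1
    push_cast
    rw [Finset.mul_sum, Finset.sum_mul]
    exact Finset.sum_congr rfl fun k _ => by ring
  simp_rw [h1]
  rw [integral_fintype_prod_eq_prod
    (f := fun (k : κ) (y : ℝ) => Complex.exp (((t * c k : ℝ) : ℂ) * (y : ℂ) * Complex.I))]
  have h2 : ∀ k, ∫ y : ℝ, Complex.exp (((t * c k : ℝ) : ℂ) * (y : ℂ) * Complex.I)
      ∂(gaussianReal 0 1) = Complex.exp (-((c k ^ 2 : ℝ) : ℂ) * t ^ 2 / 2) := by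
    intro k
    rw [← charFun_apply_real, charFun_gaussianReal]
    congr 1
    push_cast
    simp
    ring
  simp_rw [h2]
  rw [← Complex.exp_sum]
  congr 1
  rw [Real.coe_toNNReal _ hs]
  push_cast
  rw [← Finset.sum_div, ← Finset.sum_mul, Finset.sum_neg_distrib]
  ring

/-- Chernoff's bound with the exponential parameter equal to t, its optimal value. -/
lemma gaussianReal_Ici_le {t : ℝ} (ht : 0 ≤ t) :
    gaussianReal 0 1 (Set.Ici t) ≤ ENNReal.ofReal (Real.exp (-(t ^ 2 / 2))) := by
  have h := measure_ge_le_exp_mul_mgf (μ := gaussianReal 0 1) (X := fun x : ℝ => x) t ht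
    (integrable_exp_mul_gaussianReal t)
  rw [mgf_fun_id_gaussianReal, ← Real.exp_add] at h
  have h2 : gaussianReal 0 1 (Set.Ici t) =
      ENNReal.ofReal ((gaussianReal 0 1).real {x : ℝ | t ≤ x}) := by
    rw [ofReal_measureReal]; rfl
  rw [h2]
  refine ENNReal.ofReal_le_ofReal (h.trans (le_of_eq ?_))
  congr 1
  simp; ring

/-- Upper tail of a normalized Gaussian linear form. -/
lemma pi_gaussianReal_le_sum (c : κ → ℝ) (hc : ∑ k, c k ^ 2 = 1) {t : ℝ} (ht : 0 ≤ t) :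
    (Measure.pi fun _ : κ => gaussianReal 0 1) {x | t ≤ ∑ k, c k * x k} ≤
      ENNReal.ofReal (Real.exp (-(t ^ 2 / 2))) := by
  have h := map_sum_mul_pi_gaussianReal c
  rw [hc, Real.toNNReal_one] at h
  rw [show {x : κ → ℝ | t ≤ ∑ k, c k * x k} = (fun x => ∑ k, c k * x k) ⁻¹' (Set.Ici t) from rfl,
    ← Measure.map_apply (by fun_prop) measurableSet_Ici, h]
  exact gaussianReal_Ici_le ht

/-- Small ball probability of a normalized Gaussian linear form. -/
lemma pi_gaussianReal_abs_sum_lt (c : κ → ℝ) (hc : ∑ k, c k ^ 2 = 1) (t : ℝ) :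
    (Measure.pi fun _ : κ => gaussianReal 0 1) {x | |∑ k, c k * x k| < t} ≤
      ENNReal.ofReal t := by
  have h := map_sum_mul_pi_gaussianReal c
  rw [hc, Real.toNNReal_one] at h
  have hset : {x : κ → ℝ | |∑ k, c k * x k| < t} =
      (fun x => ∑ k, c k * x k) ⁻¹' (Set.Ioo (-t) t) := by
    ext x; simp [abs_lt]
  rw [hset, ← Measure.map_apply (by fun_prop) measurableSet_Ioo, h,
    gaussianReal_apply 0 one_ne_zero]
  -- The density is at most 1/√(2π) ≤ 1/2, and the interval has length 2t.
  have hpdf : ∀ x, gaussianPDF 0 1 x ≤ ENNReal.ofReal (1 / 2) := by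
    intro x
    rw [gaussianPDF]
    refine ENNReal.ofReal_le_ofReal ?_
    rw [gaussianPDFReal]
    have h1 : (√(2 * Real.pi * ((1 : NNReal) : ℝ)))⁻¹ ≤ 1 / 2 := by
      rw [inv_le_comm₀ (by positivity) (by norm_num)]
      refine Real.le_sqrt_of_sq_le ?_
      have := Real.pi_gt_three
      norm_num; linarith
    have h2 : Real.exp (-(x - 0) ^ 2 / (2 * ((1 : NNReal) : ℝ))) ≤ 1 :=
      Real.exp_le_one_iff.mpr (by
        rw [neg_div]; exact neg_nonpos.mpr (by positivity))
    calc _ ≤ 1 / 2 * 1 := mul_le_mul h1 h2 (Real.exp_pos _).le (by norm_num)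
      _ = _ := mul_one _
  calc ∫⁻ x in Set.Ioo (-t) t, gaussianPDF 0 1 x
      ≤ ∫⁻ x in Set.Ioo (-t) t, ENNReal.ofReal (1 / 2) := lintegral_mono fun x => hpdf x
    _ = ENNReal.ofReal (1 / 2) * ENNReal.ofReal (t - -t) := by
        rw [setLIntegral_const, Real.volume_Ioo]
    _ = ENNReal.ofReal t := by
        rw [← ENNReal.ofReal_mul (by norm_num)]; congr 1; ring

end LinearForms

/-! ### Nets of the sphere and the norm of a Gaussian matrix -/

section Nets

variable {n : ℕ}

/-- A `1/2`-net of the unit sphere with at most `5 ^ n` elements. -/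
lemma exists_net (n : ℕ) : ∃ N : Finset (EuclideanSpace ℝ (Fin n)), N.card ≤ 5 ^ n ∧
    (∀ x ∈ N, ‖x‖ = 1) ∧ ∀ x : EuclideanSpace ℝ (Fin n), ‖x‖ = 1 → ∃ y ∈ N, ‖x - y‖ ≤ 1 / 2 := by
  classical
  let Sep : Finset (EuclideanSpace ℝ (Fin n)) → Prop := fun s =>
    (∀ x ∈ s, ‖x‖ = 1) ∧ ∀ x ∈ s, ∀ y ∈ s, x ≠ y → 1 / 2 ≤ ‖x - y‖
  have hcard : ∀ s, Sep s → s.card ≤ 5 ^ n := by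
    intro s hs
    have hinj : Function.Injective fun x : EuclideanSpace ℝ (Fin n) => (2 : ℝ) • x :=
      smul_right_injective _ two_ne_zero
    -- Doubling brings the points to norm 2 and separation 1, the normalization under which a
    -- separated set has at most 5^n points.
    have := Besicovitch.card_le_of_separated (s.image fun x => (2 : ℝ) • x) ?_ ?_
    · rwa [Finset.card_image_of_injective _ hinj, finrank_euclideanSpace_fin] at this
    · intro c hc
      obtain ⟨x, hx, rfl⟩ := Finset.mem_image.mp hc
      rw [norm_smul, hs.1 x hx]; norm_num
    · intro c hc d hd hcd
      obtain ⟨x, hx, rfl⟩ := Finset.mem_image.mp hc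
      obtain ⟨y, hy, rfl⟩ := Finset.mem_image.mp hd
      have := hs.2 x hx y hy (fun h => hcd (by rw [h]))
      rw [← smul_sub, norm_smul]; norm_num; linarith
  have hP : ∃ k, ∃ s, Sep s ∧ s.card = k := ⟨0, ∅, by simp [Sep], rfl⟩
  have hb : ∀ k, (∃ s, Sep s ∧ s.card = k) → k ≤ 5 ^ n := by
    rintro k ⟨s, hs, rfl⟩; exact hcard s hs
  -- A separated set of greatest cardinality is a net, because any point far from it could be added.
  obtain ⟨N, hN, hNk⟩ := Nat.findGreatest_spec (P := fun k => ∃ s, Sep s ∧ s.card = k)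
    (Nat.zero_le (5 ^ n)) ⟨∅, by simp [Sep], rfl⟩
  refine ⟨N, hcard N hN, hN.1, fun x hx => ?_⟩
  by_contra hcon
  push Not at hcon
  have hxN : x ∉ N := fun h => by
    have := hcon x h; simp at this; linarith
  have hS : Sep (insert x N) := by
    refine ⟨fun y hy => ?_, fun y hy z hz hyz => ?_⟩
    · rcases Finset.mem_insert.mp hy with rfl | hy
      · exact hx
      · exact hN.1 y hy
    · rcases Finset.mem_insert.mp hy with rfl | hy' <;> rcases Finset.mem_insert.mp hz with rfl | hz'
      · exact absurd rfl hyz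
      · exact (hcon z hz').le
      · rw [norm_sub_rev]; exact (hcon y hy').le
      · exact hN.2 y hy' z hz' hyz
  have h1 := Nat.le_findGreatest (P := fun k => ∃ s, Sep s ∧ s.card = k)
    (hcard _ hS) ⟨insert x N, hS, rfl⟩
  rw [Finset.card_insert_of_notMem hxN, hNk] at h1
  omega

/-- The operator norm is controlled on a net. -/
lemma exists_mem_net_norm_le [Nonempty (Fin n)] {N : Finset (EuclideanSpace ℝ (Fin n))}
    (hN : ∀ x : EuclideanSpace ℝ (Fin n), ‖x‖ = 1 → ∃ y ∈ N, ‖x - y‖ ≤ 1 / 2)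
    (M : Matrix (Fin n) (Fin n) ℝ) : ∃ x ∈ N, ∃ y ∈ N, ‖M‖ ≤ 4 * ⟪x, op M y⟫_ℝ := by
  obtain ⟨w, hw, hw2⟩ := exists_norm_sq_eigenvector M
  have hMw : ‖op M w‖ = ‖M‖ := by
    have : ‖op M w‖ ^ 2 = ‖M‖ ^ 2 := by
      rw [← real_inner_self_eq_norm_sq, ← inner_op_transpose, ← op_mul_apply, hw2,
        real_inner_smul_left, real_inner_self_eq_norm_sq, hw]; ring
    exact (pow_left_inj₀ (norm_nonneg _) (norm_nonneg _) two_ne_zero).mp this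
  obtain ⟨y, hy, hwy⟩ := hN w hw
  -- Replacing a unit vector by a net point at distance 1/2 costs a factor 2. This is done once on
  -- each side, hence the factor 4.
  have hMy : ‖M‖ ≤ 2 * ‖op M y‖ := by
    have e1 : ‖op M w‖ ≤ ‖op M y‖ + ‖op M (w - y)‖ := by
      have : op M w = op M y + op M (w - y) := by rw [map_sub]; abel
      rw [this]; exact norm_add_le _ _
    have e2 := norm_op_apply_le M (w - y)
    rw [hMw] at e1
    nlinarith [norm_nonneg M]
  rcases eq_or_ne (op M y) 0 with h0 | h0
  · refine ⟨y, hy, y, hy, ?_⟩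
    rw [h0, norm_zero] at hMy
    rw [h0, inner_zero_right]; linarith
  · have hpos : 0 < ‖op M y‖ := norm_pos_iff.mpr h0
    obtain ⟨x, hx, hxz⟩ := hN (‖op M y‖⁻¹ • op M y) (by
      rw [norm_smul, norm_inv, norm_norm, inv_mul_cancel₀ hpos.ne'])
    refine ⟨x, hx, y, hy, ?_⟩
    have e1 : ⟪‖op M y‖⁻¹ • op M y, op M y⟫_ℝ = ‖op M y‖ := by
      rw [real_inner_smul_left, real_inner_self_eq_norm_sq]; field_simp
    have e2 : ⟪‖op M y‖⁻¹ • op M y - x, op M y⟫_ℝ ≤ 1 / 2 * ‖op M y‖ :=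
      (real_inner_le_norm _ _).trans (by gcongr)
    rw [inner_sub_left, e1] at e2
    linarith

/-- Writing the bilinear form of one slice as a linear form in all n³ entries makes the tail bound
for Gaussian linear forms applicable. -/
lemma inner_op_slice_eq (A : Tensor3 n) (i : Fin n) (x y : EuclideanSpace ℝ (Fin n)) :
    ⟪x, op (slice A i) y⟫_ℝ =
      ∑ p : Fin n × Fin n × Fin n, (if p.1 = i then x p.2.1 * y p.2.2 else 0) * A p := by
  simp only [inner_eq_sum, op_apply, slice, Matrix.of_apply, Fintype.sum_prod_type, Finset.mul_sum,
    ite_mul, zero_mul]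
  symm
  rw [Finset.sum_eq_single i]
  · simp only [if_true]
    exact Finset.sum_congr rfl fun j _ => Finset.sum_congr rfl fun k _ => by ring
  · intro b _ hb; simp [hb]
  · simp

lemma sum_sq_inner_coeff (i : Fin n) {x y : EuclideanSpace ℝ (Fin n)} (hx : ‖x‖ = 1)
    (hy : ‖y‖ = 1) :
    ∑ p : Fin n × Fin n × Fin n, (if p.1 = i then x p.2.1 * y p.2.2 else 0) ^ 2 = 1 := by
  simp only [Fintype.sum_prod_type, ite_pow, ne_eq, OfNat.ofNat_ne_zero, not_false_eq_true, zero_pow]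
  rw [Finset.sum_eq_single i]
  · simp only [if_true, mul_pow]
    rw [← Finset.sum_mul_sum, ← norm_sq_eq_sum, ← norm_sq_eq_sum, hx, hy]; norm_num
  · intro b _ hb; simp [hb]
  · simp

/-- All slices of the noise have norm `O(√n)` with very high probability. -/
lemma noise_exists_norm_slice_gt (n : ℕ) (hn : 2 ≤ n) :
    noise n {A | ∃ i, 24 * √n < ‖slice A i‖} ≤
      ENNReal.ofReal (Nat.factorial 14 / (n : ℝ) ^ 13) := by
  have := nonempty_fin hn
  obtain ⟨N, hcard, hN1, hN⟩ := exists_net n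
  have hsub : {A : Tensor3 n | ∃ i, 24 * √n < ‖slice A i‖} ⊆
      ⋃ i ∈ (Finset.univ : Finset (Fin n)), ⋃ q ∈ N ×ˢ N,
        {A : Tensor3 n | 6 * √n ≤ ∑ p : Fin n × Fin n × Fin n,
          (if p.1 = i then q.1 p.2.1 * q.2 p.2.2 else 0) * A p} := by
    rintro A ⟨i, hi⟩
    obtain ⟨x, hx, y, hy, hxy⟩ := exists_mem_net_norm_le hN (slice A i)
    simp only [Set.mem_iUnion]
    refine ⟨i, Finset.mem_univ i, (x, y), Finset.mk_mem_product hx hy, ?_⟩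
    rw [Set.mem_ofPred_eq]
    rw [← inner_op_slice_eq]; linarith
  have hb : ∀ i : Fin n, ∀ q ∈ N ×ˢ N, noise n {A : Tensor3 n | 6 * √n ≤
      ∑ p : Fin n × Fin n × Fin n, (if p.1 = i then q.1 p.2.1 * q.2 p.2.2 else 0) * A p} ≤
      ENNReal.ofReal (Real.exp (-(18 * n))) := by
    intro i q hq
    obtain ⟨h1, h2⟩ := Finset.mem_product.mp hq
    refine (pi_gaussianReal_le_sum _ (sum_sq_inner_coeff i (hN1 _ h1) (hN1 _ h2))
      (by positivity)).trans (le_of_eq ?_)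
    congr 3
    rw [mul_pow, Real.sq_sqrt (Nat.cast_nonneg n)]; ring
  refine (measure_mono hsub).trans ((measure_biUnion_finset_le _ _).trans ?_)
  calc ∑ i : Fin n, noise n (⋃ q ∈ N ×ˢ N, {A : Tensor3 n | 6 * √n ≤
        ∑ p : Fin n × Fin n × Fin n, (if p.1 = i then q.1 p.2.1 * q.2 p.2.2 else 0) * A p})
      ≤ ∑ i : Fin n, ∑ q ∈ N ×ˢ N, ENNReal.ofReal (Real.exp (-(18 * n))) :=
        Finset.sum_le_sum fun i _ => (measure_biUnion_finset_le _ _).trans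
          (Finset.sum_le_sum fun q hq => hb i q hq)
    _ = ENNReal.ofReal (n * ((N.card : ℝ) * N.card) * Real.exp (-(18 * n))) := by
        rw [Finset.sum_const, Finset.sum_const, Finset.card_univ, Fintype.card_fin,
          Finset.card_product, nsmul_eq_mul, nsmul_eq_mul, ENNReal.ofReal_mul (by positivity),
          ENNReal.ofReal_mul (by positivity), ENNReal.ofReal_mul (by positivity)]
        simp only [ENNReal.ofReal_natCast]
        push_cast
        ring
    _ ≤ _ := by
        refine ENNReal.ofReal_le_ofReal ?_
        have hc : (N.card : ℝ) ≤ 5 ^ n := by exact_mod_cast hcard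
        have h5 : (5 : ℝ) ^ n ≤ Real.exp (2 * n) := by
          rw [mul_comm, Real.exp_nat_mul]
          refine pow_le_pow_left₀ (by norm_num) ?_ n
          have h := Real.exp_one_gt_d9
          have : Real.exp 2 = Real.exp 1 ^ 2 := by rw [← Real.exp_nat_mul]; norm_num
          rw [this]; nlinarith
        have hexp : (n : ℝ) ^ 14 / Nat.factorial 14 ≤ Real.exp n :=
          Real.pow_div_factorial_le_exp n (Nat.cast_nonneg n) 14
        have hn0 : (0 : ℝ) < n := by positivity
        -- Union bound over n slices and at most 25^n ≤ e^{4n} pairs of net points. The tail at 6√n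
        -- is e^{−18n}, so n e^{−14n} remains, far more than is needed for n^{−13}.
        have hprod : (n : ℝ) * ((N.card : ℝ) * N.card) * Real.exp (-(18 * n)) ≤
            n * Real.exp (-n) := by
          have e1 : (N.card : ℝ) * N.card ≤ Real.exp (2 * n) * Real.exp (2 * n) :=
            mul_le_mul (hc.trans h5) (hc.trans h5) (by positivity) (Real.exp_pos _).le
          calc _ ≤ (n : ℝ) * (Real.exp (2 * n) * Real.exp (2 * n)) * Real.exp (-(18 * n)) := by
                gcongr
            _ = n * Real.exp (-(14 * n)) := by
                rw [mul_assoc, ← Real.exp_add, ← Real.exp_add]; congr 2; ring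
            _ ≤ _ := by gcongr; linarith
        refine hprod.trans ?_
        rw [Real.exp_neg, ← div_eq_mul_inv, div_le_div_iff₀ (Real.exp_pos _) (by positivity)]
        rw [div_le_iff₀ (by positivity)] at hexp
        calc (n : ℝ) * n ^ 13 = n ^ 14 := by ring
          _ ≤ _ := by linarith

end Nets

/-! ### Concentration of sums of quadratic functions of the slices -/

section Concentration

variable {n : ℕ} {ι : Type} [Fintype ι] [DecidableEq ι]

/-- The sum over the slices of a matrix function. -/
noncomputable def sliceSum (F : Matrix (Fin n) (Fin n) ℝ → Matrix ι ι ℝ) (A : Tensor3 n) :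
    Matrix ι ι ℝ := ∑ i, F (slice A i)

/-- The entrywise mean of the sum over the slices. -/
noncomputable def sliceMean (F : Matrix (Fin n) (Fin n) ℝ → Matrix ι ι ℝ) : Matrix ι ι ℝ :=
  Matrix.of fun a b => ∫ A, sliceSum F A a b ∂(noise n)

lemma continuous_slice (i : Fin n) : Continuous fun A : Tensor3 n => slice A i := by
  refine continuous_matrix fun j k => ?_
  exact continuous_apply (i, j, k)

lemma continuous_sliceSum {F : Matrix (Fin n) (Fin n) ℝ → Matrix ι ι ℝ} (hF : Continuous F) :
    Continuous (sliceSum F) := by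
  unfold sliceSum
  exact continuous_finsetSum _ fun i _ => hF.comp (continuous_slice i)

lemma norm_sq_matrix_le (M : Matrix (Fin n) (Fin n) ℝ) : ‖M‖ ^ 2 ≤ ∑ j, ∑ k, M j k ^ 2 := by
  have h0 : 0 ≤ ∑ j, ∑ k, M j k ^ 2 :=
    Finset.sum_nonneg fun j _ => Finset.sum_nonneg fun k _ => sq_nonneg _
  have h : ‖M‖ ≤ √(∑ j, ∑ k, M j k ^ 2) := by
    rw [← norm_op]
    refine ContinuousLinearMap.opNorm_le_bound _ (Real.sqrt_nonneg _) fun x => ?_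
    refine (pow_le_pow_iff_left₀ (norm_nonneg _) (by positivity) two_ne_zero).mp ?_
    rw [mul_pow, Real.sq_sqrt h0, norm_sq_eq_sum, norm_sq_eq_sum, Finset.sum_mul]
    refine Finset.sum_le_sum fun j _ => ?_
    rw [op_apply]
    exact Finset.sum_mul_sq_le_sq_mul_sq _ _ _
  calc ‖M‖ ^ 2 ≤ (√(∑ j, ∑ k, M j k ^ 2)) ^ 2 := pow_le_pow_left₀ (norm_nonneg _) h 2
    _ = _ := Real.sq_sqrt h0

/-- A crude Frobenius bound. It serves only to give finite and polynomially bounded second moments.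
-/
lemma norm_sliceSum_le {F : Matrix (Fin n) (Fin n) ℝ → Matrix ι ι ℝ}
    (hF : ∀ X, ‖F X‖ ≤ ‖X‖ ^ 2) (A : Tensor3 n) : ‖sliceSum F A‖ ≤ ∑ p, A p ^ 2 := by
  refine (norm_sum_le _ _).trans ?_
  rw [Fintype.sum_prod_type]
  refine Finset.sum_le_sum fun i _ => (hF _).trans ((norm_sq_matrix_le _).trans ?_)
  rw [Fintype.sum_prod_type]
  rfl

/-- The fourth moment of a standard Gaussian. -/
noncomputable def fourthMoment : ℝ := ∫ x, x ^ 4 ∂(gaussianReal 0 1)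

lemma fourthMoment_nonneg : 0 ≤ fourthMoment :=
  integral_nonneg fun x => by positivity

lemma integrable_noise_pow_four (p : Fin n × Fin n × Fin n) :
    Integrable (fun A : Tensor3 n => A p ^ 4) (noise n) := by
  have := (memLp_noise_eval p (p := 4) (by simp)).integrable_norm_pow (by norm_num)
  simpa [Even.pow_abs (show Even 4 by decide)] using this

lemma integral_noise_pow_four (p : Fin n × Fin n × Fin n) :
    ∫ A, A p ^ 4 ∂(noise n) = fourthMoment := by
  exact integral_comp_eval (μ := fun _ : Fin n × Fin n × Fin n => gaussianReal 0 1) (i := p)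
    (f := fun x : ℝ => x ^ 4) (by fun_prop)

lemma sq_sum_sq_le (A : Tensor3 n) : (∑ p, A p ^ 2) ^ 2 ≤ n ^ 3 * ∑ p, A p ^ 4 := by
  have h := sq_sum_le_card_mul_sum_sq (s := Finset.univ) (f := fun p => A p ^ 2)
  refine h.trans (le_of_eq ?_)
  rw [Finset.card_univ]
  simp only [Fintype.card_prod, Fintype.card_fin, ← pow_mul]
  push_cast; ring

/-- A continuous function of the noise that is bounded by the squared norm has a second moment. -/
lemma memLp_two_of_abs_le {f : Tensor3 n → ℝ} (hf : Continuous f)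
    (h : ∀ A, |f A| ≤ ∑ p, A p ^ 2) : MemLp f 2 (noise n) := by
  rw [memLp_two_iff_integrable_sq hf.aestronglyMeasurable]
  refine Integrable.mono' (g := fun A => n ^ 3 * ∑ p, A p ^ 4) ?_
    (by fun_prop) (Filter.Eventually.of_forall fun A => ?_)
  · exact (integrable_finsetSum _ fun p _ => integrable_noise_pow_four p).const_mul _
  · rw [Real.norm_eq_abs, abs_of_nonneg (sq_nonneg _), ← sq_abs]
    exact (pow_le_pow_left₀ (abs_nonneg _) (h A) 2).trans (sq_sum_sq_le A)

lemma integral_sq_le_of_abs_le {f : Tensor3 n → ℝ} (hf : Continuous f)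
    (h : ∀ A, |f A| ≤ ∑ p, A p ^ 2) : ∫ A, f A ^ 2 ∂(noise n) ≤ n ^ 6 * fourthMoment := by
  have hint : Integrable (fun A : Tensor3 n => (n : ℝ) ^ 3 * ∑ p, A p ^ 4) (noise n) :=
    (integrable_finsetSum _ fun p _ => integrable_noise_pow_four p).const_mul _
  calc ∫ A, f A ^ 2 ∂(noise n) ≤ ∫ A, (n : ℝ) ^ 3 * ∑ p, A p ^ 4 ∂(noise n) := by
        refine integral_mono (memLp_two_of_abs_le hf h).integrable_sq hint fun A => ?_
        simp only
        rw [← sq_abs]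
        exact (pow_le_pow_left₀ (abs_nonneg _) (h A) 2).trans (sq_sum_sq_le A)
    _ = n ^ 6 * fourthMoment := by
        rw [integral_const_mul, integral_finsetSum _ fun p _ => integrable_noise_pow_four p]
        simp only [integral_noise_pow_four]
        rw [Finset.sum_const, Finset.card_univ]
        simp only [Fintype.card_prod, Fintype.card_fin, nsmul_eq_mul]
        push_cast; ring

/-- A centered variable does not exceed half of `t` with a probability that is not too small. -/
lemma measure_le_of_integral_eq_zero {Ω : Type*} [MeasurableSpace Ω] (μ : Measure Ω)
    [IsProbabilityMeasure μ] {f : Ω → ℝ} (hm : Measurable f) (hf : MemLp f 2 μ)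
    (h0 : ∫ x, f x ∂μ = 0) {V t : ℝ} (ht : 0 < t) (hV : 0 < V) (h2 : ∫ x, f x ^ 2 ∂μ ≤ V) :
    t ^ 2 / (2 * t ^ 2 + 4 * V) ≤ μ.real {x | f x ≤ t / 2} := by
  set B := {x | f x ≤ t / 2} with hB
  have hBm : MeasurableSet B := measurableSet_le hm measurable_const
  -- A Paley–Zygmund type argument: the quadratic α(t/2 − f) − c f² lies below the indicator of B.
  -- Off B it is negative. With c = α t/(4V) its maximum is α(t/2 + V/t), which this choice of α
  -- makes equal to 1. Its integral is at least α t/2 − c V = α t/4.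
  set α := 1 / (t / 2 + V / t) with hα
  have hα0 : 0 < α := by positivity
  have hα1 : α * (t / 2 + V / t) = 1 := by rw [hα]; field_simp
  set c := α * t / (4 * V) with hc
  have hc0 : 0 < c := by positivity
  have hfi : Integrable f μ := hf.integrable (by norm_num)
  have hpt : ∀ x, α * (t / 2 - f x) - c * f x ^ 2 ≤ B.indicator (fun _ => (1 : ℝ)) x := by
    intro x
    by_cases hx : x ∈ B
    · rw [Set.indicator_of_mem hx]
      have h3 : α ^ 2 / (4 * c) = α * (V / t) := by rw [hc]; field_simp
      have h4 : -(α * f x) - c * f x ^ 2 ≤ α ^ 2 / (4 * c) := by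
        rw [le_div_iff₀ (by positivity)]
        nlinarith [sq_nonneg (α + 2 * c * f x)]
      nlinarith
    · rw [Set.indicator_of_notMem hx]
      have : t / 2 < f x := not_le.mp hx
      nlinarith [sq_nonneg (f x)]
  have hi0 : Integrable (fun x => t / 2 - f x) μ := (integrable_const (t / 2)).sub hfi
  have hi1 : Integrable (fun x => α * (t / 2 - f x)) μ := hi0.const_mul α
  have hi2 : Integrable (fun x => c * f x ^ 2) μ := hf.integrable_sq.const_mul c
  have hint := integral_mono (μ := μ) (hi1.sub hi2)
    ((integrable_const (1 : ℝ)).indicator hBm) hpt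
  rw [integral_indicator_const _ hBm] at hint
  have hl : ∫ x, (α * (t / 2 - f x) - c * f x ^ 2) ∂μ = α * (t / 2) - c * ∫ x, f x ^ 2 ∂μ := by
    rw [integral_sub hi1 hi2, integral_const_mul, integral_const_mul,
      integral_sub (integrable_const _) hfi, h0]
    simp
  have h5 : α * (t / 2) - c * V ≤ μ.real B := by
    have : ∫ x, (α * (t / 2 - f x) - c * f x ^ 2) ∂μ ≤ μ.real B := by simpa using hint
    rw [hl] at this
    nlinarith
  refine le_trans (le_of_eq ?_) h5
  rw [hc, hα]; field_simp; ring

/-- Exchange the slices of two tensors according to signs. -/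
def swapSlices (ε : Fin n → Bool) (z : Tensor3 n × Tensor3 n) : Tensor3 n × Tensor3 n :=
  (fun p => if ε p.1 then z.1 p else z.2 p, fun p => if ε p.1 then z.2 p else z.1 p)

/-- Seen as a family of pairs of entries, the exchange acts coordinatewise, by the identity or by
the swap, and both preserve the product of two equal laws. -/
lemma measurePreserving_swapSlices (ε : Fin n → Bool) :
    MeasurePreserving (swapSlices ε) ((noise n).prod (noise n)) ((noise n).prod (noise n)) := by
  have e := measurePreserving_arrowProdEquivProdArrow ℝ ℝ (Fin n × Fin n × Fin n)
    (fun _ => gaussianReal 0 1) (fun _ => gaussianReal 0 1)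
  have hswap : ∀ p : Fin n × Fin n × Fin n,
      MeasurePreserving (fun y : ℝ × ℝ => if ε p.1 then y else y.swap)
        ((gaussianReal 0 1).prod (gaussianReal 0 1)) ((gaussianReal 0 1).prod (gaussianReal 0 1)) := by
    intro p
    split_ifs
    · exact MeasurePreserving.id _
    · exact Measure.measurePreserving_swap
  have hpi := measurePreserving_pi _ _ hswap
  have h := (e.comp hpi).comp e.symm
  convert! h using 1
  funext z
  refine Prod.ext (funext fun p => ?_) (funext fun p => ?_)
  · simp only [swapSlices, Function.comp_apply]
    cases hε : ε p.1 <;>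
      simp [MeasurableEquiv.arrowProdEquivProdArrow, Equiv.arrowProdEquivProdArrow, hε]
  · simp only [swapSlices, Function.comp_apply]
    cases hε : ε p.1 <;>
      simp [MeasurableEquiv.arrowProdEquivProdArrow, Equiv.arrowProdEquivProdArrow, hε]

lemma slice_swapSlices_fst (ε : Fin n → Bool) (z : Tensor3 n × Tensor3 n) (i : Fin n) :
    slice (swapSlices ε z).1 i = if ε i then slice z.1 i else slice z.2 i := by
  ext j k
  cases h : ε i <;> simp [slice, swapSlices, h]

lemma slice_swapSlices_snd (ε : Fin n → Bool) (z : Tensor3 n × Tensor3 n) (i : Fin n) :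
    slice (swapSlices ε z).2 i = if ε i then slice z.2 i else slice z.1 i := by
  ext j k
  cases h : ε i <;> simp [slice, swapSlices, h]

/-- Exchanging the i-th slices negates the i-th difference. With the two tensors fixed, the
symmetrized deviation over all exchanges is therefore a Rademacher sum of fixed matrices. -/
lemma sliceSum_swapSlices_sub (F : Matrix (Fin n) (Fin n) ℝ → Matrix ι ι ℝ) (ε : Fin n → Bool)
    (z : Tensor3 n × Tensor3 n) :
    sliceSum F (swapSlices ε z).1 - sliceSum F (swapSlices ε z).2 =
      signedSum (fun i => F (slice z.1 i) - F (slice z.2 i)) ε := by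
  rw [sliceSum, sliceSum, signedSum, ← Finset.sum_sub_distrib]
  refine Finset.sum_congr rfl fun i _ => ?_
  rw [slice_swapSlices_fst, slice_swapSlices_snd]
  cases ε i <;> simp [boolSign]

/-- All slices have norm at most `24 √n`. -/
def SlicesBounded (A : Tensor3 n) : Prop := ∀ i, ‖slice A i‖ ≤ 24 * √n

lemma isClosed_slicesBounded : IsClosed {A : Tensor3 n | SlicesBounded A} := by
  simp only [SlicesBounded, Set.ofPred_forall]
  exact isClosed_iInter fun i => isClosed_le (continuous_slice i).norm continuous_const

/-- Tail bound for the symmetrized sum on the event of bounded slices. -/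
lemma prod_noise_norm_sub_ge_le [Nonempty ι] {F : Matrix (Fin n) (Fin n) ℝ → Matrix ι ι ℝ}
    (hFc : Continuous F) (hFs : ∀ X, (F X).transpose = F X) (hF : ∀ X, ‖F X‖ ≤ ‖X‖ ^ 2)
    {t : ℝ} (ht : 0 < t) (p : ℕ) :
    ((noise n).prod (noise n)) {z | t ≤ ‖sliceSum F z.1 - sliceSum F z.2‖ ∧
      SlicesBounded z.1 ∧ SlicesBounded z.2} ≤
      ENNReal.ofReal (Fintype.card ι * (2 * p * (1152 ^ 2 * n ^ 3) / t ^ 2) ^ p) := by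
  classical
  set ν := (noise n).prod (noise n) with hν
  set S := {z : Tensor3 n × Tensor3 n | t ≤ ‖sliceSum F z.1 - sliceSum F z.2‖ ∧
      SlicesBounded z.1 ∧ SlicesBounded z.2} with hS
  set c : ℝ := Fintype.card ι * (2 * p * (1152 ^ 2 * n ^ 3) / t ^ 2) ^ p with hc
  have hc0 : 0 ≤ c := by positivity
  have hSm : MeasurableSet S := by
    refine (IsClosed.inter ?_ (IsClosed.inter ?_ ?_)).measurableSet
    · exact isClosed_le continuous_const
        (((continuous_sliceSum hFc).comp continuous_fst).sub
          ((continuous_sliceSum hFc).comp continuous_snd)).norm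
    · exact isClosed_slicesBounded.preimage continuous_fst
    · exact isClosed_slicesBounded.preimage continuous_snd
  -- pointwise count of the bad signs
  have hcount : ∀ z : Tensor3 n × Tensor3 n,
      ((Finset.univ.filter fun ε => swapSlices ε z ∈ S).card : ℝ) ≤ 2 ^ n * c := by
    intro z
    by_cases hz : SlicesBounded z.1 ∧ SlicesBounded z.2
    · set H : Fin n → Matrix ι ι ℝ := fun i => F (slice z.1 i) - F (slice z.2 i) with hH
      have hsq : (24 * √(n : ℝ)) ^ 2 = 576 * n := by
        rw [mul_pow, Real.sq_sqrt (Nat.cast_nonneg n)]; norm_num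
      -- Each of the two terms is at most (24√n)² = 576 n.
      have hHb : ∀ i, ‖H i‖ ≤ 1152 * n := by
        intro i
        have h1 := (hF (slice z.1 i)).trans (pow_le_pow_left₀ (norm_nonneg _) (hz.1 i) 2)
        have h2 := (hF (slice z.2 i)).trans (pow_le_pow_left₀ (norm_nonneg _) (hz.2 i) 2)
        have := norm_sub_le (F (slice z.1 i)) (F (slice z.2 i))
        rw [hsq] at h1 h2
        linarith
      have hHs : ∑ i, ‖H i‖ ^ 2 ≤ 1152 ^ 2 * n ^ 3 := by
        calc ∑ i, ‖H i‖ ^ 2 ≤ ∑ _i : Fin n, (1152 * (n : ℝ)) ^ 2 :=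
              Finset.sum_le_sum fun i _ => pow_le_pow_left₀ (norm_nonneg _) (hHb i) 2
          _ = _ := by rw [Finset.sum_const, Finset.card_univ, Fintype.card_fin, nsmul_eq_mul]; ring
      have hcard := card_le_norm_signedSum_symm (H := H)
        (fun i => by rw [hH]; simp only [Matrix.transpose_sub, hFs]) ht.le hHs p
      have hle : ((Finset.univ.filter fun ε => swapSlices ε z ∈ S).card : ℝ) ≤
          (Finset.univ.filter fun ε => t ≤ ‖signedSum H ε‖).card := by
        have : (Finset.univ.filter fun ε => swapSlices ε z ∈ S) ⊆
            (Finset.univ.filter fun ε => t ≤ ‖signedSum H ε‖) := by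
          intro ε hε
          rw [Finset.mem_filter] at hε ⊢
          refine ⟨hε.1, ?_⟩
          have := hε.2.1
          rwa [sliceSum_swapSlices_sub] at this
        exact_mod_cast Finset.card_le_card this
      refine hle.trans ?_
      have htp : 0 < t ^ (2 * p) := by positivity
      rw [← mul_le_mul_iff_of_pos_right htp]
      refine hcard.trans (le_of_eq ?_)
      rw [hc, div_pow, ← pow_mul]
      field_simp
    -- Boundedness of all slices of both tensors is invariant under exchanges. If it fails for `z`,
    -- no exchange leads into `S`, so truncation does not destroy the symmetry.
    · have : (Finset.univ.filter fun ε => swapSlices ε z ∈ S) = ∅ := by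
        refine Finset.filter_eq_empty_iff.mpr fun ε _ hε => hz ?_
        obtain ⟨-, h1, h2⟩ := hε
        constructor <;> intro i
        · have e1 := h1 i
          have e2 := h2 i
          rw [slice_swapSlices_fst] at e1
          rw [slice_swapSlices_snd] at e2
          cases hε : ε i <;> simp only [hε, if_true] at e1 e2 <;> simp_all
        · have e1 := h1 i
          have e2 := h2 i
          rw [slice_swapSlices_fst] at e1
          rw [slice_swapSlices_snd] at e2
          cases hε : ε i <;> simp only [hε, if_true] at e1 e2 <;> simp_all
      rw [this]; simp; positivity
  have hsum : ∀ ε : Fin n → Bool, ν S = ∫⁻ z, S.indicator 1 (swapSlices ε z) ∂ν := by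
    intro ε
    rw [← (measurePreserving_swapSlices ε).measure_preimage hSm.nullMeasurableSet,
      ← lintegral_indicator_one ((measurePreserving_swapSlices ε).measurable hSm)]
    rfl
  -- All exchanges preserve ν, so 2^n ν(S) is the integral of the number of exchanges that lead into
  -- `S`, and this number is bounded pointwise.
  have htot : (2 ^ n : ENNReal) * ν S ≤ ENNReal.ofReal (2 ^ n * c) := by
    calc (2 ^ n : ENNReal) * ν S = ∑ ε : Fin n → Bool, ν S := by
          rw [Finset.sum_const, Finset.card_univ, Fintype.card_fun, Fintype.card_bool,
            Fintype.card_fin, nsmul_eq_mul]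
          push_cast; rfl
      _ = ∑ ε : Fin n → Bool, ∫⁻ z, S.indicator 1 (swapSlices ε z) ∂ν :=
          Finset.sum_congr rfl fun ε _ => hsum ε
      _ = ∫⁻ z, ∑ ε : Fin n → Bool, S.indicator 1 (swapSlices ε z) ∂ν := by
          rw [lintegral_finsetSum]
          intro ε _
          exact (measurable_one.indicator hSm).comp (measurePreserving_swapSlices ε).measurable
      _ ≤ ∫⁻ _z, ENNReal.ofReal (2 ^ n * c) ∂ν := by
          refine lintegral_mono fun z => ?_
          have : ∑ ε : Fin n → Bool, S.indicator (1 : Tensor3 n × Tensor3 n → ENNReal)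
              (swapSlices ε z) = ((Finset.univ.filter fun ε => swapSlices ε z ∈ S).card : ENNReal) := by
            rw [Finset.card_filter]
            push_cast
            exact Finset.sum_congr rfl fun ε _ => by simp [Set.indicator_apply]
          rw [this, ← ENNReal.ofReal_natCast]
          exact ENNReal.ofReal_le_ofReal (hcount z)
      _ = ENNReal.ofReal (2 ^ n * c) := by simp
  rw [ENNReal.ofReal_mul (by positivity), ENNReal.ofReal_pow (by norm_num),
    ENNReal.ofReal_ofNat] at htot
  exact (ENNReal.mul_le_mul_iff_right (by positivity) (by finiteness)).mp htot

end Concentration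

/-! ### From symmetrized deviations to deviations from the mean -/

section Desymmetrization

variable {n : ℕ} {ι : Type} [Fintype ι] [DecidableEq ι]

lemma exists_unit_inner_eq_norm [Nonempty ι] (M : Matrix ι ι ℝ) :
    ∃ x w : EuclideanSpace ℝ ι, ‖x‖ = 1 ∧ ‖w‖ = 1 ∧ ⟪x, op M w⟫_ℝ = ‖M‖ := by
  obtain ⟨w, hw, hw2⟩ := exists_norm_sq_eigenvector M
  rcases eq_or_ne ‖M‖ 0 with h0 | h0
  · refine ⟨w, w, hw, hw, ?_⟩
    rw [norm_eq_zero] at h0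
    subst h0
    simp [op]
  · refine ⟨‖M‖⁻¹ • op M w, w, ?_, hw, ?_⟩
    · have h1 : ‖op M w‖ ^ 2 = ‖M‖ ^ 2 := by
        rw [← real_inner_self_eq_norm_sq, ← inner_op_transpose, ← op_mul_apply, hw2,
          real_inner_smul_left, real_inner_self_eq_norm_sq, hw]; ring
      have h2 := (pow_left_inj₀ (norm_nonneg _) (norm_nonneg _) two_ne_zero).mp h1
      rw [norm_smul, h2, norm_inv, norm_norm, inv_mul_cancel₀ h0]
    · rw [real_inner_smul_left, ← inner_op_transpose, ← op_mul_apply, hw2, real_inner_smul_left,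
        real_inner_self_eq_norm_sq, hw]
      field_simp

lemma abs_entry_le_norm (M : Matrix ι ι ℝ) (a b : ι) : |M a b| ≤ ‖M‖ := by
  have h := inner_op_le M (EuclideanSpace.single a 1) (EuclideanSpace.single b 1)
  have : ⟪EuclideanSpace.single a (1 : ℝ), op M (EuclideanSpace.single b 1)⟫_ℝ = M a b := by
    simp [inner_eq_sum, op_apply]
  rw [this] at h
  simpa using h

variable {F : Matrix (Fin n) (Fin n) ℝ → Matrix ι ι ℝ}

lemma integrable_sliceSum_entry (hFc : Continuous F) (hF : ∀ X, ‖F X‖ ≤ ‖X‖ ^ 2) (a b : ι) :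
    Integrable (fun A => sliceSum F A a b) (noise n) :=
  (memLp_two_of_abs_le ((continuous_sliceSum hFc).matrix_elem a b) fun A =>
    (abs_entry_le_norm _ a b).trans (norm_sliceSum_le hF A)).integrable (by norm_num)

lemma integral_inner_sliceSum (hFc : Continuous F) (hF : ∀ X, ‖F X‖ ≤ ‖X‖ ^ 2)
    (x w : EuclideanSpace ℝ ι) :
    ∫ A, ⟪x, op (sliceSum F A) w⟫_ℝ ∂(noise n) = ⟪x, op (sliceMean F) w⟫_ℝ := by
  have hint : ∀ a b, Integrable (fun A => x a * (sliceSum F A a b * w b)) (noise n) := fun a b =>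
    ((integrable_sliceSum_entry hFc hF a b).mul_const _).const_mul _
  simp only [inner_eq_sum, op_apply, Finset.mul_sum]
  rw [integral_finsetSum _ fun a _ => integrable_finsetSum _ fun b _ => hint a b]
  refine Finset.sum_congr rfl fun a _ => ?_
  rw [integral_finsetSum _ fun b _ => hint a b]
  refine Finset.sum_congr rfl fun b _ => ?_
  rw [integral_const_mul, integral_mul_const, sliceMean, Matrix.of_apply]

/-- The deviation from the mean is controlled by the symmetrized deviation. -/
lemma noise_norm_sub_mean_gt_le [Nonempty ι] (hFc : Continuous F) (hF : ∀ X, ‖F X‖ ≤ ‖X‖ ^ 2)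
    (hn : 0 < n) {t : ℝ} (ht : 0 < t) :
    ENNReal.ofReal (t ^ 2 / (2 * t ^ 2 + 4 * (n ^ 6 * (fourthMoment + 1)))) *
        noise n {A | t < ‖sliceSum F A - sliceMean F‖} ≤
      ((noise n).prod (noise n)) {z | t / 2 ≤ ‖sliceSum F z.1 - sliceSum F z.2‖} := by
  have hc := continuous_sliceSum hFc
  set π := t ^ 2 / (2 * t ^ 2 + 4 * (n ^ 6 * (fourthMoment + 1))) with hπ
  set S := {z : Tensor3 n × Tensor3 n | t / 2 ≤ ‖sliceSum F z.1 - sliceSum F z.2‖} with hS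
  set G := {A : Tensor3 n | t < ‖sliceSum F A - sliceMean F‖} with hG
  have hSm : MeasurableSet S := (isClosed_le continuous_const
    ((hc.comp continuous_fst).sub (hc.comp continuous_snd)).norm).measurableSet
  have hGm : MeasurableSet G :=
    (isOpen_lt continuous_const (hc.sub continuous_const).norm).measurableSet
  have hV : (0 : ℝ) < n ^ 6 * (fourthMoment + 1) := by
    have := fourthMoment_nonneg; positivity
  -- For a bad `A`, unit vectors attaining the norm of its deviation are fixed. The bilinear form of
  -- an independent copy at these vectors exceeds its mean by at most t/2 with probability at least
  -- π, and then the two copies differ by at least t/2. Integration over bad `A` finishes the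
  -- comparison.
  have hfib : ∀ A ∈ G, ENNReal.ofReal π ≤ noise n (Prod.mk A ⁻¹' S) := by
    intro A hA
    obtain ⟨x, w, hx, hw, hxw⟩ := exists_unit_inner_eq_norm (sliceSum F A - sliceMean F)
    set h : Tensor3 n → ℝ := fun A' => ⟪x, op (sliceSum F A') w⟫_ℝ with hh
    have hhc : Continuous h := by
      have : h = fun A' => ∑ a, x a * ∑ b, sliceSum F A' a b * w b := by
        funext A'; simp only [hh, inner_eq_sum, op_apply]
      rw [this]
      exact continuous_finsetSum _ fun a _ => continuous_const.mul
        (continuous_finsetSum _ fun b _ => (hc.matrix_elem a b).mul continuous_const)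
    have hhb : ∀ A', |h A'| ≤ ∑ p, A' p ^ 2 := fun A' => by
      have := inner_op_le (sliceSum F A') x w
      rw [hx, hw, mul_one, mul_one] at this
      exact this.trans (norm_sliceSum_le hF A')
    have hL := memLp_two_of_abs_le hhc hhb
    set m := ∫ A', h A' ∂(noise n) with hm
    have hvar : ∫ A', (h A' - m) ^ 2 ∂(noise n) ≤ n ^ 6 * (fourthMoment + 1) := by
      have h1 := variance_le_expectation_sq (μ := noise n) (X := h) hhc.aestronglyMeasurable
      rw [variance_eq_integral hhc.measurable.aemeasurable] at h1
      refine h1.trans ((integral_sq_le_of_abs_le hhc hhb).trans ?_)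
      gcongr; linarith
    have hmean : ∫ A', (h A' - m) ∂(noise n) = 0 := by
      rw [integral_sub (hL.integrable (by norm_num)) (integrable_const _)]
      simp [hm]
    have key := measure_le_of_integral_eq_zero (noise n) (f := fun A' => h A' - m)
      (hhc.sub continuous_const).measurable (hL.sub (memLp_const m)) hmean ht hV hvar
    rw [← ofReal_measureReal]
    refine ENNReal.ofReal_le_ofReal (key.trans ?_)
    refine measureReal_mono (fun A' hA' => ?_) (by finiteness)
    have hA'' : h A' - m ≤ t / 2 := hA'
    change t / 2 ≤ ‖sliceSum F A - sliceSum F A'‖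
    have hA1 : t < ‖sliceSum F A - sliceMean F‖ := hA
    have e1 : ⟪x, op (sliceSum F A - sliceSum F A') w⟫_ℝ =
        ‖sliceSum F A - sliceMean F‖ - (h A' - m) := by
      rw [← hxw, hm, hh, integral_inner_sliceSum hFc hF]
      simp only [op, map_sub, sub_apply, inner_sub_right]
      ring
    have e2 := (le_abs_self _).trans (inner_op_le (sliceSum F A - sliceSum F A') x w)
    rw [hx, hw, mul_one, mul_one, e1] at e2
    linarith
  calc ENNReal.ofReal π * noise n G = ∫⁻ _A in G, ENNReal.ofReal π ∂(noise n) := by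
        rw [setLIntegral_const]
    _ ≤ ∫⁻ A in G, noise n (Prod.mk A ⁻¹' S) ∂(noise n) := setLIntegral_mono' hGm hfib
    _ ≤ ∫⁻ A, noise n (Prod.mk A ⁻¹' S) ∂(noise n) := setLIntegral_le_lintegral _ _
    _ = _ := (Measure.prod_apply hSm).symm

/-- Removes the truncation, at the cost of the probability that a slice of either copy is large. -/
lemma prod_noise_norm_sub_ge_le' [Nonempty ι] (hFc : Continuous F)
    (hFs : ∀ X, (F X).transpose = F X) (hF : ∀ X, ‖F X‖ ≤ ‖X‖ ^ 2) (hn : 2 ≤ n)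
    {t : ℝ} (ht : 0 < t) (p : ℕ) :
    ((noise n).prod (noise n)) {z | t ≤ ‖sliceSum F z.1 - sliceSum F z.2‖} ≤
      ENNReal.ofReal (Fintype.card ι * (2 * p * (1152 ^ 2 * n ^ 3) / t ^ 2) ^ p +
        2 * (Nat.factorial 14 / (n : ℝ) ^ 13)) := by
  set B := {A : Tensor3 n | ∃ i, 24 * √n < ‖slice A i‖} with hB
  have hBm : MeasurableSet B := by
    have : B = {A : Tensor3 n | SlicesBounded A}ᶜ := by
      ext A; simp [hB, SlicesBounded]
    rw [this]; exact isClosed_slicesBounded.measurableSet.compl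
  have hsub : {z : Tensor3 n × Tensor3 n | t ≤ ‖sliceSum F z.1 - sliceSum F z.2‖} ⊆
      {z | t ≤ ‖sliceSum F z.1 - sliceSum F z.2‖ ∧ SlicesBounded z.1 ∧ SlicesBounded z.2} ∪
        (Prod.fst ⁻¹' B ∪ Prod.snd ⁻¹' B) := by
    intro z hz
    by_cases h1 : SlicesBounded z.1
    · by_cases h2 : SlicesBounded z.2
      · exact Or.inl ⟨hz, h1, h2⟩
      · refine Or.inr (Or.inr ?_)
        simp only [SlicesBounded, not_forall, not_le] at h2
        exact h2
    · refine Or.inr (Or.inl ?_)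
      simp only [SlicesBounded, not_forall, not_le] at h1
      exact h1
  have hBle := noise_exists_norm_slice_gt n hn
  refine (measure_mono hsub).trans ((measure_union_le _ _).trans ?_)
  rw [ENNReal.ofReal_add (by positivity) (by positivity)]
  refine add_le_add (prod_noise_norm_sub_ge_le hFc hFs hF ht p)
    ((measure_union_le _ _).trans ?_)
  rw [measurePreserving_fst.measure_preimage hBm.nullMeasurableSet,
    measurePreserving_snd.measure_preimage hBm.nullMeasurableSet, two_mul,
    ENNReal.ofReal_add (by positivity) (by positivity)]
  exact add_le_add hBle hBle

/-- Sums of quadratic functions of the slices concentrate at the order of the threshold. -/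
theorem exists_sliceSum_concentration : ∃ C : ℝ, 0 ≤ C ∧ ∀ (n : ℕ), 2 ≤ n →
    ∀ (ι : Type) [Fintype ι] [DecidableEq ι] [Nonempty ι], Fintype.card ι ≤ 2 * n ^ 2 →
    ∀ F : Matrix (Fin n) (Fin n) ℝ → Matrix ι ι ℝ, Continuous F → (∀ X, (F X).transpose = F X) →
      (∀ X, ‖F X‖ ≤ ‖X‖ ^ 2) →
      noise n {A | 23040 * threshold n < ‖sliceSum F A - sliceMean F‖} ≤ smallProb C n := by
  set c₄ := fourthMoment + 1 with hc₄
  have hc₄0 : 0 < c₄ := by have := fourthMoment_nonneg; positivity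
  refine ⟨(2 + 2 * Nat.factorial 14) * (2 + 4 * c₄), by positivity, ?_⟩
  intro n hn ι _ _ _ hcard F hFc hFs hF
  have hn0 : (0 : ℝ) < n := by positivity
  have hn2 : (2 : ℝ) ≤ n := by exact_mod_cast hn
  have hlog := half_le_log hn
  have hlog0 : 0 < Real.log n := by linarith
  set t := 23040 * threshold n with ht
  have htsq : t ^ 2 = 23040 ^ 2 * (n ^ 3 * Real.log n) := by rw [ht, mul_pow, threshold_sq]
  have ht0 : 0 < t := by
    have := lt_of_lt_of_le hn0 (natCast_le_threshold hn)
    positivity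
  -- The moment bound decays like e^{−p} ≤ n^{−15}. Two powers of n are spent on the dimension 2n²,
  -- leaving n^{−13}.
  set p := ⌈15 * Real.log n⌉₊ with hp
  have hp1 : 15 * Real.log n ≤ p := Nat.le_ceil _
  have hp2 : (p : ℝ) ≤ 17 * Real.log n := by
    have := Nat.ceil_lt_add_one (a := 15 * Real.log n) (by positivity)
    linarith
  have h1 := prod_noise_norm_sub_ge_le' hFc hFs hF hn (t := t / 2) (by positivity) p
  have h2 := noise_norm_sub_mean_gt_le (n := n) hFc hF (by omega) ht0
  -- the moment bound
  have hratio : 2 * p * (1152 ^ 2 * n ^ 3) / (t / 2) ^ 2 ≤ Real.exp (-1) := by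
    -- Since 23040 = 20 · 1152, the ratio is at most 4 · 34/400 = 0.34, just below 1/e.
    rw [div_pow, htsq, div_le_iff₀ (by positivity)]
    have he := Real.exp_neg_one_gt_d9
    have e1 : 2 * (p : ℝ) * (1152 ^ 2 * n ^ 3) ≤ 2 * (17 * Real.log n) * (1152 ^ 2 * n ^ 3) := by
      gcongr
    have e2 : (0 : ℝ) < n ^ 3 * Real.log n := by positivity
    nlinarith
  have hpow : (2 * p * (1152 ^ 2 * n ^ 3) / (t / 2) ^ 2) ^ p ≤ 1 / (n : ℝ) ^ 15 := by
    refine (pow_le_pow_left₀ (by positivity) hratio p).trans ?_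
    rw [← Real.exp_nat_mul, one_div, ← Real.rpow_natCast, ← Real.rpow_neg hn0.le,
      Real.rpow_def_of_pos hn0]
    refine Real.exp_le_exp.mpr ?_
    push_cast
    linarith
  have hδ : Fintype.card ι * (2 * p * (1152 ^ 2 * n ^ 3) / (t / 2) ^ 2) ^ p +
        2 * (Nat.factorial 14 / (n : ℝ) ^ 13) ≤ (2 + 2 * Nat.factorial 14) / (n : ℝ) ^ 13 := by
    have e1 : (Fintype.card ι : ℝ) ≤ 2 * n ^ 2 := by exact_mod_cast hcard
    have e2 : (Fintype.card ι : ℝ) * (2 * p * (1152 ^ 2 * n ^ 3) / (t / 2) ^ 2) ^ p ≤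
        2 * n ^ 2 * (1 / (n : ℝ) ^ 15) := mul_le_mul e1 hpow (by positivity) (by positivity)
    have e3 : 2 * (n : ℝ) ^ 2 * (1 / (n : ℝ) ^ 15) = 2 / (n : ℝ) ^ 13 := by
      field_simp
    rw [add_div, ← e3]
    have e4 : 2 * ((Nat.factorial 14 : ℝ) / (n : ℝ) ^ 13) = 2 * Nat.factorial 14 / (n : ℝ) ^ 13 := by
      ring
    linarith
  -- Desymmetrization loses a factor of order n³. This is why the symmetrized estimates aim at
  -- n^{−13} when n^{−10} is wanted.
  have hπ : 1 / ((2 + 4 * c₄) * (n : ℝ) ^ 3) ≤ t ^ 2 / (2 * t ^ 2 + 4 * (n ^ 6 * c₄)) := by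
    have htl : (n : ℝ) ^ 3 ≤ t ^ 2 := by
      rw [htsq]
      have : (0 : ℝ) < n ^ 3 := by positivity
      nlinarith
    rw [div_le_div_iff₀ (by positivity) (by positivity)]
    have e1 : (1 : ℝ) ≤ n ^ 3 := one_le_pow₀ (by linarith)
    have e2 : 2 * t ^ 2 ≤ 2 * (t ^ 2 * n ^ 3) := by nlinarith [sq_nonneg t]
    have e3 : 4 * ((n : ℝ) ^ 6 * c₄) ≤ 4 * c₄ * (t ^ 2 * n ^ 3) := by
      have : (n : ℝ) ^ 6 ≤ t ^ 2 * n ^ 3 := by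
        calc (n : ℝ) ^ 6 = n ^ 3 * n ^ 3 := by ring
          _ ≤ _ := by gcongr
      nlinarith
    nlinarith
  have h3 := (mul_le_mul_left (ENNReal.ofReal_le_ofReal hπ)
    (noise n {A | t < ‖sliceSum F A - sliceMean F‖})).trans
    (h2.trans (h1.trans (ENNReal.ofReal_le_ofReal hδ)))
  set q := noise n {A | t < ‖sliceSum F A - sliceMean F‖} with hq
  have h4 : q = ENNReal.ofReal ((2 + 4 * c₄) * (n : ℝ) ^ 3) *
      (ENNReal.ofReal (1 / ((2 + 4 * c₄) * (n : ℝ) ^ 3)) * q) := by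
    rw [← mul_assoc, ← ENNReal.ofReal_mul (by positivity), mul_one_div_cancel (by positivity)]
    simp
  rw [h4]
  refine (mul_le_mul_right h3 _).trans ?_
  rw [← ENNReal.ofReal_mul (by positivity), smallProb]
  refine ENNReal.ofReal_le_ofReal (le_of_eq ?_)
  field_simp

end Desymmetrization

/-! ### The good event for the noise has high probability -/

section GoodEvent

variable {n : ℕ}

/-- The symmetric dilation of a square matrix. -/
def dilation {ι : Type*} (M : Matrix ι ι ℝ) : Matrix (ι ⊕ ι) (ι ⊕ ι) ℝ :=
  Matrix.fromBlocks 0 M M.transpose 0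

lemma transpose_dilation {ι : Type*} (M : Matrix ι ι ℝ) :
    (dilation M).transpose = dilation M := by
  simp [dilation, Matrix.fromBlocks_transpose]

lemma dilation_sum {ι κ : Type*} (s : Finset κ) (M : κ → Matrix ι ι ℝ) :
    dilation (∑ i ∈ s, M i) = ∑ i ∈ s, dilation (M i) := by
  ext a b
  rw [Matrix.sum_apply]
  cases a <;> cases b <;> simp [dilation, Matrix.sum_apply]

variable {ι : Type*} [Fintype ι] [DecidableEq ι]

lemma norm_dilation_le (M : Matrix ι ι ℝ) : ‖dilation M‖ ≤ ‖M‖ := by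
  rw [← norm_op]
  refine ContinuousLinearMap.opNorm_le_bound _ (norm_nonneg _) fun x => ?_
  refine (pow_le_pow_iff_left₀ (norm_nonneg _) (by positivity) two_ne_zero).mp ?_
  have h1 := pow_le_pow_left₀ (norm_nonneg _)
    (norm_op_apply_le M (WithLp.toLp 2 fun i => x (Sum.inr i))) 2
  have h2 := pow_le_pow_left₀ (norm_nonneg _)
    (norm_op_apply_le M.transpose (WithLp.toLp 2 fun i => x (Sum.inl i))) 2
  rw [mul_pow, norm_sq_eq_sum, norm_sq_eq_sum] at h1 h2
  rw [norm_transpose_eq] at h2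
  rw [mul_pow, norm_sq_eq_sum, norm_sq_eq_sum, Fintype.sum_sum_type, Fintype.sum_sum_type]
  simp only [op_apply, dilation, Fintype.sum_sum_type, Matrix.fromBlocks_apply₁₁,
    Matrix.fromBlocks_apply₁₂, Matrix.fromBlocks_apply₂₁, Matrix.fromBlocks_apply₂₂,
    Matrix.zero_apply, zero_mul, Finset.sum_const_zero, zero_add, add_zero] at h1 h2 ⊢
  nlinarith

/-- It suffices to test the dilation on vectors (0, x). -/
lemma norm_le_norm_dilation (M : Matrix ι ι ℝ) : ‖M‖ ≤ ‖dilation M‖ := by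
  rw [← norm_op]
  refine ContinuousLinearMap.opNorm_le_bound _ (norm_nonneg _) fun x => ?_
  refine (pow_le_pow_iff_left₀ (norm_nonneg _) (by positivity) two_ne_zero).mp ?_
  have h1 := pow_le_pow_left₀ (norm_nonneg _)
    (norm_op_apply_le (dilation M) (WithLp.toLp 2 (Sum.elim (fun _ => 0) x))) 2
  rw [mul_pow, norm_sq_eq_sum, norm_sq_eq_sum, Fintype.sum_sum_type, Fintype.sum_sum_type] at h1
  rw [mul_pow, norm_sq_eq_sum, norm_sq_eq_sum]
  simp only [op_apply, dilation, Fintype.sum_sum_type, Matrix.fromBlocks_apply₁₁,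
    Matrix.fromBlocks_apply₁₂, Matrix.fromBlocks_apply₂₁, Matrix.fromBlocks_apply₂₂,
    Matrix.zero_apply, zero_mul, mul_zero, Finset.sum_const_zero, zero_add, add_zero, Sum.elim_inl,
    Sum.elim_inr, ne_eq, OfNat.ofNat_ne_zero, not_false_eq_true, zero_pow] at h1 ⊢
  exact h1

lemma continuous_dilation : Continuous (dilation : Matrix ι ι ℝ → _) := by
  unfold dilation
  exact Continuous.matrix_fromBlocks continuous_const continuous_id
    (Continuous.matrix_transpose continuous_id) continuous_const

lemma sliceMean_dilation_kronecker :
    sliceMean (fun X : Matrix (Fin n) (Fin n) ℝ => dilation (X ⊗ₖ X)) = dilation (noiseMean n) := by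
  have h : ∀ A : Tensor3 n, sliceSum (fun X => dilation (X ⊗ₖ X)) A = dilation (sliceSquare A) :=
    fun A => by rw [sliceSum, sliceSquare, dilation_sum]
  ext a b
  rw [sliceMean, Matrix.of_apply]
  simp only [h]
  cases a <;> cases b <;> simp [dilation, noiseMean]

lemma sliceMean_mul_transpose :
    sliceMean (fun X : Matrix (Fin n) (Fin n) ℝ => X * X.transpose) = (n : ℝ) ^ 2 • 1 := by
  ext a b
  have h : ∀ A : Tensor3 n, sliceSum (fun X => X * X.transpose) A a b =
      ∑ i, ∑ k, A (i, a, k) * A (i, b, k) := fun A => by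
    simp [sliceSum, Matrix.sum_apply, Matrix.mul_apply, slice]
  rw [sliceMean, Matrix.of_apply]
  simp only [h]
  rw [integral_finsetSum _ fun i _ => integrable_finsetSum _ fun k _ => integrable_noise_mul _ _]
  simp_rw [integral_finsetSum _ fun k _ => integrable_noise_mul _ _, integral_noise_mul]
  by_cases hab : a = b
  · simp [hab, sq]
  · simp [hab]

/-- The good event for the noise holds with high probability. -/
theorem exists_noiseBound : ∃ K C : ℝ, 0 ≤ K ∧ 0 ≤ C ∧ ∀ n : ℕ, 2 ≤ n →
    noise n {A | ¬ NoiseBound K A} ≤ smallProb C n := by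
  obtain ⟨C, hC, h⟩ := exists_sliceSum_concentration
  refine ⟨23040, 2 * C, by norm_num, by positivity, fun n hn => ?_⟩
  have := nonempty_fin hn
  -- X ⊗ X is not symmetric, so the concentration theorem is applied to its dilation. This is where
  -- dimension 2n² is needed.
  have h1 := h n hn ((Fin n × Fin n) ⊕ (Fin n × Fin n)) (by simp; nlinarith)
    (fun X => dilation (X ⊗ₖ X))
    (continuous_dilation.comp (by
      refine continuous_matrix fun i j => ?_
      simp only [Matrix.kroneckerMap_apply]
      exact (continuous_id.matrix_elem _ _).mul (continuous_id.matrix_elem _ _)))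
    (fun X => transpose_dilation _)
    (fun X => (norm_dilation_le _).trans ((norm_kronecker_le X X).trans_eq (sq _).symm))
  have h2 := h n hn (Fin n) (by simp; nlinarith) (fun X => X * X.transpose)
    (continuous_id.matrix_mul (Continuous.matrix_transpose continuous_id))
    (fun X => by simp [Matrix.transpose_mul])
    (fun X => by
      refine (norm_mul_le _ _).trans ?_
      rw [norm_transpose_eq, sq])
  have hsub : {A : Tensor3 n | ¬ NoiseBound 23040 A} ⊆
      {A | 23040 * threshold n < ‖sliceSum (fun X : Matrix (Fin n) (Fin n) ℝ => dilation (X ⊗ₖ X)) A -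
          sliceMean (fun X : Matrix (Fin n) (Fin n) ℝ => dilation (X ⊗ₖ X))‖} ∪
      {A | 23040 * threshold n < ‖sliceSum (fun X : Matrix (Fin n) (Fin n) ℝ => X * X.transpose) A -
          sliceMean (fun X : Matrix (Fin n) (Fin n) ℝ => X * X.transpose)‖} := by
    intro A hA
    rcases not_and_or.mp hA with hA | hA
    · left
      rw [not_le] at hA
      refine lt_of_lt_of_le hA ((norm_le_norm_dilation _).trans (le_of_eq ?_))
      rw [sliceMean_dilation_kronecker, sliceSum, ← dilation_sum]
      congr 1
      ext a b
      cases a <;> cases b <;> simp [dilation, centered, sliceSquare]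
    · right
      rw [not_le] at hA
      rw [Set.mem_ofPred_eq, sliceMean_mul_transpose]
      exact hA
  refine (measure_mono hsub).trans ((measure_union_le _ _).trans ((add_le_add h1 h2).trans ?_))
  rw [smallProb, smallProb, ← ENNReal.ofReal_add (by positivity) (by positivity)]
  exact ENNReal.ofReal_le_ofReal (le_of_eq (by ring))

end GoodEvent

/-! ### Running programs with a time bound and a postcondition -/

section Runs

variable {ω : ℕ → ℝ}

/-- Started in `s`, the program `p` halts within `t` steps in a state that satisfies `P`. -/
def Runs (ω : ℕ → ℝ) (p : Program) (s : State) (t : ℕ) (P : State → Prop) : Prop :=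
  ∃ t' s', t' ≤ t ∧ Exec ω p s t' s' ∧ P s'

lemma Runs.mono {p : Program} {s : State} {t u : ℕ} {P Q : State → Prop} (h : Runs ω p s t P)
    (htu : t ≤ u) (hPQ : ∀ s', P s' → Q s') : Runs ω p s u Q := by
  obtain ⟨t', s', h1, h2, h3⟩ := h
  exact ⟨t', s', h1.trans htu, h2, hPQ _ h3⟩

lemma Runs.seq {p q : Program} {s : State} {t u : ℕ} {P Q : State → Prop}
    (hp : Runs ω p s t P) (hq : ∀ s', P s' → Runs ω q s' u Q) :
    Runs ω (.seq p q) s (t + u) Q := by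
  obtain ⟨t', s', h1, h2, h3⟩ := hp
  obtain ⟨u', s'', h4, h5, h6⟩ := hq s' h3
  exact ⟨t' + u', s'', by omega, .seq h2 h5, h6⟩

lemma Runs.instr {c : Instr} {s : State} {P : State → Prop} (h : P (c.run ω s)) :
    Runs ω (.instr c) s 1 P := ⟨1, _, le_rfl, .instr c s, h⟩

lemma Runs.skip {s : State} {P : State → Prop} (h : P s) : Runs ω .skip s 1 P :=
  ⟨1, _, le_rfl, .skip s, h⟩

lemma Runs.ifIdxLt {a b : ℕ} {p q : Program} {s : State} {t : ℕ} {P : State → Prop}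
    (hp : s.idx a < s.idx b → Runs ω p s t P) (hq : ¬ s.idx a < s.idx b → Runs ω q s t P) :
    Runs ω (.ifIdxLt a b p q) s (t + 1) P := by
  by_cases h : s.idx a < s.idx b
  · obtain ⟨t', s', h1, h2, h3⟩ := hp h
    exact ⟨t' + 1, s', by omega, .ifIdxTrue h h2, h3⟩
  · obtain ⟨t', s', h1, h2, h3⟩ := hq h
    exact ⟨t' + 1, s', by omega, .ifIdxFalse h h2, h3⟩

lemma Runs.ifValLe {a b : ℕ} {p q : Program} {s : State} {t : ℕ} {P : State → Prop}
    (hp : s.val a ≤ s.val b → Runs ω p s t P) (hq : ¬ s.val a ≤ s.val b → Runs ω q s t P) :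
    Runs ω (.ifValLe a b p q) s (t + 1) P := by
  by_cases h : s.val a ≤ s.val b
  · obtain ⟨t', s', h1, h2, h3⟩ := hp h
    exact ⟨t' + 1, s', by omega, .ifValTrue h h2, h3⟩
  · obtain ⟨t', s', h1, h2, h3⟩ := hq h
    exact ⟨t' + 1, s', by omega, .ifValFalse h h2, h3⟩

/-- The invariant is indexed by the number of completed iterations and determines the outcome of the
test, so the number of rounds is exactly N. The induction runs over the rounds that remain. -/
lemma Runs.whileIdxLt {a b : ℕ} {p : Program} {N : ℕ} {t : ℕ → ℕ} {Inv : ℕ → State → Prop}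
    (hstep : ∀ k < N, ∀ s, Inv k s → s.idx a < s.idx b ∧ Runs ω p s (t k) (Inv (k + 1)))
    (hexit : ∀ s, Inv N s → ¬ s.idx a < s.idx b) {s : State} (h0 : Inv 0 s) :
    Runs ω (.whileIdxLt a b p) s (∑ k ∈ Finset.range N, (t k + 1) + 1) (Inv N) := by
  have key : ∀ m k, k + m = N → ∀ s, Inv k s →
      Runs ω (.whileIdxLt a b p) s (∑ j ∈ Finset.range m, (t (k + j) + 1) + 1) (Inv N) := by
    intro m
    induction m with
    | zero =>
      intro k hk s hs
      obtain rfl : k = N := by omega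
      exact ⟨1, s, by simp, .whileStop (hexit s hs), hs⟩
    | succ m ih =>
      intro k hk s hs
      obtain ⟨hlt, t', s', h1, h2, h3⟩ := hstep k (by omega) s hs
      obtain ⟨u', s'', h4, h5, h6⟩ := ih (k + 1) (by omega) s' h3
      refine ⟨t' + u' + 1, s'', ?_, .whileStep hlt h2 h5, h6⟩
      rw [Finset.sum_range_succ', Finset.sum_congr rfl fun j _ =>
        congrArg (fun x => t x + 1) (show k + (j + 1) = k + 1 + j by omega)]
      simp only [add_zero]
      omega
  simpa using key N 0 (by omega) s h0

/-- Executions are unique. -/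
lemma Exec.unique {p : Program} {s : State} {t : ℕ} {s₁ : State} (h : Exec ω p s t s₁) :
    ∀ {u : ℕ} {s₂ : State}, Exec ω p s u s₂ → s₁ = s₂ := by
  induction h with
  | skip s => intro u s₂ h; cases h; rfl
  | instr c s => intro u s₂ h; cases h; rfl
  | seq _ _ ih1 ih2 =>
    intro u s₂ h
    cases h with
    | seq h1 h2 =>
      obtain rfl := ih1 h1
      exact ih2 h2
  | ifIdxTrue hc _ ih =>
    intro u s₂ h
    cases h with
    | ifIdxTrue _ h => exact ih h
    | ifIdxFalse hn _ => exact absurd hc hn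
  | ifIdxFalse hc _ ih =>
    intro u s₂ h
    cases h with
    | ifIdxTrue hn _ => exact absurd hn hc
    | ifIdxFalse _ h => exact ih h
  | ifValTrue hc _ ih =>
    intro u s₂ h
    cases h with
    | ifValTrue _ h => exact ih h
    | ifValFalse hn _ => exact absurd hc hn
  | ifValFalse hc _ ih =>
    intro u s₂ h
    cases h with
    | ifValTrue hn _ => exact absurd hn hc
    | ifValFalse _ h => exact ih h
  | whileStop hc =>
    intro u s₂ h
    cases h with
    | whileStop _ => rfl
    | whileStep hn _ _ => exact absurd hn hc
  | whileStep hc _ _ ih1 ih2 =>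
    intro u s₂ h
    cases h with
    | whileStop hn => exact absurd hc hn
    | whileStep _ h1 h2 =>
      obtain rfl := ih1 h1
      exact ih2 h2

end Runs

/-! ### Structured states: variables and arrays -/

/-- The view of a machine state that structured programs work with: index variables, real
variables, arrays with three indices, the cells below an offset, and the position on the tape. -/
@[ext] structure View where
  iv : ℕ → ℕ
  vv : ℕ → ℝ
  arr : ℕ → ℕ → ℕ → ℕ → ℝ
  raw : ℕ → ℝ
  used : ℕ

/-- Write to an index variable. -/
def View.setI (σ : View) (x k : ℕ) : View := { σ with iv := Function.update σ.iv x k }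

/-- Write to a real variable. -/
def View.setV (σ : View) (x : ℕ) (r : ℝ) : View := { σ with vv := Function.update σ.vv x r }

/-- Replace an array. -/
def View.setArr (σ : View) (i : ℕ) (F : ℕ → ℕ → ℕ → ℝ) : View :=
  { σ with arr := Function.update σ.arr i F }

/-- An injective polynomial pairing function. -/
def pairing (x y : ℕ) : ℕ := (x + y) * (x + y) + x

/-- As x ≤ x + y is smaller than the gap 2(x + y) + 1 to the next square, the value determines x +
y. A polynomial pairing keeps address arithmetic within the index operations of the machine, at
constant cost. -/
lemma pairing_injective {x y x' y' : ℕ} (h : pairing x y = pairing x' y') : x = x' ∧ y = y' := by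
  unfold pairing at h
  have h1 : x + y = x' + y' := by
    rcases lt_trichotomy (x + y) (x' + y') with h2 | h2 | h2
    · nlinarith [Nat.mul_le_mul h2 h2]
    · exact h2
    · nlinarith [Nat.mul_le_mul h2 h2]
  rw [h1] at h
  omega

/-- The address of an array entry, relative to the offset. -/
def cell (i a b c : ℕ) : ℕ := pairing i (pairing a (pairing b c))

lemma cell_injective {i a b c i' a' b' c' : ℕ} (h : cell i a b c = cell i' a' b' c') :
    i = i' ∧ a = a' ∧ b = b' ∧ c = c' := by
  obtain ⟨h1, h⟩ := pairing_injective h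
  obtain ⟨h2, h⟩ := pairing_injective h
  exact ⟨h1, h2, pairing_injective h⟩

/-- The view of a machine state. Variables live in the even registers. -/
def view (off : ℕ) (s : State) : View where
  iv x := s.idx (2 * x)
  vv x := s.val (2 * x)
  arr i a b c := s.valMem (off + cell i a b c)
  raw j := if j < off then s.valMem j else 0
  used := s.used

section View

variable (off : ℕ) (s : State)

/-- Odd registers are scratch space for evaluating expressions and are invisible in the view. -/
lemma view_setIdx_odd (k v : ℕ) : view off (s.setIdx (2 * k + 1) v) = view off s := by
  ext x
  · simp only [view, State.setIdx]
    rw [Function.update_of_ne (by omega)]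
  all_goals rfl

lemma view_setVal_odd (k : ℕ) (v : ℝ) : view off (s.setVal (2 * k + 1) v) = view off s := by
  ext x
  · rfl
  · simp only [view, State.setVal]
    rw [Function.update_of_ne (by omega)]
  all_goals rfl

lemma view_setIdx_even (x v : ℕ) : view off (s.setIdx (2 * x) v) = (view off s).setI x v := by
  ext y
  · simp only [view, State.setIdx, View.setI, Function.update_apply]
    simp
  all_goals rfl

lemma view_setVal_even (x : ℕ) (v : ℝ) : view off (s.setVal (2 * x) v) = (view off s).setV x v := by
  ext y
  · rfl
  · simp only [view, State.setVal, View.setV, Function.update_apply]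
    simp
  all_goals rfl

end View

lemma View.setI_setI (σ : View) (x k l : ℕ) : (σ.setI x k).setI x l = σ.setI x l := by
  simp [View.setI]

lemma View.setI_self (σ : View) (x : ℕ) : σ.setI x (σ.iv x) = σ := by
  simp [View.setI]

section Projections

variable (σ : View) (x k : ℕ) (r : ℝ) (F : ℕ → ℕ → ℕ → ℝ)

@[simp] lemma View.setI_iv (y : ℕ) : (σ.setI x k).iv y = if y = x then k else σ.iv y := by
  simp [View.setI, Function.update_apply]
@[simp] lemma View.setI_vv : (σ.setI x k).vv = σ.vv := rfl
@[simp] lemma View.setI_arr : (σ.setI x k).arr = σ.arr := rfl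
@[simp] lemma View.setI_raw : (σ.setI x k).raw = σ.raw := rfl
@[simp] lemma View.setI_used : (σ.setI x k).used = σ.used := rfl
@[simp] lemma View.setV_vv (y : ℕ) : (σ.setV x r).vv y = if y = x then r else σ.vv y := by
  simp [View.setV, Function.update_apply]
@[simp] lemma View.setV_iv : (σ.setV x r).iv = σ.iv := rfl
@[simp] lemma View.setV_arr : (σ.setV x r).arr = σ.arr := rfl
@[simp] lemma View.setV_raw : (σ.setV x r).raw = σ.raw := rfl
@[simp] lemma View.setV_used : (σ.setV x r).used = σ.used := rfl
@[simp] lemma View.setArr_arr (y : ℕ) :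
    (σ.setArr x F).arr y = if y = x then F else σ.arr y := by
  simp [View.setArr, Function.update_apply]
@[simp] lemma View.setArr_iv : (σ.setArr x F).iv = σ.iv := rfl
@[simp] lemma View.setArr_vv : (σ.setArr x F).vv = σ.vv := rfl
@[simp] lemma View.setArr_raw : (σ.setArr x F).raw = σ.raw := rfl
@[simp] lemma View.setArr_used : (σ.setArr x F).used = σ.used := rfl

end Projections

/-! ### Expressions -/

/-- Binary operations on indices. -/
inductive IOp
  | add
  | sub
  | mul

/-- The value of an index operation. -/
def IOp.eval : IOp → ℕ → ℕ → ℕ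
  | add => (· + ·)
  | sub => (· - ·)
  | mul => (· * ·)

/-- The instruction for an index operation. -/
def IOp.instr : IOp → ℕ → ℕ → ℕ → Instr
  | add => .idxAdd
  | sub => .idxSub
  | mul => .idxMul

/-- Index expressions. -/
inductive IExp
  | const (c : ℕ)
  | var (x : ℕ)
  | off
  | op (o : IOp) (a b : IExp)

instance : Add IExp := ⟨.op .add⟩
instance : Sub IExp := ⟨.op .sub⟩
instance : Mul IExp := ⟨.op .mul⟩
instance (c : ℕ) : OfNat IExp c := ⟨.const c⟩

/-- The value of an index expression. -/
def IExp.eval (off : ℕ) (σ : View) : IExp → ℕ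
  | const c => c
  | var x => σ.iv x
  | .off => off
  | op o a b => o.eval (a.eval off σ) (b.eval off σ)

/-- The time to evaluate an index expression. -/
def IExp.cost : IExp → ℕ
  | const _ => 1
  | var _ => 2
  | off => 2
  | op _ a b => a.cost + (b.cost + 1)

section

variable (o : ℕ) (σ : View) (a b : IExp)

@[simp] lemma IExp.eval_add : (a + b).eval o σ = a.eval o σ + b.eval o σ := rfl
@[simp] lemma IExp.eval_sub : (a - b).eval o σ = a.eval o σ - b.eval o σ := rfl
@[simp] lemma IExp.eval_mul : (a * b).eval o σ = a.eval o σ * b.eval o σ := rfl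
@[simp] lemma IExp.eval_var (x : ℕ) : (IExp.var x).eval o σ = σ.iv x := rfl
@[simp] lemma IExp.eval_ofNat (c : ℕ) : (OfNat.ofNat c : IExp).eval o σ = c := rfl
@[simp] lemma IExp.cost_add : (a + b).cost = a.cost + (b.cost + 1) := rfl
@[simp] lemma IExp.cost_sub : (a - b).cost = a.cost + (b.cost + 1) := rfl
@[simp] lemma IExp.cost_mul : (a * b).cost = a.cost + (b.cost + 1) := rfl
@[simp] lemma IExp.cost_var (x : ℕ) : (IExp.var x).cost = 2 := rfl
@[simp] lemma IExp.cost_ofNat (c : ℕ) : (OfNat.ofNat c : IExp).cost = 1 := rfl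

end

attribute [simp] IExp.eval IExp.cost IOp.eval

/-- Copy an index register. -/
def moveIdx (d a : ℕ) : Program := .seq (.instr (.idxConst d 0)) (.instr (.idxAdd d d a))

/-- Code that leaves the value of an index expression in the register `2 D + 3`; odd registers
below it are preserved. -/
def IExp.code : IExp → ℕ → Program
  | const c, D => .instr (.idxConst (2 * D + 3) c)
  | var x, D => moveIdx (2 * D + 3) (2 * x)
  | off, D => moveIdx (2 * D + 3) 1
  | op o a b, D => .seq (a.code D) (.seq (b.code (D + 1))
      (.instr (o.instr (2 * D + 3) (2 * D + 3) (2 * D + 5))))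

/-- The index expression for the address of an array entry. -/
def IExp.addr (i a b c : IExp) : IExp :=
  let f (x y : IExp) : IExp := (x + y) * (x + y) + x
  .off + f i (f a (f b c))

lemma IExp.eval_addr (off : ℕ) (σ : View) (i a b c : IExp) :
    (IExp.addr i a b c).eval off σ =
      off + cell (i.eval off σ) (a.eval off σ) (b.eval off σ) (c.eval off σ) := rfl

/-- The odd registers with number at most `2 D + 1` agree. -/
def SameLow (D : ℕ) (s s' : State) : Prop :=
  ∀ k ≤ D, s'.idx (2 * k + 1) = s.idx (2 * k + 1) ∧ s'.val (2 * k + 1) = s.val (2 * k + 1)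

lemma SameLow.refl (D : ℕ) (s : State) : SameLow D s s := fun _ _ => ⟨rfl, rfl⟩

lemma SameLow.trans {D E : ℕ} {s s' s'' : State} (h : SameLow D s s') (h' : SameLow E s' s'')
    (hDE : D ≤ E := by omega) : SameLow D s s'' := fun k hk =>
  ⟨(h' k (hk.trans hDE)).1.trans (h k hk).1, (h' k (hk.trans hDE)).2.trans (h k hk).2⟩

lemma SameLow.mono {D E : ℕ} {s s' : State} (h : SameLow E s s') (hDE : D ≤ E := by omega) :
    SameLow D s s' := fun k hk => h k (hk.trans hDE)

/-- Index register 1 holds the offset of the array region. As the case k = 0 it is protected at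
every depth. -/
lemma SameLow.idx_one {D : ℕ} {s s' : State} (h : SameLow D s s') : s'.idx 1 = s.idx 1 :=
  (h 0 (Nat.zero_le _)).1

lemma sameLow_setIdx {D : ℕ} (s : State) {r : ℕ} (v : ℕ)
    (h : 2 * D + 1 < r ∨ r % 2 = 0 := by omega) : SameLow D s (s.setIdx r v) := fun k hk =>
  ⟨by simp only [State.setIdx]; rw [Function.update_of_ne (by omega)], rfl⟩

lemma sameLow_setVal {D : ℕ} (s : State) {r : ℕ} (v : ℝ)
    (h : 2 * D + 1 < r ∨ r % 2 = 0 := by omega) : SameLow D s (s.setVal r v) := fun k hk =>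
  ⟨rfl, by simp only [State.setVal]; rw [Function.update_of_ne (by omega)]⟩

lemma State.setIdx_idx (s : State) (d v : ℕ) : (s.setIdx d v).idx d = v := by
  simp [State.setIdx]

lemma State.setVal_val (s : State) (d : ℕ) (v : ℝ) : (s.setVal d v).val d = v := by
  simp [State.setVal]

section Code

variable {ω : ℕ → ℝ} {off : ℕ}

lemma runs_moveIdx {d a : ℕ} {s : State} (h : a ≠ d) {P : State → Prop}
    (hP : P (s.setIdx d (s.idx a))) : Runs ω (moveIdx d a) s 2 P := by
  refine Runs.seq (P := fun s' => s' = s.setIdx d 0) (Runs.instr rfl) fun s' hs' => Runs.instr ?_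
  subst hs'
  convert hP using 1
  simp [Instr.run, State.setIdx, Function.update_of_ne h]

/-- The postcondition of code for an index expression. -/
def IdxPost (off D : ℕ) (s : State) (v : ℕ) (s' : State) : Prop :=
  view off s' = view off s ∧ SameLow D s s' ∧ s'.idx (2 * D + 3) = v ∧ s'.val = s.val

lemma idxPost_setIdx (s : State) (D v : ℕ) : IdxPost off D s v (s.setIdx (2 * D + 3) v) :=
  ⟨view_setIdx_odd off s (D + 1) v, sameLow_setIdx s v, s.setIdx_idx _ v, rfl⟩

lemma IExp.runs_code (e : IExp) : ∀ (D : ℕ) (s : State), s.idx 1 = off →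
    Runs ω (e.code D) s e.cost (IdxPost off D s (e.eval off (view off s))) := by
  induction e with
  | const c => exact fun D s _ => Runs.instr (idxPost_setIdx s D c)
  | var x => exact fun D s _ => runs_moveIdx (by omega) (idxPost_setIdx s D _)
  | off =>
    intro D s hs
    refine runs_moveIdx (by omega) ?_
    rw [hs]
    exact idxPost_setIdx s D _
  | op o a b iha ihb =>
    intro D s hs
    refine Runs.seq (iha D s hs) fun s1 ⟨v1, f1, e1, g1⟩ =>
      Runs.seq (ihb (D + 1) s1 (f1.idx_one.trans hs)) fun s2 ⟨v2, f2, e2, g2⟩ => Runs.instr ?_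
    have h3 : s2.idx (2 * D + 3) = a.eval off (view off s) := (f2 (D + 1) le_rfl).1.trans e1
    have h5 : s2.idx (2 * D + 5) = b.eval off (view off s) := e2.trans (by rw [v1])
    have h : (o.instr (2 * D + 3) (2 * D + 3) (2 * D + 5)).run ω s2 =
        s2.setIdx (2 * D + 3) (o.eval (s2.idx (2 * D + 3)) (s2.idx (2 * D + 5))) := by
      cases o <;> rfl
    rw [h, h3, h5]
    refine ⟨?_, (f1.trans f2).trans (sameLow_setIdx _ _) le_rfl, State.setIdx_idx _ _ _,
      g2.trans g1⟩
    exact (view_setIdx_odd off s2 (D + 1) _).trans (v2.trans v1)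

/-! ### Loops -/

/-- The loop `for x < b do body`; the loop variable is restored at the end. -/
def loopCode (x : ℕ) (b : IExp) (body : ℕ → Program) (D : ℕ) : Program :=
  .seq (b.code D) (.seq (moveIdx (2 * D + 5) (2 * x)) (.seq (.instr (.idxConst (2 * x) 0)) (.seq
    (.whileIdxLt (2 * x) (2 * D + 3) (.seq (body (D + 2)) (.seq
      (.instr (.idxConst (2 * D + 7) 1)) (.instr (.idxAdd (2 * x) (2 * x) (2 * D + 7))))))
    (moveIdx (2 * x) (2 * D + 5)))))

/-- The loop rule. The invariant may depend on the real register `2 D + 3`. -/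
lemma runs_loopCode {x : ℕ} {b : IExp} {body : ℕ → Program} {D : ℕ} {s : State} {t : ℕ → ℕ}
    (hs : s.idx 1 = off) (J : ℕ → View → ℝ → Prop) (h0 : J 0 (view off s) (s.val (2 * D + 3)))
    (hbody : ∀ k < b.eval off (view off s), ∀ s', s'.idx 1 = off → (view off s').iv x = k →
      J k ((view off s').setI x ((view off s).iv x)) (s'.val (2 * D + 3)) →
      Runs ω (body (D + 2)) s' (t k) fun s'' => (view off s'').iv x = k ∧
        J (k + 1) ((view off s'').setI x ((view off s).iv x)) (s''.val (2 * D + 3)) ∧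
        SameLow D s' s'' ∧ s''.idx (2 * D + 3) = s'.idx (2 * D + 3) ∧
        s''.idx (2 * D + 5) = s'.idx (2 * D + 5)) :
    Runs ω (loopCode x b body D) s
      (b.cost + 6 + ∑ k ∈ Finset.range (b.eval off (view off s)), (t k + 3))
      fun s' => J (b.eval off (view off s)) (view off s') (s'.val (2 * D + 3)) ∧
        SameLow D s s' := by
  set N := b.eval off (view off s)
  set v := (view off s).iv x
  -- Index register 2D + 3 holds the bound and 2D + 5 the saved value of the loop variable. The body
  -- runs at depth D + 2, which protects both. J sees the view with the loop variable restored.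
  let Inv (k : ℕ) (s' : State) : Prop := (view off s').iv x = k ∧
    J k ((view off s').setI x v) (s'.val (2 * D + 3)) ∧ SameLow D s s' ∧
    s'.idx (2 * D + 3) = N ∧ s'.idx (2 * D + 5) = v
  suffices H : Runs ω (loopCode x b body D) s
      (b.cost + (2 + (1 + ((∑ k ∈ Finset.range N, (t k + (1 + 1) + 1) + 1) + 2)))) fun s' =>
        J N (view off s') (s'.val (2 * D + 3)) ∧ SameLow D s s' from
    H.mono (by simp only [add_assoc, Nat.reduceAdd]; omega) fun _ h => h
  refine Runs.seq (b.runs_code D s hs) fun s1 ⟨v1, f1, e1, g1⟩ => Runs.seq (runs_moveIdx (P := fun s' =>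
    s' = s1.setIdx (2 * D + 5) (s1.idx (2 * x))) (by omega) rfl) fun s2 h2 =>
    Runs.seq (P := Inv 0) (Runs.instr ?_) fun s3 h3 => Runs.seq (P := Inv N)
    (Runs.whileIdxLt (Inv := Inv) (t := fun k => t k + (1 + 1)) ?_ ?_ h3) fun s4 h4 =>
    runs_moveIdx (by omega) ?_
  · subst h2
    have h1 : s1.idx (2 * x) = v := congrFun (congrArg View.iv v1) x
    have h2 : view off ((s1.setIdx (2 * D + 5) (s1.idx (2 * x))).setIdx (2 * x) 0) =
        (view off s).setI x 0 := by
      rw [view_setIdx_even, show view off (s1.setIdx (2 * D + 5) (s1.idx (2 * x))) = view off s1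
        from view_setIdx_odd off s1 (D + 2) _, v1]
    refine ⟨?_, ?_, (f1.trans (sameLow_setIdx (D := D) _ _)).trans
      (sameLow_setIdx (D := D) _ _), ?_, ?_⟩
    · exact (congrFun (congrArg View.iv h2) x).trans (by simp [View.setI])
    · show J 0 ((view off ((s1.setIdx (2 * D + 5) (s1.idx (2 * x))).setIdx (2 * x) 0)).setI x v)
        (s1.val (2 * D + 3))
      rw [h2, View.setI_setI, View.setI_self, g1]
      exact h0
    · simp only [Instr.run, State.setIdx]
      rw [Function.update_of_ne (by omega), Function.update_of_ne (by omega)]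
      exact e1
    · simp only [Instr.run, State.setIdx]
      rw [Function.update_of_ne (by omega), Function.update_self]
      exact h1
  · rintro k hk s' ⟨i1, i2, i3, i4, i5⟩
    refine ⟨?_, Runs.seq (hbody k hk s' (i3.idx_one.trans hs) i1 i2) fun s5 ⟨j1, j2, j3, j4, j5⟩ =>
      Runs.seq (P := fun s' => s' = s5.setIdx (2 * D + 7) 1) (Runs.instr rfl) fun s6 h6 =>
      Runs.instr ?_⟩
    · rw [i4, show s'.idx (2 * x) = k from i1]
      exact hk
    · subst h6
      have h7 : (s5.setIdx (2 * D + 7) 1).idx (2 * x) +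
          (s5.setIdx (2 * D + 7) 1).idx (2 * D + 7) = k + 1 := by
        simp only [State.setIdx]
        rw [Function.update_self, Function.update_of_ne (by omega)]
        exact congrArg (· + 1) j1
      simp only [Instr.run, h7]
      have h2 : view off ((s5.setIdx (2 * D + 7) 1).setIdx (2 * x) (k + 1)) =
          (view off s5).setI x (k + 1) := by
        rw [view_setIdx_even, show view off (s5.setIdx (2 * D + 7) 1) = view off s5 from
          view_setIdx_odd off s5 (D + 3) 1]
      refine ⟨?_, ?_, ((i3.trans j3).trans (sameLow_setIdx (D := D) _ _)).trans
        (sameLow_setIdx (D := D) _ _), ?_, ?_⟩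
      · exact (congrFun (congrArg View.iv h2) x).trans (by simp [View.setI])
      · rw [h2, View.setI_setI]
        exact j2
      · simp only [State.setIdx]
        rw [Function.update_of_ne (by omega), Function.update_of_ne (by omega)]
        exact j4.trans i4
      · simp only [State.setIdx]
        rw [Function.update_of_ne (by omega), Function.update_of_ne (by omega)]
        exact j5.trans i5
  · rintro s' ⟨i1, i2, i3, i4, i5⟩
    rw [i4, show s'.idx (2 * x) = N from i1]
    exact lt_irrefl _
  · obtain ⟨i1, i2, i3, i4, i5⟩ := h4
    rw [i5]
    refine ⟨?_, i3.trans (sameLow_setIdx _ _) le_rfl⟩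
    rw [view_setIdx_even]
    exact i2

/-! ### Real expressions -/

/-- Binary operations on reals. -/
inductive VOp
  | add
  | sub
  | mul
  | div

/-- The value of a real operation. -/
noncomputable def VOp.eval : VOp → ℝ → ℝ → ℝ
  | add => (· + ·)
  | sub => (· - ·)
  | mul => (· * ·)
  | div => (· / ·)

/-- The instruction for a real operation. -/
def VOp.instr : VOp → ℕ → ℕ → ℕ → Instr
  | add => .valAdd
  | sub => .valSub
  | mul => .valMul
  | div => .valDiv

/-- Real expressions; `ite a b v w` is `v` if `a < b` and `w` otherwise, and `sum x b v` is the sum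
of `v` over `x < b`. -/
inductive VExp
  | ofI (e : IExp)
  | var (x : ℕ)
  | arr (i a b c : IExp)
  | raw (e : IExp)
  | op (o : VOp) (v w : VExp)
  | sqrt (v : VExp)
  | ite (a b : IExp) (v w : VExp)
  | sum (x : ℕ) (b : IExp) (v : VExp)

instance : Add VExp := ⟨.op .add⟩
instance : Sub VExp := ⟨.op .sub⟩
instance : Mul VExp := ⟨.op .mul⟩
instance : Div VExp := ⟨.op .div⟩
instance (c : ℕ) : OfNat VExp c := ⟨.ofI (.const c)⟩

/-- The value of a real expression. -/
noncomputable def VExp.eval (off : ℕ) : VExp → View → ℝ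
  | ofI e, σ => (e.eval off σ : ℝ)
  | var x, σ => σ.vv x
  | arr i a b c, σ => σ.arr (i.eval off σ) (a.eval off σ) (b.eval off σ) (c.eval off σ)
  | raw e, σ => σ.raw (e.eval off σ)
  | op o v w, σ => o.eval (v.eval off σ) (w.eval off σ)
  | sqrt v, σ => Real.sqrt (v.eval off σ)
  | ite a b v w, σ => if a.eval off σ < b.eval off σ then v.eval off σ else w.eval off σ
  | sum x b v, σ => ∑ k ∈ Finset.range (b.eval off σ), v.eval off (σ.setI x k)

/-- A bound for the time to evaluate a real expression. -/
def VExp.cost (off : ℕ) : VExp → View → ℕ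
  | ofI e, _ => e.cost + 1
  | var _, _ => 3
  | arr i a b c, _ => (IExp.addr i a b c).cost + 1
  | raw e, _ => e.cost + 2
  | op _ v w, σ => v.cost off σ + (w.cost off σ + 1)
  | sqrt v, σ => v.cost off σ + 1
  | ite a b v w, σ => a.cost + (b.cost + (v.cost off σ + w.cost off σ + 1))
  | sum x b v, σ =>
    1 + (b.cost + 6 + ∑ k ∈ Finset.range (b.eval off σ), (v.cost off (σ.setI x k) + 1 + 3))

section

variable (o : ℕ) (σ : View) (a b : VExp)

@[simp] lemma VExp.eval_add : (a + b).eval o σ = a.eval o σ + b.eval o σ := rfl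
@[simp] lemma VExp.eval_sub : (a - b).eval o σ = a.eval o σ - b.eval o σ := rfl
@[simp] lemma VExp.eval_mul : (a * b).eval o σ = a.eval o σ * b.eval o σ := rfl
@[simp] lemma VExp.eval_div : (a / b).eval o σ = a.eval o σ / b.eval o σ := rfl
@[simp] lemma VExp.eval_ofNat (c : ℕ) : (OfNat.ofNat c : VExp).eval o σ = (c : ℝ) := rfl
@[simp] lemma VExp.cost_add : (a + b).cost o σ = a.cost o σ + (b.cost o σ + 1) := rfl
@[simp] lemma VExp.cost_sub : (a - b).cost o σ = a.cost o σ + (b.cost o σ + 1) := rfl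
@[simp] lemma VExp.cost_mul : (a * b).cost o σ = a.cost o σ + (b.cost o σ + 1) := rfl
@[simp] lemma VExp.cost_div : (a / b).cost o σ = a.cost o σ + (b.cost o σ + 1) := rfl
@[simp] lemma VExp.cost_ofNat (c : ℕ) : (OfNat.ofNat c : VExp).cost o σ = 2 := rfl

end

attribute [simp] VExp.eval VExp.cost VOp.eval

/-- Code that leaves the value of a real expression in the register `2 D + 3`. -/
def VExp.code : VExp → ℕ → Program
  | ofI e, D => .seq (e.code D) (.instr (.valOfIdx (2 * D + 3) (2 * D + 3)))
  | var x, D => .seq (.instr (.idxConst (2 * D + 3) 0)) (.seq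
      (.instr (.valOfIdx (2 * D + 3) (2 * D + 3)))
      (.instr (.valAdd (2 * D + 3) (2 * D + 3) (2 * x))))
  | arr i a b c, D => .seq ((IExp.addr i a b c).code D) (.instr (.valLoad (2 * D + 3) (2 * D + 3)))
  | raw e, D => .seq (e.code D) (.ifIdxLt (2 * D + 3) 1 (.instr (.valLoad (2 * D + 3) (2 * D + 3)))
      (.instr (.valSub (2 * D + 3) (2 * D + 3) (2 * D + 3))))
  | op o v w, D => .seq (v.code D) (.seq (w.code (D + 1))
      (.instr (o.instr (2 * D + 3) (2 * D + 3) (2 * D + 5))))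
  | sqrt v, D => .seq (v.code D) (.instr (.valSqrt (2 * D + 3) (2 * D + 3)))
  | ite a b v w, D => .seq (a.code D) (.seq (b.code (D + 1))
      (.ifIdxLt (2 * D + 3) (2 * D + 5) (v.code D) (w.code D)))
  | sum x b v, D => .seq (.instr (.valSub (2 * D + 3) (2 * D + 3) (2 * D + 3)))
      (loopCode x b (fun E => .seq (v.code E)
        (.instr (.valAdd (2 * D + 3) (2 * D + 3) (2 * E + 3)))) D)

/-- The postcondition of code for a real expression. -/
def ValPost (off D : ℕ) (s : State) (v : ℝ) (s' : State) : Prop :=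
  view off s' = view off s ∧ SameLow D s s' ∧ s'.val (2 * D + 3) = v

lemma valPost_setVal {s s' : State} {D : ℕ} {v : ℝ} (h : view off s' = view off s)
    (h' : SameLow D s s') : ValPost off D s v (s'.setVal (2 * D + 3) v) :=
  ⟨(view_setVal_odd off s' (D + 1) v).trans h, h'.trans (sameLow_setVal (D := D) s' v),
    s'.setVal_val _ v⟩

lemma View.eq_setI_of_setI_eq {σ τ : View} {x k v : ℕ} (h : σ.iv x = k) (h' : σ.setI x v = τ) :
    σ = τ.setI x k := by
  rw [← h', View.setI_setI, ← h, View.setI_self]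

lemma VExp.runs_code (e : VExp) : ∀ (D : ℕ) (s : State), s.idx 1 = off →
    Runs ω (e.code D) s (e.cost off (view off s)) (ValPost off D s (e.eval off (view off s))) := by
  induction e with
  | ofI e =>
    intro D s hs
    refine Runs.seq (e.runs_code D s hs) fun s1 ⟨v1, f1, e1, g1⟩ => Runs.instr ?_
    simp only [Instr.run, e1]
    exact valPost_setVal v1 f1
  | var x =>
    intro D s hs
    refine Runs.seq (P := fun s' => s' = s.setIdx (2 * D + 3) 0) (Runs.instr rfl) fun s1 h1 =>
      Runs.seq (P := fun s' => s' = s1.setVal (2 * D + 3) 0) (Runs.instr ?_) fun s2 h2 =>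
      Runs.instr ?_
    · simp [Instr.run, h1, State.setIdx]
    · have h3 : s2.val (2 * D + 3) + s2.val (2 * x) = s.val (2 * x) := by
        rw [h2, h1]
        simp only [State.setVal, State.setIdx]
        rw [Function.update_self, Function.update_of_ne (by omega), zero_add]
      simp only [Instr.run, h3]
      refine valPost_setVal ?_ ?_
      · rw [h2, h1, show view off ((s.setIdx (2 * D + 3) 0).setVal (2 * D + 3) 0) =
          view off (s.setIdx (2 * D + 3) 0) from view_setVal_odd off _ (D + 1) 0]
        exact view_setIdx_odd off _ (D + 1) 0
      · rw [h2, h1]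
        exact (sameLow_setIdx (D := D) s 0).trans (sameLow_setVal (D := D) _ 0)
  | arr i a b c =>
    intro D s hs
    refine Runs.seq (IExp.runs_code _ D s hs) fun s1 ⟨v1, f1, e1, g1⟩ => Runs.instr ?_
    simp only [Instr.run, e1, IExp.eval_addr]
    have h : s1.valMem (off + cell (i.eval off (view off s)) (a.eval off (view off s))
        (b.eval off (view off s)) (c.eval off (view off s))) =
        (VExp.arr i a b c).eval off (view off s) :=
      congrFun (congrFun (congrFun (congrFun (congrArg View.arr v1) _) _) _) _
    rw [h]
    exact valPost_setVal v1 f1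
  | raw e =>
    intro D s hs
    -- Reading beyond the offset yields 0, in agreement with the default in the view; otherwise the
    -- raw part of the view would overlap with the arrays.
    refine Runs.seq (e.runs_code D s hs) fun s1 ⟨v1, f1, e1, g1⟩ => Runs.ifIdxLt (t := 1)
      (fun h => Runs.instr ?_) fun h => Runs.instr ?_
    all_goals
      rw [e1, f1.idx_one, hs] at h
      have h1 := congrFun (congrArg View.raw v1) (e.eval off (view off s))
    · simp only [Instr.run, e1]
      have h2 : s1.valMem (e.eval off (view off s)) = (VExp.raw e).eval off (view off s) := by
        rw [VExp.eval, ← h1]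
        exact (if_pos h).symm
      rw [h2]
      exact valPost_setVal v1 f1
    · simp only [Instr.run, sub_self]
      have h2 : (VExp.raw e).eval off (view off s) = 0 := by
        rw [VExp.eval, ← h1]
        exact if_neg h
      rw [h2]
      exact valPost_setVal v1 f1
  | op o a b iha ihb =>
    intro D s hs
    refine Runs.seq (iha D s hs) fun s1 ⟨v1, f1, e1⟩ => Runs.seq
      ((ihb (D + 1) s1 (f1.idx_one.trans hs)).mono (by rw [v1]) fun _ h => h)
      fun s2 ⟨v2, f2, e2⟩ => Runs.instr ?_
    have h3 : s2.val (2 * D + 3) = a.eval off (view off s) := (f2 (D + 1) le_rfl).2.trans e1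
    have h5 : s2.val (2 * D + 5) = b.eval off (view off s) := e2.trans (by rw [v1])
    have h : (o.instr (2 * D + 3) (2 * D + 3) (2 * D + 5)).run ω s2 =
        s2.setVal (2 * D + 3) (o.eval (s2.val (2 * D + 3)) (s2.val (2 * D + 5))) := by
      cases o <;> rfl
    rw [h, h3, h5]
    exact valPost_setVal (v2.trans v1) (f1.trans f2)
  | sqrt v ih =>
    intro D s hs
    refine Runs.seq (ih D s hs) fun s1 ⟨v1, f1, e1⟩ => Runs.instr ?_
    simp only [Instr.run, e1]
    exact valPost_setVal v1 f1
  | ite a b v w ihv ihw =>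
    intro D s hs
    refine Runs.seq (a.runs_code D s hs) fun s1 ⟨v1, f1, e1, g1⟩ =>
      Runs.seq (b.runs_code (D + 1) s1 (f1.idx_one.trans hs)) fun s2 ⟨v2, f2, e2, g2⟩ => ?_
    have h3 : s2.idx (2 * D + 3) = a.eval off (view off s) := (f2 (D + 1) le_rfl).1.trans e1
    have h5 : s2.idx (2 * D + 5) = b.eval off (view off s) := e2.trans (by rw [v1])
    have h2 : s2.idx 1 = off := f2.idx_one.trans (f1.idx_one.trans hs)
    have f3 : SameLow D s s2 := f1.trans f2
    refine Runs.ifIdxLt (fun h => ?_) fun h => ?_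
    all_goals rw [h3, h5] at h
    · refine (ihv D s2 h2).mono (by rw [v2, v1]; omega) fun s3 ⟨v3, f4, e3⟩ =>
        ⟨v3.trans (v2.trans v1), f3.trans f4, ?_⟩
      rw [e3, v2, v1]
      exact (if_pos h).symm
    · refine (ihw D s2 h2).mono (by rw [v2, v1]; omega) fun s3 ⟨v3, f4, e3⟩ =>
        ⟨v3.trans (v2.trans v1), f3.trans f4, ?_⟩
      rw [e3, v2, v1]
      exact (if_neg h).symm
  | sum x b v ih =>
    intro D s hs
    refine Runs.seq (P := fun s' => s' = s.setVal (2 * D + 3) 0) (Runs.instr (by simp [Instr.run]))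
      fun s1 h1 => ?_
    have v1 : view off s1 = view off s := h1 ▸ view_setVal_odd off s (D + 1) 0
    have f1 : SameLow D s s1 := h1 ▸ sameLow_setVal s 0
    have e1 : s1.val (2 * D + 3) = 0 := h1 ▸ s.setVal_val _ 0
    -- Real register 2D + 3 accumulates the partial sums. The loop uses only the index register with
    -- the same number.
    refine (runs_loopCode (t := fun k => v.cost off ((view off s).setI x k) + 1)
      (f1.idx_one.trans hs) (fun k σ r => σ = view off s ∧
      r = ∑ j ∈ Finset.range k, v.eval off ((view off s).setI x j)) ⟨v1, by simp [e1]⟩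
      ?_).mono ?_ ?_
    · rintro k - s2 hs2 hk ⟨hv, hr⟩
      have v2 := View.eq_setI_of_setI_eq hk hv
      refine Runs.seq ((ih (D + 2) s2 hs2).mono (by rw [v2]) fun _ h => h) fun s3 ⟨v3, f3, e3⟩ =>
        Runs.instr ?_
      have h3 : s3.val (2 * D + 3) = _ := (f3 (D + 1) (by omega)).2.trans hr
      have v4 := (view_setVal_odd off s3 (D + 1)
        (s3.val (2 * D + 3) + s3.val (2 * (D + 2) + 3))).trans v3
      refine ⟨(congrFun (congrArg View.iv v4) x).trans hk, ⟨?_, ?_⟩,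
        (f3.mono (D := D)).trans (sameLow_setVal (D := D) _ _),
        (f3 (D + 1) (by omega)).1, (f3 (D + 2) (by omega)).1⟩
      · rw [← hv]
        exact congrArg (fun τ => View.setI τ x ((view off s1).iv x)) v4
      · refine (State.setVal_val _ _ _).trans ?_
        rw [h3, e3, v2, Finset.sum_range_succ]
    · rw [v1]
    · rintro s2 ⟨⟨v2, e2⟩, f2⟩
      refine ⟨v2, f1.trans f2, ?_⟩
      rw [e2, v1, VExp.eval]

end Code

/-! ### Structured commands -/

section Commands

variable {ω : ℕ → ℝ} {off : ℕ}

/-- Overwrite an array entry. -/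
def View.setCell (σ : View) (i a b c : ℕ) (r : ℝ) : View :=
  { σ with arr := fun i' a' b' c' =>
      if i' = i ∧ a' = a ∧ b' = b ∧ c' = c then r else σ.arr i' a' b' c' }

/-- Started in a state with view `σ`, the command halts within `t` steps in a state whose view
satisfies `Q`. Commands take the number of scratch registers that they have to preserve. -/
def Spec (ω : ℕ → ℝ) (off : ℕ) (c : ℕ → Program) (σ : View) (t : ℕ) (Q : View → Prop) : Prop :=
  ∀ D s, s.idx 1 = off → view off s = σ →
    Runs ω (c D) s t fun s' => Q (view off s') ∧ SameLow D s s'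

lemma Spec.mono {c : ℕ → Program} {σ : View} {t u : ℕ} {P Q : View → Prop}
    (h : Spec ω off c σ t P) (htu : t ≤ u) (hPQ : ∀ τ, P τ → Q τ) : Spec ω off c σ u Q :=
  fun D s hs hv => (h D s hs hv).mono htu fun _ h => ⟨hPQ _ h.1, h.2⟩

/-- Sequential composition. -/
def seqC (c d : ℕ → Program) (D : ℕ) : Program := .seq (c D) (d D)

lemma Spec.seq {c d : ℕ → Program} {σ : View} {t u : ℕ} {P Q : View → Prop}
    (hc : Spec ω off c σ t P) (hd : ∀ τ, P τ → Spec ω off d τ u Q) :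
    Spec ω off (seqC c d) σ (t + u) Q := fun D s hs hv =>
  Runs.seq (hc D s hs hv) fun s1 h1 =>
    (hd _ h1.1 D s1 (h1.2.idx_one.trans hs) rfl).mono le_rfl fun _ h2 => ⟨h2.1, h1.2.trans h2.2⟩

/-- The empty command. -/
def skipC (_ : ℕ) : Program := .skip

lemma Spec.skip {σ : View} {Q : View → Prop} (h : Q σ) : Spec ω off skipC σ 1 Q :=
  fun _ _ _ hv => Runs.skip ⟨hv ▸ h, SameLow.refl _ _⟩

/-- Assignment to an index variable. -/
def setI (x : ℕ) (e : IExp) (D : ℕ) : Program := .seq (e.code D) (moveIdx (2 * x) (2 * D + 3))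

lemma Spec.setI {x : ℕ} {e : IExp} {σ : View} {Q : View → Prop}
    (h : Q (σ.setI x (e.eval off σ))) : Spec ω off (setI x e) σ (e.cost + 2) Q := by
  intro D s hs hv
  refine Runs.seq (e.runs_code D s hs) fun s1 ⟨v1, f1, e1, g1⟩ => runs_moveIdx (by omega) ?_
  rw [view_setIdx_even, e1, v1, hv]
  exact ⟨h, f1.trans (sameLow_setIdx (D := D) _ _)⟩

/-- Assignment to a real variable. -/
def setV (x : ℕ) (v : VExp) (D : ℕ) : Program :=
  .seq (v.code D) (.seq (.instr (.valSub (2 * x) (2 * x) (2 * x)))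
    (.instr (.valAdd (2 * x) (2 * x) (2 * D + 3))))

lemma Spec.setV {x : ℕ} {v : VExp} {σ : View} {Q : View → Prop}
    (h : Q (σ.setV x (v.eval off σ))) : Spec ω off (setV x v) σ (v.cost off σ + 2) Q := by
  intro D s hs hv
  subst hv
  refine Runs.seq (v.runs_code D s hs) fun s1 ⟨v1, f1, e1⟩ =>
    Runs.seq (P := fun s' => s' = s1.setVal (2 * x) 0) (Runs.instr (by simp [Instr.run]))
    fun s2 h2 => Runs.instr ?_
  have h3 : Instr.run ω (.valAdd (2 * x) (2 * x) (2 * D + 3)) s2 =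
      s1.setVal (2 * x) (v.eval off (view off s)) := by
    rw [← e1, h2]
    simp only [Instr.run, State.setVal, Function.update_self, Function.update_idem]
    rw [Function.update_of_ne (by omega), zero_add]
  rw [h3, view_setVal_even, v1]
  exact ⟨h, f1.trans (sameLow_setVal (D := D) _ _)⟩

lemma view_setCell (s : State) (i a b c : ℕ) (r : ℝ) :
    view off { s with valMem := Function.update s.valMem (off + cell i a b c) r } =
      (view off s).setCell i a b c r := by
  ext i' a' b' c'
  · rfl
  · rfl
  · simp only [view, View.setCell, Function.update_apply, Nat.add_left_cancel_iff]
    refine if_congr ⟨cell_injective, ?_⟩ rfl rfl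
    rintro ⟨rfl, rfl, rfl, rfl⟩
    rfl
  · simp only [view, View.setCell]
    refine ite_congr rfl (fun h => ?_) fun _ => rfl
    rw [Function.update_of_ne (by omega)]
  · rfl

/-- Assignment to an array entry. -/
def store (i a b c : IExp) (v : VExp) (D : ℕ) : Program :=
  .seq (v.code D) (.seq ((IExp.addr i a b c).code (D + 1)) (.instr (.valStore (2 * D + 5) (2 * D + 3))))

lemma Spec.store {i a b c : IExp} {v : VExp} {σ : View} {Q : View → Prop}
    (h : Q (σ.setCell (i.eval off σ) (a.eval off σ) (b.eval off σ) (c.eval off σ)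
      (v.eval off σ))) :
    Spec ω off (store i a b c v) σ (v.cost off σ + ((IExp.addr i a b c).cost + 1)) Q := by
  intro D s hs hv
  subst hv
  refine Runs.seq (v.runs_code D s hs) fun s1 ⟨v1, f1, e1⟩ => Runs.seq
    (IExp.runs_code _ (D + 1) s1 (f1.idx_one.trans hs)) fun s2 ⟨v2, f2, e2, g2⟩ => Runs.instr ?_
  have e3 : s2.idx (2 * D + 5) = _ := e2
  rw [IExp.eval_addr, v1] at e3
  simp only [Instr.run, e3]
  rw [(congrFun g2 _).trans e1, view_setCell, v2, v1]
  exact ⟨h, (f1.trans f2).trans (fun _ _ => ⟨rfl, rfl⟩) le_rfl⟩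

/-- Write to a cell below the offset. -/
def out (e : IExp) (v : VExp) (D : ℕ) : Program :=
  .seq (v.code D) (.seq (e.code (D + 1)) (.instr (.valStore (2 * D + 5) (2 * D + 3))))

lemma Spec.out {e : IExp} {v : VExp} {σ : View} {Q : View → Prop} (he : e.eval off σ < off)
    (h : Q { σ with raw := Function.update σ.raw (e.eval off σ) (v.eval off σ) }) :
    Spec ω off (out e v) σ (v.cost off σ + (e.cost + 1)) Q := by
  intro D s hs hv
  subst hv
  refine Runs.seq (v.runs_code D s hs) fun s1 ⟨v1, f1, e1⟩ => Runs.seq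
    (IExp.runs_code _ (D + 1) s1 (f1.idx_one.trans hs)) fun s2 ⟨v2, f2, e2, g2⟩ => Runs.instr ?_
  have e3 : s2.idx (2 * D + 5) = _ := e2
  rw [v1] at e3
  simp only [Instr.run, e3]
  rw [(congrFun g2 _).trans e1]
  refine ⟨?_, (f1.trans f2).trans (fun _ _ => ⟨rfl, rfl⟩) le_rfl⟩
  rw [← v1, ← v2] at h he ⊢
  generalize e.eval off (view off s2) = m at h he ⊢
  generalize v.eval off (view off s2) = r at h ⊢
  convert h using 1
  ext i' a' b' c'
  · rfl
  · rfl
  · simp only [view]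
    rw [Function.update_of_ne (by omega)]
  · simp only [view, Function.update_apply]
    split_ifs <;> first | rfl | omega
  · rfl

/-- Draw a random number. -/
def draw (x : ℕ) (_ : ℕ) : Program := .instr (.sample (2 * x))

lemma Spec.draw {x : ℕ} {σ : View} {Q : View → Prop}
    (h : Q { σ.setV x (ω σ.used) with used := σ.used + 1 }) :
    Spec ω off (draw x) σ 1 Q := by
  intro D s hs hv
  subst hv
  refine Runs.instr ⟨?_, fun k hk => ⟨rfl, (sameLow_setVal (D := D) s _ (by omega) k hk).2⟩⟩
  convert h using 1
  exact congrArg (fun τ : View => { τ with used := s.used + 1 }) (view_setVal_even off s x _)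

/-- Branch on a comparison of indices. -/
def ifLt (a b : IExp) (c d : ℕ → Program) (D : ℕ) : Program :=
  .seq (a.code D) (.seq (b.code (D + 1)) (.ifIdxLt (2 * D + 3) (2 * D + 5) (c D) (d D)))

lemma Spec.ifLt {a b : IExp} {c d : ℕ → Program} {σ : View} {t : ℕ} {Q : View → Prop}
    (hc : a.eval off σ < b.eval off σ → Spec ω off c σ t Q)
    (hd : ¬ a.eval off σ < b.eval off σ → Spec ω off d σ t Q) :
    Spec ω off (ifLt a b c d) σ (a.cost + (b.cost + (t + 1))) Q := by
  intro D s hs hv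
  subst hv
  refine Runs.seq (a.runs_code D s hs) fun s1 ⟨v1, f1, e1, g1⟩ =>
    Runs.seq (b.runs_code (D + 1) s1 (f1.idx_one.trans hs)) fun s2 ⟨v2, f2, e2, g2⟩ => ?_
  have h3 : s2.idx (2 * D + 3) = a.eval off (view off s) := (f2 (D + 1) le_rfl).1.trans e1
  have h5 : s2.idx (2 * D + 5) = b.eval off (view off s) := e2.trans (by rw [v1])
  have h2 : s2.idx 1 = off := f2.idx_one.trans (f1.idx_one.trans hs)
  have f3 : SameLow D s s2 := f1.trans f2
  refine Runs.ifIdxLt (fun h => ?_) fun h => ?_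
  all_goals rw [h3, h5] at h
  · exact (hc h D s2 h2 (v2.trans v1)).mono le_rfl fun _ h => ⟨h.1, f3.trans h.2⟩
  · exact (hd h D s2 h2 (v2.trans v1)).mono le_rfl fun _ h => ⟨h.1, f3.trans h.2⟩

/-- Branch on a comparison of reals. -/
def ifLe (a b : VExp) (c d : ℕ → Program) (D : ℕ) : Program :=
  .seq (a.code D) (.seq (b.code (D + 1)) (.ifValLe (2 * D + 3) (2 * D + 5) (c D) (d D)))

lemma Spec.ifLe {a b : VExp} {c d : ℕ → Program} {σ : View} {t : ℕ} {Q : View → Prop}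
    (hc : a.eval off σ ≤ b.eval off σ → Spec ω off c σ t Q)
    (hd : ¬ a.eval off σ ≤ b.eval off σ → Spec ω off d σ t Q) :
    Spec ω off (ifLe a b c d) σ (a.cost off σ + (b.cost off σ + (t + 1))) Q := by
  intro D s hs hv
  subst hv
  refine Runs.seq (a.runs_code D s hs) fun s1 ⟨v1, f1, e1⟩ =>
    Runs.seq ((b.runs_code (D + 1) s1 (f1.idx_one.trans hs)).mono (by rw [v1]) fun _ h => h)
    fun s2 ⟨v2, f2, e2⟩ => ?_
  have h3 : s2.val (2 * D + 3) = a.eval off (view off s) := (f2 (D + 1) le_rfl).2.trans e1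
  have h5 : s2.val (2 * D + 5) = b.eval off (view off s) := e2.trans (by rw [v1])
  have h2 : s2.idx 1 = off := f2.idx_one.trans (f1.idx_one.trans hs)
  have f3 : SameLow D s s2 := f1.trans f2
  refine Runs.ifValLe (fun h => ?_) fun h => ?_
  all_goals rw [h3, h5] at h
  · exact (hc h D s2 h2 (v2.trans v1)).mono le_rfl fun _ h => ⟨h.1, f3.trans h.2⟩
  · exact (hd h D s2 h2 (v2.trans v1)).mono le_rfl fun _ h => ⟨h.1, f3.trans h.2⟩

/-- The invariant speaks of the state with the loop variable restored, so invariants need not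
mention the counter. The body only has to leave the counter as it found it. -/
lemma Spec.loop {x : ℕ} {b : IExp} {c : ℕ → Program} {σ : View} {t : ℕ → ℕ}
    (Inv : ℕ → View → Prop) (h0 : Inv 0 σ)
    (hstep : ∀ k < b.eval off σ, ∀ τ, τ.iv x = σ.iv x → Inv k τ →
      Spec ω off c (τ.setI x k) (t k) fun τ' => τ'.iv x = k ∧ Inv (k + 1) (τ'.setI x (σ.iv x))) :
    Spec ω off (loopCode x b c) σ
      (b.cost + 6 + ∑ k ∈ Finset.range (b.eval off σ), (t k + 3)) (Inv (b.eval off σ)) := by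
  intro D s hs hv
  subst hv
  refine (runs_loopCode (t := t) hs (fun k τ _ => τ.iv x = (view off s).iv x ∧ Inv k τ)
    ⟨rfl, h0⟩ ?_).mono le_rfl fun s' h => ⟨h.1.2, h.2⟩
  rintro k hk s1 hs1 hx ⟨-, hI⟩
  refine (hstep k hk _ (by simp [View.setI]) hI (D + 2) s1 hs1 ?_).mono le_rfl ?_
  · rw [View.setI_setI, ← hx, View.setI_self]
  · rintro s2 ⟨⟨h1, h2⟩, h3⟩
    exact ⟨h1, ⟨by simp [View.setI], h2⟩, h3.mono, (h3 (D + 1) (by omega)).1,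
      (h3 (D + 2) (by omega)).1⟩

end Commands

/-! ### Tabulation of an expression -/

section Tab

variable {ω : ℕ → ℝ} {off : ℕ}

/-- Fill the box `b₁ × b₂ × b₃` of an array with the values of an expression in the index variables
`10`, `11` and `12`. -/
def tab (i b₁ b₂ b₃ : IExp) (v : VExp) : ℕ → Program :=
  loopCode 10 b₁ (loopCode 11 b₂ (loopCode 12 b₃ (store i (.var 10) (.var 11) (.var 12) v)))

lemma View.setCell_setArr (σ : View) (i a b c : ℕ) (F : ℕ → ℕ → ℕ → ℝ) (r : ℝ) :
    (σ.setArr i F).setCell i a b c r = σ.setArr i fun a' b' c' =>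
      if a' = a ∧ b' = b ∧ c' = c then r else F a' b' c' := by
  simp only [View.setCell, View.setArr, View.mk.injEq, true_and, and_true]
  funext i' a' b' c'
  by_cases h : i' = i
  · subst h
    simp
  · simp [h]

/-- The hypotheses quantify over arbitrary contents of the target array, because the expression is
evaluated while that array is partly overwritten. Positivity of the box sizes lets the overhead of
the three loops be absorbed into the number of entries. -/
lemma Spec.tab {i b₁ b₂ b₃ : IExp} {v : VExp} {σ : View} {id B₁ B₂ B₃ t : ℕ}
    {val : ℕ → ℕ → ℕ → ℝ} {Q : View → Prop} (hB₁ : b₁.eval off σ = B₁)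
    (hB₂ : ∀ G a, b₂.eval off ((σ.setArr id G).setI 10 a) = B₂)
    (hB₃ : ∀ G a b, b₃.eval off (((σ.setArr id G).setI 10 a).setI 11 b) = B₃)
    (hi : ∀ G a b c, i.eval off ((((σ.setArr id G).setI 10 a).setI 11 b).setI 12 c) = id)
    (hv : ∀ G, ∀ a < B₁, ∀ b < B₂, ∀ c < B₃,
      v.eval off ((((σ.setArr id G).setI 10 a).setI 11 b).setI 12 c) = val a b c)
    (ht : ∀ G a b c, v.cost off ((((σ.setArr id G).setI 10 a).setI 11 b).setI 12 c) ≤ t)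
    (hpos : 0 < B₁ ∧ 0 < B₂ ∧ 0 < B₃)
    (hc : i.cost ≤ 20 ∧ b₁.cost ≤ 20 ∧ b₂.cost ≤ 20 ∧ b₃.cost ≤ 20)
    (hQ : ∀ G : ℕ → ℕ → ℕ → ℝ, (∀ a < B₁, ∀ b < B₂, ∀ c < B₃, G a b c = val a b c) →
      Q (σ.setArr id G)) :
    Spec ω off (tab i b₁ b₂ b₃ v) σ ((t + 300) * (B₁ * B₂ * B₃)) Q := by
  have hcost : ∀ m : ℕ → ℕ, ∀ u N, (∀ k, m k = u) →
      ∑ k ∈ Finset.range N, (m k + 3) = N * (u + 3) := fun m u N h => by simp [h]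
  refine (Spec.loop (σ := σ) (t := fun _ => b₂.cost + 6 + B₂ * (b₃.cost + 6 + B₃ *
    (t + ((IExp.addr i (.var 10) (.var 11) (.var 12)).cost + 1) + 3) + 3))
    (fun k τ => ∃ G, τ = σ.setArr id G ∧ ∀ a < k, ∀ b < B₂, ∀ c < B₃, G a b c = val a b c)
    ⟨σ.arr id, by simp [View.setArr], by simp⟩ ?_).mono ?_ ?_
  · rintro k hk _ - ⟨G, rfl, hG⟩
    rw [hB₁] at hk
    refine (Spec.loop (t := fun _ => b₃.cost + 6 + B₃ *
      (t + ((IExp.addr i (.var 10) (.var 11) (.var 12)).cost + 1) + 3))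
      (fun m τ => ∃ G, τ = (σ.setArr id G).setI 10 k ∧
        (∀ a < k, ∀ b < B₂, ∀ c < B₃, G a b c = val a b c) ∧
        ∀ b < m, ∀ c < B₃, G k b c = val k b c)
      ⟨G, rfl, hG, by simp⟩ ?_).mono ?_ ?_
    · rintro m hm _ - ⟨G, rfl, hG, hG'⟩
      rw [hB₂] at hm
      refine (Spec.loop (t := fun _ => t + ((IExp.addr i (.var 10) (.var 11) (.var 12)).cost + 1))
        (fun j τ => ∃ G, τ = ((σ.setArr id G).setI 10 k).setI 11 m ∧
          (∀ a < k, ∀ b < B₂, ∀ c < B₃, G a b c = val a b c) ∧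
          (∀ b < m, ∀ c < B₃, G k b c = val k b c) ∧ ∀ c < j, G k m c = val k m c)
        ⟨G, rfl, hG, hG', by simp⟩ ?_).mono ?_ ?_
      · rintro j hj _ - ⟨G, rfl, hG, hG', hG''⟩
        rw [hB₃] at hj
        refine (Spec.store (Q := _) ⟨?_, ?_⟩).mono (Nat.add_le_add_right (ht G k m j) _) fun _ h => h
        · simp [View.setCell, View.setI]
        · rw [hi, hv G k hk m hm j hj]
          simp only [IExp.eval_var]
          refine ⟨fun a b c => if a = k ∧ b = m ∧ c = j then val k m j else G a b c, ?_, ?_, ?_, ?_⟩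
          · rw [← View.setCell_setArr]
            simp [View.setCell, View.setI, View.setArr]
          · intro a ha b hb c hc
            simp only [show ¬ (a = k ∧ b = m ∧ c = j) by omega, if_false]
            exact hG a ha b hb c hc
          · intro b hb c hc
            simp only [show ¬ (b = m ∧ c = j) by omega, and_false, if_false]
            exact hG' b hb c hc
          · intro c hc
            by_cases h : c = j
            · simp [h]
            · simp only [h, and_false, if_false]
              exact hG'' c (by omega)
      · rw [hB₃, hcost _ _ _ fun _ => rfl]
      · rintro _ ⟨G, rfl, hG, hG', hG''⟩
        rw [hB₃] at hG''
        refine ⟨by simp [View.setI], G, ?_, hG, ?_⟩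
        · simp [View.setI, View.setArr]
        · intro b hb c hc
          rcases Nat.lt_succ_iff_lt_or_eq.mp hb with h | rfl
          · exact hG' b h c hc
          · exact hG'' c hc
    · rw [hB₂, hcost _ _ _ fun _ => rfl]
    · rintro _ ⟨G, rfl, hG, hG'⟩
      rw [hB₂] at hG'
      refine ⟨by simp [View.setI], G, ?_, ?_⟩
      · rw [View.setI_setI]
        exact View.setI_self _ _
      · intro a ha b hb c hc
        rcases Nat.lt_succ_iff_lt_or_eq.mp ha with h | rfl
        · exact hG a h b hb c hc
        · exact hG' b hb c hc
  · rw [hB₁, hcost _ _ _ fun _ => rfl]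
    have h1 : (IExp.addr i (.var 10) (.var 11) (.var 12)).cost = 3 * i.cost + 83 := by
      simp only [IExp.addr, IExp.cost_add, IExp.cost]
      ring
    rw [h1]
    obtain ⟨c0, c1, c2, c3⟩ := hc
    obtain ⟨p1, p2, p3⟩ := hpos
    have e3 : b₃.cost + 6 + B₃ * (t + (3 * i.cost + 83 + 1) + 3) + 3 ≤ B₃ * (t + 176) := by
      nlinarith [Nat.mul_le_mul_left B₃ c0]
    have e2 : b₂.cost + 6 + B₂ * (b₃.cost + 6 + B₃ * (t + (3 * i.cost + 83 + 1) + 3) + 3) + 3 ≤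
        B₂ * (B₃ * (t + 205)) := by
      have := Nat.mul_le_mul_left B₂ e3
      have h4 : 1 ≤ B₂ * B₃ := Nat.mul_pos p2 p3
      nlinarith
    have := Nat.mul_le_mul_left B₁ e2
    have h4 : 1 ≤ B₁ * B₂ * B₃ := Nat.mul_pos (Nat.mul_pos p1 p2) p3
    nlinarith
  · rintro _ ⟨G, rfl, hG⟩
    rw [hB₁] at hG
    exact hQ G hG

end Tab

/-! ### Strassen's recursion on families of matrices -/

section StrassenIdentity

/-- The seven left factors of Strassen's identity, for each of `P` matrices of size `2 H`. -/
def splitLeft (P H : ℕ) (A : ℕ → ℕ → ℕ → ℝ) (s i j : ℕ) : ℝ :=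
  if s < P then A s i j + A s (i + H) (j + H)
  else if s < 2 * P then A (s - P) (i + H) j + A (s - P) (i + H) (j + H)
  else if s < 3 * P then A (s - 2 * P) i j
  else if s < 4 * P then A (s - 3 * P) (i + H) (j + H)
  else if s < 5 * P then A (s - 4 * P) i j + A (s - 4 * P) i (j + H)
  else if s < 6 * P then A (s - 5 * P) (i + H) j - A (s - 5 * P) i j
  else A (s - 6 * P) i (j + H) - A (s - 6 * P) (i + H) (j + H)

/-- The seven right factors of Strassen's identity. -/
def splitRight (P H : ℕ) (A : ℕ → ℕ → ℕ → ℝ) (s i j : ℕ) : ℝ :=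
  if s < P then A s i j + A s (i + H) (j + H)
  else if s < 2 * P then A (s - P) i j
  else if s < 3 * P then A (s - 2 * P) i (j + H) - A (s - 2 * P) (i + H) (j + H)
  else if s < 4 * P then A (s - 3 * P) (i + H) j - A (s - 3 * P) i j
  else if s < 5 * P then A (s - 4 * P) (i + H) (j + H)
  else if s < 6 * P then A (s - 5 * P) i j + A (s - 5 * P) i (j + H)
  else A (s - 6 * P) (i + H) j + A (s - 6 * P) (i + H) (j + H)

/-- The products are recovered from the seven products of the factors. -/
def mergeProducts (P H : ℕ) (M : ℕ → ℕ → ℕ → ℝ) (p i j : ℕ) : ℝ :=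
  if i < H then
    if j < H then M p i j + M (p + 3 * P) i j - M (p + 4 * P) i j + M (p + 6 * P) i j
    else M (p + 2 * P) i (j - H) + M (p + 4 * P) i (j - H)
  else
    if j < H then M (p + P) (i - H) j + M (p + 3 * P) (i - H) j
    else M p (i - H) (j - H) - M (p + P) (i - H) (j - H) + M (p + 2 * P) (i - H) (j - H) +
      M (p + 5 * P) (i - H) (j - H)

/-- Strassen's identity, for P pairs of matrices at once: the positions from rP to (r + 1)P − 1 hold
the r-th factors of all pairs. This breadth-first layout turns the recursion into loops over layers,
as the machine has no procedure calls. -/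
lemma mergeProducts_eq {P H : ℕ} {A B A' B' M : ℕ → ℕ → ℕ → ℝ}
    (hA : ∀ s < 7 * P, ∀ i < H, ∀ j < H, A' s i j = splitLeft P H A s i j)
    (hB : ∀ s < 7 * P, ∀ i < H, ∀ j < H, B' s i j = splitRight P H B s i j)
    (hM : ∀ s < 7 * P, ∀ i < H, ∀ j < H, M s i j = ∑ k ∈ Finset.range H, A' s i k * B' s k j)
    {p i j : ℕ} (hp : p < P) (hi : i < 2 * H) (hj : j < 2 * H) :
    mergeProducts P H M p i j = ∑ k ∈ Finset.range (2 * H), A p i k * B p k j := by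
  have hM' : ∀ s < 7 * P, ∀ i < H, ∀ j < H, M s i j =
      ∑ k ∈ Finset.range H, splitLeft P H A s i k * splitRight P H B s k j := by
    intro s hs i hi j hj
    rw [hM s hs i hi j hj]
    refine Finset.sum_congr rfl fun k hk => ?_
    rw [hA s hs i hi k (Finset.mem_range.mp hk), hB s hs k (Finset.mem_range.mp hk) j hj]
  have l0 : ∀ i j, splitLeft P H A p i j = A p i j + A p (i + H) (j + H) := fun i j => by
    rw [splitLeft, if_pos hp]
  have r0 : ∀ i j, splitRight P H B p i j = B p i j + B p (i + H) (j + H) := fun i j => by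
    rw [splitRight, if_pos hp]
  have l1 : ∀ i j, splitLeft P H A (p + P) i j = A p (i + H) j + A p (i + H) (j + H) := fun i j => by
    rw [splitLeft, if_neg (by omega), if_pos (by omega), Nat.add_sub_cancel]
  have r1 : ∀ i j, splitRight P H B (p + P) i j = B p i j := fun i j => by
    rw [splitRight, if_neg (by omega), if_pos (by omega), Nat.add_sub_cancel]
  have l2 : ∀ i j, splitLeft P H A (p + 2 * P) i j = A p i j := fun i j => by
    rw [splitLeft, if_neg (by omega), if_neg (by omega), if_pos (by omega), Nat.add_sub_cancel]
  have r2 : ∀ i j, splitRight P H B (p + 2 * P) i j = B p i (j + H) - B p (i + H) (j + H) :=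
    fun i j => by
    rw [splitRight, if_neg (by omega), if_neg (by omega), if_pos (by omega), Nat.add_sub_cancel]
  have l3 : ∀ i j, splitLeft P H A (p + 3 * P) i j = A p (i + H) (j + H) := fun i j => by
    rw [splitLeft, if_neg (by omega), if_neg (by omega), if_neg (by omega), if_pos (by omega),
      Nat.add_sub_cancel]
  have r3 : ∀ i j, splitRight P H B (p + 3 * P) i j = B p (i + H) j - B p i j := fun i j => by
    rw [splitRight, if_neg (by omega), if_neg (by omega), if_neg (by omega), if_pos (by omega),
      Nat.add_sub_cancel]
  have l4 : ∀ i j, splitLeft P H A (p + 4 * P) i j = A p i j + A p i (j + H) := fun i j => by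
    rw [splitLeft, if_neg (by omega), if_neg (by omega), if_neg (by omega), if_neg (by omega),
      if_pos (by omega), Nat.add_sub_cancel]
  have r4 : ∀ i j, splitRight P H B (p + 4 * P) i j = B p (i + H) (j + H) := fun i j => by
    rw [splitRight, if_neg (by omega), if_neg (by omega), if_neg (by omega), if_neg (by omega),
      if_pos (by omega), Nat.add_sub_cancel]
  have l5 : ∀ i j, splitLeft P H A (p + 5 * P) i j = A p (i + H) j - A p i j := fun i j => by
    rw [splitLeft, if_neg (by omega), if_neg (by omega), if_neg (by omega), if_neg (by omega),
      if_neg (by omega), if_pos (by omega), Nat.add_sub_cancel]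
  have r5 : ∀ i j, splitRight P H B (p + 5 * P) i j = B p i j + B p i (j + H) := fun i j => by
    rw [splitRight, if_neg (by omega), if_neg (by omega), if_neg (by omega), if_neg (by omega),
      if_neg (by omega), if_pos (by omega), Nat.add_sub_cancel]
  have l6 : ∀ i j, splitLeft P H A (p + 6 * P) i j = A p i (j + H) - A p (i + H) (j + H) :=
    fun i j => by
    rw [splitLeft, if_neg (by omega), if_neg (by omega), if_neg (by omega), if_neg (by omega),
      if_neg (by omega), if_neg (by omega), Nat.add_sub_cancel]
  have r6 : ∀ i j, splitRight P H B (p + 6 * P) i j = B p (i + H) j + B p (i + H) (j + H) :=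
    fun i j => by
    rw [splitRight, if_neg (by omega), if_neg (by omega), if_neg (by omega), if_neg (by omega),
      if_neg (by omega), if_neg (by omega), Nat.add_sub_cancel]
  have hsum : ∀ f : ℕ → ℝ, ∑ k ∈ Finset.range (2 * H), f k =
      ∑ k ∈ Finset.range H, (f k + f (k + H)) := fun f => by
    rw [two_mul, Finset.sum_range_add, Finset.sum_add_distrib]
    simp only [add_comm H]
  rw [hsum, mergeProducts]
  obtain ⟨i', hi', rfl⟩ | ⟨hi1, hi2⟩ : (∃ i', i' < H ∧ i = i' + H) ∨ (i < H ∧ True) := by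
    by_cases h : i < H
    · exact Or.inr ⟨h, trivial⟩
    · exact Or.inl ⟨i - H, by omega, by omega⟩
  all_goals
    obtain ⟨j', hj', rfl⟩ | ⟨hj1, hj2⟩ : (∃ j', j' < H ∧ j = j' + H) ∨ (j < H ∧ True) := by
      by_cases h : j < H
      · exact Or.inr ⟨h, trivial⟩
      · exact Or.inl ⟨j - H, by omega, by omega⟩
  · rw [if_neg (by omega), if_neg (by omega), Nat.add_sub_cancel, Nat.add_sub_cancel,
      hM' _ (by omega) _ hi' _ hj', hM' _ (by omega) _ hi' _ hj', hM' _ (by omega) _ hi' _ hj',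
      hM' _ (by omega) _ hi' _ hj', ← Finset.sum_sub_distrib, ← Finset.sum_add_distrib,
      ← Finset.sum_add_distrib]
    refine Finset.sum_congr rfl fun k _ => ?_
    rw [l0, r0, l1, r1, l2, r2, l5, r5]
    ring
  · rw [if_neg (by omega), if_pos hj1, Nat.add_sub_cancel,
      hM' _ (by omega) _ hi' _ hj1, hM' _ (by omega) _ hi' _ hj1, ← Finset.sum_add_distrib]
    refine Finset.sum_congr rfl fun k _ => ?_
    rw [l1, r1, l3, r3]
    ring
  · rw [if_pos hi1, if_neg (by omega), Nat.add_sub_cancel,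
      hM' _ (by omega) _ hi1 _ hj', hM' _ (by omega) _ hi1 _ hj', ← Finset.sum_add_distrib]
    refine Finset.sum_congr rfl fun k _ => ?_
    rw [l2, r2, l4, r4]
    ring
  · rw [if_pos hi1, if_pos hj1, hM' _ (by omega) _ hi1 _ hj1, hM' _ (by omega) _ hi1 _ hj1,
      hM' _ (by omega) _ hi1 _ hj1, hM' _ (by omega) _ hi1 _ hj1, ← Finset.sum_add_distrib,
      ← Finset.sum_sub_distrib, ← Finset.sum_add_distrib]
    refine Finset.sum_congr rfl fun k _ => ?_
    rw [l0, r0, l3, r3, l4, r4, l6, r6]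
    ring

end StrassenIdentity

/-! ### The commands of Strassen's algorithm -/

section StrassenCommands

variable {ω : ℕ → ℝ} {off : ℕ}

/-- The state `τ` differs from `σ` only in the index variables `8, …, 16` and in arrays outside
`S`. -/
structure Keeps (S : ℕ → Prop) (σ τ : View) : Prop where
  iv : ∀ x, x < 8 ∨ 17 ≤ x → τ.iv x = σ.iv x
  vv : τ.vv = σ.vv
  raw : τ.raw = σ.raw
  used : τ.used = σ.used
  arr : ∀ i, S i → τ.arr i = σ.arr i

lemma Keeps.refl (S : ℕ → Prop) (σ : View) : Keeps S σ σ := ⟨by simp, rfl, rfl, rfl, by simp⟩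

lemma Keeps.setI {S : ℕ → Prop} {σ τ : View} (h : Keeps S σ τ) {x k : ℕ}
    (hx : 8 ≤ x ∧ x < 17) : Keeps S σ (τ.setI x k) :=
  ⟨fun y hy => by simp [show y ≠ x by omega, h.iv y hy], h.vv, h.raw, h.used, h.arr⟩

lemma Keeps.setArr {S : ℕ → Prop} {σ τ : View} (h : Keeps S σ τ) {i : ℕ}
    {F : ℕ → ℕ → ℕ → ℝ} (hi : ¬ S i) : Keeps S σ (τ.setArr i F) :=
  ⟨h.iv, h.vv, h.raw, h.used, fun j hj => by
    simp [show j ≠ i from fun e => hi (e ▸ hj), h.arr j hj]⟩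

/-- Assign a power to an index variable. -/
def powI (x c : ℕ) (e : IExp) : ℕ → Program :=
  seqC (setI x 1) (loopCode 16 e (setI x (.op .mul (.const c) (.var x))))

lemma Spec.powI {x c : ℕ} {e : IExp} {σ : View} {Q : View → Prop} {E : ℕ} (hx : x ≠ 16)
    (he : ∀ k, e.eval off (σ.setI x k) = E) (hQ : Q (σ.setI x (c ^ E))) :
    Spec ω off (powI x c e) σ (e.cost + 9 + 9 * E) Q := by
  refine (Spec.seq (u := e.cost + 6 + ∑ k ∈ Finset.range E, (6 + 3))
    (P := fun τ => τ = σ.setI x 1) (Spec.setI rfl) fun τ hτ => ?_).mono ?_ fun _ h => h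
  · subst hτ
    refine (Spec.loop (t := fun _ => 6) (fun k τ => τ = σ.setI x (c ^ k)) (by simp) ?_).mono
      (by rw [he]) ?_
    · rintro k - _ - rfl
      refine Spec.setI (Q := _) ⟨by simp [hx.symm], ?_⟩
      ext y <;> simp [IOp.eval]
      split_ifs <;> simp_all [pow_succ, mul_comm]
    · rintro τ rfl
      rw [he]
      exact hQ
  · simp
    omega

/-- The family of matrices on layer `l` in the family of arrays with number `f`. -/
def layerId (f : ℕ) (l : IExp) : IExp := .const (11 + f) + 5 * l

/-- An entry of a quadrant. -/
def quad (f : ℕ) (p : IExp) (a b : ℕ) : VExp :=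
  .arr (layerId f (.var 7)) p (.var 11 + .const a * .var 8) (.var 12 + .const b * .var 8)

/-- Choose one of seven expressions according to the position of the index variable `10`. -/
def sevenCases (e : IExp → ℕ → VExp) : VExp :=
  .ite (.var 10) (.var 9) (e (.var 10) 0) <|
  .ite (.var 10) (2 * .var 9) (e (.var 10 - .var 9) 1) <|
  .ite (.var 10) (3 * .var 9) (e (.var 10 - 2 * .var 9) 2) <|
  .ite (.var 10) (4 * .var 9) (e (.var 10 - 3 * .var 9) 3) <|
  .ite (.var 10) (5 * .var 9) (e (.var 10 - 4 * .var 9) 4) <|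
  .ite (.var 10) (6 * .var 9) (e (.var 10 - 5 * .var 9) 5) (e (.var 10 - 6 * .var 9) 6)

/-- The expression for `splitLeft`. -/
def leftExp : VExp :=
  sevenCases fun p r => match r with
    | 0 => quad 0 p 0 0 + quad 0 p 1 1
    | 1 => quad 0 p 1 0 + quad 0 p 1 1
    | 2 => quad 0 p 0 0
    | 3 => quad 0 p 1 1
    | 4 => quad 0 p 0 0 + quad 0 p 0 1
    | 5 => quad 0 p 1 0 - quad 0 p 0 0
    | _ => quad 0 p 0 1 - quad 0 p 1 1

/-- The expression for `splitRight`. -/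
def rightExp : VExp :=
  sevenCases fun p r => match r with
    | 0 => quad 1 p 0 0 + quad 1 p 1 1
    | 1 => quad 1 p 0 0
    | 2 => quad 1 p 0 1 - quad 1 p 1 1
    | 3 => quad 1 p 1 0 - quad 1 p 0 0
    | 4 => quad 1 p 1 1
    | 5 => quad 1 p 0 0 + quad 1 p 0 1
    | _ => quad 1 p 1 0 + quad 1 p 1 1

lemma eval_leftExp (σ : View) : leftExp.eval off σ =
    splitLeft (σ.iv 9) (σ.iv 8) (σ.arr (11 + 5 * σ.iv 7)) (σ.iv 10) (σ.iv 11) (σ.iv 12) := by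
  simp [leftExp, sevenCases, quad, layerId, splitLeft]

lemma eval_rightExp (σ : View) : rightExp.eval off σ =
    splitRight (σ.iv 9) (σ.iv 8) (σ.arr (12 + 5 * σ.iv 7)) (σ.iv 10) (σ.iv 11) (σ.iv 12) := by
  simp [rightExp, sevenCases, quad, layerId, splitRight]

lemma cost_leftExp (σ : View) : leftExp.cost off σ ≤ 10000 := by
  simp [leftExp, sevenCases, quad, layerId, IExp.addr]

lemma cost_rightExp (σ : View) : rightExp.cost off σ ≤ 10000 := by
  simp [rightExp, sevenCases, quad, layerId, IExp.addr]

/-- One layer of splittings. -/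
def splitLayer : ℕ → Program :=
  seqC (powI 8 2 (.var 3 - 1 - .var 7)) <| seqC (powI 9 7 (.var 7)) <|
  seqC (tab (layerId 0 (.var 7 + 1)) (7 * .var 9) (.var 8) (.var 8) leftExp)
    (tab (layerId 1 (.var 7 + 1)) (7 * .var 9) (.var 8) (.var 8) rightExp)

lemma spec_splitLayer {σ : View} {d l : ℕ} (hd : σ.iv 3 = d) (hl : σ.iv 7 = l) (hld : l < d) :
    Spec ω off splitLayer σ (150000 * (7 ^ (l + 1) * 4 ^ (d - 1 - l)) + 18 * d + 50) fun τ =>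
      Keeps (fun i => i ≠ 11 + 5 * (l + 1) ∧ i ≠ 12 + 5 * (l + 1)) σ τ ∧
      (∀ s < 7 * 7 ^ l, ∀ i < 2 ^ (d - 1 - l), ∀ j < 2 ^ (d - 1 - l),
        τ.arr (11 + 5 * (l + 1)) s i j =
          splitLeft (7 ^ l) (2 ^ (d - 1 - l)) (σ.arr (11 + 5 * l)) s i j) ∧
      ∀ s < 7 * 7 ^ l, ∀ i < 2 ^ (d - 1 - l), ∀ j < 2 ^ (d - 1 - l),
        τ.arr (12 + 5 * (l + 1)) s i j =
          splitRight (7 ^ l) (2 ^ (d - 1 - l)) (σ.arr (12 + 5 * l)) s i j := by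
  set H := 2 ^ (d - 1 - l) with hH
  have h7 : 0 < 7 ^ l := by positivity
  have h2 : 0 < H := by positivity
  refine (Spec.seq (P := fun τ => τ = σ.setI 8 H)
    (Spec.powI (E := d - 1 - l) (by decide) (by simp [hd, hl]) rfl) fun τ hτ =>
    Spec.seq (P := fun τ => τ = (σ.setI 8 H).setI 9 (7 ^ l))
    (Spec.powI (E := l) (by decide) (by simp [hl, hτ]) (by rw [hτ])) fun τ hτ =>
    Spec.seq (u := (10000 + 300) * (7 * 7 ^ l * H * H)) (P := fun τ => ∃ G, τ = ((σ.setI 8 H).setI 9 (7 ^ l)).setArr (11 + 5 * (l + 1)) G ∧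
      ∀ s < 7 * 7 ^ l, ∀ i < H, ∀ j < H,
        G s i j = splitLeft (7 ^ l) H (σ.arr (11 + 5 * l)) s i j)
    (Spec.tab (id := 11 + 5 * (l + 1)) (B₁ := 7 * 7 ^ l) (B₂ := H) (B₃ := H) (t := 10000)
      (val := splitLeft (7 ^ l) H (σ.arr (11 + 5 * l))) ?_ ?_ ?_ ?_ ?_ (fun _ _ _ _ => cost_leftExp _)
      ⟨by positivity, h2, h2⟩ (by decide) fun G hG => ⟨G, by rw [hτ], hG⟩) ?_).mono ?_ fun _ h => h
  · simp [hτ]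
  · simp [hτ]
  · simp [hτ]
  · simp [hτ, hl, layerId]
  · intro G a ha b hb c hc
    simp [eval_leftExp, hτ, hl]
  · rintro _ ⟨G, rfl, hG⟩
    refine Spec.tab (id := 12 + 5 * (l + 1)) (B₁ := 7 * 7 ^ l) (B₂ := H) (B₃ := H) (t := 10000)
      (val := splitRight (7 ^ l) H (σ.arr (12 + 5 * l))) ?_ ?_ ?_ ?_ ?_
      (fun _ _ _ _ => cost_rightExp _) ⟨by positivity, h2, h2⟩ (by decide)
      fun G' hG' => ⟨?_, ?_, ?_⟩
    · simp
    · simp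
    · simp
    · simp [hl, layerId]
    · intro G a ha b hb c hc
      simp [eval_rightExp, hl, show 12 + 5 * l ≠ 11 + 5 * (l + 1) by omega]
    · exact ((((Keeps.refl _ _).setI (by omega)).setI (by omega)).setArr (by simp)).setArr
        (by simp)
    · intro s hs i hi j hj
      simp [hG s hs i hi j hj]
    · intro s hs i hi j hj
      simp [hG' s hs i hi j hj]
  · have h4 : H * H = 4 ^ (d - 1 - l) := by
      rw [hH, ← mul_pow]
      norm_num
    have h5 : 7 * 7 ^ l * H * H = 7 ^ (l + 1) * 4 ^ (d - 1 - l) := by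
      rw [mul_assoc, h4, pow_succ, mul_comm 7]
    simp only [h5, IExp.cost, IExp.cost_sub]
    omega

/-- The expression for `mergeProducts`. -/
def mergeExp : VExp :=
  let M (r : ℕ) (i j : IExp) : VExp :=
    .arr (layerId 2 (.var 3 - .var 7)) (.var 10 + .const r * .var 9) i j
  let i : IExp := .var 11
  let i' : IExp := .var 11 - .var 8
  let j : IExp := .var 12
  let j' : IExp := .var 12 - .var 8
  .ite i (.var 8)
    (.ite j (.var 8) (M 0 i j + M 3 i j - M 4 i j + M 6 i j) (M 2 i j' + M 4 i j'))
    (.ite j (.var 8) (M 1 i' j + M 3 i' j) (M 0 i' j' - M 1 i' j' + M 2 i' j' + M 5 i' j'))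

lemma eval_mergeExp (σ : View) : mergeExp.eval off σ = mergeProducts (σ.iv 9) (σ.iv 8)
    (σ.arr (13 + 5 * (σ.iv 3 - σ.iv 7))) (σ.iv 10) (σ.iv 11) (σ.iv 12) := by
  simp [mergeExp, layerId, mergeProducts]

lemma cost_mergeExp (σ : View) : mergeExp.cost off σ ≤ 10000 := by
  simp [mergeExp, layerId, IExp.addr]

/-- One layer of merging. -/
def mergeLayer : ℕ → Program :=
  seqC (powI 8 2 (.var 7)) <| seqC (powI 9 7 (.var 3 - 1 - .var 7)) <|
  tab (layerId 2 (.var 3 - 1 - .var 7)) (.var 9) (2 * .var 8) (2 * .var 8) mergeExp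

lemma spec_mergeLayer {σ : View} {d l m : ℕ} (hd : σ.iv 3 = d) (hm : σ.iv 7 = m)
    (hml : m + l + 1 = d) :
    Spec ω off mergeLayer σ (150000 * (7 ^ (l + 1) * 4 ^ m) + 18 * d + 50) fun τ =>
      Keeps (fun i => i ≠ 13 + 5 * l) σ τ ∧
      (∀ p < 7 ^ l, ∀ i < 2 * 2 ^ m, ∀ j < 2 * 2 ^ m,
        τ.arr (13 + 5 * l) p i j = mergeProducts (7 ^ l) (2 ^ m) (σ.arr (13 + 5 * (l + 1))) p i j) := by
  set H := 2 ^ m with hH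
  have h7 : 0 < 7 ^ l := by positivity
  have h2 : 0 < H := by positivity
  have hl1 : d - 1 - m = l := by omega
  have hl2 : d - m = l + 1 := by omega
  refine (Spec.seq (P := fun τ => τ = σ.setI 8 H)
    (Spec.powI (E := m) (by decide) (by simp [hm]) rfl) fun τ hτ =>
    Spec.seq (P := fun τ => τ = (σ.setI 8 H).setI 9 (7 ^ l))
    (Spec.powI (E := l) (by decide) (by simp [hm, hd, hτ, hl1]) (by rw [hτ])) fun τ hτ =>
    (Spec.tab (id := 13 + 5 * l) (B₁ := 7 ^ l) (B₂ := 2 * H) (B₃ := 2 * H) (t := 10000)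
      (val := mergeProducts (7 ^ l) H (σ.arr (13 + 5 * (l + 1)))) ?_ ?_ ?_ ?_ ?_
      (fun _ _ _ _ => cost_mergeExp _) ⟨h7, by omega, by omega⟩ (by decide)
      fun G hG => ⟨?_, ?_⟩)).mono ?_ fun _ h => h
  · simp [hτ]
  · simp [hτ]
  · simp [hτ]
  · simp [hτ, hm, hd, hl1, layerId]
  · intro G a ha b hb c hc
    simp [eval_mergeExp, hτ, hm, hd, hl2]
  · have h4 : H * H = 4 ^ m := by
      rw [hH, ← mul_pow]
      norm_num
    have h5 : 7 ^ l * (2 * H) * (2 * H) = 4 * (7 ^ l * 4 ^ m) := by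
      rw [← h4]
      ring
    have h6 : 7 ^ (l + 1) * 4 ^ m = 7 * (7 ^ l * 4 ^ m) := by
      rw [pow_succ]
      ring
    simp only [h5, h6, IExp.cost, IExp.cost_sub]
    have : IExp.cost 1 = 1 := rfl
    omega
  · rw [hτ]
    exact (((Keeps.refl _ _).setI (by omega)).setI (by omega)).setArr (by simp)
  · intro s hs i hi j hj
    simp [hG s hs i hi j hj]

/-- The layers `1, …, l` of factors are obtained by splitting. -/
def Splits (d l : ℕ) (F : ℕ → ℕ → ℕ → ℕ → ℝ) : Prop :=
  ∀ m < l, ∀ s < 7 * 7 ^ m, ∀ i < 2 ^ (d - 1 - m), ∀ j < 2 ^ (d - 1 - m),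
    F (11 + 5 * (m + 1)) s i j = splitLeft (7 ^ m) (2 ^ (d - 1 - m)) (F (11 + 5 * m)) s i j ∧
    F (12 + 5 * (m + 1)) s i j = splitRight (7 ^ m) (2 ^ (d - 1 - m)) (F (12 + 5 * m)) s i j

/-- The product of the matrices of order `2 ^ (var 3) = var 2` whose entries are given by two
expressions in the index variables `11` and `12`; the result is in the array `13`. -/
def strassen (EA EB : VExp) : ℕ → Program :=
  seqC (tab 11 1 (.var 2) (.var 2) EA) <| seqC (tab 12 1 (.var 2) (.var 2) EB) <|
  seqC (loopCode 7 (.var 3) splitLayer) <| seqC (powI 9 7 (.var 3)) <|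
  seqC (tab (layerId 2 (.var 3)) (.var 9) 1 1
    (.arr (layerId 0 (.var 3)) (.var 10) 0 0 * .arr (layerId 1 (.var 3)) (.var 10) 0 0))
  (loopCode 7 (.var 3) mergeLayer)

/-- Layer l + 1 has 7^(l+1) matrices with 4^(d−1−l) entries. The sum is geometric with ratio 7/4, so
it is dominated by the last layer. -/
lemma sum_layers_le (d : ℕ) : ∑ l ∈ Finset.range d, 7 ^ (l + 1) * 4 ^ (d - 1 - l) ≤ 3 * 7 ^ d := by
  have h : (∑ l ∈ Finset.range d, (7 : ℤ) ^ l * 4 ^ (d - 1 - l)) * (7 - 4) = 7 ^ d - 4 ^ d :=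
    geom_sum₂_mul 7 4 d
  have h1 : ∑ l ∈ Finset.range d, 7 ^ (l + 1) * 4 ^ (d - 1 - l) =
      7 * ∑ l ∈ Finset.range d, 7 ^ l * 4 ^ (d - 1 - l) := by
    rw [Finset.mul_sum]
    exact Finset.sum_congr rfl fun l _ => by ring
  have h2 : (0 : ℤ) ≤ 4 ^ d := by positivity
  have h3 : (0 : ℤ) ≤ 7 ^ d := by positivity
  rw [h1]
  zify
  linarith

/-- Absorbs the overhead, linear in d, of each of the d layers. -/
lemma sq_le_seven_pow (d : ℕ) : d * d ≤ 7 ^ d := by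
  have h : d ≤ 2 ^ d := Nat.lt_two_pow_self.le
  calc d * d ≤ 2 ^ d * 2 ^ d := Nat.mul_le_mul h h
    _ = 4 ^ d := by rw [← mul_pow]; norm_num
    _ ≤ 7 ^ d := Nat.pow_le_pow_left (by norm_num) d

lemma sum_layer_costs_le (d : ℕ) :
    ∑ l ∈ Finset.range d, (150000 * (7 ^ (l + 1) * 4 ^ (d - 1 - l)) + 18 * d + 50 + 3) ≤
      450100 * 7 ^ d := by
  rw [Finset.sum_add_distrib, Finset.sum_add_distrib, Finset.sum_add_distrib, ← Finset.mul_sum]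
  have h1 := sum_layers_le d
  have h2 := sq_le_seven_pow d
  have h3 : d ≤ d * d := Nat.le_mul_self d
  simp only [Finset.sum_const, Finset.card_range, smul_eq_mul]
  nlinarith

end StrassenCommands

/-! ### Correctness and cost of Strassen's algorithm -/

section StrassenCorrectness

variable {ω : ℕ → ℝ} {off : ℕ}

/-- Modulo 5, left factors, right factors and products occupy the array numbers with residues 1, 2
and 3, starting at 11. Residues 4 and 0 are left to the callers, and arrays 11 and 12 hold layer 0,
which splitting only reads. -/
lemma spec_splitLoop {σ : View} {d : ℕ} (hd : σ.iv 3 = d) :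
    Spec ω off (loopCode 7 (.var 3) splitLayer) σ (8 + 450100 * 7 ^ d) fun τ =>
      Keeps (fun i => i < 13 ∨ i % 5 = 4 ∨ i % 5 = 0) σ τ ∧ Splits d d τ.arr := by
  refine (Spec.loop (t := fun l => 150000 * (7 ^ (l + 1) * 4 ^ (d - 1 - l)) + 18 * d + 50)
    (fun l τ => Keeps (fun i => i < 13 ∨ i % 5 = 4 ∨ i % 5 = 0) σ τ ∧ Splits d l τ.arr)
    ⟨Keeps.refl _ _, by simp [Splits]⟩ ?_).mono ?_ ?_
  · rintro l hl τ h7 ⟨hk, hs⟩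
    have hl : l < d := by simpa [hd] using hl
    refine (spec_splitLayer (by simpa [hd] using hk.iv 3 (by omega)) (by simp) hl).mono le_rfl ?_
    rintro ρ ⟨hk', hA, hB⟩
    simp only [View.setI_arr] at hA hB
    refine ⟨by simpa using hk'.iv 7 (by omega), ⟨fun x hx => ?_, hk'.vv.trans hk.vv,
      hk'.raw.trans hk.raw, hk'.used.trans hk.used, fun i hi => ?_⟩, ?_⟩
    · rcases eq_or_ne x 7 with rfl | hx'
      · simp
      · simpa [hx'] using (hk'.iv x hx).trans (by simpa [hx'] using hk.iv x hx)
    · exact (hk'.arr i (by omega)).trans (hk.arr i hi)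
    · have e : ∀ i, (i ≠ 11 + 5 * (l + 1) ∧ i ≠ 12 + 5 * (l + 1)) → ρ.arr i = τ.arr i := hk'.arr
      intro m hm s hs' i hi j hj
      simp only [View.setI_arr]
      rw [e (11 + 5 * m) (by omega), e (12 + 5 * m) (by omega)]
      rcases Nat.lt_succ_iff_lt_or_eq.mp hm with h | rfl
      · rw [e (11 + 5 * (m + 1)) (by omega), e (12 + 5 * (m + 1)) (by omega)]
        exact hs m h s hs' i hi j hj
      · exact ⟨hA s hs' i hi j hj, hB s hs' i hi j hj⟩
  · simp only [IExp.eval, hd, IExp.cost]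
    have := sum_layer_costs_le d
    omega
  · simp [hd]

/-- Starting from the scalar products on layer d, the invariant says that after m rounds layer d − m
holds the correct products of matrices of order 2^m. Strassen's identity carries it up by one layer.
-/
lemma spec_mergeLoop {σ : View} {d : ℕ} (hd : σ.iv 3 = d) (hs : Splits d d σ.arr)
    (hp : ∀ s < 7 ^ d, σ.arr (13 + 5 * d) s 0 0 = σ.arr (11 + 5 * d) s 0 0 * σ.arr (12 + 5 * d) s 0 0) :
    Spec ω off (loopCode 7 (.var 3) mergeLayer) σ (8 + 450100 * 7 ^ d) fun τ =>
      Keeps (fun i => i < 13 ∨ i % 5 ≠ 3) σ τ ∧ ∀ i < 2 ^ d, ∀ j < 2 ^ d,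
        τ.arr 13 0 i j = ∑ k ∈ Finset.range (2 ^ d), σ.arr 11 0 i k * σ.arr 12 0 k j := by
  refine (Spec.loop (t := fun m => 150000 * (7 ^ (d - 1 - m + 1) * 4 ^ m) + 18 * d + 50)
    (fun m τ => Keeps (fun i => i < 13 ∨ i % 5 ≠ 3) σ τ ∧ ∀ p < 7 ^ (d - m), ∀ i < 2 ^ m, ∀ j < 2 ^ m,
      τ.arr (13 + 5 * (d - m)) p i j = ∑ k ∈ Finset.range (2 ^ m),
        σ.arr (11 + 5 * (d - m)) p i k * σ.arr (12 + 5 * (d - m)) p k j)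
    ⟨Keeps.refl _ _, ?_⟩ ?_).mono ?_ ?_
  · intro p hp' i hi j hj
    obtain rfl : i = 0 := by simpa using hi
    obtain rfl : j = 0 := by simpa using hj
    simpa using hp p hp'
  · rintro m hm τ h7 ⟨hk, hI⟩
    have hm : m < d := by simpa [hd] using hm
    obtain ⟨l, hl⟩ : ∃ l, d = m + l + 1 := ⟨d - m - 1, by omega⟩
    have e1 : d - 1 - m = l := by omega
    have e2 : d - m = l + 1 := by omega
    have e3 : d - (m + 1) = l := by omega
    rw [e1]
    refine (spec_mergeLayer (l := l) (by simpa [hd] using hk.iv 3 (by omega)) (by simp)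
      hl.symm).mono le_rfl ?_
    rintro ρ ⟨hk', hM⟩
    simp only [View.setI_arr] at hM
    refine ⟨by simpa using hk'.iv 7 (by omega), ⟨fun x hx => ?_, hk'.vv.trans hk.vv,
      hk'.raw.trans hk.raw, hk'.used.trans hk.used, fun i hi => ?_⟩, ?_⟩
    · rcases eq_or_ne x 7 with rfl | hx'
      · simp
      · simpa [hx'] using (hk'.iv x hx).trans (by simpa [hx'] using hk.iv x hx)
    · exact (hk'.arr i (by omega)).trans (hk.arr i hi)
    · rw [e3]
      intro p hp i hi j hj
      rw [pow_succ'] at hi hj ⊢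
      rw [View.setI_arr, hM p hp i hi j hj]
      have h1 : d - 1 - l = m := by omega
      have hs' := hs l (by omega)
      rw [h1] at hs'
      rw [e2] at hI
      exact mergeProducts_eq (fun s h i hi j hj => (hs' s h i hi j hj).1)
        (fun s h i hi j hj => (hs' s h i hi j hj).2)
        (fun s h i hi j hj => hI s (by rw [pow_succ']; exact h) i hi j hj) hp hi hj
  · simp only [IExp.eval, hd, IExp.cost]
    have := sum_layer_costs_le d
    rw [← Finset.sum_range_reflect] at this
    refine (Nat.add_le_add_left (le_trans (Finset.sum_le_sum fun m hm => ?_) this) _)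
    have hm := Finset.mem_range.mp hm
    rw [show d - 1 - (d - 1 - m) = m by omega]
  · rintro τ ⟨hk, hI⟩
    refine ⟨hk, fun i hi j hj => ?_⟩
    simpa [hd] using hI 0 (by simp [hd]) i (by simpa [hd] using hi) j (by simpa [hd] using hj)

/-- The values of the two expressions are required in all states reached while the arguments are
copied; the second is evaluated after array 11 is filled. Since both arguments are copied first, an
argument may be array 13, the result of an earlier product. -/
lemma spec_strassen {EA EB : VExp} {σ : View} {d : ℕ} {A B : ℕ → ℕ → ℝ} (hN : σ.iv 2 = 2 ^ d)
    (hd : σ.iv 3 = d)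
    (hA : ∀ τ, Keeps (fun i => i ≠ 11) σ τ → τ.iv 11 < 2 ^ d → τ.iv 12 < 2 ^ d →
      EA.eval off τ = A (τ.iv 11) (τ.iv 12))
    (hB : ∀ τ, Keeps (fun i => i ≠ 11 ∧ i ≠ 12) σ τ → τ.iv 11 < 2 ^ d → τ.iv 12 < 2 ^ d →
      EB.eval off τ = B (τ.iv 11) (τ.iv 12))
    (hcA : ∀ τ, EA.cost off τ ≤ 10000) (hcB : ∀ τ, EB.cost off τ ≤ 10000) :
    Spec ω off (strassen EA EB) σ (1000000 * 7 ^ d) fun τ =>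
      Keeps (fun i => i < 11 ∨ i % 5 = 4 ∨ i % 5 = 0) σ τ ∧ ∀ i < 2 ^ d, ∀ j < 2 ^ d,
        τ.arr 13 0 i j = ∑ k ∈ Finset.range (2 ^ d), A i k * B k j := by
  have h2 : 0 < 2 ^ d := by positivity
  have h7 : 0 < 7 ^ d := by positivity
  have h0 : ∀ i < 2 ^ d, i < 2 ^ d := fun _ h => h
  refine (Spec.seq (u := 10300 * (1 * 2 ^ d * 2 ^ d) + (8 + 450100 * 7 ^ d + (11 + 9 * d +
      (800 * (7 ^ d * 1 * 1) + (8 + 450100 * 7 ^ d)))))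
    (P := fun τ => ∃ G, τ = σ.setArr 11 G ∧ ∀ i < 2 ^ d, ∀ j < 2 ^ d, G 0 i j = A i j)
    (Spec.tab (id := 11) (B₁ := 1) (B₂ := 2 ^ d) (B₃ := 2 ^ d) (t := 10000)
      (val := fun _ => A) ?_ ?_ ?_ ?_ ?_ (fun _ _ _ _ => hcA _) ⟨one_pos, h2, h2⟩ (by decide)
      fun G hG => ⟨G, rfl, hG 0 one_pos⟩) ?_).mono ?_ fun _ h => h
  · simp
  · simp [hN]
  · simp [hN]
  · simp
  · intro G a ha b hb c hc
    rw [hA _ (((((Keeps.refl _ _).setArr (by simp)).setI (by omega)).setI (by omega)).setI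
      (by omega)) (by simpa using hb) (by simpa using hc)]
    simp
  · rintro _ ⟨G, rfl, hG⟩
    refine Spec.seq (P := fun τ => ∃ G', τ = (σ.setArr 11 G).setArr 12 G' ∧
      ∀ i < 2 ^ d, ∀ j < 2 ^ d, G' 0 i j = B i j)
      (Spec.tab (id := 12) (B₁ := 1) (B₂ := 2 ^ d) (B₃ := 2 ^ d) (t := 10000)
        (val := fun _ => B) ?_ ?_ ?_ ?_ ?_ (fun _ _ _ _ => hcB _) ⟨one_pos, h2, h2⟩ (by decide)
        fun G hG => ⟨G, rfl, hG 0 one_pos⟩) ?_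
    · simp
    · simp [hN]
    · simp [hN]
    · simp
    · intro G a ha b hb c hc
      rw [hB _ ((((((Keeps.refl _ _).setArr (by simp)).setArr (by simp)).setI (by omega)).setI
        (by omega)).setI (by omega)) (by simpa using hb) (by simpa using hc)]
      simp
    · rintro _ ⟨G', rfl, hG'⟩
      refine Spec.seq (spec_splitLoop (by simpa using hd)) fun τ ⟨hk, hs⟩ => ?_
      have hd' : τ.iv 3 = d := (hk.iv 3 (by omega)).trans (by simpa using hd)
      refine Spec.seq (P := fun ρ => ρ = τ.setI 9 (7 ^ d))
        (Spec.powI (E := d) (by decide) (by simp [hd']) rfl) ?_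
      rintro _ rfl
      refine Spec.seq (P := fun ρ => ∃ F, ρ = (τ.setI 9 (7 ^ d)).setArr (13 + 5 * d) F ∧
          ∀ s < 7 ^ d, F s 0 0 = τ.arr (11 + 5 * d) s 0 0 * τ.arr (12 + 5 * d) s 0 0)
        (Spec.tab (id := 13 + 5 * d) (B₁ := 7 ^ d) (B₂ := 1) (B₃ := 1) (t := 500)
          (val := fun s _ _ => τ.arr (11 + 5 * d) s 0 0 * τ.arr (12 + 5 * d) s 0 0)
          ?_ ?_ ?_ ?_ ?_ ?_ ⟨h7, one_pos, one_pos⟩ (by decide)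
          fun F hF => ⟨F, rfl, fun s hs => hF s hs 0 one_pos 0 one_pos⟩) ?_
      · simp
      · simp
      · simp
      · simp [hd', layerId]
      · intro F a ha b hb c hc
        simp [hd', layerId]
      · intro F a b c
        simp [layerId, IExp.addr]
      · rintro _ ⟨F, rfl, hF⟩
        refine (spec_mergeLoop (d := d) (by simpa using hd') ?_ ?_).mono le_rfl ?_
        · intro m hm s hs' i hi j hj
          simpa [show ∀ k, 11 + 5 * k ≠ 13 + 5 * d by omega,
            show ∀ k, 12 + 5 * k ≠ 13 + 5 * d by omega] using hs m hm s hs' i hi j hj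
        · intro s hs
          simpa [show 11 + 5 * d ≠ 13 + 5 * d by omega,
            show 12 + 5 * d ≠ 13 + 5 * d by omega] using hF s hs
        · rintro ρ ⟨hk', hM⟩
          refine ⟨⟨fun x hx => ?_, hk'.vv.trans hk.vv, hk'.raw.trans hk.raw,
            hk'.used.trans hk.used, fun i hi => ?_⟩, fun i hi j hj => ?_⟩
          · rw [hk'.iv x hx]
            simpa [show x ≠ 9 by omega] using hk.iv x hx
          · rw [hk'.arr i (by omega)]
            have := hk.arr i (by omega)
            simpa [show i ≠ 13 + 5 * d by omega, show i ≠ 11 by omega, show i ≠ 12 by omega]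
              using this
          · rw [hM i hi j hj]
            refine Finset.sum_congr rfl fun k hk1 => ?_
            have hk1 := Finset.mem_range.mp hk1
            have h11 := hk.arr 11 (by omega)
            have h12 := hk.arr 12 (by omega)
            simp only [View.setArr_arr] at h11 h12
            simp [show 11 ≠ 13 + 5 * d by omega, show 12 ≠ 13 + 5 * d by omega, h11, h12,
              hG i hi k hk1, hG' k hk1 j hj]
  · have h4 : 1 * 2 ^ d * 2 ^ d ≤ 7 ^ d := by
      rw [one_mul, ← mul_pow]
      exact Nat.pow_le_pow_left (by norm_num) d
    have h5 : d ≤ 7 ^ d := (Nat.lt_pow_self (by norm_num)).le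
    omega

end StrassenCorrectness

/-! ### The power vector of a matrix -/

section PowerVector

/-- The first index at which the maximum of `r` over `{0, …, k - 1}` is attained. -/
noncomputable def argmaxIdx (r : ℕ → ℝ) : ℕ → ℕ
  | 0 => 0
  | k + 1 => if r k ≤ r (argmaxIdx r k) then argmaxIdx r k else k

lemma argmaxIdx_lt (r : ℕ → ℝ) {k : ℕ} (hk : 0 < k) : argmaxIdx r k < k := by
  induction k with
  | zero => exact absurd hk (lt_irrefl 0)
  | succ k ih =>
    rw [argmaxIdx]
    split_ifs
    · rcases Nat.eq_zero_or_pos k with rfl | h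
      · exact one_pos
      · exact (ih h).trans (Nat.lt_succ_self k)
    · exact Nat.lt_succ_self k

lemma le_argmaxIdx (r : ℕ → ℝ) {k j : ℕ} (hj : j < k) : r j ≤ r (argmaxIdx r k) := by
  induction k with
  | zero => exact absurd hj (Nat.not_lt_zero j)
  | succ k ih =>
    rw [argmaxIdx]
    rcases Nat.lt_succ_iff_lt_or_eq.mp hj with h | rfl
    · split_ifs with hr
      · exact ih h
      · exact (ih h).trans (not_le.mp hr).le
    · split_ifs with hr
      · exact hr
      · exact le_rfl

variable {n : ℕ} (B : Matrix (Fin n) (Fin n) ℝ)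

/-- A column, indexed by natural numbers. -/
noncomputable def column (j : ℕ) : EuclideanSpace ℝ (Fin n) :=
  WithLp.toLp 2 fun i => if h : j < n then B i ⟨j, h⟩ else 0

/-- The index of the column that grows most between `B ^ d` and `B ^ (d + 1)`. -/
noncomputable def pivot (d : ℕ) : ℕ :=
  argmaxIdx (fun j => (∑ i, column (B ^ (d + 1)) j i ^ 2) / ∑ i, column (B ^ d) j i ^ 2) n

/-- The normalized pivot column of `B ^ (d + 1)`. -/
noncomputable def powerVector (d : ℕ) : EuclideanSpace ℝ (Fin n) :=
  if √(∑ i, column (B ^ (d + 1)) (pivot B d) i ^ 2) ≤ 0 then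
    WithLp.toLp 2 fun i => if (i : ℕ) < 1 then 1 else 0
  else
    WithLp.toLp 2 fun i => column (B ^ (d + 1)) (pivot B d) i /
      √(∑ i, column (B ^ (d + 1)) (pivot B d) i ^ 2)

end PowerVector

/-! ### The recovery program -/

section Recovery

variable {ω : ℕ → ℝ} {off n d u : ℕ} {T : Tensor3 n} {τ : ℝ}

/-- The facts about the state on which all parts of the programs rely. -/
structure Base (n d u : ℕ) (T : Tensor3 n) (τ : ℝ) (σ : View) : Prop where
  iv_zero : σ.iv 0 = n
  iv_two : σ.iv 2 = 2 ^ d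
  iv_three : σ.iv 3 = d
  vv_one : σ.vv 1 = τ
  used : σ.used = u
  arr_zero : ∀ i j k : Fin n, σ.arr 0 i j k = T (i, j, k)

lemma Base.setArr {σ : View} (h : Base n d u T τ σ) {i : ℕ} (hi : i ≠ 0) (F : ℕ → ℕ → ℕ → ℝ) :
    Base n d u T τ (σ.setArr i F) :=
  ⟨h.1, h.2, h.3, h.4, h.5, by simpa [hi.symm] using h.6⟩

lemma Base.setI {σ : View} (h : Base n d u T τ σ) {x : ℕ} (hx : x ≠ 0 ∧ x ≠ 2 ∧ x ≠ 3) (k : ℕ) :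
    Base n d u T τ (σ.setI x k) :=
  ⟨by simp [hx.1.symm, h.1], by simp [hx.2.1.symm, h.2], by simp [hx.2.2.symm, h.3],
    h.4, h.5, h.6⟩

lemma Base.setV {σ : View} (h : Base n d u T τ σ) {x : ℕ} (hx : x ≠ 1) (r : ℝ) :
    Base n d u T τ (σ.setV x r) :=
  ⟨h.1, h.2, h.3, by simp [hx.symm, h.4], h.5, h.6⟩

/-- Compute the least power `2 ^ (var 3) = var 2` that is at least `var 0`. -/
def findDim : ℕ → Program :=
  seqC (setI 2 1) <| seqC (setI 3 0) <| loopCode 17 (.var 0) <|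
    ifLt (.var 2) (.var 0) (seqC (setI 2 (2 * .var 2)) (setI 3 (.var 3 + 1))) skipC

/-- The loop has a fixed number n of rounds and stops doubling once n is reached. After k rounds the
exponent is either k or already d, and d ≤ n. -/
lemma spec_findDim {σ : View} (hn : σ.iv 0 = n) (h1 : n ≤ 2 ^ d) (h2 : 2 ^ d < 2 * n) :
    Spec ω off findDim σ (20 * n + 20) fun τ => τ = (σ.setI 2 (2 ^ d)).setI 3 d := by
  have hdn : d < n + 1 := by
    have : 2 ^ d < 2 ^ (n + 1) := h2.trans_le (by
      rw [pow_succ']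
      exact Nat.mul_le_mul_left 2 Nat.lt_two_pow_self.le)
    exact (Nat.pow_lt_pow_iff_right (by norm_num)).mp this
  refine (Spec.seq (u := 20 * n + 17) (P := fun τ => τ = σ.setI 2 1) (Spec.setI rfl) ?_).mono ?_
    fun _ h => h
  · rintro _ rfl
    refine (Spec.seq (u := 8 + ∑ _ ∈ Finset.range n, (17 + 3))
      (P := fun τ => τ = (σ.setI 2 1).setI 3 0) (Spec.setI rfl) ?_).mono ?_ fun _ h => h
    · rintro _ rfl
      refine (Spec.loop (t := fun _ => 17) (fun k τ => ∃ e ≤ d,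
        τ = (σ.setI 2 (2 ^ e)).setI 3 e ∧ (e = d ∨ e = k)) ⟨0, Nat.zero_le _, by simp⟩ ?_).mono
        ?_ ?_
      · rintro k - _ - ⟨e, hed, rfl, he⟩
        refine (Spec.ifLt (t := 12) (fun h => ?_) fun h => ?_).mono (by simp) fun _ h => h
        · have hlt : e < d := by
            simp only [IExp.eval, View.setI_iv] at h
            simp [hn] at h
            rcases hed.lt_or_eq with h3 | rfl
            · exact h3
            · omega
          refine (Spec.seq (P := fun τ => τ = ((((σ.setI 2 (2 ^ e)).setI 3 e).setI 17 k).setI 2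
            (2 ^ (e + 1)))) (Spec.setI ?_) fun τ hτ => Spec.setI ?_).mono (by simp) fun _ h => h
          · simp [pow_succ']
          · subst hτ
            refine ⟨by simp, e + 1, hlt, ?_, by omega⟩
            ext y <;> simp
            split_ifs <;> simp_all
        · refine (Spec.skip ⟨by simp, e, hed, ?_, Or.inl ?_⟩).mono (by norm_num) fun _ h => h
          · ext y <;> simp
            split_ifs <;> simp_all
          · simp [hn] at h
            by_contra hne
            have h3 : 2 ^ (e + 1) ≤ 2 ^ d := Nat.pow_le_pow_right (by norm_num) (by omega)
            rw [pow_succ] at h3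
            omega
      · simp [hn]
      · rintro _ ⟨e, hed, rfl, he⟩
        have : e = d := by
          rcases he with he | he
          · exact he
          · simp [hn] at he
            omega
        rw [this]
    · simp
      omega
  · simp
    omega

/-- Copy the input tensor into the array `0`. -/
def loadTensor : ℕ → Program :=
  tab 0 (.var 0) (.var 0) (.var 0) (.raw ((.var 10 * .var 0 + .var 11) * .var 0 + .var 12))

lemma spec_loadTensor {σ : View} (hn : 0 < n) (h0 : σ.iv 0 = n) (h2 : σ.iv 2 = 2 ^ d)
    (h3 : σ.iv 3 = d) (h4 : σ.vv 1 = τ) (h5 : σ.used = u)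
    (hT : ∀ i j k : Fin n, σ.raw ((i * n + j) * n + k) = T (i, j, k)) :
    Spec ω off loadTensor σ (400 * n ^ 3) (Base n d u T τ) := by
  refine (Spec.tab (id := 0) (B₁ := n) (B₂ := n) (B₃ := n) (t := 100)
    (val := fun i j k => σ.raw ((i * n + j) * n + k)) ?_ ?_ ?_ ?_ ?_ ?_ ⟨hn, hn, hn⟩ (by decide)
    fun G hG => ⟨by simpa using h0, by simpa using h2, by simpa using h3, by simpa using h4,
      by simpa using h5, fun i j k => ?_⟩).mono (le_of_eq (by ring)) fun _ h => h
  · simp [h0]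
  · simp [h0]
  · simp [h0]
  · simp
  · intro G a ha b hb c hc
    simp [h0]
  · simp
  · simp [hG i i.2 j j.2 k k.2, hT]

/-- Compute the matrix `∑ T_i T_iᵀ - n² I`. -/
def gramProg : ℕ → Program :=
  tab 1 (.var 0) (.var 0) 1
    (.sum 13 (.var 0) (.sum 14 (.var 0)
      (.arr 0 (.var 13) (.var 10) (.var 14) * .arr 0 (.var 13) (.var 11) (.var 14))) -
    .ite (.var 10) (.var 11) 0 (.ite (.var 11) (.var 10) 0 (.ofI (.var 0 * .var 0))))

/-- Equality of indices is decided by two strict comparisons, the only test available on them. Each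
of the n² entries is a sum of n² products. -/
lemma spec_gramProg {σ : View} (hn : 0 < n) (h : Base n d u T τ σ) :
    Spec ω off gramProg σ (1500 * n ^ 4) fun ρ =>
      Base n d u T τ ρ ∧ ∀ a b : Fin n, ρ.arr 1 a b 0 = gram T a b := by
  refine (Spec.tab (id := 1) (B₁ := n) (B₂ := n) (B₃ := 1) (t := 1000 * n ^ 2)
    (val := fun a b _ => ∑ i ∈ Finset.range n, ∑ k ∈ Finset.range n, σ.arr 0 i a k * σ.arr 0 i b k -
      if a = b then (n : ℝ) ^ 2 else 0) ?_ ?_ ?_ ?_ ?_ ?_ ⟨hn, hn, one_pos⟩ (by decide)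
    fun G hG => ⟨h.setArr (by norm_num) G, fun a b => ?_⟩).mono ?_ fun _ h => h
  · simp [h.1]
  · simp [h.1]
  · simp
  · simp
  · intro G a ha b hb c hc
    simp [h.1]
    rcases lt_trichotomy a b with hab | rfl | hab
    · simp [hab, hab.ne]
    · simp [sq]
    · simp [hab, hab.ne', hab.not_gt]
  · intro G a b c
    simp [h.1, IExp.addr]
    nlinarith
  · have := Nat.pow_le_pow_right hn (show 2 ≤ 4 by norm_num)
    nlinarith
  · simp [hG a a.2 b b.2 0 one_pos, gram_apply, Finset.sum_range, h.6, Fin.ext_iff]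

/-- Compute the matrices `B ^ k` for `k ≤ var 3 + 1`. -/
def powersProg : ℕ → Program :=
  seqC (tab 10 (.var 0) (.var 0) 1 (.ite (.var 10) (.var 11) 0 (.ite (.var 11) (.var 10) 0 1))) <|
  loopCode 7 (.var 3 + 1) <| tab (10 + 5 * (.var 7 + 1)) (.var 0) (.var 0) 1
    (.sum 13 (.var 0) (.arr 1 (.var 10) (.var 13) 0 *
      .arr (10 + 5 * .var 7) (.var 13) (.var 11) 0))

/-- Schoolbook multiplication is enough here: d + 1 ≤ n products at cost O(n³) stay within O(n⁴).
The powers are stored in the arrays 10 + 5k. -/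
lemma spec_powersProg {σ : View} {B : Matrix (Fin n) (Fin n) ℝ} (hn : 0 < n) (hdn : d < n)
    (h : Base n d u T τ σ) (hB : ∀ a b : Fin n, σ.arr 1 a b 0 = B a b) :
    Spec ω off powersProg σ (2000 * n ^ 4) fun ρ => Base n d u T τ ρ ∧
      ∀ k ≤ d + 1, ∀ a b : Fin n, ρ.arr (10 + 5 * k) a b 0 = (B ^ k) a b := by
  refine (Spec.seq (u := 10 + ∑ _ ∈ Finset.range (d + 1), ((1000 * n + 300) * (n * n * 1) + 3))
    (P := fun ρ => Base n d u T τ ρ ∧ (∀ a b : Fin n, ρ.arr 1 a b 0 = B a b) ∧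
      ∀ a b : Fin n, ρ.arr 10 a b 0 = (1 : Matrix (Fin n) (Fin n) ℝ) a b)
    (Spec.tab (id := 10) (B₁ := n) (B₂ := n) (B₃ := 1) (t := 100)
    (val := fun a b _ => if a = b then 1 else 0) ?_ ?_ ?_ ?_ ?_ ?_ ⟨hn, hn, one_pos⟩ (by decide)
    fun G hG => ⟨h.setArr (by norm_num) G, ?_, ?_⟩) ?_).mono ?_ fun _ h => h
  · simp [h.1]
  · simp [h.1]
  · simp
  · simp
  · intro G a ha b hb c hc
    rcases lt_trichotomy a b with hab | rfl | hab
    · simp [hab, hab.ne]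
    · simp
    · simp [hab, hab.ne', hab.not_gt]
  · simp
  · intro a b
    simpa using hB a b
  · intro a b
    simp [hG a a.2 b b.2 0 one_pos, Matrix.one_apply, Fin.ext_iff]
  · rintro ρ ⟨hρ, hρB, hρ1⟩
    refine (Spec.loop (t := fun _ => (1000 * n + 300) * (n * n * 1))
      (fun m σ => Base n d u T τ σ ∧ (∀ a b : Fin n, σ.arr 1 a b 0 = B a b) ∧
        ∀ k ≤ m, ∀ a b : Fin n, σ.arr (10 + 5 * k) a b 0 = (B ^ k) a b)
      ⟨hρ, hρB, fun k hk => by simpa [Nat.le_zero.mp hk] using hρ1⟩ ?_).mono ?_ ?_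
    · rintro m hm σ - ⟨h, hB, hk⟩
      refine Spec.tab (id := 10 + 5 * (m + 1)) (B₁ := n) (B₂ := n) (B₃ := 1) (t := 1000 * n)
        (val := fun a b _ => ∑ c ∈ Finset.range n, σ.arr 1 a c 0 * σ.arr (10 + 5 * m) c b 0)
        ?_ ?_ ?_ ?_ ?_ ?_ ⟨hn, hn, one_pos⟩ (by decide)
        fun G hG => ⟨by simp, ?_, ?_, ?_⟩
      · simp [h.1]
      · simp [h.1]
      · simp
      · simp
      · intro G a ha b hb c hc
        simp [h.1, show 1 ≠ 10 + 5 * (m + 1) by omega]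
      · intro G a b c
        simp [h.1, IExp.addr]
        omega
      · exact ((h.setI (by norm_num) _).setArr (by omega) G).setI (by norm_num) _
      · intro a b
        simpa [show 1 ≠ 10 + 5 * (m + 1) by omega] using hB a b
      · intro k hk' a b
        rcases hk'.lt_or_eq with h1 | rfl
        · simpa [show k ≠ m + 1 by omega] using hk k (by omega) a b
        · simp [hG a a.2 b b.2 0 one_pos, pow_succ', Matrix.mul_apply, Finset.sum_range, hB,
            hk m le_rfl]
    · simp [hρ.3]
    · rintro σ' ⟨h1, -, h3⟩
      simp only [IExp.eval_add, IExp.eval_var, hρ.3] at h3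
      exact ⟨h1, h3⟩
  · rw [Finset.sum_const, Finset.card_range, smul_eq_mul]
    have h1 : n ≤ n ^ 4 := Nat.le_self_pow (by norm_num) n
    have h2 := Nat.pow_le_pow_right hn (show 2 ≤ 4 by norm_num)
    have h3 := Nat.pow_le_pow_right hn (show 3 ≤ 4 by norm_num)
    have h4 := Nat.pow_pos hn (n := 4)
    have h5 := Nat.mul_le_mul_right ((1000 * n + 300) * (n * n * 1) + 3) (show d + 1 ≤ n from hdn)
    have h6 : n * ((1000 * n + 300) * (n * n * 1) + 3) = 1000 * n ^ 4 + 300 * n ^ 3 + 3 * n := by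
      ring
    rw [h6] at h5
    linarith

/-- The squared norm of a column of the power with exponent `k`. -/
def columnSq (k : IExp) (j : IExp) : VExp :=
  .sum 13 (.var 0) (.arr (10 + 5 * k) (.var 13) j 0 * .arr (10 + 5 * k) (.var 13) j 0)

/-- Find the pivot column. -/
def pivotProg : ℕ → Program :=
  seqC (tab 2 (.var 0) 1 1 (columnSq (.var 3 + 1) (.var 10) / columnSq (.var 3) (.var 10))) <|
  seqC (setI 4 0) <| loopCode 17 (.var 0) <|
    ifLe (.arr 2 (.var 17) 0 0) (.arr 2 (.var 4) 0 0) skipC (setI 4 (.var 17))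

/-- Normalize the pivot column. -/
def normalizeProg : ℕ → Program :=
  seqC (setV 2 (.sqrt (columnSq (.var 3 + 1) (.var 4)))) <|
  ifLe (.var 2) 0 (tab 5 (.var 0) 1 1 (.ite (.var 10) 1 1 0))
    (tab 5 (.var 0) 1 1 (.arr (10 + 5 * (.var 3 + 1)) (.var 10) (.var 4) 0 / .var 2))

lemma eval_columnSq {σ : View} {k j : IExp} {K : ℕ} {B : Matrix (Fin n) (Fin n) ℝ}
    (h0 : σ.iv 0 = n) (hk : ∀ i, k.eval off (σ.setI 13 i) = K)
    (hj : ∀ i, j.eval off (σ.setI 13 i) = j.eval off σ) (hjn : j.eval off σ < n)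
    (hB : ∀ a b : Fin n, σ.arr (10 + 5 * K) a b 0 = B a b) :
    (columnSq k j).eval off σ = ∑ i, column B (j.eval off σ) i ^ 2 := by
  simp only [columnSq, VExp.eval, IExp.eval_add, IExp.eval_mul, IExp.eval_var, hk, hj, h0, View.setI_arr, View.setI_iv, if_true]
  rw [Finset.sum_range]
  refine Finset.sum_congr rfl fun i _ => ?_
  have := hB i ⟨_, hjn⟩
  simp only at this
  simp [column, hjn, this, sq]

lemma cost_columnSq {σ : View} {k j : IExp} (h0 : σ.iv 0 = n) (hk : k.cost ≤ 10)
    (hj : j.cost ≤ 10) : (columnSq k j).cost off σ ≤ 10 + 1000 * n := by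
  simp [columnSq, h0, IExp.addr]
  nlinarith

lemma spec_pivotProg {σ : View} {B : Matrix (Fin n) (Fin n) ℝ} (hn : 0 < n)
    (h : Base n d u T τ σ)
    (hB : ∀ k ≤ d + 1, ∀ a b : Fin n, σ.arr (10 + 5 * k) a b 0 = (B ^ k) a b) :
    Spec ω off pivotProg σ (4000 * n ^ 2) fun ρ => Base n d u T τ ρ ∧ ρ.iv 4 = pivot B d ∧
      ∀ k ≤ d + 1, ∀ a b : Fin n, ρ.arr (10 + 5 * k) a b 0 = (B ^ k) a b := by
  set r : ℕ → ℝ := fun j => (∑ i, column (B ^ (d + 1)) j i ^ 2) / ∑ i, column (B ^ d) j i ^ 2 with hr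
  refine (Spec.seq (u := 3 + (8 + ∑ _ ∈ Finset.range n, (1000 + 3)))
    (P := fun ρ => Base n d u T τ ρ ∧ (∀ j < n, ρ.arr 2 j 0 0 = r j) ∧
      ∀ k ≤ d + 1, ∀ a b : Fin n, ρ.arr (10 + 5 * k) a b 0 = (B ^ k) a b)
    (Spec.tab (id := 2) (B₁ := n) (B₂ := 1) (B₃ := 1) (t := 2000 * n + 50)
    (val := fun j _ _ => r j) ?_ ?_ ?_ ?_ ?_ ?_ ⟨hn, one_pos, one_pos⟩ (by decide)
    fun G hG => ⟨h.setArr (by norm_num) G, ?_, ?_⟩) ?_).mono ?_ fun _ h => h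
  · simp [h.1]
  · simp
  · simp
  · simp
  · intro G a ha b hb c hc
    rw [VExp.eval_div, eval_columnSq (K := d + 1) (B := B ^ (d + 1)) (by simp [h.1])
      (by simp [h.3]) (by simp) (by simpa using ha)
      (by simpa [show 10 + 5 * (d + 1) ≠ 2 by omega] using hB (d + 1) le_rfl),
      eval_columnSq (K := d) (B := B ^ d) (by simp [h.1]) (by simp [h.3]) (by simp)
      (by simpa using ha) (by simpa [show 10 + 5 * d ≠ 2 by omega] using hB d (by omega))]
    simp [hr]
  · intro G a b c
    rw [VExp.cost_div]
    have h1 := cost_columnSq (off := off) (k := .var 3 + 1) (j := .var 10)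
      (σ := (((σ.setArr 2 G).setI 10 a).setI 11 b).setI 12 c) (n := n) (by simp [h.1])
      (by decide) (by decide)
    have h2 := cost_columnSq (off := off) (k := .var 3) (j := .var 10)
      (σ := (((σ.setArr 2 G).setI 10 a).setI 11 b).setI 12 c) (n := n) (by simp [h.1])
      (by decide) (by decide)
    omega
  · intro j hj
    simp [hG j hj 0 one_pos 0 one_pos]
  · intro k hk a b
    simpa [show 10 + 5 * k ≠ 2 by omega] using hB k hk a b
  · rintro ρ ⟨h, hρ, hB⟩
    refine Spec.seq (P := fun ρ' => ρ' = ρ.setI 4 0) (Spec.setI rfl) ?_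
    rintro _ rfl
    refine (Spec.loop (t := fun _ => 1000) (fun k ρ' => ρ' = ρ.setI 4 (argmaxIdx r k)) rfl ?_).mono
      ?_ ?_
    · rintro k hk _ - rfl
      have hk : k < n := by simpa [h.1] using hk
      have hJ : argmaxIdx r k < n := by
        rcases Nat.eq_zero_or_pos k with rfl | h
        · exact hn
        · exact (argmaxIdx_lt r h).trans hk
      refine (Spec.ifLe (t := 4) (fun hle => ?_) fun hle => ?_).mono (by simp [IExp.addr])
        fun _ h => h
      · refine (Spec.skip ⟨by simp, ?_⟩).mono (by norm_num) fun _ h => h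
        simp [hρ k hk, hρ _ hJ] at hle
        rw [show argmaxIdx r (k + 1) = argmaxIdx r k from if_pos hle]
        ext y <;> simp
        split_ifs <;> simp_all
      · refine Spec.setI ⟨by simp, ?_⟩
        simp [hρ k hk, hρ _ hJ] at hle
        rw [show argmaxIdx r (k + 1) = k from if_neg (not_le.mpr hle)]
        ext y <;> simp
        split_ifs <;> simp_all
    · simp [h.1]
    · rintro _ rfl
      exact ⟨h.setI (by norm_num) _, by simp [pivot, hr, h.1], hB⟩
  · simp
    nlinarith

lemma spec_normalizeProg {σ : View} {B : Matrix (Fin n) (Fin n) ℝ} (hn : 0 < n)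
    (h : Base n d u T τ σ) (hJ : σ.iv 4 = pivot B d)
    (hB : ∀ k ≤ d + 1, ∀ a b : Fin n, σ.arr (10 + 5 * k) a b 0 = (B ^ k) a b) :
    Spec ω off normalizeProg σ (3000 * n) fun ρ => Base n d u T τ ρ ∧
      ∀ i : Fin n, ρ.arr 5 i 0 0 = powerVector B d i := by
  have hJn : pivot B d < n := argmaxIdx_lt _ hn
  set q := √(∑ i, column (B ^ (d + 1)) (pivot B d) i ^ 2) with hq
  refine (Spec.seq (u := 900 * n + 10) (P := fun ρ => ρ = σ.setV 2 q) (Spec.setV ?_) ?_).mono ?_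
    fun _ h => h
  · rw [VExp.eval, eval_columnSq (K := d + 1) (B := B ^ (d + 1)) h.1 (by simp [h.3]) (by simp)
      (by simpa [hJ] using hJn) (hB (d + 1) le_rfl)]
    simp [hJ, hq]
  · rintro _ rfl
    refine (Spec.ifLe (t := 900 * (n * 1 * 1)) (fun hle => ?_) fun hle => ?_).mono
      (by simp; omega) fun _ h => h
    · refine (Spec.tab (id := 5) (B₁ := n) (B₂ := 1) (B₃ := 1) (t := 100)
        (val := fun i _ _ => if i < 1 then 1 else 0) ?_ ?_ ?_ ?_ ?_ ?_ ⟨hn, one_pos, one_pos⟩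
        (by decide) fun G hG => ⟨(h.setV (by norm_num) q).setArr (by norm_num) G, ?_⟩).mono
        (by omega) fun _ h => h
      · simp [h.1]
      · simp
      · simp
      · simp
      · intro G a ha b hb c hc
        simp
      · simp
      · intro i
        simp at hle
        simp [hG i i.2 0 one_pos 0 one_pos, powerVector, ← hq, hle]
    · refine (Spec.tab (id := 5) (B₁ := n) (B₂ := 1) (B₃ := 1) (t := 500)
        (val := fun i _ _ => σ.arr (10 + 5 * (d + 1)) i (pivot B d) 0 / q) ?_ ?_ ?_ ?_ ?_ ?_
        ⟨hn, one_pos, one_pos⟩ (by decide)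
        fun G hG => ⟨(h.setV (by norm_num) q).setArr (by norm_num) G, ?_⟩).mono
        (by omega) fun _ h => h
      · simp [h.1]
      · simp
      · simp
      · simp
      · intro G a ha b hb c hc
        simp [h.3, hJ, show 10 + 5 * (d + 1) ≠ 5 by omega]
      · simp [IExp.addr]
      · intro i
        have h1 : ¬ q ≤ 0 := by simpa using hle
        have h2 := hB (d + 1) le_rfl i ⟨_, hJn⟩
        simp only at h2
        rw [powerVector, ← hq, if_neg h1]
        simp [hG i i.2 0 one_pos 0 one_pos, column, hJn, h2]
  · have h1 := cost_columnSq (off := off) (σ := σ) (k := .var 3 + 1) (j := .var 4) h.1 (by decide)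
      (by decide)
    simp only [VExp.cost]
    omega

/-- Leave the normalized pivot column of a power of `∑ T_i T_iᵀ - n² I` in the array `5`. -/
def recoverProg : ℕ → Program :=
  seqC findDim <| seqC loadTensor <| seqC gramProg <| seqC powersProg <| seqC pivotProg normalizeProg

lemma spec_recoverProg {σ : View} (hn : 2 ≤ n) (h1 : n ≤ 2 ^ d) (h2 : 2 ^ d < 2 * n)
    (h0 : σ.iv 0 = n) (hτ : σ.vv 1 = τ) (hu : σ.used = u)
    (hT : ∀ i j k : Fin n, σ.raw ((i * n + j) * n + k) = T (i, j, k)) :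
    Spec ω off recoverProg σ (20000 * n ^ 4) fun ρ => Base n d u T τ ρ ∧
      ∀ i : Fin n, ρ.arr 5 i 0 0 = powerVector (gram T) d i := by
  have hn0 : 0 < n := by omega
  have hdn : d < n := by
    have h3 : 2 * n ≤ 2 ^ n := by
      obtain ⟨m, rfl⟩ := Nat.exists_eq_add_of_le' hn
      have := (Nat.lt_two_pow_self (n := m + 1))
      rw [pow_succ']
      omega
    exact (Nat.pow_lt_pow_iff_right (by norm_num)).mp (h2.trans_le h3)
  refine (Spec.seq (spec_findDim h0 h1 h2) fun ρ hρ => Spec.seq (spec_loadTensor hn0 (by simp [hρ, h0])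
    (by simp [hρ]) (by simp [hρ]) (by simpa [hρ] using hτ) (by simpa [hρ] using hu)
    (by simpa [hρ] using hT)) fun ρ hρ => Spec.seq (spec_gramProg hn0 hρ) fun ρ hρ =>
    Spec.seq (spec_powersProg hn0 hdn hρ.1 hρ.2) fun ρ hρ =>
    Spec.seq (spec_pivotProg hn0 hρ.1 hρ.2) fun ρ hρ =>
    spec_normalizeProg hn0 hρ.1 hρ.2.1 hρ.2.2).mono ?_ fun _ h => h
  have h1 : n ≤ n ^ 4 := Nat.le_self_pow (by norm_num) n
  have h2 := Nat.pow_le_pow_right hn0 (show 2 ≤ 4 by norm_num)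
  have h3 := Nat.pow_le_pow_right hn0 (show 3 ≤ 4 by norm_num)
  have h4 := Nat.pow_pos hn0 (n := 4)
  omega

end Recovery

/-! ### Padded matrices -/

section Padding

variable {n N : ℕ}

/-- Extend a square array by zero. -/
def pad (f : Fin n → Fin n → ℝ) (a b : ℕ) : ℝ :=
  if h : a < n ∧ b < n then f ⟨a, h.1⟩ ⟨b, h.2⟩ else 0

lemma pad_coe (f : Fin n → Fin n → ℝ) (a b : Fin n) : pad f a b = f a b := by
  simp [pad]

lemma pad_of_not {f : Fin n → Fin n → ℝ} {a b : ℕ} (h : ¬ (a < n ∧ b < n)) : pad f a b = 0 :=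
  dif_neg h

/-- Padding by zeros commutes with multiplication, so products of order n can be computed in order
2^d ≥ n. -/
lemma sum_pad_mul_pad (hN : n ≤ N) (f g : Fin n → Fin n → ℝ) (a b : ℕ) :
    ∑ k ∈ Finset.range N, pad f a k * pad g k b = pad (fun a b => ∑ k, f a k * g k b) a b := by
  rw [← Finset.sum_subset (Finset.range_subset_range.mpr hN) fun k _ hk => by
    rw [pad_of_not (f := f) fun h => hk (Finset.mem_range.mpr h.2), zero_mul]]
  by_cases h : a < n ∧ b < n
  · obtain ⟨a, rfl⟩ : ∃ a' : Fin n, (a' : ℕ) = a := ⟨⟨a, h.1⟩, rfl⟩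
    obtain ⟨b, rfl⟩ : ∃ b' : Fin n, (b' : ℕ) = b := ⟨⟨b, h.2⟩, rfl⟩
    rw [Finset.sum_range]
    simp [pad_coe]
  · rw [pad_of_not h]
    refine Finset.sum_eq_zero fun k hk => ?_
    rcases not_and_or.mp h with h | h
    · rw [pad_of_not (f := f) fun h' => h h'.1, zero_mul]
    · rw [pad_of_not (f := g) fun h' => h h'.2, mul_zero]

end Padding

/-! ### Applying the centered operator -/

section Apply

variable {ω : ℕ → ℝ} {off n d u : ℕ} {T : Tensor3 n} {τ : ℝ}

lemma Base.keeps {S : ℕ → Prop} {σ ρ : View} (h : Base n d u T τ σ) (hk : Keeps S σ ρ) (hS : S 0) :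
    Base n d u T τ ρ :=
  ⟨(hk.iv 0 (by norm_num)).trans h.1, (hk.iv 2 (by norm_num)).trans h.2,
    (hk.iv 3 (by norm_num)).trans h.3, (congrFun hk.vv 1).trans h.4, hk.used.trans h.5,
    fun i j k => by rw [hk.arr 0 hS, h.6]⟩

/-- Apply `X ↦ (∑ P_i X Q_i - n tr(X) I) / var 6`. -/
def applyProg (p q src dst : ℕ) : ℕ → Program :=
  seqC (loopCode 5 (.var 0) <|
    seqC (strassen (.arr (.const p) (.var 5) (.var 11) (.var 12)) (.arr (.const src) 0 (.var 11) (.var 12))) <|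
    seqC (strassen (.arr 13 0 (.var 11) (.var 12)) (.arr (.const q) (.var 5) (.var 11) (.var 12))) <|
    tab (14 + 5 * .var 5) 1 (.var 2) (.var 2) (.arr 13 0 (.var 11) (.var 12))) <|
  tab (.const dst) 1 (.var 2) (.var 2)
    ((.sum 13 (.var 0) (.arr (14 + 5 * .var 13) 0 (.var 11) (.var 12)) -
      .ite (.var 11) (.var 12) 0 (.ite (.var 12) (.var 11) 0 (.ite (.var 11) (.var 0)
        (.ofI (.var 0) * .sum 13 (.var 0) (.arr (.const src) 0 (.var 13) (.var 13))) 0))) / .var 6)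

/-- Two Strassen products per slice. The result for slice i is kept in array 14 + 5i, a number that
Strassen's layers never use, until all are summed. -/
lemma spec_applyLoop {p q src : ℕ} {σ : View} (hn : 0 < n) (hp : p < 11) (hq : q < 11)
    (hsrc : src < 11) (h0 : σ.iv 0 = n) (h2 : σ.iv 2 = 2 ^ d) (h3 : σ.iv 3 = d) :
    Spec ω off (loopCode 5 (.var 0) <|
      seqC (strassen (.arr (.const p) (.var 5) (.var 11) (.var 12))
        (.arr (.const src) 0 (.var 11) (.var 12))) <|
      seqC (strassen (.arr 13 0 (.var 11) (.var 12)) (.arr (.const q) (.var 5) (.var 11) (.var 12))) <|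
      tab (14 + 5 * .var 5) 1 (.var 2) (.var 2) (.arr 13 0 (.var 11) (.var 12))) σ
      (2002000 * (n * 7 ^ d)) fun ρ => Keeps (fun i => i < 11) σ ρ ∧
        ∀ i < n, ∀ a < 2 ^ d, ∀ b < 2 ^ d, ρ.arr (14 + 5 * i) 0 a b =
          ∑ k ∈ Finset.range (2 ^ d), (∑ l ∈ Finset.range (2 ^ d), σ.arr p i a l * σ.arr src 0 l k) *
            σ.arr q i k b := by
  have h7 : 0 < 7 ^ d := by positivity
  have hp2 : 0 < 2 ^ d := by positivity
  refine (Spec.loop (t := fun _ => 1000000 * 7 ^ d + (1000000 * 7 ^ d + 800 * (1 * 2 ^ d * 2 ^ d)))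
    (fun m ρ => Keeps (fun i => i < 11) σ ρ ∧ ∀ i < m, ∀ a < 2 ^ d, ∀ b < 2 ^ d,
      ρ.arr (14 + 5 * i) 0 a b = ∑ k ∈ Finset.range (2 ^ d),
        (∑ l ∈ Finset.range (2 ^ d), σ.arr p i a l * σ.arr src 0 l k) * σ.arr q i k b)
    ⟨Keeps.refl _ _, by simp⟩ ?_).mono ?_ ?_
  · rintro m hm ρ h5 ⟨hk, hI⟩
    have e0 : ρ.iv 0 = n := (hk.iv 0 (by norm_num)).trans h0
    have e2 : ρ.iv 2 = 2 ^ d := (hk.iv 2 (by norm_num)).trans h2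
    have e3 : ρ.iv 3 = d := (hk.iv 3 (by norm_num)).trans h3
    refine Spec.seq (spec_strassen (d := d) (A := σ.arr p m) (B := σ.arr src 0) (by simp [e2])
      (by simp [e3]) ?_ ?_ ?_ ?_) ?_
    · intro τ hτ _ _
      simp [hτ.iv 5 (by norm_num), hτ.arr p (by omega), hk.arr p hp]
    · intro τ hτ _ _
      simp [hτ.arr src (by omega), hk.arr src hsrc]
    · intro τ
      simp [IExp.addr]
    · intro τ
      simp [IExp.addr]
    · rintro ρ₁ ⟨hk1, hI1⟩
      refine Spec.seq (spec_strassen (d := d) (A := ρ₁.arr 13 0) (B := σ.arr q m)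
        (by rw [hk1.iv 2 (by norm_num)]; simp [e2]) (by rw [hk1.iv 3 (by norm_num)]; simp [e3])
        ?_ ?_ ?_ ?_) ?_
      · intro τ hτ _ _
        simp [hτ.arr 13 (by norm_num)]
      · intro τ hτ _ _
        simp [hτ.iv 5 (by norm_num), hk1.iv 5 (by norm_num), hτ.arr q (by omega),
          hk1.arr q (by omega), hk.arr q hq]
      · intro τ
        simp [IExp.addr]
      · intro τ
        simp [IExp.addr]
      · rintro ρ₂ ⟨hk2, hI2⟩
        have f5 : ρ₂.iv 5 = m := by rw [hk2.iv 5 (by norm_num), hk1.iv 5 (by norm_num)]; simp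
        have f2 : ρ₂.iv 2 = 2 ^ d := by
          rw [hk2.iv 2 (by norm_num), hk1.iv 2 (by norm_num)]; simp [e2]
        refine Spec.tab (id := 14 + 5 * m) (B₁ := 1) (B₂ := 2 ^ d) (B₃ := 2 ^ d) (t := 500)
          (val := fun _ => ρ₂.arr 13 0) ?_ ?_ ?_ ?_ ?_ ?_ ⟨one_pos, hp2, hp2⟩ (by decide)
          fun G hG => ⟨by simp [f5], ⟨fun x hx => ?_, ?_, ?_, ?_, ?_⟩, ?_⟩
        · simp
        · simp [f2]
        · simp [f2]
        · simp [f5]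
        · intro G a ha b hb c hc
          simp [show 13 ≠ 14 + 5 * m by omega]
        · simp [IExp.addr]
        · rcases eq_or_ne x 5 with rfl | hx'
          · simp
          · simp [hx', hk2.iv x hx, hk1.iv x hx, hk.iv x hx]
        · simp [hk2.vv, hk1.vv, hk.vv]
        · simp [hk2.raw, hk1.raw, hk.raw]
        · simp [hk2.used, hk1.used, hk.used]
        · intro i hi
          simp [show i ≠ 14 + 5 * m by omega, hk2.arr i (by omega), hk1.arr i (by omega),
            hk.arr i hi]
        · intro i hi a ha b hb
          rcases Nat.lt_succ_iff_lt_or_eq.mp hi with h | rfl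
          · have := hI i h a ha b hb
            simpa [show i ≠ m by omega, hk2.arr (14 + 5 * i) (by omega),
              hk1.arr (14 + 5 * i) (by omega)] using this
          · simp only [View.setI_arr, View.setArr_arr, if_true]
            rw [hG 0 one_pos a ha b hb, hI2 a ha b hb]
            refine Finset.sum_congr rfl fun k hk' => ?_
            rw [hI1 a ha k (Finset.mem_range.mp hk')]
  · have h4 : 1 * 2 ^ d * 2 ^ d ≤ 7 ^ d := by
      rw [one_mul, ← mul_pow]
      exact Nat.pow_le_pow_left (by norm_num) d
    have h5 : 1 ≤ n * 7 ^ d := Nat.mul_pos hn h7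
    simp [h0]
    nlinarith [Nat.mul_le_mul_left n h4]
  · rintro ρ ⟨h1, h2⟩
    rw [IExp.eval, h0] at h2
    exact ⟨h1, h2⟩

/-- With x folded into a matrix X, M ⊗ M acts as X ↦ M X Mᵀ and the mean as X ↦ n tr(X) I. The n² ×
n² matrix, whose entries would take n⁵ operations to form by definition, is never written down. -/
lemma op_centered_apply (M : Fin n → Matrix (Fin n) (Fin n) ℝ) (x : EuclideanSpace ℝ (Fin n × Fin n))
    (a b : Fin n) : op (∑ i, M i ⊗ₖ M i - noiseMean n) x (a, b) =
      ∑ i, ∑ k, (∑ l, M i a l * x (l, k)) * M i b k - if a = b then (n : ℝ) * ∑ c, x (c, c) else 0 := by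
  have h := op_noiseMean_apply x (a, b)
  rw [op_apply] at h ⊢
  simp only [Matrix.sub_apply, sub_mul, Finset.sum_sub_distrib, h, Matrix.sum_apply,
    Matrix.kroneckerMap_apply]
  congr 1
  simp only [Finset.sum_mul]
  rw [Finset.sum_comm]
  refine Finset.sum_congr rfl fun i _ => ?_
  rw [Fintype.sum_prod_type, Finset.sum_comm]
  refine Finset.sum_congr rfl fun k _ => Finset.sum_congr rfl fun l _ => by ring

lemma spec_applyProg {p q src dst : ℕ} {σ : View} {s : ℝ} {M : Fin n → Matrix (Fin n) (Fin n) ℝ}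
    {x : EuclideanSpace ℝ (Fin n × Fin n)} (hn : 0 < n) (hp : p < 11) (hq : q < 11)
    (hsrc : src < 11) (hdst : dst < 11) (hne : src ≠ dst) (h : Base n d u T τ σ) (hnd : n ≤ 2 ^ d)
    (hs : σ.vv 6 = s)
    (hP : ∀ i : Fin n, ∀ a < 2 ^ d, ∀ b < 2 ^ d, σ.arr p i a b = pad (fun a b => M i a b) a b)
    (hQ : ∀ i : Fin n, ∀ a < 2 ^ d, ∀ b < 2 ^ d, σ.arr q i a b = pad (fun a b => M i b a) a b)
    (hX : ∀ a < 2 ^ d, ∀ b < 2 ^ d, σ.arr src 0 a b = pad (fun a b => x (a, b)) a b) :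
    Spec ω off (applyProg p q src dst) σ (3000000 * (n * 7 ^ d)) fun ρ =>
      Keeps (fun i => i < 11 ∧ i ≠ dst) σ ρ ∧ ∀ a < 2 ^ d, ∀ b < 2 ^ d, ρ.arr dst 0 a b =
        pad (fun a b => (s⁻¹ • op (∑ i, M i ⊗ₖ M i - noiseMean n) x) (a, b)) a b := by
  have hp2 : 0 < 2 ^ d := by positivity
  refine (Spec.seq (u := (2000 * n + 300) * (1 * 2 ^ d * 2 ^ d))
    (spec_applyLoop hn hp hq hsrc h.1 h.2 h.3) ?_).mono ?_ fun _ h => h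
  · rintro ρ ⟨hk, hI⟩
    have hρ := h.keeps hk (by norm_num)
    refine Spec.tab (id := dst) (B₁ := 1) (B₂ := 2 ^ d) (B₃ := 2 ^ d) (t := 2000 * n)
      (val := fun _ a b => (∑ i ∈ Finset.range n, ρ.arr (14 + 5 * i) 0 a b -
        if a = b ∧ a < n then n * ∑ c ∈ Finset.range n, ρ.arr src 0 c c else 0) / s)
      ?_ ?_ ?_ ?_ ?_ ?_ ⟨one_pos, hp2, hp2⟩ (by simp) fun G hG => ⟨?_, ?_⟩
    · simp
    · simp [hρ.2]
    · simp [hρ.2]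
    · simp
    · intro G _ _ a _ b _
      have e1 : ∀ i, 14 + 5 * i ≠ dst := fun i => by omega
      have e2 : ρ.vv 6 = s := by rw [hk.vv, hs]
      simp [hρ.1, e1, hne, e2]
      congr 2
      rcases lt_trichotomy a b with hab | rfl | hab
      · simp [hab, hab.ne]
      · simp
      · simp [hab, hab.ne', hab.not_gt]
    · intro G a b c
      simp [hρ.1, IExp.addr]
      omega
    · exact ⟨hk.iv, hk.vv, hk.raw, hk.used, fun i hi => by simp [hi.2, hk.arr i hi.1]⟩
    · intro a ha b hb
      rw [View.setArr_arr, if_pos rfl, hG 0 one_pos a ha b hb]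
      have e1 : ∀ i < n, ρ.arr (14 + 5 * i) 0 a b = ∑ k ∈ Finset.range (2 ^ d),
          (∑ l ∈ Finset.range (2 ^ d), σ.arr p i a l * σ.arr src 0 l k) * σ.arr q i k b :=
        fun i hi => hI i hi a ha b hb
      have e2 : ∀ i : Fin n, ρ.arr (14 + 5 * (i : ℕ)) 0 a b =
          pad (fun a b => ∑ k, (∑ l, M i a l * x (l, k)) * M i b k) a b := by
        intro i
        refine (e1 i i.2).trans (Eq.trans ?_ (sum_pad_mul_pad hnd
          (fun a k => ∑ l, M i a l * x (l, k)) (fun k b => M i b k) a b))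
        refine Finset.sum_congr rfl fun k hk' => ?_
        have hk' := Finset.mem_range.mp hk'
        rw [hQ i k hk' b hb, ← sum_pad_mul_pad hnd (fun a b => M i a b) (fun l k => x (l, k))]
        congr 1
        refine Finset.sum_congr rfl fun l hl => ?_
        have hl := Finset.mem_range.mp hl
        rw [hP i a ha l hl, hX l hl k hk']
      have e3 : ∀ c : Fin n, ρ.arr src 0 c c = x (c, c) := by
        intro c
        rw [hk.arr src hsrc, hX c (c.2.trans_le hnd) c (c.2.trans_le hnd), pad_coe]
      rw [Finset.sum_range, Finset.sum_range]
      simp only [e2, e3]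
      by_cases hab : a < n ∧ b < n
      · obtain ⟨a, rfl⟩ : ∃ a' : Fin n, (a' : ℕ) = a := ⟨⟨a, hab.1⟩, rfl⟩
        obtain ⟨b, rfl⟩ : ∃ b' : Fin n, (b' : ℕ) = b := ⟨⟨b, hab.2⟩, rfl⟩
        simp only [pad_coe, PiLp.smul_apply, op_centered_apply, smul_eq_mul]
        rw [div_eq_inv_mul]
        simp [Fin.ext_iff]
      · have h1 : ¬ (a = b ∧ a < n) := fun h => hab ⟨h.2, h.1 ▸ h.2⟩
        simp [pad_of_not hab, h1]
  · have h4 : 1 * 2 ^ d * 2 ^ d ≤ 7 ^ d := by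
      rw [one_mul, ← mul_pow]
      exact Nat.pow_le_pow_left (by norm_num) d
    nlinarith [Nat.mul_le_mul_left n h4, Nat.mul_pos hn (show 0 < 7 ^ d by positivity)]

end Apply

/-! ### The certification program -/

section Certification

variable {ω : ℕ → ℝ} {off n d u : ℕ} {T : Tensor3 n} {τ : ℝ}

/-- The vector or its negative, so that the cubic form is nonnegative. -/
noncomputable def signed (T : Tensor3 n) (v : EuclideanSpace ℝ (Fin n)) : EuclideanSpace ℝ (Fin n) :=
  (if 0 ≤ cubicForm T v then (1 : ℝ) else -1) • v

/-- The first `n²` numbers on the tape as a vector. -/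
noncomputable def tapeVec (n : ℕ) (ω : ℕ → ℝ) : EuclideanSpace ℝ (Fin n × Fin n) :=
  WithLp.toLp 2 fun p => ω (p.1 * n + p.2)

/-- Iterated application of `Cᵀ C / s²`. -/
noncomputable def powIter {ι : Type*} [Fintype ι] [DecidableEq ι] (s : ℝ) (C : Matrix ι ι ℝ)
    (g : EuclideanSpace ℝ ι) : ℕ → EuclideanSpace ℝ ι
  | 0 => g
  | k + 1 => s⁻¹ • op C.transpose (s⁻¹ • op C (powIter s C g k))

/-- Choose the sign of the vector in the array `5`. -/
def signProg : ℕ → Program :=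
  seqC (setV 3 (.sum 13 (.var 0) (.sum 14 (.var 0) (.sum 15 (.var 0)
    (.arr 0 (.var 13) (.var 14) (.var 15) * .arr 5 (.var 13) 0 0 * .arr 5 (.var 14) 0 0 *
      .arr 5 (.var 15) 0 0))))) <|
  seqC (ifLe 0 (.var 3) (setV 4 1) (setV 4 (0 - 1))) <|
  tab 6 (.var 0) 1 1 (.var 4 * .arr 5 (.var 10) 0 0)

lemma spec_signProg {σ : View} {v : EuclideanSpace ℝ (Fin n)} (hn : 0 < n) (h : Base n d u T τ σ)
    (hv : ∀ i : Fin n, σ.arr 5 i 0 0 = v i) :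
    Spec ω off signProg σ (3000 * n ^ 4) fun ρ => Base n d u T τ ρ ∧
      ∀ i : Fin n, ρ.arr 6 i 0 0 = signed T v i := by
  refine (Spec.seq (u := 13 + 800 * (n * 1 * 1)) (t := 2000 * n ^ 3 + 2)
    (P := fun ρ => ρ = σ.setV 3 (cubicForm T v))
    ((Spec.setV (Q := fun ρ => ρ = σ.setV 3 (cubicForm T v)) ?_).mono ?_ fun _ h => h) ?_).mono ?_
    fun _ h => h
  · congr 1
    simp [cubicForm, Finset.sum_range, h.1, h.6, hv]
  · simp [h.1, IExp.addr]
    have h1 : 1 ≤ n ^ 3 := Nat.pow_pos hn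
    have h2 : n ≤ n ^ 3 := Nat.le_self_pow (by norm_num) n
    have h3 : n ^ 2 ≤ n ^ 3 := Nat.pow_le_pow_right hn (by norm_num)
    nlinarith
  · rintro _ rfl
    have hr : ∀ r : ℝ, Base n d u T τ ((σ.setV 3 (cubicForm T v)).setV 4 r) := fun r =>
      (h.setV (by norm_num) _).setV (by norm_num) _
    refine Spec.seq (P := fun ρ => ρ = (σ.setV 3 (cubicForm T v)).setV 4
      (if 0 ≤ cubicForm T v then 1 else -1)) ((Spec.ifLe (t := 7) (fun hle => ?_) fun hle => ?_).mono
      (by simp) fun _ h => h) ?_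
    · have hle : 0 ≤ cubicForm T v := by simpa using hle
      rw [if_pos hle]
      exact (Spec.setV (by simp)).mono (by simp) fun _ h => h
    · have hle : ¬ 0 ≤ cubicForm T v := by simpa using hle
      rw [if_neg hle]
      exact (Spec.setV (by simp)).mono (by simp) fun _ h => h
    · rintro _ rfl
      refine Spec.tab (id := 6) (B₁ := n) (B₂ := 1) (B₃ := 1) (t := 500)
        (val := fun i _ _ => (if 0 ≤ cubicForm T v then 1 else -1) * σ.arr 5 i 0 0)
        ?_ ?_ ?_ ?_ ?_ ?_ ⟨hn, one_pos, one_pos⟩ (by decide)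
        fun G hG => ⟨(hr _).setArr (by norm_num) G, ?_⟩
      · simp [h.1]
      · simp
      · simp
      · simp
      · intro G a _ b _ c _
        simp
      · simp [IExp.addr]
      · intro i
        simp [hG i i.2 0 one_pos 0 one_pos, hv, signed]
        split_ifs <;> simp
  · have h1 : 1 ≤ n ^ 4 := Nat.pow_pos hn
    have h2 : n ≤ n ^ 4 := Nat.le_self_pow (by norm_num) n
    have h3 : n ^ 3 ≤ n ^ 4 := Nat.pow_le_pow_right hn (by norm_num)
    omega

/-- The slices of `T - (var 1) v³` and their transposes, padded to order `var 2`. -/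
def residualProg : ℕ → Program :=
  seqC (tab 7 (.var 0) (.var 2) (.var 2) (.ite (.var 11) (.var 0) (.ite (.var 12) (.var 0)
    (.arr 0 (.var 10) (.var 11) (.var 12) -
      .var 1 * (.arr 6 (.var 10) 0 0 * .arr 6 (.var 11) 0 0 * .arr 6 (.var 12) 0 0)) 0) 0)) <|
  tab 8 (.var 0) (.var 2) (.var 2) (.arr 7 (.var 10) (.var 12) (.var 11))

lemma spec_residualProg {σ : View} {v : EuclideanSpace ℝ (Fin n)} (hn : 0 < n)
    (h : Base n d u T τ σ) (hv : ∀ i : Fin n, σ.arr 6 i 0 0 = v i) :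
    Spec ω off residualProg σ (3000 * (n * 2 ^ d * 2 ^ d)) fun ρ => Base n d u T τ ρ ∧
      (∀ i : Fin n, ρ.arr 6 i 0 0 = v i) ∧
      (∀ i : Fin n, ∀ a < 2 ^ d, ∀ b < 2 ^ d, ρ.arr 7 i a b =
        pad (fun a b => slice (T - τ • cube v) i a b) a b) ∧
      ∀ i : Fin n, ∀ a < 2 ^ d, ∀ b < 2 ^ d, ρ.arr 8 i a b =
        pad (fun a b => slice (T - τ • cube v) i b a) a b := by
  have hp2 : 0 < 2 ^ d := by positivity
  refine (Spec.seq (t := 1800 * (n * 2 ^ d * 2 ^ d)) (u := 800 * (n * 2 ^ d * 2 ^ d))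
    (P := fun ρ => Base n d u T τ ρ ∧ (∀ i : Fin n, ρ.arr 6 i 0 0 = v i) ∧
      (∀ i : Fin n, ∀ a < 2 ^ d, ∀ b < 2 ^ d, ρ.arr 7 i a b =
        pad (fun a b => slice (T - τ • cube v) i a b) a b))
    (Spec.tab (id := 7) (B₁ := n) (B₂ := 2 ^ d) (B₃ := 2 ^ d) (t := 1500)
      (val := fun i a b => if a < n then if b < n then σ.arr 0 i a b -
        τ * (σ.arr 6 i 0 0 * σ.arr 6 a 0 0 * σ.arr 6 b 0 0) else 0 else 0)
      ?_ ?_ ?_ ?_ ?_ ?_ ⟨hn, hp2, hp2⟩ (by decide) fun G hG => ⟨h.setArr (by norm_num) G, ?_, ?_⟩)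
    ?_).mono (by omega) fun _ h => h
  · simp [h.1]
  · simp [h.2]
  · simp [h.2]
  · simp
  · intro G a _ b _ c _
    simp [h.1, h.4]
  · simp [IExp.addr]
  · simpa using hv
  · intro i a ha b hb
    simp only [View.setArr_arr, if_true, hG i i.2 a ha b hb]
    by_cases hab : a < n ∧ b < n
    · obtain ⟨a, rfl⟩ : ∃ a' : Fin n, (a' : ℕ) = a := ⟨⟨a, hab.1⟩, rfl⟩
      obtain ⟨b, rfl⟩ : ∃ b' : Fin n, (b' : ℕ) = b := ⟨⟨b, hab.2⟩, rfl⟩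
      simp [pad_coe, h.6, hv, slice, cube]
    · rw [pad_of_not hab]
      rcases not_and_or.mp hab with h | h <;> simp [h]
  · rintro ρ ⟨hρ, hρ6, hρ7⟩
    refine (Spec.tab (id := 8) (B₁ := n) (B₂ := 2 ^ d) (B₃ := 2 ^ d) (t := 500)
      (val := fun i a b => ρ.arr 7 i b a)
      ?_ ?_ ?_ ?_ ?_ ?_ ⟨hn, hp2, hp2⟩ (by decide) fun G hG =>
        ⟨hρ.setArr (by norm_num) G, ?_, ?_, ?_⟩)
    · simp [hρ.1]
    · simp [hρ.2]
    · simp [hρ.2]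
    · simp
    · intro G a _ b _ c _
      simp
    · simp [IExp.addr]
    · simpa using hρ6
    · simpa using hρ7
    · intro i a ha b hb
      simp only [View.setArr_arr, if_true, hG i i.2 a ha b hb, hρ7 i b hb a ha]
      simp [pad, and_comm]

/-- Fill the array `9` with a padded random matrix. -/
def sampleProg : ℕ → Program :=
  seqC (tab 9 1 (.var 2) (.var 2) 0) <| loopCode 17 (.var 0) <| loopCode 18 (.var 0) <|
    seqC (draw 5) (store 9 0 (.var 17) (.var 18) (.var 5))

lemma spec_sampleProg {σ : View} (hn : 0 < n) (h : Base n d 0 T τ σ) (hnd : n ≤ 2 ^ d) :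
    Spec ω off sampleProg σ (1000 * (n * 2 ^ d * 2 ^ d)) fun ρ => Base n d (n * n) T τ ρ ∧
      (∀ i ≠ 9, ρ.arr i = σ.arr i) ∧ ∀ a < 2 ^ d, ∀ b < 2 ^ d, ρ.arr 9 0 a b =
        pad (fun a b => tapeVec n ω (a, b)) a b := by
  have hp2 : 0 < 2 ^ d := by positivity
  -- k complete rows and m entries of row k have been drawn. The tape position k n + m ties entry
  -- (a, b) to the number at a n + b.
  let R (k m : ℕ) (ρ : View) : Prop := Base n d (k * n + m) T τ ρ ∧
      (∀ i ≠ 9, ρ.arr i = σ.arr i) ∧ ∀ a < 2 ^ d, ∀ b < 2 ^ d, ρ.arr 9 0 a b =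
        if (a < k ∧ b < n) ∨ (a = k ∧ b < m) then ω (a * n + b) else 0
  refine (Spec.seq (t := 800 * (1 * 2 ^ d * 2 ^ d))
    (u := 8 + ∑ _ ∈ Finset.range n, (8 + ∑ _ ∈ Finset.range n, (1 + 99 + 3) + 3))
    (P := R 0 0) (Spec.tab (id := 9) (B₁ := 1) (B₂ := 2 ^ d) (B₃ := 2 ^ d) (t := 500)
      (val := fun _ _ _ => 0) ?_ ?_ ?_ ?_ ?_ ?_ ⟨one_pos, hp2, hp2⟩ (by decide)
      fun G hG => ⟨?_, ?_, ?_⟩) ?_).mono ?_ fun _ h => h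
  · simp
  · simp [h.2]
  · simp [h.2]
  · simp
  · simp
  · simp
  · simpa using h.setArr (show 9 ≠ 0 by norm_num) G
  · intro i hi
    simp [hi]
  · intro a ha b hb
    simp [hG 0 one_pos a ha b hb]
  · rintro ρ hρ
    refine (Spec.loop (t := fun _ => 8 + ∑ _ ∈ Finset.range n, (1 + 99 + 3)) (fun k => R k 0) hρ
      ?_).mono ?_ ?_
    · rintro k hk ρ' - ⟨hb', ho', h9'⟩
      have hk : k < n := by simpa [hρ.1.1] using hk
      refine (Spec.loop (t := fun _ => 1 + 99) (fun m ρ => ρ.iv 17 = k ∧ R k m ρ)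
        ⟨by simp, hb'.setI (by norm_num) _, ho', h9'⟩ ?_).mono ?_ ?_
      · rintro m hm ρ₁ - ⟨h17, hb, ho, h9⟩
        have hm : m < n := by simpa [hb'.1] using hm
        refine Spec.seq (Spec.draw (Q := fun ρ => ρ = { (ρ₁.setI 18 m).setV 5 (ω (k * n + m))
          with used := k * n + m + 1 }) ?_) ?_
        · simp [hb.5]
        · rintro _ rfl
          refine (Spec.store (Q := _) ⟨?_, ?_, ⟨?_, ?_, ?_, ?_, ?_, ?_⟩, ?_, ?_⟩).mono
            (by simp [IExp.addr]) fun _ h => h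
          · simp [View.setCell]
          · simp [View.setCell, h17]
          · simp [View.setCell, hb.1]
          · simp [View.setCell, hb.2]
          · simp [View.setCell, hb.3]
          · simp [View.setCell, hb.4]
          · simp [View.setCell, add_assoc]
          · simp [View.setCell, hb.6]
          · intro i hi
            funext a b c
            simp [View.setCell, hi, ho i hi]
          · intro a ha b hb
            simp only [View.setCell, h17, View.setI_arr, View.setV_arr, IExp.eval, View.setI_iv,
              View.setV_iv, VExp.eval, View.setV_vv, true_and, if_true, h9 a ha b hb]
            by_cases h1 : a = k ∧ b = m
            · obtain ⟨rfl, rfl⟩ := h1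
              simp
            · have h2 : ((a < k ∧ b < n) ∨ (a = k ∧ b < m + 1)) ↔
                  ((a < k ∧ b < n) ∨ (a = k ∧ b < m)) := by omega
              simp only [h2]
              simp
              tauto
      · simp [hb'.1]
      · rintro ρ₁ ⟨h17, hb, ho, h9⟩
        have e : (ρ'.setI 17 k).iv 0 = n := by simp [hb'.1]
        simp only [IExp.eval, e] at hb h9
        have e1 : k * n + n = (k + 1) * n + 0 := by ring
        rw [e1] at hb
        refine ⟨h17, hb.setI (by norm_num) _, ho, fun a ha b hb => ?_⟩
        have h2 : ((a < k + 1 ∧ b < n) ∨ (a = k + 1 ∧ b < 0)) ↔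
            ((a < k ∧ b < n) ∨ (a = k ∧ b < n)) := by omega
        simp only [h2]
        exact h9 a ha b hb
    · simp [hρ.1.1]
    · rintro ρ₁ ⟨hb, ho, h9⟩
      simp only [IExp.eval, hρ.1.1] at hb h9
      refine ⟨hb, ho, fun a ha b hb => ?_⟩
      rw [h9 a ha b hb, pad]
      by_cases h1 : a < n ∧ b < n
      · simp [h1, tapeVec]
      · simp [h1]
  · simp only [Finset.sum_const, Finset.card_range, smul_eq_mul]
    have h1 : n * n * n ≤ n * 2 ^ d * 2 ^ d := by gcongr
    have h2 : 1 * 2 ^ d * 2 ^ d ≤ n * 2 ^ d * 2 ^ d := by gcongr; exact hn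
    have h3 : n ≤ n * n * n := by nlinarith [Nat.mul_pos hn hn]
    have h4 : n * n ≤ n * n * n := by nlinarith [Nat.mul_pos hn hn]
    nlinarith

/-- As the mean is symmetric, transposing the operator amounts to transposing the slices. The same
program, with the arrays of slices and of transposed slices interchanged, thus performs the second
half of each iteration. -/
lemma centered_transpose_eq (S : Tensor3 n) :
    ∑ i, (slice S i).transpose ⊗ₖ (slice S i).transpose - noiseMean n = (centered S).transpose := by
  rw [centered, Matrix.transpose_sub, transpose_noiseMean, sliceSquare, Matrix.transpose_sum]
  rfl

/-- The power iteration, scaled by the square root of `c n³ (var 3)`. -/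
def iterateProg (c : ℕ) : ℕ → Program :=
  seqC (setV 6 (.sqrt (.ofI (.const c * (.var 0 * .var 0 * .var 0) * .var 3)))) <|
  loopCode 19 (.var 3) (seqC (applyProg 7 8 9 2) (applyProg 8 7 2 9))

/-- The scale √(c n³ d) replaces a multiple of the threshold: the machine has no logarithm, and d =
⌈log₂ n⌉ is available and comparable to log n. -/
lemma spec_iterateProg {σ : View} {c : ℕ} {S : Tensor3 n}
    {g : EuclideanSpace ℝ (Fin n × Fin n)} (hn : 0 < n) (h : Base n d u T τ σ) (hnd : n ≤ 2 ^ d)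
    (h7 : ∀ i : Fin n, ∀ a < 2 ^ d, ∀ b < 2 ^ d, σ.arr 7 i a b =
      pad (fun a b => slice S i a b) a b)
    (h8 : ∀ i : Fin n, ∀ a < 2 ^ d, ∀ b < 2 ^ d, σ.arr 8 i a b =
      pad (fun a b => slice S i b a) a b)
    (h9 : ∀ a < 2 ^ d, ∀ b < 2 ^ d, σ.arr 9 0 a b = pad (fun a b => g (a, b)) a b) :
    Spec ω off (iterateProg c) σ (50 + 6000003 * (n * (d * 7 ^ d))) fun ρ => Base n d u T τ ρ ∧
      (∀ i < 9, i ≠ 2 → ρ.arr i = σ.arr i) ∧ ∀ a < 2 ^ d, ∀ b < 2 ^ d, ρ.arr 9 0 a b =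
        pad (fun a b => powIter √((c * n ^ 3 * d : ℕ) : ℝ) (centered S) g d (a, b)) a b := by
  set s := √((c * n ^ 3 * d : ℕ) : ℝ) with hs
  refine (Spec.seq (t := 30) (u := 8 + ∑ _ ∈ Finset.range d,
      (3000000 * (n * 7 ^ d) + 3000000 * (n * 7 ^ d) + 3)) (P := fun ρ => ρ = σ.setV 6 s)
    ((Spec.setV ?_).mono (by simp) fun _ h => h) ?_).mono ?_ fun _ h => h
  · have e : c * (n * n * n) * d = c * n ^ 3 * d := by ring
    simp only [VExp.eval, IExp.eval, h.1, h.3, hs, ← e]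
    rfl
  · rintro _ rfl
    have hb := h.setV (show 6 ≠ 1 by norm_num) s
    refine (Spec.loop (t := fun _ => 3000000 * (n * 7 ^ d) + 3000000 * (n * 7 ^ d))
      (fun k ρ => Keeps (fun i => i < 9 ∧ i ≠ 2) (σ.setV 6 s) ρ ∧
      ∀ a < 2 ^ d, ∀ b < 2 ^ d, ρ.arr 9 0 a b =
        pad (fun a b => powIter s (centered S) g k (a, b)) a b) ⟨Keeps.refl _ _, h9⟩ ?_).mono ?_ ?_
    · rintro k - ρ h19 ⟨hk, hI⟩
      have hρ := (hb.keeps hk (by norm_num)).setI (x := 19) (by norm_num) k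
      refine Spec.seq (spec_applyProg (M := fun i => slice S i) (x := powIter s (centered S) g k)
        (s := s) hn (by norm_num) (by norm_num) (by norm_num) (by norm_num) (by norm_num) hρ hnd
        (by simp [hk.vv]) ?_ ?_ ?_) ?_
      · intro i a ha b hb
        rw [View.setI_arr, hk.arr 7 (by norm_num)]
        exact h7 i a ha b hb
      · intro i a ha b hb
        rw [View.setI_arr, hk.arr 8 (by norm_num)]
        exact h8 i a ha b hb
      · exact hI
      · rintro ρ₁ ⟨hk1, hI1⟩
        have hρ1 := hρ.keeps hk1 (by norm_num)
        refine (spec_applyProg (M := fun i => (slice S i).transpose)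
          (x := s⁻¹ • op (centered S) (powIter s (centered S) g k)) (s := s) hn (by norm_num)
          (by norm_num) (by norm_num) (by norm_num) (by norm_num) hρ1 hnd
          (by simp [hk1.vv, hk.vv]) ?_ ?_ ?_).mono le_rfl ?_
        · intro i a ha b hb
          rw [hk1.arr 8 (by norm_num), View.setI_arr, hk.arr 8 (by norm_num)]
          exact h8 i a ha b hb
        · intro i a ha b hb
          rw [hk1.arr 7 (by norm_num), View.setI_arr, hk.arr 7 (by norm_num)]
          exact h7 i a ha b hb
        · exact hI1
        · rintro ρ₂ ⟨hk2, hI2⟩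
          refine ⟨?_, ⟨fun x hx => ?_, ?_, ?_, ?_, ?_⟩, ?_⟩
          · rw [hk2.iv 19 (by norm_num), hk1.iv 19 (by norm_num)]
            simp
          · rcases eq_or_ne x 19 with rfl | hx'
            · simp
            · rw [View.setI_iv, if_neg hx', hk2.iv x hx, hk1.iv x hx, View.setI_iv, if_neg hx',
                hk.iv x hx]
          · exact hk2.vv.trans (hk1.vv.trans hk.vv)
          · exact hk2.raw.trans (hk1.raw.trans hk.raw)
          · exact hk2.used.trans (hk1.used.trans hk.used)
          · intro i hi
            exact (hk2.arr i (by omega)).trans ((hk1.arr i (by omega)).trans (hk.arr i hi))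
          · intro a ha b hb
            rw [View.setI_arr, hI2 a ha b hb, centered_transpose_eq]
            rfl
    · simp [h.3]
    · rintro ρ ⟨hk, hI⟩
      simp only [IExp.eval, View.setV_iv, h.3] at hI
      exact ⟨hb.keeps hk (by norm_num), fun i hi hi2 => hk.arr i ⟨hi, hi2⟩, hI⟩
  · simp only [Finset.sum_const, Finset.card_range, smul_eq_mul]
    have h1 : d ≤ n * (d * 7 ^ d) := by
      have : 1 ≤ n * 7 ^ d := Nat.mul_pos hn (by positivity)
      nlinarith
    nlinarith

/-- Copy the vector in an array to the output cells. -/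
def outProg (i : ℕ) : ℕ → Program :=
  loopCode 17 (.var 0) (out (.var 17) (.arr (.const i) (.var 17) 0 0))

lemma spec_outProg {σ : View} {i : ℕ} (h : σ.iv 0 = n) (hoff : n ≤ off) :
    Spec ω off (outProg i) σ (300 * n + 8) fun ρ => ρ.iv = σ.iv ∧ ρ.arr = σ.arr ∧
      ∀ a < n, ρ.raw a = σ.arr i a 0 0 := by
  refine (Spec.loop (t := fun _ => 297) (fun k ρ => ρ.iv = σ.iv ∧ ρ.arr = σ.arr ∧
    ∀ a < k, ρ.raw a = σ.arr i a 0 0) ⟨rfl, rfl, by simp⟩ ?_).mono ?_ ?_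
  · rintro k hk ρ - ⟨h1, h2, h3⟩
    have hk : k < n := by simpa [h] using hk
    refine (Spec.out (by simp; omega) ⟨?_, ?_, ?_, ?_⟩).mono (by simp [IExp.addr]) fun _ h => h
    · simp
    · funext y
      simp only [View.setI_iv, h1]
      split_ifs <;> simp_all
    · simp [h2]
    · intro a ha
      rcases Nat.lt_succ_iff_lt_or_eq.mp ha with h | rfl
      · simpa [h.ne] using h3 a h
      · simp [h2]
  · simp [h]
    omega
  · rintro ρ ⟨h1, h2, h3⟩
    rw [IExp.eval, h] at h3
    exact ⟨h1, h2, h3⟩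

/-- Set `var 0` to `1` if the squared norm of the array `9` is at most `n ^ 12`. -/
def testProg : ℕ → Program :=
  seqC (setV 7 (.sum 13 (.var 0) (.sum 14 (.var 0)
    (.arr 9 0 (.var 13) (.var 14) * .arr 9 0 (.var 13) (.var 14))))) <|
  seqC (setI 4 (.var 0 * .var 0 * .var 0)) <|
  ifLe (.var 7) (.ofI (.var 4 * .var 4 * .var 4 * .var 4)) (setI 0 1) skipC

lemma spec_testProg {σ : View} {y : EuclideanSpace ℝ (Fin n × Fin n)} (hn : 2 ≤ n)
    (h : σ.iv 0 = n) (h9 : ∀ a b : Fin n, σ.arr 9 0 a b = y (a, b)) :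
    Spec ω off testProg σ (1000 * n ^ 2) fun ρ => ρ.raw = σ.raw ∧
      (ρ.iv 0 = 1 ↔ ‖y‖ ^ 2 ≤ (n : ℝ) ^ 12) := by
  refine (Spec.seq (t := 600 * n ^ 2) (u := 50) (P := fun ρ => ρ = σ.setV 7 (‖y‖ ^ 2))
    ((Spec.setV ?_).mono ?_ fun _ h => h) ?_).mono ?_ fun _ h => h
  · congr 1
    rw [norm_sq_eq_sum, Fintype.sum_prod_type]
    simp [Finset.sum_range, h, h9, sq]
  · simp [h, IExp.addr]
    nlinarith
  · rintro _ rfl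
    refine Spec.seq (t := 10) (u := 40) (P := fun ρ => ρ = (σ.setV 7 (‖y‖ ^ 2)).setI 4 (n * n * n))
      ((Spec.setI (by simp [h])).mono (by simp) fun _ h => h) ?_
    have e : (n : ℝ) * n * n * (n * n * n) * (n * n * n) * (n * n * n) = (n : ℝ) ^ 12 := by ring
    rintro _ rfl
    refine (Spec.ifLe (t := 3) (fun hle => ?_) fun hle => ?_).mono (by simp) fun _ h => h
    · refine (Spec.setI ⟨by simp, ?_⟩).mono (by simp) fun _ h => h
      simp [e] at hle
      simpa using hle
    · refine (Spec.skip ⟨by simp, ?_⟩).mono (by norm_num) fun _ h => h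
      simp [e] at hle
      -- On rejection index register 0 still contains n. As n ≥ 2, this is not read as CERTIFY.
      have h1 : n ≠ 1 := by omega
      simpa [h, h1] using hle
  · nlinarith

/-- The certification program. -/
def certifyProg (c : ℕ) : ℕ → Program :=
  seqC recoverProg <| seqC signProg <| seqC residualProg <| seqC sampleProg <|
  seqC (iterateProg c) <| seqC (outProg 6) testProg

/-- Where fast multiplication pays: the gap between 7^d and 8^d, the latter at most (2n)³, absorbs
the factor d of the iteration count. -/
lemma mul_seven_pow_le (d : ℕ) : d * 7 ^ d ≤ 7 * 8 ^ d := by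
  induction d with
  | zero => simp
  | succ d ih =>
    have : 7 ^ d ≤ 8 ^ d := Nat.pow_le_pow_left (by norm_num) d
    rw [pow_succ, pow_succ]
    nlinarith

lemma spec_certifyProg {σ : View} {c : ℕ} (hn : 2 ≤ n) (h1 : n ≤ 2 ^ d) (h2 : 2 ^ d < 2 * n)
    (hoff : n ≤ off) (h0 : σ.iv 0 = n) (hτ : σ.vv 1 = τ) (hu : σ.used = 0)
    (hT : ∀ i j k : Fin n, σ.raw ((i * n + j) * n + k) = T (i, j, k)) :
    Spec ω off (certifyProg c) σ (400000000 * n ^ 4) fun ρ =>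
      (∀ i : Fin n, ρ.raw i = signed T (powerVector (gram T) d) i) ∧
      (ρ.iv 0 = 1 ↔ ‖powIter √((c * n ^ 3 * d : ℕ) : ℝ)
        (centered (T - τ • cube (signed T (powerVector (gram T) d)))) (tapeVec n ω) d‖ ^ 2 ≤
          (n : ℝ) ^ 12) := by
  have hn0 : 0 < n := by omega
  refine (Spec.seq (spec_recoverProg hn h1 h2 h0 hτ hu hT) fun ρ hρ =>
    Spec.seq (spec_signProg hn0 hρ.1 hρ.2) fun ρ hρ =>
    Spec.seq (spec_residualProg hn0 hρ.1 hρ.2) fun ρ₁ hρ₁ =>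
    Spec.seq (spec_sampleProg hn0 hρ₁.1 h1) fun ρ₂ hρ₂ =>
    Spec.seq (spec_iterateProg (c := c) (S := T - τ • cube (signed T (powerVector (gram T) d)))
      (g := tapeVec n ω) hn0 hρ₂.1 h1 ?_ ?_ hρ₂.2.2) fun ρ₃ hρ₃ =>
    Spec.seq (spec_outProg hρ₃.1.1 hoff) fun ρ₄ hρ₄ =>
    (spec_testProg hn (hρ₄.1 ▸ hρ₃.1.1) ?_).mono le_rfl fun ρ₅ hρ₅ => ⟨?_, hρ₅.2⟩).mono ?_
    fun _ h => h
  · intro i a ha b hb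
    rw [hρ₂.2.1 7 (by norm_num)]
    exact hρ₁.2.2.1 i a ha b hb
  · intro i a ha b hb
    rw [hρ₂.2.1 8 (by norm_num)]
    exact hρ₁.2.2.2 i a ha b hb
  · intro a b
    rw [hρ₄.2.1, hρ₃.2.2 a (a.2.trans_le h1) b (b.2.trans_le h1), pad_coe]
  · have e1 : n ≤ n ^ 4 := Nat.le_self_pow (by norm_num) n
    have e2 : n ^ 2 ≤ n ^ 4 := Nat.pow_le_pow_right hn0 (by norm_num)
    have e3 : 16 ≤ n ^ 4 := Nat.pow_le_pow_left hn 4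
    have e4 : n * 2 ^ d * 2 ^ d ≤ 4 * n ^ 3 := by
      have : 2 ^ d * 2 ^ d ≤ (2 * n) * (2 * n) := Nat.mul_le_mul h2.le h2.le
      nlinarith
    have e5 : n ^ 3 ≤ n ^ 4 := Nat.pow_le_pow_right hn0 (by norm_num)
    have e6 : n * (d * 7 ^ d) ≤ 56 * n ^ 4 := by
      have h8 : 8 ^ d ≤ (2 * n) ^ 3 := by
        calc 8 ^ d = (2 ^ d) ^ 3 := by rw [← pow_mul, mul_comm, pow_mul]; norm_num
          _ ≤ _ := Nat.pow_le_pow_left h2.le 3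
      calc n * (d * 7 ^ d) ≤ n * (7 * (2 * n) ^ 3) :=
            Nat.mul_le_mul_left n ((mul_seven_pow_le d).trans (Nat.mul_le_mul_left 7 h8))
        _ = 56 * n ^ 4 := by ring
    nlinarith
  · intro i
    rw [hρ₅.1, hρ₄.2.2 i i.2, hρ₃.2.1 6 (by norm_num) (by norm_num), hρ₂.2.1 6 (by norm_num),
      hρ₁.2.1 i]

end Certification

/-! ### The two programs -/

section Programs

variable {n : ℕ}

/-- Put `n³` into index register `1`. -/
def cubeProg : Program := .seq (.instr (.idxMul 1 0 0)) (.instr (.idxMul 1 1 0))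

/-- The recovery algorithm. -/
def recoveryProgram : Program := .seq cubeProg (seqC recoverProg (outProg 5) 0)

/-- The certification algorithm. -/
def certificationProgram (c : ℕ) : Program :=
  .seq (.seq cubeProg (.instr (.valAdd 2 1 3))) (certifyProg c 0)

lemma le_two_pow_clog (n : ℕ) : n ≤ 2 ^ Nat.clog 2 n := Nat.le_pow_clog (by norm_num) n

lemma two_pow_clog_lt (hn : 2 ≤ n) : 2 ^ Nat.clog 2 n < 2 * n := by
  have h1 := Nat.pow_pred_clog_lt_self (b := 2) (by norm_num) hn
  have h2 : 0 < Nat.clog 2 n := Nat.clog_pos (by norm_num) hn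
  obtain ⟨m, hm⟩ := Nat.exists_eq_succ_of_ne_zero h2.ne'
  rw [hm] at h1 ⊢
  simp only [Nat.pred_succ, Nat.succ_eq_add_one] at h1 ⊢
  rw [pow_succ]
  omega

lemma input_valMem (l : List ℝ) (T : Tensor3 n) (i j k : Fin n) :
    (input n l T).valMem ((i * n + j) * n + k) = T (i, j, k) := by
  have h : ((i : ℕ) * n + j) * n + k =
      (finProdFinEquiv (i, finProdFinEquiv (j, k)) : Fin (n * (n * n))) := by
    simp [finProdFinEquiv]
    ring
  rw [h]
  simp only [input, Fin.is_lt, dif_pos, Fin.eta, Equiv.symm_apply_apply]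

lemma index_lt (i j k : Fin n) : ((i : ℕ) * n + j) * n + k < n * n * n := by
  have h : ((i : ℕ) * n + j) * n + k =
      (finProdFinEquiv (i, finProdFinEquiv (j, k)) : Fin (n * (n * n))) := by
    simp [finProdFinEquiv]
    ring
  rw [h, mul_assoc]
  exact Fin.is_lt _

lemma recoveryProgram_exec (hn : 2 ≤ n) (ε : ℝ) (T : Tensor3 n) (ω : ℕ → ℝ) :
    ∃ (t : ℕ) (s : State), Exec ω recoveryProgram (input n [ε] T) t s ∧ t ≤ 30000 * n ^ 4 ∧
      outVector n s = powerVector (gram T) (Nat.clog 2 n) := by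
  have hoff : n ≤ n * n * n := by nlinarith [Nat.mul_pos (show 0 < n by omega) (show 0 < n by omega)]
  have h : Runs ω recoveryProgram (input n [ε] T) (1 + 1 + (20000 * n ^ 4 + (300 * n + 8)))
      fun s => outVector n s = powerVector (gram T) (Nat.clog 2 n) := by
    refine Runs.seq (Runs.seq (Runs.instr rfl) fun s hs => Runs.instr (P := fun s =>
      s = (input n [ε] T).setIdx 1 (n * n * n)) ?_) ?_
    · subst hs
      simp [Instr.run, State.setIdx, input]
    · rintro _ rfl
      refine (Spec.seq (off := n * n * n) (spec_recoverProg (τ := 0) (u := 0) (T := T) hn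
        (le_two_pow_clog n) (two_pow_clog_lt hn) ?_ ?_ ?_ ?_) (fun ρ hρ =>
        (spec_outProg (i := 5) hρ.1.1 hoff).mono le_rfl fun ρ' hρ' => (?_ : ∀ a : Fin n,
          ρ'.raw a = powerVector (gram T) (Nat.clog 2 n) a)) 0 _ ?_ rfl).mono le_rfl ?_
      · simp [view, State.setIdx, input]
      · simp [view, State.setIdx, input]
      · simp [view, State.setIdx, input]
      · intro i j k
        rw [← input_valMem [ε] T i j k]
        exact if_pos (index_lt i j k)
      · intro a
        rw [hρ'.2.2 a a.2, hρ.2 a]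
      · simp [State.setIdx]
      · rintro s ⟨hs, -⟩
        ext a
        rw [← hs a]
        exact (if_pos (a.2.trans_le hoff)).symm
  obtain ⟨t, s, ht, hs, hP⟩ := h
  refine ⟨t, s, hs, ?_, hP⟩
  have e1 : n ≤ n ^ 4 := Nat.le_self_pow (by norm_num) n
  omega

lemma certificationProgram_exec (hn : 2 ≤ n) (c : ℕ) (ε τ : ℝ) (T : Tensor3 n) (ω : ℕ → ℝ) :
    ∃ (t : ℕ) (s : State), Exec ω (certificationProgram c) (input n [ε, τ] T) t s ∧
      t ≤ 500000000 * n ^ 4 ∧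
      outVector n s = signed T (powerVector (gram T) (Nat.clog 2 n)) ∧
      (SaysCertify s ↔ ‖powIter √((c * n ^ 3 * Nat.clog 2 n : ℕ) : ℝ)
        (centered (T - τ • cube (outVector n s))) (tapeVec n ω) (Nat.clog 2 n)‖ ^ 2 ≤
          (n : ℝ) ^ 12) := by
  have hoff : n ≤ n * n * n := by nlinarith [Nat.mul_pos (show 0 < n by omega) (show 0 < n by omega)]
  set v := signed T (powerVector (gram T) (Nat.clog 2 n)) with hv
  have h : Runs ω (certificationProgram c) (input n [ε, τ] T) (1 + 1 + 1 + 400000000 * n ^ 4)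
      fun s => outVector n s = v ∧
        (SaysCertify s ↔ ‖powIter √((c * n ^ 3 * Nat.clog 2 n : ℕ) : ℝ)
          (centered (T - τ • cube v)) (tapeVec n ω) (Nat.clog 2 n)‖ ^ 2 ≤ (n : ℝ) ^ 12) := by
    refine Runs.seq (Runs.seq (Runs.seq (Runs.instr rfl) fun s hs => Runs.instr (P := fun s =>
      s = (input n [ε, τ] T).setIdx 1 (n * n * n)) ?_) fun s hs => Runs.instr (P := fun s =>
        s = ((input n [ε, τ] T).setIdx 1 (n * n * n)).setVal 2 τ) ?_) ?_
    · subst hs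
      simp [Instr.run, State.setIdx, input]
    -- The input places τ in real register 1, a scratch register. Real register 3 is initially 0, so
    -- the addition copies τ into register 2, that is, variable 1.
    · subst hs
      simp [Instr.run, State.setIdx, State.setVal, input]
    · rintro _ rfl
      refine (spec_certifyProg (off := n * n * n) (c := c) (T := T) (τ := τ) hn
        (le_two_pow_clog n) (two_pow_clog_lt hn) hoff ?_ ?_ ?_ ?_ 0 _ ?_ rfl).mono le_rfl ?_
      · simp [view, State.setIdx, State.setVal, input]
      · simp [view, State.setIdx, State.setVal, input]
      · simp [view, State.setIdx, State.setVal, input]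
      · intro i j k
        rw [← input_valMem [ε, τ] T i j k]
        exact if_pos (index_lt i j k)
      · simp [State.setIdx, State.setVal]
      · rintro s ⟨⟨hs, hs'⟩, -⟩
        refine ⟨?_, hs'⟩
        ext a
        rw [hv, ← hs a]
        exact (if_pos (a.2.trans_le hoff)).symm
  obtain ⟨t, s, ht, hs, hP, hP'⟩ := h
  refine ⟨t, s, hs, ?_, hP, ?_⟩
  · have e1 : n ≤ n ^ 4 := Nat.le_self_pow (by norm_num) n
    omega
  · rw [hP]
    exact hP'

end Programs

/-! ### Accuracy of the power iteration -/

section PowerIteration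

/-- For a log-convex sequence starting at 1 the roots a_k^{1/k} do not decrease; equivalently, the
last ratio a_{k+1}/a_k is at least the geometric mean of all ratios so far. -/
lemma pow_le_pow_of_logConvex {a : ℕ → ℝ} (h0 : a 0 = 1) (hpos : ∀ k, 0 ≤ a k)
    (h : ∀ k, a (k + 1) ^ 2 ≤ a k * a (k + 2)) (k : ℕ) : a k ^ (k + 1) ≤ a (k + 1) ^ k := by
  induction k with
  | zero => simp [h0]
  | succ k ih =>
    rcases (hpos (k + 1)).eq_or_lt with h1 | h1
    · rw [← h1, zero_pow (by omega)]
      exact pow_nonneg (hpos _) _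
    · have h2 : (a (k + 1) ^ 2) ^ (k + 1) ≤ a (k + 1) ^ k * a (k + 2) ^ (k + 1) := by
        refine (pow_le_pow_left₀ (by positivity) (h k) _).trans ?_
        rw [mul_pow]
        exact mul_le_mul_of_nonneg_right ih (pow_nonneg (hpos _) _)
      have h3 : (a (k + 1) ^ 2) ^ (k + 1) = a (k + 1) ^ k * a (k + 1) ^ (k + 1 + 1) := by ring
      rw [h3] at h2
      exact le_of_mul_le_mul_left h2 (pow_pos h1 k)

variable {ι : Type*} [Fintype ι] [DecidableEq ι]

lemma norm_op_sq_le_sum (M : Matrix ι ι ℝ) {w : EuclideanSpace ℝ ι} (hw : ‖w‖ = 1) :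
    ‖op M w‖ ^ 2 ≤ ∑ j, ∑ i, M i j ^ 2 := by
  rw [norm_sq_eq_sum, Finset.sum_comm]
  refine Finset.sum_le_sum fun i _ => ?_
  rw [op_apply]
  refine (Finset.sum_mul_sq_le_sq_mul_sq _ _ _).trans ?_
  rw [← norm_sq_eq_sum w, hw]
  simp

lemma norm_pow_le_norm_op_pow [Nonempty ι] {B : Matrix ι ι ℝ} (hB : B.transpose = B) (m : ℕ) :
    ∃ w : EuclideanSpace ℝ ι, ‖w‖ = 1 ∧ ‖op (B ^ m) w‖ ^ 2 = (‖B‖ ^ 2) ^ m := by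
  obtain ⟨w, hw, h⟩ := exists_norm_sq_eigenvector B
  refine ⟨w, hw, ?_⟩
  have h1 : ∀ m, op ((B.transpose * B) ^ m) w = (‖B‖ ^ 2) ^ m • w := by
    intro m
    induction m with
    | zero => simp
    | succ m ih =>
      rw [pow_succ, op_mul_apply, h, map_smul, ih, smul_smul, pow_succ (‖B‖ ^ 2) m, mul_comm]
  have h2 : (B.transpose * B) ^ m = (B ^ m).transpose * B ^ m := by
    rw [Matrix.transpose_pow, hB, ← sq, ← pow_mul, ← pow_add, two_mul]
  rw [← real_inner_self_eq_norm_sq, ← inner_op_transpose, ← op_mul_apply, ← h2, h1,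
    real_inner_smul_left, real_inner_self_eq_norm_sq, hw]
  simp

variable {n : ℕ}

lemma column_eq_op (B : Matrix (Fin n) (Fin n) ℝ) (j : Fin n) :
    column B j = op B (EuclideanSpace.single j 1) := by
  ext i
  simp [column, op_apply]

/-- Some column of a power of a symmetric matrix grows fast in the last step. -/
lemma exists_growing_column {B : Matrix (Fin n) (Fin n) ℝ} (hB : B.transpose = B) (hB0 : B ≠ 0)
    {d : ℕ} (hn : 0 < n) (hd : n ≤ 2 ^ d) :
    ∃ j < n, ‖B‖ ^ 2 / 2 ≤ ‖column (B ^ (d + 1)) j‖ ^ 2 / ‖column (B ^ d) j‖ ^ 2 := by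
  have : Nonempty (Fin n) := ⟨⟨0, hn⟩⟩
  have hβ : 0 < ‖B‖ := norm_pos_iff.mpr hB0
  obtain ⟨w, hw, h⟩ := norm_pow_le_norm_op_pow hB (d + 1)
  -- The Frobenius norm of B^(d+1) dominates ‖B‖^(d+1), so some column carries at least a fraction
  -- 1/n of its square.
  have h1 : (‖B‖ ^ 2) ^ (d + 1) ≤ ∑ j : Fin n, ‖column (B ^ (d + 1)) j‖ ^ 2 := by
    rw [← h]
    refine (norm_op_sq_le_sum _ hw).trans (le_of_eq (Finset.sum_congr rfl fun j _ => ?_))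
    rw [norm_sq_eq_sum]
    simp [column]
  obtain ⟨j, -, hj⟩ := Finset.exists_le_of_sum_le (s := Finset.univ)
    (f := fun _ : Fin n => (‖B‖ ^ 2) ^ (d + 1) / n) (g := fun j => ‖column (B ^ (d + 1)) j‖ ^ 2)
    Finset.univ_nonempty (by
      simp only [Finset.sum_const, Finset.card_univ, Fintype.card_fin, nsmul_eq_mul]
      rwa [mul_div_cancel₀ _ (by positivity)])
  refine ⟨j, j.2, ?_⟩
  set a : ℕ → ℝ := fun k => ‖column (B ^ k) j‖ ^ 2 with ha
  have hsucc : ∀ k, column (B ^ (k + 1)) j = op B (column (B ^ k) j) := fun k => by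
    rw [column_eq_op, column_eq_op, pow_succ', op_mul_apply]
  -- By symmetry ‖B^(k+1) e‖² = ⟨B^k e, B^(k+2) e⟩, so Cauchy–Schwarz makes the squared norms
  -- log-convex.
  have hconv : a d ^ (d + 1) ≤ a (d + 1) ^ d := by
    refine pow_le_pow_of_logConvex ?_ (fun k => by positivity) (fun k => ?_) d
    · simp [ha, column_eq_op]
    · have e : a (k + 1) = ⟪column (B ^ k) j, column (B ^ (k + 2)) j⟫_ℝ := by
        rw [ha, hsucc (k + 1), ← inner_op_transpose, hB, ← hsucc, real_inner_self_eq_norm_sq]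
      have h4 := real_inner_mul_inner_self_le (column (B ^ k) (j : ℕ)) (column (B ^ (k + 2)) (j : ℕ))
      rw [real_inner_self_eq_norm_sq, real_inner_self_eq_norm_sq] at h4
      rw [e, sq]
      exact h4
  -- The loss 1/n is at most a factor 2 per step, since n ≤ 2^(d+1).
  have hm : (‖B‖ ^ 2 / 2) ^ (d + 1) ≤ a (d + 1) := by
    refine le_trans ?_ hj
    rw [div_pow]
    have h5 : (n : ℝ) ≤ 2 ^ (d + 1) := by
      have : n ≤ 2 ^ (d + 1) := hd.trans (Nat.pow_le_pow_right (by norm_num) (by omega))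
      exact_mod_cast this
    gcongr
  have hpos : 0 < a (d + 1) := lt_of_lt_of_le (by positivity) hm
  have hpos' : 0 < a d := by
    refine lt_of_le_of_ne (by positivity) fun h0 => ?_
    have h6 : column (B ^ d) (j : ℕ) = 0 := by simpa [ha] using h0.symm
    have h7 : a (d + 1) = 0 := by simp [ha, hsucc, h6]
    exact hpos.ne' h7
  change ‖B‖ ^ 2 / 2 ≤ a (d + 1) / a d
  refine (pow_le_pow_iff_left₀ (by positivity) (by positivity) (Nat.succ_ne_zero d)).mp ?_
  refine hm.trans ?_
  rw [div_pow, le_div_iff₀ (by positivity), pow_succ (a (d + 1)) d, mul_comm]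
  exact mul_le_mul_of_nonneg_right hconv hpos.le

lemma norm_powerVector (B : Matrix (Fin n) (Fin n) ℝ) (hn : 0 < n) (d : ℕ) :
    ‖powerVector B d‖ = 1 := by
  rw [powerVector, ← norm_sq_eq_sum, Real.sqrt_sq (norm_nonneg _)]
  split_ifs with h
  -- When the pivot column vanishes, the default is the first basis vector, so the output is a unit
  -- vector for every input.
  · have e : (WithLp.toLp 2 fun i : Fin n => if (i : ℕ) < 1 then (1 : ℝ) else 0) =
        EuclideanSpace.single ⟨0, hn⟩ 1 := by
      ext i
      simp [Fin.ext_iff]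
    rw [e]
    simp
  · have e : (WithLp.toLp 2 fun i : Fin n => column (B ^ (d + 1)) (pivot B d) i /
        ‖column (B ^ (d + 1)) (pivot B d)‖) =
        ‖column (B ^ (d + 1)) (pivot B d)‖⁻¹ • column (B ^ (d + 1)) (pivot B d) := by
      ext i
      simp [div_eq_inv_mul]
    rw [e, norm_smul, norm_inv, norm_norm, inv_mul_cancel₀ (not_le.mp h).ne']

/-- The power vector is the direction of `B y` where `‖B y‖` is not much smaller than
`‖B‖ ‖y‖`. -/
lemma exists_smul_powerVector_eq {B : Matrix (Fin n) (Fin n) ℝ} (hB : B.transpose = B) (hB0 : B ≠ 0)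
    {d : ℕ} (hn : 0 < n) (hd : n ≤ 2 ^ d) :
    ∃ y, 0 < ‖op B y‖ ∧ ‖B‖ ^ 2 / 2 * ‖y‖ ^ 2 ≤ ‖op B y‖ ^ 2 ∧
      ‖op B y‖ • powerVector B d = op B y := by
  have hβ : 0 < ‖B‖ := norm_pos_iff.mpr hB0
  obtain ⟨j, hj, h⟩ := exists_growing_column hB hB0 hn hd
  have h1 := h.trans (by
    simp only [norm_sq_eq_sum]
    exact le_argmaxIdx (fun j => (∑ i, column (B ^ (d + 1)) j i ^ 2) / ∑ i, column (B ^ d) j i ^ 2) hj)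
  change _ ≤ (∑ i, column (B ^ (d + 1)) (pivot B d) i ^ 2) / ∑ i, column (B ^ d) (pivot B d) i ^ 2 at h1
  rw [← norm_sq_eq_sum, ← norm_sq_eq_sum] at h1
  obtain ⟨J, hJ⟩ : ∃ J : Fin n, (J : ℕ) = pivot B d := ⟨⟨_, argmaxIdx_lt _ hn⟩, rfl⟩
  have hsucc : column (B ^ (d + 1)) (pivot B d) = op B (column (B ^ d) (pivot B d)) := by
    rw [← hJ, column_eq_op, column_eq_op, pow_succ', op_mul_apply]
  have hq : 0 < ‖op B (column (B ^ d) (pivot B d))‖ ^ 2 / ‖column (B ^ d) (pivot B d)‖ ^ 2 := by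
    rw [← hsucc]
    exact lt_of_lt_of_le (by positivity) h1
  have hy : ‖column (B ^ d) (pivot B d)‖ ^ 2 ≠ 0 := fun h0 => by simp [h0] at hq
  have hBy : 0 < ‖op B (column (B ^ d) (pivot B d))‖ := by
    refine lt_of_le_of_ne (norm_nonneg _) fun h0 => ?_
    simp [← h0] at hq
  refine ⟨column (B ^ d) (pivot B d), hBy, ?_, ?_⟩
  · rw [hsucc] at h1
    exact (le_div_iff₀ (lt_of_le_of_ne (by positivity) hy.symm)).mp h1
  · rw [powerVector, ← norm_sq_eq_sum, Real.sqrt_sq (norm_nonneg _), hsucc, if_neg (not_le.mpr hBy)]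
    ext i
    simp only [PiLp.smul_apply, smul_eq_mul]
    field_simp

/-- Accuracy for a perturbation of a matrix of rank one. -/
lemma inner_powerVector_sq_ge {B F : Matrix (Fin n) (Fin n) ℝ} (hB : B.transpose = B)
    {p : EuclideanSpace ℝ (Fin n)} {c η : ℝ} (hc : 0 < c) (hp : ‖p‖ = 1)
    (hBF : B = c • Matrix.vecMulVec p p + F) (hF : ‖F‖ ≤ η * c) {d : ℕ} (hn : 0 < n)
    (hd : n ≤ 2 ^ d) : 1 - 9 * η ^ 2 ≤ ⟪powerVector B d, p⟫_ℝ ^ 2 := by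
  have hη0 : 0 ≤ η := by
    by_contra h
    nlinarith [norm_nonneg F]
  -- Here 9 η² > 1 and the claim is vacuous.
  by_cases hη : 1 / 2 ≤ η
  · nlinarith [sq_nonneg ⟪powerVector B d, p⟫_ℝ]
  have happ : ∀ y, op B y = (c * ⟪p, y⟫_ℝ) • p + op F y := fun y => by
    rw [hBF, op, map_add, add_apply, map_smul, smul_apply]
    change c • op (Matrix.vecMulVec p p) y + op F y = _
    rw [op_vecMulVec, smul_smul]
  have hnorm : c / 2 ≤ ‖B‖ := by
    have h1 := norm_op_apply_le B p
    have h2 := norm_op_apply_le F p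
    have h3 := norm_sub_le (op B p) (op F p)
    have h4 : op B p - op F p = c • p := by
      rw [happ, real_inner_self_eq_norm_sq, hp, one_pow, mul_one, add_sub_cancel_right]
    rw [h4, norm_smul, hp, mul_one, Real.norm_of_nonneg hc.le] at h3
    rw [hp, mul_one] at h1 h2
    nlinarith
  have hB0 : B ≠ 0 := fun h0 => by
    rw [h0, norm_zero] at hnorm
    linarith
  obtain ⟨y, hpos, hy, hu⟩ := exists_smul_powerVector_eq hB hB0 hn hd
  have hδ : ‖op F y‖ ≤ (3 * η) * ‖op B y‖ := by
    -- From ‖B y‖ ≥ ‖B‖‖y‖/√2 and ‖B‖ ≥ c/2, as 2√2 < 3. The last multiplication by `B` therefore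
    -- leaves a relative error of at most 3η, whatever `y` was.
    have h1 : c / 3 * ‖y‖ ≤ ‖op B y‖ := by
      refine (pow_le_pow_iff_left₀ (by positivity) (norm_nonneg _) two_ne_zero).mp (le_trans ?_ hy)
      have : (c / 2) ^ 2 ≤ ‖B‖ ^ 2 := by gcongr
      have h5 : (c / 3) ^ 2 ≤ ‖B‖ ^ 2 / 2 := by nlinarith
      rw [mul_pow]
      gcongr
    have h2 := norm_op_apply_le F y
    have h3 : ‖F‖ * ‖y‖ ≤ η * c * ‖y‖ := by gcongr
    nlinarith
  have := one_sub_inner_sq_le_of_smul_eq hp (norm_powerVector B hn d) hpos (hu.trans (happ y)) hδ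
  nlinarith

/-- The constant, larger than needed, is the one of the exact algorithm, so that the same residual
estimate serves both. -/
lemma inner_powerVector_spiked_sq_ge (hn : 2 ≤ n) {K τ : ℝ} (hK : 0 ≤ K) (hτ : 0 < τ)
    (hle : noiseLevel n ≤ τ) {v₀ : EuclideanSpace ℝ (Fin n)} (hv₀ : ‖v₀‖ = 1) {A : Tensor3 n}
    (hA : NoiseBound K A) {d : ℕ} (hd : n ≤ 2 ^ d) :
    1 - 32 * (3 * K + 2) ^ 2 * (noiseLevel n / τ) ^ 2 ≤
      ⟪powerVector (gram (spiked τ v₀ A)) d, v₀⟫_ℝ ^ 2 := by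
  have h := inner_powerVector_sq_ge (transpose_gram _) (sq_pos_of_pos hτ) hv₀
    (gram_spiked τ hv₀ A) (norm_gram_spiked_error_le hn hK hτ hle hv₀ hA) (show 0 < n by omega) hd
  nlinarith [sq_nonneg ((3 * K + 2) * (noiseLevel n / τ))]

lemma norm_signed (T : Tensor3 n) (v : EuclideanSpace ℝ (Fin n)) : ‖signed T v‖ = ‖v‖ := by
  rw [signed]
  split_ifs <;> simp

lemma inner_signed_sq (T : Tensor3 n) (v w : EuclideanSpace ℝ (Fin n)) :
    ⟪signed T v, w⟫_ℝ ^ 2 = ⟪v, w⟫_ℝ ^ 2 := by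
  rw [signed]
  split_ifs <;> simp

lemma cubicForm_neg (T : Tensor3 n) (v : EuclideanSpace ℝ (Fin n)) :
    cubicForm T (-v) = -cubicForm T v := by
  simp [cubicForm]

lemma cubicForm_signed_nonneg (T : Tensor3 n) (v : EuclideanSpace ℝ (Fin n)) :
    0 ≤ cubicForm T (signed T v) := by
  rw [signed]
  split_ifs with h
  · simpa using h
  · rw [neg_one_smul, cubicForm_neg]
    linarith

end PowerIteration

/-! ### Testing the operator norm by randomized power iteration -/

section NormTest

variable {ι : Type*} [Fintype ι] [DecidableEq ι]

/-- CᵀC is symmetric, so the component along an eigenvector is multiplied by β/s² in each step,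
independently of the other components. -/
lemma inner_powIter {C : Matrix ι ι ℝ} {w : EuclideanSpace ℝ ι} {β : ℝ}
    (hw : op (C.transpose * C) w = β • w) (s : ℝ) (g : EuclideanSpace ℝ ι) (k : ℕ) :
    ⟪powIter s C g k, w⟫_ℝ = (β / s ^ 2) ^ k * ⟪g, w⟫_ℝ := by
  induction k with
  | zero => simp [powIter]
  | succ k ih =>
    rw [powIter, map_smul, ← op_mul_apply, real_inner_smul_left, real_inner_smul_left]
    have h : ⟪op (C.transpose * C) (powIter s C g k), w⟫_ℝ = β * ⟪powIter s C g k, w⟫_ℝ := by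
      rw [← inner_op_transpose', Matrix.transpose_mul, Matrix.transpose_transpose, hw,
        real_inner_smul_right]
    rw [h, ih, pow_succ]
    ring

lemma norm_powIter_le {C : Matrix ι ι ℝ} {s : ℝ} (hs : ‖C‖ ≤ s) (g : EuclideanSpace ℝ ι) (k : ℕ) :
    ‖powIter s C g k‖ ≤ ‖g‖ := by
  have hstep : ∀ (M : Matrix ι ι ℝ) (x : EuclideanSpace ℝ ι), ‖M‖ ≤ s → ‖s⁻¹ • op M x‖ ≤ ‖x‖ := by
    intro M x hM
    have hs0 : 0 ≤ s := (norm_nonneg _).trans hM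
    rw [norm_smul, norm_inv, Real.norm_of_nonneg hs0]
    rcases hs0.eq_or_lt with rfl | hs1
    · simp
    · rw [inv_mul_le_iff₀ hs1]
      exact (norm_op_apply_le M x).trans (by gcongr)
  induction k with
  | zero => rfl
  | succ k ih =>
    exact ((hstep _ _ ((norm_transpose_eq C).trans_le hs)).trans (hstep _ _ hs)).trans ih

/-- The initial component is at least n^{−10} and the final one at most n⁶, so (‖C‖²/s²)^d ≤ n^{16}
≤ 2^{16d}. The d-th root turns polynomial losses into a constant. -/
lemma norm_sq_le_of_powIter [Nonempty ι] {C : Matrix ι ι ℝ} {w : EuclideanSpace ℝ ι} (hw1 : ‖w‖ = 1)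
    (hw : op (C.transpose * C) w = ‖C‖ ^ 2 • w) {s : ℝ} (hs : 0 < s) {g : EuclideanSpace ℝ ι}
    {n d : ℕ} (hn : 0 < n) (hd0 : d ≠ 0) (hd : n ≤ 2 ^ d)
    (hg : ((n : ℝ) ^ 10)⁻¹ ≤ |⟪g, w⟫_ℝ|) (ht : ‖powIter s C g d‖ ^ 2 ≤ (n : ℝ) ^ 12) :
    ‖C‖ ^ 2 ≤ 2 ^ 16 * s ^ 2 := by
  have hn' : (0 : ℝ) < n := by exact_mod_cast hn
  have h1 : ‖powIter s C g d‖ ≤ (n : ℝ) ^ 6 := by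
    refine (pow_le_pow_iff_left₀ (norm_nonneg _) (by positivity) two_ne_zero).mp (ht.trans_eq ?_)
    ring
  have h2 : |⟪powIter s C g d, w⟫_ℝ| ≤ (n : ℝ) ^ 6 := by
    refine (abs_real_inner_le_norm _ _).trans ?_
    rwa [hw1, mul_one]
  rw [inner_powIter hw, abs_mul, abs_of_nonneg (by positivity)] at h2
  have h3 : (‖C‖ ^ 2 / s ^ 2) ^ d ≤ (2 ^ 16) ^ d := by
    have h4 : (‖C‖ ^ 2 / s ^ 2) ^ d * ((n : ℝ) ^ 10)⁻¹ ≤ (n : ℝ) ^ 6 :=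
      (mul_le_mul_of_nonneg_left hg (by positivity)).trans h2
    rw [mul_inv_le_iff₀ (by positivity), ← pow_add] at h4
    refine h4.trans ?_
    have h5 : (n : ℝ) ≤ 2 ^ d := by exact_mod_cast hd
    calc (n : ℝ) ^ (6 + 10) ≤ (2 ^ d) ^ (6 + 10) := by gcongr
      _ = _ := by rw [← pow_mul, ← pow_mul, mul_comm]
  have h6 := (pow_le_pow_iff_left₀ (by positivity) (by positivity) hd0).mp h3
  rwa [div_le_iff₀ (by positivity)] at h6

end NormTest

/-! ### Random vectors drawn from the tape -/

section Tape

variable {n : ℕ}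

instance : IsProbabilityMeasure tape := by
  unfold tape
  infer_instance

instance (n : ℕ) : IsProbabilityMeasure (noise n) := by
  unfold noise
  infer_instance

lemma index_injective (n : ℕ) :
    Function.Injective fun p : Fin n × Fin n => (p.1 : ℕ) * n + p.2 := by
  intro p q h
  have h1 : (finProdFinEquiv p : ℕ) = finProdFinEquiv q := by
    simpa [finProdFinEquiv, mul_comm, add_comm] using h
  exact finProdFinEquiv.injective (Fin.ext h1)

lemma map_tape (n : ℕ) :
    tape.map (fun ω (p : Fin n × Fin n) => ω (p.1 * n + p.2)) =
      Measure.pi fun _ => gaussianReal 0 1 := by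
  rw [tape, Measure.map_infinitePi_infinitePi_of_inj (index_injective n), Measure.infinitePi_eq_pi]

/-- The component along a fixed unit vector is a standard Gaussian, and its density is bounded. -/
lemma tape_abs_inner_lt {w : EuclideanSpace ℝ (Fin n × Fin n)} (hw : ‖w‖ = 1) :
    tape {ω | |⟪tapeVec n ω, w⟫_ℝ| < ((n : ℝ) ^ 10)⁻¹} ≤ smallProb 1 n := by
  have h1 : ∑ p, w p ^ 2 = 1 := by rw [← norm_sq_eq_sum, hw, one_pow]
  have h2 := pi_gaussianReal_abs_sum_lt (fun p => w p) h1 ((n : ℝ) ^ 10)⁻¹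
  rw [← map_tape, Measure.map_apply (by fun_prop)
    (measurableSet_lt (by fun_prop) measurable_const)] at h2
  simpa [smallProb, inner_eq_sum, tapeVec, mul_comm] using h2

/-- Markov's inequality: the mean of the squared norm is n², and n²/n^{12} = n^{−10}. -/
lemma tape_lt_norm_sq (hn : 0 < n) :
    tape {ω | (n : ℝ) ^ 12 < ‖tapeVec n ω‖ ^ 2} ≤ smallProb 1 n := by
  have hn' : (0 : ℝ) < n := by exact_mod_cast hn
  have hint : ∀ k : ℕ, ∫⁻ ω, ENNReal.ofReal (ω k ^ 2) ∂tape = 1 := by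
    intro k
    have h1 := (measurePreserving_eval_infinitePi (fun _ : ℕ => gaussianReal 0 1) k).lintegral_comp
      (f := fun x : ℝ => ENNReal.ofReal (x ^ 2)) (by fun_prop)
    rw [tape]
    refine h1.trans ?_
    have h2 : Integrable (fun x : ℝ => x ^ 2) (gaussianReal 0 1) :=
      (memLp_id_gaussianReal' 2 (by simp)).integrable_sq
    rw [← ofReal_integral_eq_lintegral_ofReal h2 (.of_forall fun x => sq_nonneg x),
      integral_sq_gaussianReal, ENNReal.ofReal_one]
  have hsum : ∫⁻ ω, ENNReal.ofReal (‖tapeVec n ω‖ ^ 2) ∂tape = ENNReal.ofReal ((n : ℝ) ^ 2) := by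
    have e : ∀ ω, ENNReal.ofReal (‖tapeVec n ω‖ ^ 2) =
        ∑ p : Fin n × Fin n, ENNReal.ofReal (ω (p.1 * n + p.2) ^ 2) := fun ω => by
      rw [norm_sq_eq_sum, ENNReal.ofReal_sum_of_nonneg fun _ _ => sq_nonneg _]
      rfl
    simp only [e]
    rw [lintegral_finsetSum _ fun p _ => by fun_prop]
    simp only [hint, Finset.sum_const, Finset.card_univ, Fintype.card_prod, Fintype.card_fin,
      nsmul_eq_mul, mul_one]
    rw [← Nat.cast_pow, ENNReal.ofReal_natCast, sq]
  have hmeas : Measurable fun ω : ℕ → ℝ => ENNReal.ofReal (‖tapeVec n ω‖ ^ 2) := by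
    simp only [norm_sq_eq_sum, tapeVec]
    fun_prop
  have hm := mul_meas_ge_le_lintegral (μ := tape) hmeas (ENNReal.ofReal ((n : ℝ) ^ 12))
  rw [hsum, mul_comm] at hm
  have hle : tape {ω | (n : ℝ) ^ 12 < ‖tapeVec n ω‖ ^ 2} ≤
      tape {ω | ENNReal.ofReal ((n : ℝ) ^ 12) ≤ ENNReal.ofReal (‖tapeVec n ω‖ ^ 2)} :=
    measure_mono fun ω hω => ENNReal.ofReal_le_ofReal (le_of_lt hω)
  refine hle.trans ((ENNReal.le_div_iff_mul_le (Or.inl ?_) (Or.inl ENNReal.ofReal_ne_top)).mpr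
    hm |>.trans_eq ?_)
  · simp only [ne_eq, ENNReal.ofReal_eq_zero, not_le]
    positivity
  · rw [← ENNReal.ofReal_div_of_pos (by positivity), smallProb]
    congr 1
    field_simp

lemma prod_tape_fst (S : Set (Tensor3 n)) : (noise n).prod tape {q | q.1 ∈ S} = noise n S := by
  have h : {q : Tensor3 n × (ℕ → ℝ) | q.1 ∈ S} = S ×ˢ Set.univ := by
    ext q
    simp
  rw [h, Measure.prod_prod, measure_univ, mul_one]

lemma prod_tape_snd (S : Set (ℕ → ℝ)) : (noise n).prod tape {q | q.2 ∈ S} = tape S := by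
  have h : {q : Tensor3 n × (ℕ → ℝ) | q.2 ∈ S} = Set.univ ×ˢ S := by
    ext q
    simp
  rw [h, Measure.prod_prod, measure_univ, one_mul]

lemma smallProb_mono {C D : ℝ} (h : C ≤ D) (n : ℕ) : smallProb C n ≤ smallProb D n :=
  ENNReal.ofReal_le_ofReal (by gcongr)

lemma smallProb_add {C D : ℝ} (hC : 0 ≤ C) (hD : 0 ≤ D) (n : ℕ) :
    smallProb C n + smallProb D n = smallProb (C + D) n := by
  rw [smallProb, smallProb, smallProb, ← ENNReal.ofReal_add (by positivity) (by positivity), add_div]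

end Tape

/-! ### Correctness of the two programs -/

section Correctness

variable {n : ℕ}

lemma log_le_clog (n : ℕ) : Real.log n ≤ Nat.clog 2 n := by
  rcases Nat.eq_zero_or_pos n with rfl | hn
  · simp
  have h1 : (n : ℝ) ≤ 2 ^ Nat.clog 2 n := by exact_mod_cast le_two_pow_clog n
  have h2 := Real.log_le_log (by exact_mod_cast hn) h1
  rw [Real.log_pow] at h2
  nlinarith [Real.log_two_lt_d9, (Nat.cast_nonneg (Nat.clog 2 n) : (0 : ℝ) ≤ _)]

lemma clog_le_log (hn : 2 ≤ n) : (Nat.clog 2 n : ℝ) ≤ 4 * Real.log n := by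
  have h1 : (2 : ℝ) ^ Nat.clog 2 n ≤ 2 * n := by exact_mod_cast (two_pow_clog_lt hn).le
  have h2 := Real.log_le_log (by positivity) h1
  rw [Real.log_pow, Real.log_mul (by norm_num) (by positivity)] at h2
  have h3 : Real.log 2 ≤ Real.log n := Real.log_le_log (by norm_num) (by exact_mod_cast hn)
  nlinarith [Real.log_two_gt_d9, (Nat.cast_nonneg (Nat.clog 2 n) : (0 : ℝ) ≤ _)]

lemma noiseLevel_div_le (hn : 2 ≤ n) {ε τ : ℝ} (hε : 0 < ε) (hτ : noiseLevel n / ε ≤ τ) :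
    0 < τ ∧ noiseLevel n / τ ≤ ε := by
  have h := noiseLevel_pos hn
  have hτ0 : 0 < τ := lt_of_lt_of_le (by positivity) hτ
  refine ⟨hτ0, ?_⟩
  rw [div_le_iff₀ hε] at hτ
  rw [div_le_iff₀ hτ0]
  linarith

lemma noiseLevel_div_sq_le (hn : 2 ≤ n) {ε τ : ℝ} (hε : 0 < ε) (hε1 : ε ≤ 1)
    (hτ : noiseLevel n / ε ≤ τ) : (noiseLevel n / τ) ^ 2 ≤ ε := by
  obtain ⟨hτ0, h⟩ := noiseLevel_div_le hn hε hτ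
  have h0 : 0 ≤ noiseLevel n / τ := div_nonneg (noiseLevel_pos hn).le hτ0.le
  nlinarith

/-- The constant in the accuracy of the recovered vector. -/
def recoveryConst (K : ℝ) : ℝ := 32 * (3 * K + 2) ^ 2

/-- The constant in the bound for the residual of a recovered spike. -/
def residualConst (K : ℝ) : ℝ :=
  10 * (8 * K + 5 * recoveryConst K + 9) ^ 2 + 6 * (8 * K + 5 * recoveryConst K + 9) * (K + 1) + K

lemma recoveryConst_nonneg (K : ℝ) : 0 ≤ recoveryConst K := by
  unfold recoveryConst
  positivity

lemma residualConst_pos {K : ℝ} (hK : 0 ≤ K) : 0 < residualConst K := by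
  have := recoveryConst_nonneg K
  unfold residualConst
  positivity

lemma norm_centered_residual_le_of_accurate (hn : 2 ≤ n) {K τ : ℝ} (hK : 0 ≤ K) (hτ : 0 < τ)
    {v₀ u : EuclideanSpace ℝ (Fin n)} (hv₀ : ‖v₀‖ = 1) (hu : ‖u‖ = 1) {A : Tensor3 n}
    (hA : NoiseBound K A) (h : 1 - recoveryConst K * (noiseLevel n / τ) ^ 2 ≤ ⟪u, v₀⟫_ℝ ^ 2)
    (hpos : 0 ≤ cubicForm (spiked τ v₀ A) u) :
    ‖centered (spiked τ v₀ A - τ • cube u)‖ ≤ residualConst K * threshold n :=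
  norm_centered_residual_le hn hK hτ hv₀ hu hA.1
    (mul_norm_sub_le_of_cubicForm_nonneg hn hK (recoveryConst_nonneg K) hτ hv₀ hu hA.1 h hpos)

/-- A vector as accurate as the exact outputs approximates all of them. -/
lemma approxRecovery_of_accurate (hn : 2 ≤ n) {C K ε τ : ℝ} (hK : 0 ≤ K) (hε : 0 < ε) (hε1 : ε ≤ 1)
    (hτ : noiseLevel n / ε ≤ τ) (hC : 4 * recoveryConst K ≤ C)
    {v₀ u : EuclideanSpace ℝ (Fin n)} (hv₀ : ‖v₀‖ = 1) (hu : ‖u‖ = 1) {A : Tensor3 n}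
    (hA : NoiseBound K A) (h : 1 - recoveryConst K * (noiseLevel n / τ) ^ 2 ≤ ⟪u, v₀⟫_ℝ ^ 2) :
    ApproxRecovery C ε v₀ (spiked τ v₀ A) u := by
  have hτ0 := (noiseLevel_div_le hn hε hτ).1
  have hsq := noiseLevel_div_sq_le hn hε hε1 hτ
  have hR := recoveryConst_nonneg K
  refine ⟨hu, ?_, fun v hv => ?_⟩
  · nlinarith [mul_le_mul_of_nonneg_left hsq hR]
  · have hv1 : ‖v‖ = 1 := by
      obtain ⟨w, -, hw⟩ := hv
      exact norm_eq_one_of_isTopSingularVector hw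
    have h1 := inner_sq_ge_of_inner_sq_ge hu hv1 hv₀ h
      (inner_sq_ge_of_isRecoveryOutput hn hK hτ0 hv₀ hA.1 hv)
    rw [← recoveryConst] at h1
    nlinarith [mul_le_mul_of_nonneg_left hsq hR]

/-- The programs take O(n⁴) steps for every ε. As ε ≤ 1/2, the logarithm is at least log 2 > 1/2, so
including it costs only a factor 2. -/
lemma time_le (n : ℕ) {C ε : ℝ} (hε : 0 < ε) (hε1 : ε ≤ 1 / 2) {t N : ℕ} (ht : t ≤ N * n ^ 4)
    (hC : 2 * N ≤ C) : (t : ℝ) ≤ C * (n : ℝ) ^ 4 * Real.log (1 / ε) := by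
  have h1 : 1 / 2 ≤ Real.log (1 / ε) := by
    have h2 : Real.log 2 ≤ Real.log (1 / ε) := by
      refine Real.log_le_log (by norm_num) ?_
      rw [le_div_iff₀ hε]
      linarith
    linarith [Real.log_two_gt_d9]
  have h3 : (t : ℝ) ≤ N * (n : ℝ) ^ 4 := by exact_mod_cast ht
  have h4 : (0 : ℝ) ≤ (n : ℝ) ^ 4 := by positivity
  have h5 : (N : ℝ) * n ^ 4 ≤ C * n ^ 4 * (1 / 2) := by nlinarith
  refine h3.trans (h5.trans (mul_le_mul_of_nonneg_left h1 ?_))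
  have : (0 : ℝ) ≤ N := Nat.cast_nonneg N
  exact mul_nonneg (by linarith) h4

theorem implementsRecovery {C C₀ K : ℝ} (hK : 0 ≤ K)
    (hnoise : ∀ n : ℕ, 2 ≤ n → noise n {A | ¬ NoiseBound K A} ≤ smallProb C₀ n)
    (hC : 60000 ≤ C) (hC₀ : C₀ ≤ C) (hCK : 4 * recoveryConst K ≤ C) :
    ImplementsRecovery C recoveryProgram := by
  refine ⟨fun n hn ε τ hε hε1 T ω => ?_, fun n hn v₀ hv₀ ε τ hε hε1 hτ => ?_⟩
  · obtain ⟨t, s, h, ht, -⟩ := recoveryProgram_exec hn ε T ω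
    exact ⟨t, s, h, time_le n hε hε1 ht (by norm_num; linarith)⟩
  · refine le_trans ?_ ((prod_tape_fst _).trans_le ((hnoise n hn).trans (smallProb_mono hC₀ n)))
    refine measure_mono fun q hq hA => hq ?_
    obtain ⟨t, s, h, -, hs⟩ := recoveryProgram_exec hn ε (spiked τ v₀ q.1) q.2
    obtain ⟨hτ0, hle⟩ := noiseLevel_div_le hn hε hτ
    refine ⟨t, s, h, ?_⟩
    rw [hs]
    refine approxRecovery_of_accurate hn hK hε (by linarith) hτ hCK hv₀
      (norm_powerVector _ (by omega) _) hA
      (inner_powerVector_spiked_sq_ge hn hK hτ0 ?_ hv₀ hA (le_two_pow_clog n))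
    rw [div_le_iff₀ hτ0] at hle
    nlinarith

/-- The output vector depends on the tensor but not on the tape, so the top singular vector of the
residual is fixed before the Gaussian start is drawn. Uniqueness of executions transfers the
analysis of one run to every run. -/
lemma certificationProgram_sound (hn : 2 ≤ n) {c : ℕ} (hc : 0 < c) (ε τ : ℝ) (T : Tensor3 n) :
    tape {ω | ¬ ∀ (t : ℕ) (s : State), Exec ω (certificationProgram c) (input n [ε, τ] T) t s →
      SaysCertify s → ‖outVector n s‖ = 1 ∧
        ‖centered (T - τ • cube (outVector n s))‖ ≤ 2 ^ 9 * c * threshold n} ≤ smallProb 1 n := by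
  have := nonempty_fin hn
  set v := signed T (powerVector (gram T) (Nat.clog 2 n)) with hv
  obtain ⟨w, hw, hw2⟩ := exists_norm_sq_eigenvector (centered (T - τ • cube v))
  refine le_trans (measure_mono fun ω hω => ?_) (tape_abs_inner_lt hw)
  by_contra hg
  refine hω fun t s hs hcert => ?_
  obtain ⟨t', s', hs', -, hout, hiff⟩ := certificationProgram_exec hn c ε τ T ω
  obtain rfl := hs'.unique hs
  rw [hout, ← hv]
  refine ⟨?_, ?_⟩
  · rw [hv, norm_signed, norm_powerVector _ (by omega)]
  · have ht := hiff.mp hcert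
    rw [hout, ← hv] at ht
    have hd0 : 0 < Nat.clog 2 n := Nat.clog_pos (by norm_num) hn
    have hpos : (0 : ℝ) < (c * n ^ 3 * Nat.clog 2 n : ℕ) := by
      have : 0 < n := by omega
      exact_mod_cast (by positivity : 0 < c * n ^ 3 * Nat.clog 2 n)
    have h1 := norm_sq_le_of_powIter hw hw2 (Real.sqrt_pos.mpr hpos) (by omega : 0 < n) hd0.ne'
      (le_two_pow_clog n) (not_lt.mp hg) ht
    rw [Real.sq_sqrt hpos.le] at h1
    push_cast at h1
    have h2 := clog_le_log hn
    have hc1 : (1 : ℝ) ≤ c := by exact_mod_cast hc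
    refine (pow_le_pow_iff_left₀ (norm_nonneg _) (mul_nonneg (by positivity) (threshold_nonneg n))
      two_ne_zero).mp ?_
    rw [mul_pow, threshold_sq]
    have hl := (log_pos_of_two_le hn).le
    calc _ ≤ 2 ^ 16 * ((c : ℝ) * n ^ 3 * Nat.clog 2 n) := h1
      _ ≤ 2 ^ 16 * ((c : ℝ) * n ^ 3 * (4 * Real.log n)) := by gcongr
      _ = 2 ^ 18 * (c * (n ^ 3 * Real.log n)) := by ring
      _ ≤ 2 ^ 18 * (c ^ 2 * (n ^ 3 * Real.log n)) := by
        gcongr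
        nlinarith
      _ = _ := by ring

/-- The certification program accepts accurate vectors. -/
lemma certificationProgram_complete (hn : 2 ≤ n) {c : ℕ} {K ε τ : ℝ} (hK : 0 ≤ K)
    (hc : residualConst K ^ 2 ≤ c) (hε : 0 < ε) (hε1 : ε ≤ 1) (hτ : noiseLevel n / ε ≤ τ)
    {v₀ : EuclideanSpace ℝ (Fin n)} (hv₀ : ‖v₀‖ = 1) {A : Tensor3 n} (hA : NoiseBound K A)
    {ω : ℕ → ℝ} (hω : ‖tapeVec n ω‖ ^ 2 ≤ (n : ℝ) ^ 12) :
    ∃ (t : ℕ) (s : State),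
      Exec ω (certificationProgram c) (input n [ε, τ] (spiked τ v₀ A)) t s ∧ SaysCertify s ∧
      ‖outVector n s‖ = 1 ∧
      1 - recoveryConst K * (noiseLevel n / τ) ^ 2 ≤ ⟪outVector n s, v₀⟫_ℝ ^ 2 := by
  obtain ⟨t, s, h, -, hs, hiff⟩ := certificationProgram_exec hn c ε τ (spiked τ v₀ A) ω
  obtain ⟨hτ0, hle⟩ := noiseLevel_div_le hn hε hτ
  have h1 : ‖outVector n s‖ = 1 := by rw [hs, norm_signed, norm_powerVector _ (by omega)]
  have h2 : 1 - recoveryConst K * (noiseLevel n / τ) ^ 2 ≤ ⟪outVector n s, v₀⟫_ℝ ^ 2 := by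
    rw [hs, inner_signed_sq]
    refine inner_powerVector_spiked_sq_ge hn hK hτ0 ?_ hv₀ hA (le_two_pow_clog n)
    rw [div_le_iff₀ hτ0] at hle
    nlinarith
  refine ⟨t, s, h, hiff.mpr (le_trans ?_ hω), h1, h2⟩
  have h3 := norm_centered_residual_le_of_accurate hn hK hτ0 hv₀ h1 hA h2
    (by rw [hs]; exact cubicForm_signed_nonneg _ _)
  gcongr
  -- The residual norm is at most the scale, because c ≥ residualConst² and d ≥ log n. So the
  -- iterate is no longer than the start, and the test passes.
  refine norm_powIter_le (Real.le_sqrt_of_sq_le ?_) _ _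
  have h4 : ‖centered (spiked τ v₀ A - τ • cube (outVector n s))‖ ^ 2 ≤
      (residualConst K * threshold n) ^ 2 := by gcongr
  refine h4.trans ?_
  rw [mul_pow, threshold_sq]
  push_cast
  have hl := (log_pos_of_two_le hn).le
  calc residualConst K ^ 2 * (n ^ 3 * Real.log n) ≤ c * (n ^ 3 * Nat.clog 2 n) := by
        gcongr
        exact log_le_clog n
    _ = _ := by ring

theorem implementsCertification {C C₀ K : ℝ} {c : ℕ} (hK : 0 ≤ K) (hC₀ : 0 ≤ C₀)
    (hnoise : ∀ n : ℕ, 2 ≤ n → noise n {A | ¬ NoiseBound K A} ≤ smallProb C₀ n)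
    (hc : 0 < c) (hcK : residualConst K ^ 2 ≤ c) (hC : 1000000000 ≤ C) (hC₀C : C₀ + 1 ≤ C)
    (hCc : 2 ^ 9 * c + 1 ≤ C) (hCK : 4 * recoveryConst K ≤ C) :
    ImplementsCertification C (certificationProgram c) := by
  refine ⟨fun n hn ε τ hε hε1 T ω => ?_, fun n hn ε τ hε hε1 T => ?_,
    fun n hn v₀ hv₀ ε τ hε hε1 hτ => ?_⟩
  · obtain ⟨t, s, h, ht, -⟩ := certificationProgram_exec hn c ε τ T ω
    exact ⟨t, s, h, time_le n hε hε1 ht (by norm_num; linarith)⟩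
  · have := nonempty_fin hn
    have h1C : (1 : ℝ) ≤ C := by linarith
    refine le_trans (measure_mono ?_)
      ((certificationProgram_sound hn hc ε τ T).trans (smallProb_mono h1C n))
    refine fun ω hω h => hω fun t s hs hcert => ?_
    obtain ⟨h1, h2⟩ := h t s hs hcert
    refine ⟨h1, ?_, fun x hx => ?_⟩
    · rw [topSingularValue_eq_norm]
      exact h2.trans (mul_le_mul_of_nonneg_right (by linarith) (threshold_nonneg n))
    · have h3 := cubicForm_le_of_norm_centered_le hn (by positivity) h2 hx
      have h4 : (2 ^ 9 * c + 1) * noiseLevel n ≤ C * noiseLevel n :=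
        mul_le_mul_of_nonneg_right hCc (noiseLevel_pos hn).le
      linarith
  · have hbad : (noise n).prod tape ({q | q.1 ∈ {A | ¬ NoiseBound K A}} ∪
        {q | q.2 ∈ {ω | (n : ℝ) ^ 12 < ‖tapeVec n ω‖ ^ 2}}) ≤ smallProb C n := by
      refine (measure_union_le _ _).trans ?_
      rw [prod_tape_fst, prod_tape_snd]
      refine (add_le_add (hnoise n hn) (tape_lt_norm_sq (by omega))).trans ?_
      rw [smallProb_add hC₀ zero_le_one]
      exact smallProb_mono hC₀C n
    refine le_trans (measure_mono fun q hq => ?_) hbad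
    by_contra hgood
    simp only [Set.mem_union, Set.mem_ofPred_eq, not_or, not_not, not_lt] at hgood
    obtain ⟨t, s, h, hcert, hu, hacc⟩ := certificationProgram_complete hn hK hcK hε (by linarith) hτ
      hv₀ hgood.1 hgood.2
    exact hq ⟨t, s, h, hcert,
      approxRecovery_of_accurate hn hK hε (by linarith) hτ hCK hv₀ hu hgood.1 hacc⟩

end Correctness

end SpikedTensor

theorem mainTheorem3 :
    ∃ C κ : ℝ, 0 < C ∧ 0 < κ ∧
      -- recovery succeeds with high probability
      (∀ n : ℕ, 2 ≤ n → ∀ v₀ : EuclideanSpace ℝ (Fin n), ‖v₀‖ = 1 →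
        ∀ ε τ : ℝ, 0 < ε → SpikedTensor.noiseLevel n / ε ≤ τ →
          SpikedTensor.noise n
            {A | ¬ ∀ v, SpikedTensor.IsRecoveryOutput (SpikedTensor.spiked τ v₀ A) v →
              1 - C * ε ≤ ⟪v, v₀⟫_ℝ ^ 2} ≤ SpikedTensor.smallProb C n) ∧
      -- certification is sound for every tensor
      (∀ n : ℕ, 2 ≤ n → ∀ (τ : ℝ) (T : SpikedTensor.Tensor3 n) (v : EuclideanSpace ℝ (Fin n)),
        SpikedTensor.IsCertificationOutput κ τ T v SpikedTensor.Verdict.certify →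
          ∀ x : EuclideanSpace ℝ (Fin n), ‖x‖ = 1 →
            SpikedTensor.cubicForm T x ≤ τ * ⟪v, x⟫_ℝ ^ 3 + C * SpikedTensor.noiseLevel n) ∧
      -- certification succeeds with high probability
      (∀ n : ℕ, 2 ≤ n → ∀ v₀ : EuclideanSpace ℝ (Fin n), ‖v₀‖ = 1 →
        ∀ ε τ : ℝ, 0 < ε → SpikedTensor.noiseLevel n / ε ≤ τ →
          SpikedTensor.noise n
            {A | ¬ ∀ v b,
              SpikedTensor.IsCertificationOutput κ τ (SpikedTensor.spiked τ v₀ A) v b →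
                b = SpikedTensor.Verdict.certify} ≤ SpikedTensor.smallProb C n) ∧
      -- both algorithms can be implemented in time `O(n⁴ log (1/ε))`
      (∃ P, SpikedTensor.ImplementsRecovery C P) ∧
      (∃ Q, SpikedTensor.ImplementsCertification C Q) := by
  obtain ⟨K, C₀, hK, hC₀, hnoise⟩ := SpikedTensor.exists_noiseBound
  obtain ⟨c, hc⟩ := exists_nat_ge (SpikedTensor.residualConst K ^ 2)
  have hR := SpikedTensor.recoveryConst_nonneg K
  have hκ := SpikedTensor.residualConst_pos hK
  have hc0 : (0 : ℝ) < c := lt_of_lt_of_le (by positivity) hc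
  set κ := SpikedTensor.residualConst K with hκd
  -- The summands serve the running times, the failure probability, the accuracy, and the soundness
  -- of the exact and of the implemented certification.
  set C := 1000000000 + C₀ + 4 * SpikedTensor.recoveryConst K + κ + 2 ^ 9 * c with hC
  have hC₀C : C₀ ≤ C := by linarith
  refine ⟨C, κ, by positivity, hκ, fun n hn v₀ hv₀ ε τ hε hτ => ?_, fun n hn τ T v hv x hx => ?_,
    fun n hn v₀ hv₀ ε τ hε hτ => ?_,
    ⟨_, SpikedTensor.implementsRecovery hK hnoise (by linarith) (by linarith) (by linarith)⟩,
    ⟨_, SpikedTensor.implementsCertification hK hC₀ hnoise (by exact_mod_cast hc0) hc (by linarith)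
      (by linarith) (by linarith) (by linarith)⟩⟩
  · refine le_trans (MeasureTheory.measure_mono ?_)
      ((hnoise n hn).trans (SpikedTensor.smallProb_mono hC₀C n))
    refine fun A hbad hA => hbad fun v hv => ?_
    have h := SpikedTensor.inner_sq_ge_of_isRecoveryOutput hn hK
      (SpikedTensor.noiseLevel_div_le hn hε hτ).1 hv₀ hA.1 hv
    rw [← SpikedTensor.recoveryConst] at h
    -- The error is of order (noiseLevel/τ)² ≤ ε² ≤ ε. For ε > 1 the claim is vacuous because C > 1.
    by_cases hε1 : ε ≤ 1
    · nlinarith [SpikedTensor.noiseLevel_div_sq_le hn hε hε1 hτ]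
    · nlinarith [sq_nonneg ⟪v, v₀⟫_ℝ]
  · have := SpikedTensor.nonempty_fin hn
    have h := hv.2.2.mp rfl
    rw [SpikedTensor.topSingularValue_eq_norm] at h
    have h1 := SpikedTensor.cubicForm_le_of_norm_centered_le hn hκ.le h hx
    have h2 : (κ + 1) * SpikedTensor.noiseLevel n ≤ C * SpikedTensor.noiseLevel n :=
      mul_le_mul_of_nonneg_right (by linarith) (SpikedTensor.noiseLevel_pos hn).le
    linarith
  · have := SpikedTensor.nonempty_fin hn
    refine le_trans (MeasureTheory.measure_mono ?_)
      ((hnoise n hn).trans (SpikedTensor.smallProb_mono hC₀C n))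
    refine fun A hbad hA => hbad fun v b hv => ?_
    have hτ0 := (SpikedTensor.noiseLevel_div_le hn hε hτ).1
    have hv1 : ‖v‖ = 1 := by
      obtain ⟨⟨w, -, hw⟩, -⟩ := hv
      exact SpikedTensor.norm_eq_one_of_isTopSingularVector hw
    -- The accuracy is used in the form 1 − O((noiseLevel/τ)²) and not in terms of ε, so the
    -- residual bound needs only τ > 0 and the noise event.
    rw [hv.2.2, SpikedTensor.topSingularValue_eq_norm]
    exact SpikedTensor.norm_centered_residual_le_of_accurate hn hK hτ0 hv₀ hv1 hA
      (SpikedTensor.inner_sq_ge_of_isRecoveryOutput hn hK hτ0 hv₀ hA.1 hv.1) hv.2.1
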